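/- Let $\mathbb F$ be a field of characteristic $0$ and let $V=V_{\bar 0}\oplus V_{\bar 1}$ be a vector superspace over $\mathbb F$ (of any dimension), with the trivial action $\partial=0$ of $\mathbb F[\partial]$. \emph{Notation.} For an even endomorphism $\partial$ of $V$ put $V_n=V[\lambda_1,\dots,\lambda_n]/\langle\partial+\lambda_1+\dots+\lambda_n\rangle$, where $\langle\Phi\rangle$ is the image of $\Phi$; put $z_{ij}=z_i-z_j$ and $\mathcal O_n^{\star T}=\mathbb F[z_{ij}^{\pm1}]_{1\le i<j\le n}$. Let $\mathrm F^r\mathcal O_n^{\star T}$ be the span of the algebras $\mathbb F[z_{ij}]_{i<j}[z_{i_1j_1}^{-1},\dots,z_{i_sj_s}^{-1}]$ with $s\le r$. The \emph{chiral operad} $\mathcal P^{\mathrm{ch}}(V)$: $\mathcal P^{\mathrm{ch}}(n)$ is the superspace of linear maps $X\colon V^{\otimes n}\otimes\mathcal O_n^{\star T}\to V_n$ with $X(v\otimes\partial_{z_i}f)=X((\partial_i+\lambda_i)v\otimes f)$ and $X(v\otimes z_{ij}f)=(\partial_{\lambda_j}-\partial_{\lambda_i})X(v\otimes f)$. A permutation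 $\sigma\in S_n$ acts on the right by permuting simultaneously the vectors (with the Koszul sign), the $\lambda_i$ and the $z_i$. For $Y_i\in\mathcal P^{\mathrm{ch}}(m_i)$ and $f=g_1\cdots g_n h$, where $g_i\in\mathcal O^{\star T}_{m_i}$ is a function of the variables of the $i$-th of $n$ consecutive blocks of lengths $m_1,\dots,m_n$, and $h$ has no pole at $z_k=z_l$ for $k,l$ in the same block, $$X(Y_1\otimes\dots\otimes Y_n)_\lambda(v\otimes f)=\pm X_{\Lambda}\bigl((Y_1)_{\lambda-\partial_z}(v_1\otimes g_1)\otimes\dots\otimes(Y_n)_{\lambda-\partial_z}(v_n\otimes g_n)\otimes h|\bigr),$$ where $v_i$ is the $i$-th block of $v$, $\Lambda_i$ is the sum of the $\lambda_k$ of the $i$-th block, the derivatives $\partial_{z_k}$ act on $h$, after which the variables of the $i$-th block are all set equal to $z_i$, and the sign is the Koszul sign. For the filtration $\mathrm F^sV=0$ ($s<0$), $\mathrm F^sV=V$ ($s\ge0$) one has the decreasing filtration of $\mathcal P^{\mathrm{ch}}(n)$ with $\mathrm F^r\mathcal P^{\mathrm{ch}}(n)=\{X : X(V^{\otimes n}\otimes\mathrm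 F^{r-1}\mathcal O_n^{\star T})=0\}$. The \emph{classical operad} $\mathcal P^{\mathrm{cl}}(V)$: let $\mathcal G(n)$ be the set of graphs with vertices $1,\dots,n$ and oriented edges (multiple edges allowed, no tadpoles). $\mathcal P^{\mathrm{cl}}(n)$ is the superspace of maps $Y\colon\mathcal G(n)\times V^{\otimes n}\to V_n$, $(\Gamma,v)\mapsto Y^\Gamma(v)$, linear in $v$, such that: $Y^\Gamma=0$ and $\sum_{e\in C}Y^{\Gamma\setminus e}=0$ whenever $\Gamma$ contains an oriented cycle $C$; and, for each connected component of $\Gamma$ with vertex set $I$, $(\partial_{\lambda_j}-\partial_{\lambda_i})Y^\Gamma(v)=0$ for $i,j\in I$ and $Y^\Gamma(\sum_{i\in I}(\partial_i+\lambda_i)v)=0$. $S_n$ acts by permuting simultaneously the vectors (with the Koszul sign), the $\lambda_i$ and the vertices. The composition is $$X(Y_1\otimes\dots\otimes Y_n)^\Gamma_\lambda(v)=\pm X^{\Gamma_0}_\Lambda\bigl(Y_1^{\Gamma_1}(v_1)\otimes\dots\otimes Y_n^{\Gamma_n}(v_n)\bigr),$$ where $\Gamma_i$ is the restriction of $\Gamma$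 to the $i$-th block, $\Gamma_0$ is obtained from $\Gamma$ by deleting the edges inside the blocks and collapsing each block to a vertex, and each variable $\lambda_k$ of $Y_i^{\Gamma_i}$ is replaced by $\lambda_k+\sum_j(\Lambda_j+\partial_j)$, the sum being over the blocks $j$ that can be reached in $\Gamma_0$ by a path that starts with an edge of $\Gamma$ at the vertex $k$ and does not return to the block of $k$. $\mathcal P^{\mathrm{cl}}(n)$ is graded: $Y\in\mathrm{gr}^r\mathcal P^{\mathrm{cl}}(n)$ iff $Y^\Gamma=0$ for all $\Gamma$ with a number of edges different from $r$. Finally, $\mathcal Hom(V)(n)=\operatorname{Hom}(V^{\otimes n},V)$; $\mathcal Lie(n)$ is the multilinear part of the free Lie algebra on $x_1,\dots,x_n$, with substitutions as compositions (so $\mathcal Lie(0)=0$); and $(\mathcal Hom(V)\otimes\mathcal Lie)(n)=\mathcal Hom(V)(n)\otimes\mathcal Lie(n)$ with component-wise structure. \textbf{Theorem.} Let $\partial=0$ on $V$. (a) For every $n\ge1$: $\mathrm F^{r}\mathcal P^{\mathrm{ch}}(n)=\mathcal P^{\mathrm{ch}}(n)$ for $r\le n-1$ and $\mathrm F^{r}\mathcal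 P^{\mathrm{ch}}(n)=0$ for $r\ge n$; moreover $\mathcal P^{\mathrm{cl}}(n)=\mathrm{gr}^{n-1}\mathcal P^{\mathrm{cl}}(n)$, and $\mathrm{gr}^{r}\mathcal P^{\mathrm{cl}}(n)=0$ for $r\ne n-1$. (b) The unit, the actions of the symmetric groups and the compositions of $\mathcal P^{\mathrm{ch}}(V)$ and $\mathcal P^{\mathrm{cl}}(V)$ are well defined, and there is an isomorphism of superoperads $\mathcal P^{\mathrm{ch}}(V)\simeq\mathcal P^{\mathrm{cl}}(V)$ (in all arities $n\ge0$), which sends $X\in\mathcal P^{\mathrm{ch}}(n)$, $n\ge1$, to the $Y$ with $Y^\Gamma(v)=X\bigl(v\otimes\prod_{i\to j}z_{ij}^{-1}\bigr)$, the product being over the edges of $\Gamma$, for every $\Gamma\in\mathcal G(n)$ with $n-1$ edges. (c) There is an isomorphism of superoperads $\mathcal P^{\mathrm{cl}}(V)\simeq\mathcal Hom(V)\otimes\mathcal Lie$ in arities $n\ge1$, that is, a family of parity preserving linear isomorphisms $\mathcal P^{\mathrm{cl}}(V)(n)\simeq\operatorname{Hom}(V^{\otimes n},V)\otimes\mathcal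 Lie(n)$, $n\ge1$, compatible with the units, the actions of $S_n$ and the compositions of operations of positive arity. -/

import Mathlib

open scoped TensorProduct BigOperators

noncomputable section

namespace VertexOperad

universe u v w w'

/-! ### Blocks of consecutive indices

For `m : Fin n → ℕ` the set `{1, …, m₁ + ⋯ + mₙ}` is cut into `n` consecutive blocks;
`emb m i k` is the `k`-th element of the `i`-th block and `block m k` is the block of `k`. -/

def emb {n : ℕ} (m : Fin n → ℕ) (i : Fin n) (k : Fin (m i)) : Fin (∑ i, m i) :=
  finSigmaFinEquiv ⟨i, k⟩

def block {n : ℕ} (m : Fin n → ℕ) (k : Fin (∑ i, m i)) : Fin n :=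
  (finSigmaFinEquiv.symm k).1

theorem emb_injective {n : ℕ} (m : Fin n → ℕ) (i : Fin n) :
    Function.Injective (emb m i) := by
  intro k l h
  have h' := finSigmaFinEquiv.injective h
  simpa using h'

/-- A multi-index on each block, assembled to a multi-index on the union of the blocks. -/
def glue {n : ℕ} {m : Fin n → ℕ} (α : ∀ i, Fin (m i) →₀ ℕ) (k : Fin (∑ i, m i)) : ℕ :=
  α (finSigmaFinEquiv.symm k).1 (finSigmaFinEquiv.symm k).2

/-! ### Signs -/

/-- `(-1) ^ (a b)` for parities `a`, `b`. -/
def ksign (a b : ZMod 2) : ℤ := (-1) ^ (a * b).val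

/-- `ε_v(σ) = ∏_{i < j, σ i > σ j} (-1) ^ (p(v_i) p(v_j))`, where `q i` is the parity of `v_i`. -/
def permSign {n : ℕ} (q : Fin n → ZMod 2) (σ : Equiv.Perm (Fin n)) : ℤ :=
  ∏ i, ∏ j, if i < j ∧ σ j < σ i then ksign (q i) (q j) else 1

/-- The sign in `(Y₁ ⊗ ⋯ ⊗ Yₙ)(w₁ ⊗ ⋯ ⊗ wₙ) = ± Y₁(w₁) ⊗ ⋯ ⊗ Yₙ(wₙ)`, where `p i` is the parity
of `Y_i` and `w_i` is the tensor product of the `i`-th block of vectors, of parities `q`. -/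
def compSign {n : ℕ} {m : Fin n → ℕ} (p : Fin n → ZMod 2) (q : Fin (∑ i, m i) → ZMod 2) : ℤ :=
  ∏ i, ∏ j, if i < j then ksign (p j) (∑ k, q (emb m i k)) else 1

/-! ### Linear superoperads

The data of a symmetric operad in vector superspaces: the spaces of `n`-ary operations with their
parity, the unit, the right action of the symmetric groups and the compositions
`(X; Y₁, …, Yₙ) ↦ X(Y₁ ⊗ ⋯ ⊗ Yₙ)`. The unit, the action and the compositions are given by their
graphs: `IsOne X` says that `X` is the unit, `IsAct σ X X'` says that `X' = X ^ σ`, and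
`IsComp p X Y Z` says that the `Y i` are homogeneous of parity `p i` and
`Z = X(Y₁ ⊗ ⋯ ⊗ Yₙ)`. The compositions being multilinear, they are determined by their values at
homogeneous `Y i`. -/
structure OperadData (F : Type u) [Field F] where
  obj : ℕ → Type w
  [addCommGroup : ∀ n, AddCommGroup (obj n)]
  [module : ∀ n, Module F (obj n)]
  parity : ∀ n, ZMod 2 → Submodule F (obj n)
  IsOne : obj 1 → Prop
  IsAct : ∀ {n : ℕ}, Equiv.Perm (Fin n) → obj n → obj n → Prop
  IsComp : ∀ {n : ℕ} {m : Fin n → ℕ}, (Fin n → ZMod 2) → obj n → (∀ i, obj (m i)) →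
    obj (∑ i, m i) → Prop

attribute [instance] OperadData.addCommGroup OperadData.module

/-- The unit, the actions of the symmetric groups and the compositions exist and are unique. -/
structure OperadData.WellDefined {F : Type u} [Field F] (A : OperadData.{u, w} F) : Prop where
  one : ∃! X, A.IsOne X
  act : ∀ {n : ℕ} (σ : Equiv.Perm (Fin n)) (X : A.obj n), ∃! X', A.IsAct σ X X'
  comp : ∀ {n : ℕ} {m : Fin n → ℕ} (p : Fin n → ZMod 2) (X : A.obj n) (Y : ∀ i, A.obj (m i)),
    (∀ i, Y i ∈ A.parity (m i) (p i)) → ∃! Z, A.IsComp p X Y Z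

/-- Isomorphisms between the parts of arity `≥ k` of two superoperads. For `k = 0` these are the
isomorphisms of operads; for `k = 1` operations of arity `0` are left out. -/
structure OperadIso {F : Type u} [Field F] (k : ℕ) (A : OperadData.{u, w} F)
    (B : OperadData.{u, w'} F) where
  equiv : ∀ n, k ≤ n → (A.obj n ≃ₗ[F] B.obj n)
  parity_iff : ∀ n (hn : k ≤ n) (p : ZMod 2) (X : A.obj n),
    X ∈ A.parity n p ↔ equiv n hn X ∈ B.parity n p
  one_iff : ∀ (h : k ≤ 1) (X : A.obj 1), A.IsOne X ↔ B.IsOne (equiv 1 h X)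
  act_iff : ∀ n (hn : k ≤ n) (σ : Equiv.Perm (Fin n)) (X X' : A.obj n),
    A.IsAct σ X X' ↔ B.IsAct σ (equiv n hn X) (equiv n hn X')
  comp_iff : ∀ n (hn : k ≤ n) (m : Fin n → ℕ) (hm : ∀ i, k ≤ m i) (hM : k ≤ ∑ i, m i)
    (p : Fin n → ZMod 2) (X : A.obj n) (Y : ∀ i, A.obj (m i)) (Z : A.obj (∑ i, m i)),
    A.IsComp p X Y Z ↔
      B.IsComp p (equiv n hn X) (fun i => equiv (m i) (hm i) (Y i)) (equiv _ hM Z)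

/-! ### Tensor products of operads -/

section Tensor

variable {F : Type u} [Field F] (A : OperadData.{u, w} F) (B : OperadData.{u, w'} F)

/-- The linear extension of `(X ⊗ X') ^ σ = X ^ σ ⊗ X' ^ σ`. -/
inductive TensorAct {n : ℕ} (σ : Equiv.Perm (Fin n)) :
    A.obj n ⊗[F] B.obj n → A.obj n ⊗[F] B.obj n → Prop
  | pure (X X₁ : A.obj n) (X' X₁' : B.obj n) (h : A.IsAct σ X X₁) (h' : B.IsAct σ X' X₁') :
      TensorAct σ (X ⊗ₜ[F] X') (X₁ ⊗ₜ[F] X₁')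
  | add (s t s₁ t₁ : A.obj n ⊗[F] B.obj n) (hs : TensorAct σ s s₁) (ht : TensorAct σ t t₁) :
      TensorAct σ (s + t) (s₁ + t₁)

/-- The multilinear extension of
`(X ⊗ X')(Y₁ ⊗ Y₁', …, Yₙ ⊗ Yₙ') = X(Y₁, …, Yₙ) ⊗ X'(Y₁', …, Yₙ')`, for the operations `X'`, `Yᵢ'`
of a purely even operad `B` (so that there are no signs). -/
inductive TensorComp {n : ℕ} {m : Fin n → ℕ} (p : Fin n → ZMod 2) :
    A.obj n ⊗[F] B.obj n → (∀ i, A.obj (m i) ⊗[F] B.obj (m i)) →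
      A.obj (∑ i, m i) ⊗[F] B.obj (∑ i, m i) → Prop
  | pure (X : A.obj n) (Y : ∀ i, A.obj (m i)) (Z : A.obj (∑ i, m i))
      (X' : B.obj n) (Y' : ∀ i, B.obj (m i)) (Z' : B.obj (∑ i, m i))
      (h : A.IsComp p X Y Z) (h' : B.IsComp (fun _ => 0) X' Y' Z') :
      TensorComp p (X ⊗ₜ[F] X') (fun i => Y i ⊗ₜ[F] Y' i) (Z ⊗ₜ[F] Z')
  | add_left (s t : A.obj n ⊗[F] B.obj n) (y : ∀ i, A.obj (m i) ⊗[F] B.obj (m i))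
      (s₁ t₁ : A.obj (∑ i, m i) ⊗[F] B.obj (∑ i, m i))
      (hs : TensorComp p s y s₁) (ht : TensorComp p t y t₁) :
      TensorComp p (s + t) y (s₁ + t₁)
  | add_right (s : A.obj n ⊗[F] B.obj n) (y : ∀ i, A.obj (m i) ⊗[F] B.obj (m i)) (i : Fin n)
      (a b : A.obj (m i) ⊗[F] B.obj (m i)) (s₁ t₁ : A.obj (∑ i, m i) ⊗[F] B.obj (∑ i, m i))
      (hs : TensorComp p s (Function.update y i a) s₁)
      (ht : TensorComp p s (Function.update y i b) t₁) :
      TensorComp p s (Function.update y i (a + b)) (s₁ + t₁)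

/-- The tensor product `A ⊗ B` of a superoperad `A` and a purely even operad `B`, with
`(A ⊗ B)(n) = A(n) ⊗ B(n)` and component-wise structure. -/
def OperadData.tensorEven : OperadData.{u, max w w'} F where
  obj n := A.obj n ⊗[F] B.obj n
  parity n p := LinearMap.range (LinearMap.rTensor (B.obj n) (A.parity n p).subtype)
  IsOne t := ∃ X X', A.IsOne X ∧ B.IsOne X' ∧ t = X ⊗ₜ[F] X'
  IsAct σ s t := TensorAct A B σ s t
  IsComp p s y z := TensorComp A B p s y z

end Tensor

/-! ### The operad `Lie` -/

section Lie

variable (F : Type u) [Field F]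

/-- `IsLieMonomial F s a`: `a` is an iterated bracket of the generators `x_i`, `i ∈ s`, in which each
of them occurs exactly once. -/
inductive IsLieMonomial {n : ℕ} : Finset (Fin n) → FreeLieAlgebra F (Fin n) → Prop
  | of (i : Fin n) : IsLieMonomial {i} (FreeLieAlgebra.of F i)
  | lie (s t : Finset (Fin n)) (a b : FreeLieAlgebra F (Fin n)) (hst : Disjoint s t)
      (ha : IsLieMonomial s a) (hb : IsLieMonomial t b) : IsLieMonomial (s ∪ t) ⁅a, b⁆

/-- The multilinear part of the free Lie algebra on `x₁, …, xₙ`. -/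
def lieMultilinear (n : ℕ) : Submodule F (FreeLieAlgebra F (Fin n)) :=
  Submodule.span F {a | IsLieMonomial F Finset.univ a}

/-- The operad `Lie`: `Lie(n)` is the multilinear part of the free Lie algebra on `x₁, …, xₙ`,
`P ^ σ = P(x_{σ⁻¹(1)}, …, x_{σ⁻¹(n)})`, and compositions are substitutions. -/
def lieOperad : OperadData.{u, u} F where
  obj n := lieMultilinear F n
  parity _ p := if p = 0 then ⊤ else ⊥
  IsOne P := (P : FreeLieAlgebra F (Fin 1)) = FreeLieAlgebra.of F 0
  IsAct σ P P' := (P' : FreeLieAlgebra F _) =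
    FreeLieAlgebra.lift F (fun s => FreeLieAlgebra.of F (σ⁻¹ s)) (P : FreeLieAlgebra F _)
  IsComp {n m} p P Q R :=
    (∀ i, Q i ∈ (if p i = 0 then ⊤ else ⊥ : Submodule F (lieMultilinear F (m i)))) ∧
    (R : FreeLieAlgebra F _) =
      FreeLieAlgebra.lift F
        (fun i => FreeLieAlgebra.lift F (fun k => FreeLieAlgebra.of F (emb m i k))
          (Q i : FreeLieAlgebra F _))
        (P : FreeLieAlgebra F (Fin n))

end Lie

/-! ### The operad `Hom(V)` -/

section Hom

variable {F : Type u} [Field F] {V : Type v} [AddCommGroup V] [Module F V]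
  (𝒱 : ZMod 2 → Submodule F V)

/-- Multilinear maps `V × ⋯ × V → V` (that is, linear maps `V^{⊗ n} → V`) of parity `p`. -/
def homParity (n : ℕ) (p : ZMod 2) : Submodule F (MultilinearMap F (fun _ : Fin n => V) V) where
  carrier := {φ | ∀ (q : Fin n → ZMod 2) (x : Fin n → V), (∀ i, x i ∈ 𝒱 (q i)) →
    φ x ∈ 𝒱 (p + ∑ i, q i)}
  add_mem' h h' q x hx := Submodule.add_mem _ (h q x hx) (h' q x hx)
  zero_mem' _ _ _ := Submodule.zero_mem _
  smul_mem' c _ h q x hx := Submodule.smul_mem _ c (h q x hx)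

/-- The operad `Hom(V)` of a vector superspace `V = 𝒱 0 ⊕ 𝒱 1`. -/
def homOperad : OperadData.{u, v} F where
  obj n := MultilinearMap F (fun _ : Fin n => V) V
  parity n p := homParity 𝒱 n p
  IsOne φ := ∀ x : Fin 1 → V, φ x = x 0
  IsAct {n} σ φ φ' := ∀ (q : Fin n → ZMod 2) (x : Fin n → V), (∀ i, x i ∈ 𝒱 (q i)) →
    φ' x = permSign q σ • φ (fun s => x (σ⁻¹ s))
  IsComp {_ m} p φ ψ χ := (∀ i, ψ i ∈ homParity 𝒱 (m i) (p i)) ∧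
    ∀ (q : Fin (∑ i, m i) → ZMod 2) (x : Fin (∑ i, m i) → V), (∀ k, x k ∈ 𝒱 (q k)) →
      χ x = compSign p q • φ (fun i => ψ i (fun k => x (emb m i k)))

end Hom

/-! ### Translation invariant rational functions -/

section Functions

variable (F : Type u) [Field F]

/-- The multiplicative set generated by the `z_k - z_l` with `π k ≠ π l`. -/
def diagonals {n : ℕ} {κ : Type} (π : Fin n → κ) : Submonoid (MvPolynomial (Fin n) F) :=
  Submonoid.closure {p | ∃ k l, π k ≠ π l ∧ p = MvPolynomial.X k - MvPolynomial.X l}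

/-- The ring `F[z_1, …, z_n][(z_k - z_l)⁻¹ : π k ≠ π l]`. -/
abbrev Fun {n : ℕ} {κ : Type} (π : Fin n → κ) : Type u := Localization (diagonals F π)

/-- `z_{kl} = z_k - z_l`. -/
def z {n : ℕ} {κ : Type} (π : Fin n → κ) (k l : Fin n) : Fun F π :=
  algebraMap (MvPolynomial (Fin n) F) (Fun F π) (MvPolynomial.X k - MvPolynomial.X l)

theorem isUnit_z {n : ℕ} {κ : Type} (π : Fin n → κ) {k l : Fin n} (h : π k ≠ π l) :
    IsUnit (z F π k l) :=
  IsLocalization.map_units (Fun F π)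
    (⟨_, Submonoid.subset_closure ⟨k, l, h, rfl⟩⟩ : diagonals F π)

/-- The algebra homomorphism `f ↦ f + ε ∂f/∂z_k` on polynomials,
with values in the dual numbers over `Fun F π`. -/
def taylorPoly {n : ℕ} {κ : Type} (π : Fin n → κ) (k : Fin n) :
    MvPolynomial (Fin n) F →ₐ[F] TrivSqZeroExt (Fun F π) (Fun F π) :=
  MvPolynomial.aeval fun j =>
    TrivSqZeroExt.inl (algebraMap (MvPolynomial (Fin n) F) (Fun F π) (MvPolynomial.X j)) +
      TrivSqZeroExt.inr (if j = k then (1 : Fun F π) else 0)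

theorem fst_taylorPoly {n : ℕ} {κ : Type} (π : Fin n → κ) (k : Fin n)
    (p : MvPolynomial (Fin n) F) :
    (taylorPoly F π k p).fst = algebraMap (MvPolynomial (Fin n) F) (Fun F π) p := by
  have : (TrivSqZeroExt.fstHom F (Fun F π) (Fun F π)).comp (taylorPoly F π k) =
      IsScalarTower.toAlgHom F (MvPolynomial (Fin n) F) (Fun F π) := by
    apply MvPolynomial.algHom_ext
    intro j
    by_cases h : j = k <;> simp [taylorPoly, h]
  exact DFunLike.congr_fun this p

def taylor {n : ℕ} {κ : Type} (π : Fin n → κ) (k : Fin n) :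
    Fun F π →ₐ[F] TrivSqZeroExt (Fun F π) (Fun F π) :=
  IsLocalization.liftAlgHom (A := F) (R := MvPolynomial (Fin n) F) (M := diagonals F π) (S := Fun F π)
    (P := TrivSqZeroExt (Fun F π) (Fun F π)) (f := taylorPoly F π k)
    fun y => (TrivSqZeroExt.isUnit_iff_isUnit_fst).2
      ((fst_taylorPoly F π k y).symm ▸ IsLocalization.map_units (Fun F π) y)

theorem fst_taylor {n : ℕ} {κ : Type} (π : Fin n → κ) (k : Fin n) (f : Fun F π) :
    (taylor F π k f).fst = f := by
  have : (TrivSqZeroExt.fstHom F (Fun F π) (Fun F π)).comp (taylor F π k) =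
      AlgHom.id F (Fun F π) := by
    apply IsLocalization.algHom_ext (diagonals F π)
    apply AlgHom.ext
    intro p
    have h : taylor F π k (algebraMap (MvPolynomial (Fin n) F) (Fun F π) p) =
        taylorPoly F π k p := IsLocalization.lift_eq _ p
    exact (congrArg TrivSqZeroExt.fst h).trans (fst_taylorPoly F π k p)
  exact DFunLike.congr_fun this f

/-- The partial derivative `∂/∂z_k` on `F[z_1, …, z_n][(z_k - z_l)⁻¹ : π k ≠ π l]`. -/
def pderivFun {n : ℕ} {κ : Type} (π : Fin n → κ) (k : Fin n) :
    Derivation F (Fun F π) (Fun F π) :=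
  Derivation.mk'
    ((TrivSqZeroExt.sndHom (Fun F π) (Fun F π)).restrictScalars F ∘ₗ (taylor F π k).toLinearMap)
    (by intro a b; simp [fst_taylor, mul_comm])

theorem pderivFun_X {n : ℕ} {κ : Type} (π : Fin n → κ) (k j : Fin n) :
    pderivFun F π k (algebraMap (MvPolynomial (Fin n) F) (Fun F π) (MvPolynomial.X j)) =
      if j = k then 1 else 0 := by
  have h : taylor F π k (algebraMap (MvPolynomial (Fin n) F) (Fun F π) (MvPolynomial.X j)) =
      taylorPoly F π k (MvPolynomial.X j) := IsLocalization.lift_eq _ _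
  refine (congrArg TrivSqZeroExt.snd h).trans ?_
  by_cases hj : j = k <;> simp [taylorPoly, hj]

/-- The translation invariant functions in `F[z_1, …, z_n][(z_k - z_l)⁻¹ : π k ≠ π l]`, namely
`F[z_{kl}][z_{kl}⁻¹ : π k ≠ π l]`. For `π = id` this is `F[z_{kl}^{±1}]`. -/
def invFun {n : ℕ} {κ : Type} (π : Fin n → κ) : Subalgebra F (Fun F π) :=
  Algebra.adjoin F ({f | ∃ k l, f = z F π k l} ∪
    {f | ∃ k l, π k ≠ π l ∧ f = Ring.inverse (z F π k l)})

theorem pderivFun_mem {n : ℕ} {κ : Type} (π : Fin n → κ) (k : Fin n) {f : Fun F π}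
    (hf : f ∈ invFun F π) : pderivFun F π k f ∈ invFun F π := by
  have hz : ∀ a b, pderivFun F π k (z F π a b) ∈ invFun F π := by
    intro a b
    rw [z, map_sub, map_sub, pderivFun_X, pderivFun_X]
    apply Subalgebra.sub_mem <;> split_ifs <;> simp
  induction hf using Algebra.adjoin_induction with
  | mem x hx =>
    rcases hx with ⟨a, b, rfl⟩ | ⟨a, b, hab, rfl⟩
    · exact hz a b
    · have hmem : Ring.inverse (z F π a b) ∈ invFun F π :=
        Algebra.subset_adjoin (Or.inr ⟨a, b, hab, rfl⟩)
      rw [Derivation.leibniz_of_mul_eq_one (pderivFun F π k)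
        (Ring.inverse_mul_cancel _ (isUnit_z F π hab))]
      rw [smul_eq_mul]
      exact Subalgebra.mul_mem _ (Subalgebra.neg_mem _ (Subalgebra.pow_mem _ hmem 2)) (hz a b)
  | algebraMap r => simp
  | add x y _ _ hx hy => rw [map_add]; exact Subalgebra.add_mem _ hx hy
  | mul x y hx' hy' hx hy =>
    rw [Derivation.leibniz, smul_eq_mul, smul_eq_mul]
    exact Subalgebra.add_mem _ (Subalgebra.mul_mem _ hx' hy) (Subalgebra.mul_mem _ hy' hx)

/-- The partial derivative `∂/∂z_k` on translation invariant functions. -/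
def dz {n : ℕ} {κ : Type} (π : Fin n → κ) (k : Fin n) : invFun F π →ₗ[F] invFun F π :=
  LinearMap.codRestrict (Subalgebra.toSubmodule (invFun F π))
    ((pderivFun F π k).toLinearMap ∘ₗ (invFun F π).val.toLinearMap)
    fun f => pderivFun_mem F π k f.2

/-- The substitution `z_k ↦ z_{θ k}`. -/
def renameFun {a b : ℕ} {κ κ' : Type} (π : Fin a → κ) (π' : Fin b → κ') (θ : Fin a → Fin b)
    (h : ∀ k l, π k ≠ π l → π' (θ k) ≠ π' (θ l)) : Fun F π →ₐ[F] Fun F π' :=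
  IsLocalization.liftAlgHom (M := diagonals F π) (S := Fun F π)
    (f := (IsScalarTower.toAlgHom F (MvPolynomial (Fin b) F) (Fun F π')).comp
      (MvPolynomial.rename θ)) (by
    intro y
    have hle : diagonals F π ≤ (IsUnit.submonoid (Fun F π')).comap
        ((IsScalarTower.toAlgHom F (MvPolynomial (Fin b) F) (Fun F π')).comp
          (MvPolynomial.rename θ)) := by
      refine (Submonoid.closure_le).2 ?_
      rintro _ ⟨k, l, hkl, rfl⟩
      have := isUnit_z F π' (h k l hkl)
      simpa [z, IsUnit.mem_submonoid_iff] using this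
    exact hle y.2)

theorem renameFun_z {a b : ℕ} {κ κ' : Type} (π : Fin a → κ) (π' : Fin b → κ') (θ : Fin a → Fin b)
    (h : ∀ k l, π k ≠ π l → π' (θ k) ≠ π' (θ l)) (k l : Fin a) :
    renameFun F π π' θ h (z F π k l) = z F π' (θ k) (θ l) := by
  have h : renameFun F π π' θ h (z F π k l) =
      (IsScalarTower.toAlgHom F (MvPolynomial (Fin b) F) (Fun F π')).comp
        (MvPolynomial.rename θ) (MvPolynomial.X k - MvPolynomial.X l) :=
    IsLocalization.lift_eq _ _
  rw [h]
  simp [z]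

theorem renameFun_mem {a b : ℕ} {κ κ' : Type} (π : Fin a → κ) (π' : Fin b → κ')
    (θ : Fin a → Fin b) (h : ∀ k l, π k ≠ π l → π' (θ k) ≠ π' (θ l)) {f : Fun F π}
    (hf : f ∈ invFun F π) : renameFun F π π' θ h f ∈ invFun F π' := by
  have hle : invFun F π ≤ (invFun F π').comap (renameFun F π π' θ h) := by
    refine Algebra.adjoin_le ?_
    rintro _ (⟨k, l, rfl⟩ | ⟨k, l, hkl, rfl⟩)
    · exact Algebra.subset_adjoin (Or.inl ⟨θ k, θ l, renameFun_z F π π' θ h k l⟩)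
    · refine Algebra.subset_adjoin (Or.inr ⟨θ k, θ l, h k l hkl, ?_⟩)
      have h1 : renameFun F π π' θ h (Ring.inverse (z F π k l)) * z F π' (θ k) (θ l) = 1 := by
        rw [← renameFun_z F π π' θ h, ← map_mul,
          Ring.inverse_mul_cancel _ (isUnit_z F π hkl), map_one]
      exact (isUnit_z F π' (h k l hkl)).mul_right_cancel
        (h1.trans (Ring.inverse_mul_cancel _ (isUnit_z F π' (h k l hkl))).symm)
  exact hle hf

/-- The substitution `z_k ↦ z_{θ k}` on translation invariant functions. -/
def renameInv {a b : ℕ} {κ κ' : Type} (π : Fin a → κ) (π' : Fin b → κ') (θ : Fin a → Fin b)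
    (h : ∀ k l, π k ≠ π l → π' (θ k) ≠ π' (θ l)) : invFun F π →ₐ[F] invFun F π' :=
  ((renameFun F π π' θ h).comp (invFun F π).val).codRestrict (invFun F π')
    fun f => renameFun_mem F π π' θ h f.2

/-- The algebra `F[z_{kl}^{±1}]` of translation invariant functions in `n` variables, localized
along the diagonals. -/
abbrev OT (n : ℕ) : Subalgebra F (Fun F (id : Fin n → Fin n)) := invFun F (id : Fin n → Fin n)

/-- `z_{kl}` as an element of `F[z_{kl}^{±1}]`. -/
def zOT {n : ℕ} (k l : Fin n) : OT F n :=
  ⟨z F id k l, Algebra.subset_adjoin (Or.inl ⟨k, l, rfl⟩)⟩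

/-- The filtration of `F[z_{kl}^{±1}]` by the number of divisors: the `r`-th term is spanned by the
algebras `F[z_{kl}][z_{i_1 j_1}⁻¹, …, z_{i_s j_s}⁻¹]` with `s ≤ r`. -/
def filOT (n : ℕ) (r : ℤ) : Submodule F (Fun F (id : Fin n → Fin n)) :=
  Submodule.span F {f | ∃ S : Finset (Fin n × Fin n), (S.card : ℤ) ≤ r ∧
    f ∈ Algebra.adjoin F ({f | ∃ k l, f = z F (id : Fin n → Fin n) k l} ∪
      {f | ∃ e ∈ S, e.1 ≠ e.2 ∧ f = Ring.inverse (z F (id : Fin n → Fin n) e.1 e.2)})}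

end Functions

/-! ### The space `V_n = V[λ_1, …, λ_n] / ⟨∂ + λ_1 + ⋯ + λ_n⟩` -/

section Target

variable {F : Type u} [Field F] {V : Type v} [AddCommGroup V] [Module F V] (d : V →ₗ[F] V)

/-- `∂ + λ_1 + ⋯ + λ_n` on `V[λ_1, …, λ_n]`. -/
def totalOp (n : ℕ) : MvPolynomial (Fin n) F ⊗[F] V →ₗ[F] MvPolynomial (Fin n) F ⊗[F] V :=
  LinearMap.lTensor (MvPolynomial (Fin n) F) d +
    LinearMap.rTensor V (LinearMap.mulLeft F (∑ k, MvPolynomial.X k))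

/-- `V_n`. -/
def Vn (n : ℕ) : Type (max u v) :=
  (MvPolynomial (Fin n) F ⊗[F] V) ⧸ LinearMap.range (totalOp d n)

instance (n : ℕ) : AddCommGroup (Vn d n) :=
  inferInstanceAs (AddCommGroup ((MvPolynomial (Fin n) F ⊗[F] V) ⧸ LinearMap.range (totalOp d n)))

instance (n : ℕ) : Module F (Vn d n) :=
  inferInstanceAs (Module F ((MvPolynomial (Fin n) F ⊗[F] V) ⧸ LinearMap.range (totalOp d n)))

/-- The class of a polynomial in `V_n`. -/
def mkV (n : ℕ) : MvPolynomial (Fin n) F ⊗[F] V →ₗ[F] Vn d n :=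
  (LinearMap.range (totalOp d n)).mkQ

/-- The map `V_a → V_b` induced by a map that commutes with `∂ + λ_1 + λ_2 + ⋯`. -/
def mapV {a b : ℕ}
    (T : MvPolynomial (Fin a) F ⊗[F] V →ₗ[F] MvPolynomial (Fin b) F ⊗[F] V)
    (h : T ∘ₗ totalOp d a = totalOp d b ∘ₗ T) : Vn d a →ₗ[F] Vn d b :=
  Submodule.mapQ (LinearMap.range (totalOp d a)) (LinearMap.range (totalOp d b)) T (by
    rintro _ ⟨y, rfl⟩
    exact ⟨T y, (LinearMap.congr_fun h y).symm⟩)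

theorem mapV_mkV {a b : ℕ}
    (T : MvPolynomial (Fin a) F ⊗[F] V →ₗ[F] MvPolynomial (Fin b) F ⊗[F] V)
    (h : T ∘ₗ totalOp d a = totalOp d b ∘ₗ T) (y : MvPolynomial (Fin a) F ⊗[F] V) :
    mapV d T h (mkV d a y) = mkV d b (T y) := rfl

theorem mkV_surjective (n : ℕ) : Function.Surjective (mkV d n) :=
  Submodule.mkQ_surjective (LinearMap.range (totalOp d n))

/-- Multiplication by a polynomial in `λ_1, …, λ_n` on `V_n`. -/
def mulV (n : ℕ) : MvPolynomial (Fin n) F →ₗ[F] Vn d n →ₗ[F] Vn d n where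
  toFun p := mapV d (LinearMap.rTensor V (LinearMap.mulLeft F p)) (by
    apply TensorProduct.ext'
    intro q x
    simp [totalOp, mul_left_comm])
  map_add' p q := by
    have h : LinearMap.rTensor V (LinearMap.mulLeft F (p + q)) =
        LinearMap.rTensor V (LinearMap.mulLeft F p) +
          LinearMap.rTensor V (LinearMap.mulLeft F q) := by
      apply TensorProduct.ext'
      intro r x
      simp [add_mul, TensorProduct.add_tmul]
    apply LinearMap.ext
    intro y
    obtain ⟨y, rfl⟩ := mkV_surjective d n y
    rw [LinearMap.add_apply, mapV_mkV, mapV_mkV, mapV_mkV, h, LinearMap.add_apply, map_add]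
  map_smul' c p := by
    have h : LinearMap.rTensor V (LinearMap.mulLeft F (c • p)) =
        c • LinearMap.rTensor V (LinearMap.mulLeft F p) := by
      apply TensorProduct.ext'
      intro r x
      simp [TensorProduct.smul_tmul']
    apply LinearMap.ext
    intro y
    obtain ⟨y, rfl⟩ := mkV_surjective d n y
    rw [RingHom.id_apply, LinearMap.smul_apply, mapV_mkV, mapV_mkV, h, LinearMap.smul_apply,
      map_smul]

/-- `∂/∂λ_j - ∂/∂λ_i` on `V_n`. -/
def diffV (n : ℕ) (i j : Fin n) : Vn d n →ₗ[F] Vn d n :=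
  mapV d (LinearMap.rTensor V
      ((MvPolynomial.pderiv j).toLinearMap - (MvPolynomial.pderiv i).toLinearMap))
    (by
      apply TensorProduct.ext'
      intro q x
      simp only [totalOp, LinearMap.comp_apply, LinearMap.add_apply, LinearMap.lTensor_tmul,
        LinearMap.rTensor_tmul, LinearMap.mulLeft_apply, map_add, LinearMap.sub_apply,
        Derivation.coeFn_coe, Derivation.leibniz, map_sum, MvPolynomial.pderiv_X, Pi.single_apply,
        Finset.sum_ite_eq', Finset.mem_univ, if_true, smul_eq_mul, mul_one]
      congr 2
      ring)

/-- The substitution `λ_i ↦ ∑_{π k = i} λ_k` from `V_a` to `V_b`. -/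
def substV {a b : ℕ} (π : Fin b → Fin a) : Vn d a →ₗ[F] Vn d b :=
  mapV d (LinearMap.rTensor V
      (MvPolynomial.aeval fun i => ∑ k with π k = i,
        (MvPolynomial.X k : MvPolynomial (Fin b) F)).toLinearMap)
    (by
      apply TensorProduct.ext'
      intro q x
      simp [totalOp, Finset.sum_fiberwise])

/-- The image of `U[λ_1, …, λ_n]` in `V_n`, for a subspace `U` of `V`. -/
def subV (n : ℕ) (U : Submodule F V) : Submodule F (Vn d n) :=
  Submodule.span F {y | ∃ (p : MvPolynomial (Fin n) F), ∃ x ∈ U, y = mkV d n (p ⊗ₜ[F] x)}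

/-- The polynomial `∑_α λ^α a_α` in `V[λ_1, …, λ_n]`. -/
def polyV {n : ℕ} (a : (Fin n →₀ ℕ) →₀ V) : MvPolynomial (Fin n) F ⊗[F] V :=
  a.sum fun α x => MvPolynomial.monomial α (1 : F) ⊗ₜ[F] x

/-- The linear map `p ⊗ t ↦ p · T(t)`. -/
def evalV {n : ℕ} {W : Type*} [AddCommMonoid W] [Module F W] (T : W →ₗ[F] Vn d n) :
    MvPolynomial (Fin n) F ⊗[F] W →ₗ[F] Vn d n :=
  TensorProduct.lift (mulV d n) ∘ₗ LinearMap.lTensor (MvPolynomial (Fin n) F) T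

end Target

/-! ### The chiral operad -/

section Chiral

variable {F : Type u} [Field F] {V : Type v} [AddCommGroup V] [Module F V]
  (𝒱 : ZMod 2 → Submodule F V) (d : V →ₗ[F] V)

/-- The space of `n`-ary chiral operations: linear maps `X : V^{⊗ n} ⊗ F[z_{kl}^{±1}] → V_n`
(written as multilinear maps on `V × ⋯ × V` with values in the linear maps on `F[z_{kl}^{±1}]`)
satisfying the two sesquilinearity conditions. -/
def chiral (n : ℕ) :
    Submodule F (MultilinearMap F (fun _ : Fin n => V) (OT F n →ₗ[F] Vn d n)) where
  carrier := {X |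
    (∀ (i : Fin n) (x : Fin n → V) (f : OT F n),
      X x (dz F id i f) =
        X (Function.update x i (d (x i))) f + mulV d n (MvPolynomial.X i) (X x f)) ∧
    (∀ (i j : Fin n) (x : Fin n → V) (f : OT F n),
      X x (zOT F i j * f) = diffV d n i j (X x f))}
  add_mem' h h' := by
    refine ⟨fun i x f => ?_, fun i j x f => ?_⟩
    · simp only [add_apply, LinearMap.add_apply, h.1, h'.1, map_add]
      abel
    · simp only [add_apply, LinearMap.add_apply, h.2, h'.2, map_add]
  zero_mem' := by simp
  smul_mem' c X h := by
    refine ⟨fun i x f => ?_, fun i j x f => ?_⟩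
    · simp only [smul_apply, LinearMap.smul_apply, h.1, map_smul, smul_add]
    · simp only [smul_apply, LinearMap.smul_apply, h.2, map_smul]

/-- The chiral operations of parity `p`. -/
def chiralParity (n : ℕ) (p : ZMod 2) : Submodule F (chiral d n) where
  carrier := {X | ∀ (q : Fin n → ZMod 2) (x : Fin n → V) (f : OT F n), (∀ i, x i ∈ 𝒱 (q i)) →
    X.1 x f ∈ subV d n (𝒱 (p + ∑ i, q i))}
  add_mem' h h' q x f hx := Submodule.add_mem _ (h q x f hx) (h' q x f hx)
  zero_mem' _ _ _ _ := Submodule.zero_mem _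
  smul_mem' c _ h q x f hx := Submodule.smul_mem _ c (h q x f hx)

/-- The filtration of the space of `n`-ary chiral operations induced by a filtration of `V`. -/
def chiralFil (fil : ℤ → Submodule F V) (n : ℕ) (r : ℤ) : Submodule F (chiral d n) where
  carrier := {X | ∀ (s : ℤ) (t : Fin n → ℤ) (p : ℤ), ∑ i, t i + p ≤ s →
    ∀ (x : Fin n → V) (f : OT F n), (∀ i, x i ∈ fil (t i)) →
      (f : Fun F (id : Fin n → Fin n)) ∈ filOT F n p → X.1 x f ∈ subV d n (fil (s - r))}
  add_mem' h h' s t p hs x f hx hf :=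
    Submodule.add_mem _ (h s t p hs x f hx hf) (h' s t p hs x f hx hf)
  zero_mem' _ _ _ _ _ _ _ _ := Submodule.zero_mem _
  smul_mem' c _ h s t p hs x f hx hf := Submodule.smul_mem _ c (h s t p hs x f hx hf)

/-- The functions of the variables of the `i`-th block, as functions of all variables. -/
def blockFun {n : ℕ} (m : Fin n → ℕ) (i : Fin n) : OT F (m i) →ₐ[F] OT F (∑ i, m i) :=
  renameInv F id id (emb m i) fun _ _ h h' => h (emb_injective m i h')

/-- The functions without poles at `z_k = z_l` for `k`, `l` in the same block, as elements of
`F[z_{kl}^{±1}]`. -/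
def regFun {n : ℕ} (m : Fin n → ℕ) : invFun F (block m) →ₐ[F] OT F (∑ i, m i) :=
  renameInv F (block m) id id fun _ _ h h' => h (congrArg (block m) h')

/-- The restriction of a function without poles at `z_k = z_l` for `k`, `l` in the same block to
the locus where all the variables of the `i`-th block are equal to one variable `z_i`. -/
def restrFun {n : ℕ} (m : Fin n → ℕ) : invFun F (block m) →ₐ[F] OT F n :=
  renameInv F (block m) id (block m) fun _ _ h => h

/-- The operator `λ_k - ∂/∂z_k`. -/
def chiralShift {n : ℕ} (m : Fin n → ℕ) (k : Fin (∑ i, m i)) :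
    Module.End F (MvPolynomial (Fin (∑ i, m i)) F ⊗[F] invFun F (block m)) :=
  LinearMap.rTensor (invFun F (block m)) (LinearMap.mulLeft F (MvPolynomial.X k)) -
    LinearMap.lTensor (MvPolynomial (Fin (∑ i, m i)) F) (dz F (block m) k)

/-- The operator `∏_k (λ_k - ∂/∂z_k) ^ α_k` (its factors commute). -/
def chiralShiftPow {n : ℕ} (m : Fin n → ℕ) (α : Fin (∑ i, m i) → ℕ) :
    Module.End F (MvPolynomial (Fin (∑ i, m i)) F ⊗[F] invFun F (block m)) :=
  (List.ofFn fun k => chiralShift m k ^ α k).prod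

/-- `Z = X(Y₁ ⊗ ⋯ ⊗ Yₙ)` for chiral operations, with `Y i` of parity `p i`:
if `f = g₁ ⋯ gₙ h`, where `g i` depends only on the variables of the `i`-th block and `h` has no
poles at `z_k = z_l` for `k`, `l` in the same block, then
`Z_λ(v ⊗ f) = ± X_Λ((Y₁)_{λ - ∂_z}(v₁ ⊗ g₁) ⊗ ⋯ ⊗ (Yₙ)_{λ - ∂_z}(vₙ ⊗ gₙ) ⊗ h |)`.
Here `Λ_i` is the sum of the `λ_k` in the `i`-th block, the derivatives act on `h`, and afterwards
all the variables `z_k` of the `i`-th block are set equal to `z_i`. The coefficients of a polynomial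
representing `Y_i(v_i ⊗ g_i)` are denoted by `a i`. -/
def IsChiralComp {n : ℕ} {m : Fin n → ℕ} (p : Fin n → ZMod 2) (X : chiral d n)
    (Y : ∀ i, chiral d (m i)) (Z : chiral d (∑ i, m i)) : Prop :=
  (∀ i, Y i ∈ chiralParity 𝒱 d (m i) (p i)) ∧
  ∀ (q : Fin (∑ i, m i) → ZMod 2) (x : Fin (∑ i, m i) → V), (∀ k, x k ∈ 𝒱 (q k)) →
  ∀ (g : ∀ i, OT F (m i)) (h : invFun F (block m)) (a : ∀ i, (Fin (m i) →₀ ℕ) →₀ V),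
    (∀ i, (Y i).1 (fun k => x (emb m i k)) (g i) = mkV d (m i) (polyV (a i))) →
    Z.1 x ((∏ i, blockFun m i (g i)) * regFun m h) =
      compSign p q • ∑ α ∈ Fintype.piFinset (fun i => (a i).support),
        evalV d (substV d (block m) ∘ₗ X.1 (fun i => a i (α i)) ∘ₗ (restrFun m).toLinearMap)
          (chiralShiftPow m (glue α) (1 ⊗ₜ[F] h))

/-- The chiral operad of a vector superspace `V = 𝒱 0 ⊕ 𝒱 1` with an even endomorphism `d`. -/
def chiralOperad : OperadData.{u, max u v} F where
  obj n := chiral d n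
  parity n p := chiralParity 𝒱 d n p
  IsOne X := ∀ x : Fin 1 → V, X.1 x 1 = mkV d 1 (1 ⊗ₜ[F] x 0)
  IsAct {n} σ X X' := ∀ (q : Fin n → ZMod 2) (x : Fin n → V) (f : OT F n),
    (∀ i, x i ∈ 𝒱 (q i)) →
    X'.1 x f = permSign q σ • substV d σ
      (X.1 (fun s => x (σ⁻¹ s)) (renameInv F id id σ (fun _ _ h h' => h (σ.injective h')) f))
  IsComp p X Y Z := IsChiralComp 𝒱 d p X Y Z

end Chiral

/-! ### Graphs and the classical operad -/

/-- Oriented edges between `n` vertices, without tadpoles. -/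
abbrev Edge (n : ℕ) : Type := {e : Fin n × Fin n // e.1 ≠ e.2}

/-- Graphs on `n` labelled vertices with oriented edges, without tadpoles; multiple edges are
allowed. A graph is given by the multiset of its edges. -/
abbrev NGraph (n : ℕ) : Type := Multiset (Edge n)

/-- Two vertices lie in the same connected component. -/
def Conn {n : ℕ} (Γ : NGraph n) : Fin n → Fin n → Prop :=
  Relation.EqvGen fun i j => ∃ e ∈ Γ, e.1.1 = i ∧ e.1.2 = j

/-- `c` lists the edges `i_1 → i_2, …, i_s → i_{s+1}, i_{s+1} → i_1` of an oriented cycle of `Γ`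
(addition in `Fin (s + 1)` is cyclic). -/
def IsCycle {n : ℕ} (Γ : NGraph n) {s : ℕ} (c : Fin (s + 1) → Edge n) : Prop :=
  (∀ t, (c t).1.2 = (c (t + 1)).1.1) ∧ Finset.univ.val.map c ≤ Γ

/-- The image of a graph under an injective relabelling of its vertices. -/
def NGraph.relabel {a b : ℕ} (θ : Fin a → Fin b) (h : Function.Injective θ) (Γ : NGraph a) :
    NGraph b :=
  Multiset.map (fun e => ⟨(θ e.1.1, θ e.1.2), fun h' => e.2 (h h')⟩) Γ

/-- Oriented edges between vertices of different blocks. -/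
abbrev InterEdge {n : ℕ} (m : Fin n → ℕ) : Type :=
  {e : Fin (∑ i, m i) × Fin (∑ i, m i) // block m e.1 ≠ block m e.2}

/-- The graph on all vertices with edges `E` between different blocks and with the graph `G i` on
the `i`-th block. Every graph is of this form, for a unique pair `(E, G)`. -/
def assemble {n : ℕ} {m : Fin n → ℕ} (E : Multiset (InterEdge m)) (G : ∀ i, NGraph (m i)) :
    NGraph (∑ i, m i) :=
  E.map (fun e => ⟨e.1, fun h => e.2 (congrArg (block m) h)⟩) +
    ∑ i, (G i).relabel (emb m i) (emb_injective m i)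

/-- The graph obtained by collapsing each block to a vertex. -/
def collapse {n : ℕ} {m : Fin n → ℕ} (E : Multiset (InterEdge m)) : NGraph n :=
  E.map fun e => ⟨(block m e.1.1, block m e.1.2), e.2⟩

/-- The block `j` is externally connected to the vertex `k`: in the collapsed graph it can be
reached from the block `i` of `k` by a path that starts with (the image of) an edge at `k` and does
not come back to `i`. -/
def ExtConn {n : ℕ} {m : Fin n → ℕ} (E : Multiset (InterEdge m)) (k : Fin (∑ i, m i))
    (j : Fin n) : Prop :=
  ∃ e ∈ E, ∃ l, (e.1 = (k, l) ∨ e.1 = (l, k)) ∧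
    Relation.ReflTransGen (fun a b => b ≠ block m k ∧
      ∃ e ∈ collapse E, e.1 = (a, b) ∨ e.1 = (b, a)) (block m l) j

section Classical

variable {F : Type u} [Field F] {V : Type v} [AddCommGroup V] [Module F V]
  (𝒱 : ZMod 2 → Submodule F V) (d : V →ₗ[F] V)

open Classical in
/-- The space of `n`-ary classical operations: maps `Y : G(n) × V^{⊗ n} → V_n`, linear in the second
argument, satisfying the cycle relations and the two sesquilinearity conditions. -/
def classical (n : ℕ) :
    Submodule F (NGraph n → MultilinearMap F (fun _ : Fin n => V) (Vn d n)) where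
  carrier := {Y |
    (∀ (Γ : NGraph n) (s : ℕ) (c : Fin (s + 1) → Edge n), IsCycle Γ c →
      Y Γ = 0 ∧ ∑ t, Y (Γ.erase (c t)) = 0) ∧
    (∀ (Γ : NGraph n) (i j : Fin n), Conn Γ i j → ∀ x, diffV d n i j (Y Γ x) = 0) ∧
    (∀ (Γ : NGraph n) (i : Fin n) (x : Fin n → V),
      ∑ j with Conn Γ i j,
        (Y Γ (Function.update x j (d (x j))) + mulV d n (MvPolynomial.X j) (Y Γ x)) = 0)}
  add_mem' {Y Y'} h h' := by
    refine ⟨fun Γ s c hc => ⟨?_, ?_⟩, fun Γ i j hij x => ?_, fun Γ i x => ?_⟩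
    · simp [(h.1 Γ s c hc).1, (h'.1 Γ s c hc).1]
    · simp [Finset.sum_add_distrib, (h.1 Γ s c hc).2, (h'.1 Γ s c hc).2]
    · simp [h.2.1 Γ i j hij x, h'.2.1 Γ i j hij x]
    · have := congrArg₂ (· + ·) (h.2.2 Γ i x) (h'.2.2 Γ i x)
      simp only [← Finset.sum_add_distrib, add_zero] at this
      rw [← this]
      refine Finset.sum_congr rfl fun j _ => ?_
      simp only [Pi.add_apply, add_apply, map_add]
      abel
  zero_mem' := by simp
  smul_mem' r Y h := by
    refine ⟨fun Γ s c hc => ⟨?_, ?_⟩, fun Γ i j hij x => ?_, fun Γ i x => ?_⟩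
    · simp [(h.1 Γ s c hc).1]
    · simp [← Finset.smul_sum, (h.1 Γ s c hc).2]
    · simp [h.2.1 Γ i j hij x]
    · have := congrArg (r • ·) (h.2.2 Γ i x)
      simpa [Finset.smul_sum] using this

/-- The classical operations of parity `p`. -/
def classicalParity (n : ℕ) (p : ZMod 2) : Submodule F (classical d n) where
  carrier := {Y | ∀ (Γ : NGraph n) (q : Fin n → ZMod 2) (x : Fin n → V), (∀ i, x i ∈ 𝒱 (q i)) →
    Y.1 Γ x ∈ subV d n (𝒱 (p + ∑ i, q i))}
  add_mem' h h' Γ q x hx := Submodule.add_mem _ (h Γ q x hx) (h' Γ q x hx)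
  zero_mem' _ _ _ _ := Submodule.zero_mem _
  smul_mem' c _ h Γ q x hx := Submodule.smul_mem _ c (h Γ q x hx)

/-- The `r`-th component of the grading of the space of `n`-ary classical operations induced by a
grading of `V`. -/
def classicalGr (gr : ℤ → Submodule F V) (n : ℕ) (r : ℤ) : Submodule F (classical d n) where
  carrier := {Y | ∀ (Γ : NGraph n) (t : Fin n → ℤ) (x : Fin n → V), (∀ i, x i ∈ gr (t i)) →
    Y.1 Γ x ∈ subV d n (gr ((Multiset.card Γ : ℤ) + ∑ i, t i - r))}
  add_mem' h h' Γ t x hx := Submodule.add_mem _ (h Γ t x hx) (h' Γ t x hx)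
  zero_mem' _ _ _ _ := Submodule.zero_mem _
  smul_mem' c _ h Γ t x hx := Submodule.smul_mem _ c (h Γ t x hx)

open Classical in
/-- The operator `λ_k + ∑_j (Λ_j + ∂_j)` on `V^{⊗ n}[λ]`, the sum being over the blocks `j` that are
externally connected to `k`; here `Λ_j` is the sum of the `λ_l` in the `j`-th block, and `∂_j` acts
on the `j`-th factor. -/
def classicalShift {n : ℕ} {m : Fin n → ℕ} (E : Multiset (InterEdge m)) (k : Fin (∑ i, m i)) :
    Module.End F (MvPolynomial (Fin (∑ i, m i)) F ⊗[F] PiTensorProduct F (fun _ : Fin n => V)) :=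
  LinearMap.rTensor _ (LinearMap.mulLeft F (MvPolynomial.X k)) +
    ∑ j with ExtConn E k j,
      (LinearMap.rTensor _ (LinearMap.mulLeft F (∑ l with block m l = j, MvPolynomial.X l)) +
        LinearMap.lTensor _ (PiTensorProduct.map (Function.update (fun _ => LinearMap.id) j d)))

/-- The operator `∏_k (λ_k + ∑_j (Λ_j + ∂_j)) ^ α_k` (its factors commute). -/
def classicalShiftPow {n : ℕ} {m : Fin n → ℕ} (E : Multiset (InterEdge m))
    (α : Fin (∑ i, m i) → ℕ) :
    Module.End F (MvPolynomial (Fin (∑ i, m i)) F ⊗[F] PiTensorProduct F (fun _ : Fin n => V)) :=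
  (List.ofFn fun k => classicalShift d E k ^ α k).prod

/-- `Z = X(Y₁ ⊗ ⋯ ⊗ Yₙ)` for classical operations, with `Y i` of parity `p i`:
for a graph `Γ` with restriction `G i` to the `i`-th block and with collapsed graph `Γ₀`,
`Z^Γ_λ(v) = ± X^{Γ₀}_Λ((Y₁)^{G₁}(v₁) ⊗ ⋯ ⊗ (Yₙ)^{Gₙ}(vₙ))`,
where `λ_k` is replaced by `λ_k + ∑_j (Λ_j + ∂_j)` in the values of the `Y i`, the sum being over the
blocks `j` that are externally connected to `k`. The coefficients of a polynomial representing
`Y_i^{G_i}(v_i)` are denoted by `a i`. -/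
def IsClassicalComp {n : ℕ} {m : Fin n → ℕ} (p : Fin n → ZMod 2) (X : classical d n)
    (Y : ∀ i, classical d (m i)) (Z : classical d (∑ i, m i)) : Prop :=
  (∀ i, Y i ∈ classicalParity 𝒱 d (m i) (p i)) ∧
  ∀ (q : Fin (∑ i, m i) → ZMod 2) (x : Fin (∑ i, m i) → V), (∀ k, x k ∈ 𝒱 (q k)) →
  ∀ (E : Multiset (InterEdge m)) (G : ∀ i, NGraph (m i)) (a : ∀ i, (Fin (m i) →₀ ℕ) →₀ V),
    (∀ i, (Y i).1 (G i) (fun k => x (emb m i k)) = mkV d (m i) (polyV (a i))) →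
    Z.1 (assemble E G) x =
      compSign p q • ∑ α ∈ Fintype.piFinset (fun i => (a i).support),
        evalV d (substV d (block m) ∘ₗ PiTensorProduct.lift (X.1 (collapse E)))
          (classicalShiftPow d E (glue α) (1 ⊗ₜ[F] PiTensorProduct.tprod F fun i => a i (α i)))

/-- The classical operad of a vector superspace `V = 𝒱 0 ⊕ 𝒱 1` with an even endomorphism `d`. -/
def classicalOperad : OperadData.{u, max u v} F where
  obj n := classical d n
  parity n p := classicalParity 𝒱 d n p
  IsOne Y := ∀ x : Fin 1 → V, Y.1 0 x = mkV d 1 (1 ⊗ₜ[F] x 0)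
  IsAct {n} σ Y Y' := ∀ (Γ : NGraph n) (q : Fin n → ZMod 2) (x : Fin n → V),
    (∀ i, x i ∈ 𝒱 (q i)) →
    Y'.1 Γ x = permSign q σ • substV d σ
      (Y.1 (Γ.relabel σ σ.injective) (fun s => x (σ⁻¹ s)))
  IsComp p X Y Z := IsClassicalComp 𝒱 d p X Y Z

end Classical

/-! ### The trivial filtration and grading, and the function of a graph -/

/-- The trivial increasing filtration: `fil^s V = 0` for `s < 0` and `fil^s V = V` for `s ≥ 0`. -/
def trivialFil (F : Type u) [Field F] (V : Type v) [AddCommGroup V] [Module F V] (s : ℤ) :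
    Submodule F V := if s < 0 then ⊥ else ⊤

/-- The trivial grading: `gr^0 V = V` and `gr^t V = 0` for `t ≠ 0`. -/
def trivialGr (F : Type u) [Field F] (V : Type v) [AddCommGroup V] [Module F V] (t : ℤ) :
    Submodule F V := if t = 0 then ⊤ else ⊥

/-- `z_{ij}⁻¹` for an edge `i → j`. -/
def edgeFun (F : Type u) [Field F] {n : ℕ} (e : Edge n) : OT F n :=
  ⟨Ring.inverse (z F id e.1.1 e.1.2),
    Algebra.subset_adjoin (Or.inr ⟨e.1.1, e.1.2, e.2, rfl⟩)⟩

/-- `p_Γ = ∏_{i → j} z_{ij}⁻¹`, the product being over the edges of `Γ`. -/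
def graphFun (F : Type u) [Field F] {n : ℕ} (Γ : NGraph n) : OT F n :=
  (Γ.map (edgeFun F)).prod

end VertexOperad

end

open scoped TensorProduct BigOperators

noncomputable section

namespace VertexOperad

universe u v

/-! ### The space `V_n` for `∂ = 0` -/

section TargetZero

variable {F : Type u} [Field F] {V : Type v} [AddCommGroup V] [Module F V]

/-! Because `∂ = 0`, the conditions on an operation can be checked for one choice of arguments at a
time. A chiral operation becomes a family of linear maps `φ` from functions to `V_n` that turn
`∂/∂z_i` into `λ_i` and `z_ij` into `∂/∂λ_j - ∂/∂λ_i` (`DMap`); a classical one becomes a family of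
`V_n`-valued functions on graphs (`CMap`). Let `p_Γ` be the product of the `z_e⁻¹` over the edges
`e` of `Γ`.

Everything rests on one observation. If no edge of `Γ` leaves a proper non-empty set `S` of
vertices, then `∑_{i ∈ S} ∂/∂z_i` kills `p_Γ`, so `λ_S φ(p_Γ) = 0`; but `λ_S = ∑_{i ∈ S} λ_i` is not
a zero divisor on `V_n` (`eq_zero_of_mulV_sum`), hence `φ(p_Γ) = 0`. So only connected graphs count.
On a tree, multiplication by any `z_e` deletes an edge and disconnects the graph, so every `∂/∂λ_j -
∂/∂λ_i` kills `φ(p_Γ)`, which in characteristic `0` is then a constant, that is, an element of `V`.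
Classical operations behave in the same way; their cycle relations of lengths 2 and 3 are the
antisymmetry and the partial fraction (Arnold) relation of the functions `p_Γ`. With these relations
every graph reduces to Hamiltonian paths starting at a fixed vertex `r` (`TreeRelations.eq_zero`).
This gives part (a), and shows that a chiral operation is determined by its values on trees
(`DMap.ext`), which form a classical operation (`graphVal_mem`).

Every classical operation arises in this way. Iterated residues are functionals dual to the path
functions and kill `∂/∂z_i` for `i ≠ r` (`exists_residue`). For such a functional `ρ` the map `f ↦
ρ(exp(-∑ λ_k z_kr) f)` is sesquilinear; it is polynomial in `λ` because `ρ` vanishes on homogeneous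
functions of degree different from `-(n - 1)` (`exists_DMap`, `exists_degree_bound`). This gives the
linear bijection `chiralEquiv`.

For compositions, the chiral formula is first shown to be independent of the representatives in
`V_{m_i}` and of the factorisation of `f` (`exists_compMap`, `exists_comp_DMap`). On trees all
inserted values are constants, so neither `λ - ∂_z` on the chiral side nor the shifts on the
classical side have any effect, and both compositions become `X^{Γ₀}` applied to constants
(`isClassicalComp_iff`, `compMap_graphFun`). An edge count shows that the other distributions of
edges contribute zero.

For `Lie`, the generators `x_i` are sent to basis vectors `e_i` of a Lie algebra with `[e_S, e_T] =
ω(S, T) e_{S+T}`, where `ω` has indeterminate entries `w_ij`. A multilinear Lie monomial thereby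
becomes a polynomial, the product over its brackets of the sums of the `w_ij` that the bracket
joins. Its coefficient at a graph defines a pairing `⟨Γ, P⟩` that satisfies the relations of
classical operations (`IsEdgeMonomial.treeLike`), makes paths dual to left-normed brackets
(`liePairing_chainG_leftNormed`) and is multiplicative under substitution (`liePairing_comp`). So `φ
⊗ P ↦ (Γ ↦ ⟨Γ, P⟩ φ)` is the isomorphism of part (c). -/

theorem totalOp_zero (n : ℕ) : totalOp (0 : V →ₗ[F] V) n =
    LinearMap.rTensor V (LinearMap.mulLeft F (∑ k, MvPolynomial.X k)) := by
  simp [totalOp]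

/-- The constant term `V_n → V`, `λ ↦ 0`. -/
def epsV (n : ℕ) : Vn (0 : V →ₗ[F] V) n →ₗ[F] V :=
  (LinearMap.range (totalOp (0 : V →ₗ[F] V) n)).liftQ
    ((TensorProduct.lid F V).toLinearMap ∘ₗ
      LinearMap.rTensor V (MvPolynomial.aeval (fun _ => (0 : F))).toLinearMap) (by
    rintro _ ⟨y, rfl⟩
    rw [totalOp_zero]
    induction y with
    | zero => simp
    | tmul p x => simp
    | add a b ha hb => rw [map_add]; exact Submodule.add_mem _ ha hb)

/-- The constants in `V_n`. -/
def constV (n : ℕ) : V →ₗ[F] Vn (0 : V →ₗ[F] V) n :=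
  mkV 0 n ∘ₗ TensorProduct.mk F (MvPolynomial (Fin n) F) V 1

theorem constV_apply (n : ℕ) (x : V) :
    constV (F := F) n x = mkV 0 n ((1 : MvPolynomial (Fin n) F) ⊗ₜ[F] x) := rfl

theorem epsV_mkV (n : ℕ) (p : MvPolynomial (Fin n) F) (x : V) :
    epsV n (mkV 0 n (p ⊗ₜ[F] x)) = MvPolynomial.aeval (fun _ => (0 : F)) p • x := by
  change ((LinearMap.range (totalOp (0 : V →ₗ[F] V) n)).liftQ _ _) (Submodule.Quotient.mk _) = _
  rw [Submodule.liftQ_apply]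
  simp

@[simp] theorem epsV_constV (n : ℕ) (x : V) : epsV (F := F) n (constV n x) = x := by
  rw [constV_apply, epsV_mkV]; simp

theorem mulV_mkV_tmul {d : V →ₗ[F] V} (n : ℕ) (p q : MvPolynomial (Fin n) F) (x : V) :
    mulV d n p (mkV d n (q ⊗ₜ[F] x)) = mkV d n ((p * q) ⊗ₜ[F] x) := rfl

theorem diffV_mkV_tmul {d : V →ₗ[F] V} (n : ℕ) (i j : Fin n) (q : MvPolynomial (Fin n) F)
    (x : V) : diffV d n i j (mkV d n (q ⊗ₜ[F] x)) =
      mkV d n ((MvPolynomial.pderiv j q - MvPolynomial.pderiv i q) ⊗ₜ[F] x) := rfl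

theorem substV_mkV_tmul {d : V →ₗ[F] V} {a b : ℕ} (π : Fin b → Fin a)
    (q : MvPolynomial (Fin a) F) (x : V) : substV d π (mkV d a (q ⊗ₜ[F] x)) =
      mkV d b ((MvPolynomial.aeval (fun i => ∑ k with π k = i,
        (MvPolynomial.X k : MvPolynomial (Fin b) F)) q) ⊗ₜ[F] x) := rfl

theorem Vn_induction {d : V →ₗ[F] V} {n : ℕ} {P : Vn d n → Prop} (h0 : P 0)
    (h1 : ∀ p x, P (mkV d n (p ⊗ₜ[F] x)))
    (h2 : ∀ a b, P a → P b → P (a + b)) (w : Vn d n) : P w := by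
  obtain ⟨y, rfl⟩ := mkV_surjective d n w
  induction y with
  | zero => simpa using h0
  | tmul p x => exact h1 p x
  | add a b ha hb => rw [map_add]; exact h2 _ _ ha hb

theorem Vn_ext {d : V →ₗ[F] V} {n : ℕ} {W : Type*} [AddCommGroup W] [Module F W]
    {f g : Vn d n →ₗ[F] W} (h : ∀ p x, f (mkV d n (p ⊗ₜ[F] x)) = g (mkV d n (p ⊗ₜ[F] x))) :
    f = g := by
  apply LinearMap.ext
  intro w
  induction w using Vn_induction with
  | h0 => simp
  | h1 p x => exact h p x
  | h2 a b ha hb => rw [map_add, map_add, ha, hb]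

theorem mulV_mul {d : V →ₗ[F] V} {n : ℕ} (p q : MvPolynomial (Fin n) F) (w : Vn d n) :
    mulV d n (p * q) w = mulV d n p (mulV d n q w) := by
  induction w using Vn_induction with
  | h0 => simp
  | h1 r x => simp only [mulV_mkV_tmul, mul_assoc]
  | h2 a b ha hb => simp only [map_add, ha, hb]

@[simp] theorem mulV_one {d : V →ₗ[F] V} {n : ℕ} (w : Vn d n) : mulV d n 1 w = w := by
  induction w using Vn_induction with
  | h0 => simp
  | h1 r x => simp only [mulV_mkV_tmul, one_mul]
  | h2 a b ha hb => simp only [map_add, ha, hb]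

theorem mkV_sum_mul (n : ℕ) (p : MvPolynomial (Fin n) F) (x : V) :
    mkV (0 : V →ₗ[F] V) n (((∑ k, MvPolynomial.X k) * p) ⊗ₜ[F] x) = 0 := by
  refine (Submodule.Quotient.mk_eq_zero _).2 ⟨p ⊗ₜ[F] x, ?_⟩
  rw [totalOp_zero]; simp

theorem mulV_sum_X (n : ℕ) (w : Vn (0 : V →ₗ[F] V) n) :
    mulV 0 n (∑ k, MvPolynomial.X k) w = 0 := by
  induction w using Vn_induction with
  | h0 => simp
  | h1 r x => rw [mulV_mkV_tmul, mkV_sum_mul]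
  | h2 a b ha hb => simp only [map_add, ha, hb, add_zero]

@[simp] theorem substV_constV {a b : ℕ} (π : Fin b → Fin a) (x : V) :
    substV 0 π (constV (F := F) a x) = constV b x := by
  rw [constV_apply, substV_mkV_tmul]; simp [constV_apply]

theorem diffV_self {d : V →ₗ[F] V} {n : ℕ} (i : Fin n) : diffV d n i i = 0 :=
  Vn_ext fun p x => by rw [diffV_mkV_tmul]; simp

theorem diffV_add {d : V →ₗ[F] V} {n : ℕ} (i j k : Fin n) (w : Vn d n) :
    diffV d n i j w + diffV d n j k w = diffV d n i k w := by
  induction w using Vn_induction with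
  | h0 => simp
  | h1 r x =>
    simp only [diffV_mkV_tmul, ← map_add, ← TensorProduct.add_tmul]
    congr 2; ring
  | h2 a b ha hb => simp only [map_add, ← ha, ← hb]; abel

theorem diffV_symm {d : V →ₗ[F] V} {n : ℕ} (i j : Fin n) (w : Vn d n) :
    diffV d n i j w = - diffV d n j i w := by
  have := diffV_add i j i w
  rw [diffV_self] at this
  simpa using eq_neg_of_add_eq_zero_left this

theorem diffV_mulV {d : V →ₗ[F] V} {n : ℕ} (i j : Fin n) (p : MvPolynomial (Fin n) F)
    (w : Vn d n) : diffV d n i j (mulV d n p w) =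
      mulV d n (MvPolynomial.pderiv j p - MvPolynomial.pderiv i p) w +
        mulV d n p (diffV d n i j w) := by
  induction w using Vn_induction with
  | h0 => simp
  | h1 r x =>
    simp only [diffV_mkV_tmul, mulV_mkV_tmul, ← map_add, ← TensorProduct.add_tmul]
    congr 2
    simp only [Derivation.leibniz, smul_eq_mul]
    ring
  | h2 a b ha hb => simp only [map_add, ha, hb]; abel

theorem substV_mulV {d : V →ₗ[F] V} {a b : ℕ} (π : Fin b → Fin a) (p : MvPolynomial (Fin a) F)
    (w : Vn d a) : substV d π (mulV d a p w) =
      mulV d b (MvPolynomial.aeval (fun i => ∑ k with π k = i,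
        (MvPolynomial.X k : MvPolynomial (Fin b) F)) p) (substV d π w) := by
  induction w using Vn_induction with
  | h0 => simp
  | h1 r x => simp only [mulV_mkV_tmul, substV_mkV_tmul, map_mul]
  | h2 a b ha hb => simp only [map_add, ha, hb]

/-- Chain rule: `λ_k` occurs in only one of the substituted linear forms, that of the index `π k`,
and there with coefficient `1`. -/
theorem pderiv_aeval_fiber {a b : ℕ} (π : Fin b → Fin a) (k : Fin b)
    (p : MvPolynomial (Fin a) F) :
    MvPolynomial.pderiv k (MvPolynomial.aeval (fun i => ∑ k with π k = i,
      (MvPolynomial.X k : MvPolynomial (Fin b) F)) p) =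
    MvPolynomial.aeval (fun i => ∑ k with π k = i,
      (MvPolynomial.X k : MvPolynomial (Fin b) F)) (MvPolynomial.pderiv (π k) p) := by
  classical
  induction p using MvPolynomial.induction_on with
  | C r => simp [MvPolynomial.algebraMap_eq]
  | add p q hp hq => simp only [map_add, hp, hq]
  | mul_X p i hp =>
    simp only [map_mul, Derivation.leibniz, smul_eq_mul, MvPolynomial.aeval_X, hp, map_add,
      map_sum, MvPolynomial.pderiv_X, Pi.single_apply, Finset.sum_ite_eq', Finset.mem_filter,
      Finset.mem_univ, true_and]
    congr 2
    by_cases h : i = π k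
    · simp [h]
    · simp [h, Ne.symm h]

theorem diffV_substV {d : V →ₗ[F] V} {a b : ℕ} (π : Fin b → Fin a) (k l : Fin b) (w : Vn d a) :
    diffV d b k l (substV d π w) = substV d π (diffV d a (π k) (π l) w) := by
  induction w using Vn_induction with
  | h0 => simp
  | h1 r x => simp only [diffV_mkV_tmul, substV_mkV_tmul, map_sub, pderiv_aeval_fiber]
  | h2 a b ha hb => simp only [map_add, ha, hb]

/-- The section of `V[λ] → V_n` with `λ_r` replaced by `-∑_{i ≠ r} λ_i`. -/
def secV {n : ℕ} (r : Fin n) : Vn (0 : V →ₗ[F] V) n →ₗ[F] MvPolynomial (Fin n) F ⊗[F] V :=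
  (LinearMap.range (totalOp (0 : V →ₗ[F] V) n)).liftQ
    (LinearMap.rTensor V (MvPolynomial.aeval fun i => if i = r then
        (-∑ j ∈ Finset.univ.erase r, MvPolynomial.X j : MvPolynomial (Fin n) F)
        else MvPolynomial.X i).toLinearMap) (by
    -- The substituted linear forms add up to zero, so the relation `∑ λ_i = 0` is respected.
    have h0 : (∑ i, if i = r then
        (-∑ j ∈ Finset.univ.erase r, MvPolynomial.X j : MvPolynomial (Fin n) F)
        else MvPolynomial.X i) = 0 := by
      rw [← Finset.add_sum_erase _ _ (Finset.mem_univ r), if_pos rfl,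
        Finset.sum_congr rfl (fun i hi => if_neg (Finset.ne_of_mem_erase hi)), neg_add_cancel]
    rintro _ ⟨y, rfl⟩
    rw [totalOp_zero]
    induction y with
    | zero => simp
    | tmul p x =>
      rw [LinearMap.mem_ker, LinearMap.rTensor_tmul, LinearMap.rTensor_tmul, LinearMap.mulLeft_apply,
        AlgHom.toLinearMap_apply, map_mul, map_sum]
      simp only [MvPolynomial.aeval_X]
      rw [h0, zero_mul, TensorProduct.zero_tmul]
    | add a b ha hb => rw [map_add]; exact Submodule.add_mem _ ha hb)

theorem secV_mkV {n : ℕ} (r : Fin n) (p : MvPolynomial (Fin n) F) (x : V) :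
    secV r (mkV 0 n (p ⊗ₜ[F] x)) = MvPolynomial.aeval (fun i => if i = r then
        (-∑ j ∈ Finset.univ.erase r, MvPolynomial.X j : MvPolynomial (Fin n) F)
        else MvPolynomial.X i) p ⊗ₜ[F] x := by
  change ((LinearMap.range (totalOp (0 : V →ₗ[F] V) n)).liftQ _ _) (Submodule.Quotient.mk _) = _
  rw [Submodule.liftQ_apply]
  simp

theorem mkV_secV {n : ℕ} (r : Fin n) (w : Vn (0 : V →ₗ[F] V) n) : mkV 0 n (secV r w) = w := by
  induction w using Vn_induction with
  | h0 => simp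
  | h1 p x =>
    rw [secV_mkV]
    induction p using MvPolynomial.induction_on with
    | C c => simp [MvPolynomial.algebraMap_eq]
    | add p q hp hq => rw [map_add, TensorProduct.add_tmul, TensorProduct.add_tmul, map_add,
        map_add, hp, hq]
    | mul_X p i hp =>
      rw [map_mul, mul_comm, mul_comm p, ← mulV_mkV_tmul, hp, MvPolynomial.aeval_X,
        ← mulV_mkV_tmul]
      split_ifs with h
      · subst h
        have := mulV_sum_X n (mkV (0 : V →ₗ[F] V) n (p ⊗ₜ[F] x))
        rw [← Finset.add_sum_erase _ _ (Finset.mem_univ i), map_add, LinearMap.add_apply] at this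
        rw [map_neg, LinearMap.neg_apply]
        exact (eq_neg_of_add_eq_zero_left this).symm
      · rfl
  | h2 a b ha hb => simp only [map_add, ha, hb]

/-- The substitution changes only `λ_r`, and `r ∉ S`. This moves questions about `λ_S` from the
quotient to `V[λ]`, where non-zero polynomials act injectively. -/
theorem secV_mulV {n : ℕ} (r : Fin n) {S : Finset (Fin n)} (hS : r ∉ S)
    (w : Vn (0 : V →ₗ[F] V) n) : secV r (mulV 0 n (∑ i ∈ S, MvPolynomial.X i) w) =
      LinearMap.rTensor V (LinearMap.mulLeft F (∑ i ∈ S, MvPolynomial.X i)) (secV r w) := by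
  induction w using Vn_induction with
  | h0 => simp
  | h1 p x =>
    rw [mulV_mkV_tmul, secV_mkV, secV_mkV, map_mul, map_sum]
    simp only [MvPolynomial.aeval_X, LinearMap.rTensor_tmul, LinearMap.mulLeft_apply]
    congr 2
    exact Finset.sum_congr rfl fun i hi => if_neg (by rintro rfl; exact hS hi)
  | h2 a b ha hb => simp only [map_add, ha, hb]

theorem sum_X_ne_zero {n : ℕ} {S : Finset (Fin n)} (hS : S.Nonempty) :
    (∑ i ∈ S, MvPolynomial.X i : MvPolynomial (Fin n) F) ≠ 0 := by
  classical
  obtain ⟨j, hj⟩ := hS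
  intro h
  have := congrArg (MvPolynomial.aeval (fun i => if i = j then (1 : F) else 0)) h
  simp [map_sum, hj] at this

theorem rTensor_mulLeft_injective {n : ℕ} {p : MvPolynomial (Fin n) F} (hp : p ≠ 0) :
    Function.Injective (LinearMap.rTensor V (LinearMap.mulLeft F p)) :=
  Module.Flat.rTensor_preserves_injective_linearMap _ (mul_right_injective₀ hp)

/-- `λ_S = ∑_{i ∈ S} λ_i` is not a zero divisor on `V_n` for a proper non-empty subset `S`. -/
theorem eq_zero_of_mulV_sum {n : ℕ} {S : Finset (Fin n)} (hS : S.Nonempty) (hS' : S ≠ Finset.univ)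
    {w : Vn (0 : V →ₗ[F] V) n} (hw : mulV 0 n (∑ i ∈ S, MvPolynomial.X i) w = 0) : w = 0 := by
  -- Eliminating a variable outside `S` embeds `V_n` into `V[λ]` without changing `λ_S`.
  obtain ⟨r, hr⟩ : ∃ r, r ∉ S := by
    by_contra h
    push Not at h
    exact hS' (Finset.eq_univ_of_forall h)
  have h := secV_mulV r hr w
  rw [hw, map_zero] at h
  have h2 : secV r w = 0 := rTensor_mulLeft_injective (sum_X_ne_zero hS) (by rw [← h, map_zero])
  rw [← mkV_secV r w, h2, map_zero]

/-- Chain rule: `λ_r` has become minus a sum that contains `λ_i`, so differentiating in `λ_i` also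
produces `-∂/∂λ_r`. -/
theorem pderiv_secV {n : ℕ} (r i : Fin n) (hi : i ≠ r) (w : Vn (0 : V →ₗ[F] V) n) :
    LinearMap.rTensor V (MvPolynomial.pderiv i).toLinearMap (secV r w) =
      secV r (diffV 0 n r i w) := by
  induction w using Vn_induction with
  | h0 => simp
  | h1 p x =>
    rw [diffV_mkV_tmul, secV_mkV, secV_mkV, LinearMap.rTensor_tmul]
    congr 1
    induction p using MvPolynomial.induction_on with
    | C c => simp [MvPolynomial.algebraMap_eq]
    | add p q hp hq => simp only [map_add, hp, hq, map_sub]; ring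
    | mul_X p j hp =>
      simp only [Derivation.coeFn_coe] at hp
      simp only [Derivation.coeFn_coe, map_mul, Derivation.leibniz, smul_eq_mul,
        MvPolynomial.aeval_X, hp, map_sub, map_add, MvPolynomial.pderiv_X, Pi.single_apply]
      by_cases hj : j = r
      · subst hj
        simp [MvPolynomial.pderiv_X, Pi.single_apply, hi.symm]
        ring
      · by_cases hji : j = i
        · subst hji
          simp [hj, MvPolynomial.pderiv_X]; ring
        · simp [hj, hji, MvPolynomial.pderiv_X]; ring
  | h2 a b ha hb => simp only [map_add, ha, hb]

theorem pderiv_secV_self {n : ℕ} (r : Fin n) (w : Vn (0 : V →ₗ[F] V) n) :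
    LinearMap.rTensor V (MvPolynomial.pderiv r).toLinearMap (secV r w) = 0 := by
  induction w using Vn_induction with
  | h0 => simp
  | h1 p x =>
    rw [secV_mkV, LinearMap.rTensor_tmul]
    suffices h : MvPolynomial.pderiv r (MvPolynomial.aeval (fun i => if i = r then
        (-∑ j ∈ Finset.univ.erase r, MvPolynomial.X j : MvPolynomial (Fin n) F)
        else MvPolynomial.X i) p) = 0 by
      rw [Derivation.coeFn_coe, h, TensorProduct.zero_tmul]
    induction p using MvPolynomial.induction_on with
    | C c => simp [MvPolynomial.algebraMap_eq]
    | add p q hp hq => rw [map_add, map_add, hp, hq, add_zero]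
    | mul_X p j hp =>
      rw [map_mul, Derivation.leibniz, hp, smul_zero, add_zero, MvPolynomial.aeval_X]
      split_ifs with hj
      · simp only [map_neg, map_sum, MvPolynomial.pderiv_X, Pi.single_apply]
        simp
      · simp [MvPolynomial.pderiv_X, hj]
  | h2 a b ha hb => simp only [map_add, ha, hb, add_zero]

/-- If `m i ≠ 0`, the coefficient of `p` at `m` times the non-zero number `m i` is a coefficient of
the derivative in direction `i`; this is where characteristic `0` enters. -/
theorem eq_C_of_pderiv_eq_zero [CharZero F] {n : ℕ} {p : MvPolynomial (Fin n) F}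
    (h : ∀ i, MvPolynomial.pderiv i p = 0) : p = MvPolynomial.C (MvPolynomial.coeff 0 p) := by
  classical
  ext m
  rw [MvPolynomial.coeff_C]
  split_ifs with hm
  · rw [hm]
  · obtain ⟨i, hi⟩ : ∃ i, m i ≠ 0 := by
      by_contra hc
      push Not at hc
      exact hm (Finsupp.ext fun i => (hc i).symm)
    have hle : Finsupp.single i 1 ≤ m := by
      rw [Finsupp.single_le_iff]; omega
    have := congrArg (MvPolynomial.coeff (m - Finsupp.single i 1)) (h i)
    rw [MvPolynomial.coeff_pderiv, tsub_add_cancel_of_le hle, MvPolynomial.coeff_zero] at this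
    rcases mul_eq_zero.1 this with h' | h'
    · exact h'
    · exact absurd h' (Nat.cast_add_one_ne_zero _)

theorem eq_one_tmul_of_pderiv_eq_zero [CharZero F] {n : ℕ} {u : MvPolynomial (Fin n) F ⊗[F] V}
    (h : ∀ i, LinearMap.rTensor V (MvPolynomial.pderiv i).toLinearMap u = 0) :
    ∃ x : V, u = 1 ⊗ₜ[F] x := by
  classical
  let b := Module.Basis.ofVectorSpace F V
  let e := TensorProduct.equivFinsuppOfBasisRight (M := MvPolynomial (Fin n) F) b
  have he : ∀ (i : Fin n) (u : MvPolynomial (Fin n) F ⊗[F] V) k,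
      e (LinearMap.rTensor V (MvPolynomial.pderiv i).toLinearMap u) k =
        MvPolynomial.pderiv i (e u k) := by
    intro i u k
    induction u with
    | zero => simp
    | tmul p x => simp [e]
    | add a b ha hb => simp only [map_add, Finsupp.add_apply, ha, hb]
  have hc : ∀ k, e u k = MvPolynomial.C (MvPolynomial.coeff 0 (e u k)) := fun k =>
    eq_C_of_pderiv_eq_zero fun i => by rw [← he, h i]; simp
  refine ⟨∑ k ∈ (e u).support, MvPolynomial.coeff 0 (e u k) • b k, ?_⟩
  conv_lhs => rw [← e.symm_apply_apply u]
  rw [TensorProduct.equivFinsuppOfBasisRight_symm_apply, Finsupp.sum, TensorProduct.tmul_sum]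
  refine Finset.sum_congr rfl fun k _ => ?_
  conv_lhs => rw [hc k]
  rw [← TensorProduct.smul_tmul, MvPolynomial.smul_eq_C_mul, mul_one]

/-- The elements of `V_n` killed by all `∂/∂λ_j - ∂/∂λ_i` are constants. -/
theorem constV_epsV_of_diffV [CharZero F] {n : ℕ} {w : Vn (0 : V →ₗ[F] V) n}
    (h : ∀ i j, diffV 0 n i j w = 0) : constV n (epsV n w) = w := by
  -- Without variables the relation is multiplication by an empty sum, and `V_0` is `V` itself.
  rcases n.eq_zero_or_pos with rfl | hn
  · induction w using Vn_induction with
    | h0 => simp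
    | h1 p x =>
      rw [epsV_mkV, constV_apply, ← TensorProduct.smul_tmul]
      congr 2
      rw [MvPolynomial.eq_C_of_isEmpty p]
      simp [MvPolynomial.smul_eq_C_mul]
    | h2 a b ha hb =>
      rw [map_add, map_add, ha fun i => i.elim0, hb fun i => i.elim0]
  · let r : Fin n := ⟨0, hn⟩
    obtain ⟨x, hx⟩ := eq_one_tmul_of_pderiv_eq_zero (u := secV r w) fun i => by
      by_cases hi : i = r
      · rw [hi, pderiv_secV_self]
      · rw [pderiv_secV r i hi, h, map_zero]
    have hw : w = constV n x := by rw [← mkV_secV r w, hx, constV_apply]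
    rw [hw, epsV_constV]

theorem mulV_mem_subV {d : V →ₗ[F] V} {n : ℕ} {U : Submodule F V} (p : MvPolynomial (Fin n) F)
    {w : Vn d n} (hw : w ∈ subV d n U) : mulV d n p w ∈ subV d n U := by
  induction hw using Submodule.span_induction with
  | mem y hy =>
    obtain ⟨q, x, hx, rfl⟩ := hy
    exact Submodule.subset_span ⟨p * q, x, hx, rfl⟩
  | zero => simp
  | add a b _ _ ha hb => rw [map_add]; exact Submodule.add_mem _ ha hb
  | smul c a _ ha => rw [map_smul]; exact Submodule.smul_mem _ c ha

theorem diffV_mem_subV {d : V →ₗ[F] V} {n : ℕ} {U : Submodule F V} (i j : Fin n)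
    {w : Vn d n} (hw : w ∈ subV d n U) : diffV d n i j w ∈ subV d n U := by
  induction hw using Submodule.span_induction with
  | mem y hy =>
    obtain ⟨q, x, hx, rfl⟩ := hy
    exact Submodule.subset_span ⟨_, x, hx, rfl⟩
  | zero => simp
  | add a b _ _ ha hb => rw [map_add]; exact Submodule.add_mem _ ha hb
  | smul c a _ ha => rw [map_smul]; exact Submodule.smul_mem _ c ha

theorem epsV_mem_of_mem_subV {n : ℕ} {U : Submodule F V} {w : Vn (0 : V →ₗ[F] V) n}
    (hw : w ∈ subV 0 n U) : epsV n w ∈ U := by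
  induction hw using Submodule.span_induction with
  | mem y hy =>
    obtain ⟨q, x, hx, rfl⟩ := hy
    rw [epsV_mkV]; exact Submodule.smul_mem _ _ hx
  | zero => simp
  | add a b _ _ ha hb => rw [map_add]; exact Submodule.add_mem _ ha hb
  | smul c a _ ha => rw [map_smul]; exact Submodule.smul_mem _ c ha

theorem constV_mem_subV {n : ℕ} {U : Submodule F V} {x : V} (hx : x ∈ U) :
    constV (F := F) n x ∈ subV 0 n U :=
  Submodule.subset_span ⟨1, x, hx, rfl⟩

theorem subV_top (d : V →ₗ[F] V) (n : ℕ) : subV d n ⊤ = ⊤ := by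
  refine eq_top_iff.2 fun w _ => ?_
  induction w using Vn_induction with
  | h0 => simp
  | h1 p x => exact Submodule.subset_span ⟨p, x, trivial, rfl⟩
  | h2 a b ha hb => exact Submodule.add_mem _ (ha trivial) (hb trivial)

theorem subV_bot (d : V →ₗ[F] V) (n : ℕ) : subV d n ⊥ = ⊥ := by
  refine Submodule.span_eq_bot.2 ?_
  rintro _ ⟨p, x, hx, rfl⟩
  rw [(Submodule.mem_bot F).1 hx, TensorProduct.tmul_zero, map_zero]

end TargetZero

end VertexOperad

end

noncomputable section

namespace VertexOperad

/-! ### Graphs -/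

section Graphs

variable {n : ℕ}

/-- The graph with the single edge `i → j` (without edges if `i = j`). -/
def edg (i j : Fin n) : NGraph n := if h : i ≠ j then {⟨(i, j), h⟩} else 0

theorem edg_of_ne {i j : Fin n} (h : i ≠ j) : edg i j = {⟨(i, j), h⟩} := dif_pos h

theorem edg_edge (e : Edge n) : edg e.1.1 e.1.2 = {e} := dif_pos e.2

theorem mem_edg {i j : Fin n} {e : Edge n} (h : e ∈ edg i j) : e.1.1 = i ∧ e.1.2 = j := by
  by_cases hij : i ≠ j
  · rw [edg_of_ne hij, Multiset.mem_singleton] at h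
    subst h; exact ⟨rfl, rfl⟩
  · rw [edg, dif_neg hij] at h
    simp at h

theorem exists_add_edg {Γ : NGraph n} {e : Edge n} (h : e ∈ Γ) :
    ∃ Γ', Γ = Γ' + edg e.1.1 e.1.2 := by
  classical
  refine ⟨Γ.erase e, ?_⟩
  rw [edg_edge, add_comm, Multiset.singleton_add, Multiset.cons_erase h]

theorem card_edg {i j : Fin n} (h : i ≠ j) : Multiset.card (edg i j) = 1 := by
  rw [edg_of_ne h, Multiset.card_singleton]

/-- The path `r → l₁ → l₂ → ⋯`. -/
def chainG : Fin n → List (Fin n) → NGraph n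
  | _, [] => 0
  | r, a :: l => edg r a + chainG a l

theorem chainG_append (r : Fin n) (l : List (Fin n)) (a : Fin n) :
    chainG r (l ++ [a]) = chainG r l + edg ((r :: l).getLast (List.cons_ne_nil _ _)) a := by
  induction l generalizing r with
  | nil => simp [chainG]
  | cons b l ih => simp only [List.cons_append, chainG, ih, add_assoc]; rfl

theorem mem_of_mem_chainG {r : Fin n} {l : List (Fin n)} {e : Edge n} (he : e ∈ chainG r l) :
    e.1.1 ∈ r :: l ∧ e.1.2 ∈ r :: l := by
  induction l generalizing r with
  | nil => simp [chainG] at he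
  | cons a l ih =>
    rw [chainG, Multiset.mem_add] at he
    rcases he with he | he
    · obtain ⟨h1, h2⟩ := mem_edg he
      rw [h1, h2]; simp
    · exact ⟨List.mem_cons_of_mem _ (ih he).1, List.mem_cons_of_mem _ (ih he).2⟩

theorem card_chainG {r : Fin n} {l : List (Fin n)} (h : (r :: l).Nodup) :
    Multiset.card (chainG r l) = l.length := by
  induction l generalizing r with
  | nil => rfl
  | cons a l ih =>
    have hra : r ≠ a := fun h' => by subst h'; simp at h
    rw [chainG, Multiset.card_add, card_edg hra, ih (List.nodup_cons.1 h).2, List.length_cons,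
      add_comm]

theorem length_of_nodup_of_forall_mem {l : List (Fin n)} (h : l.Nodup) (h' : ∀ i, i ∈ l) :
    l.length = n := by
  rw [← List.toFinset_card_of_nodup h]
  have : l.toFinset = Finset.univ := Finset.eq_univ_of_forall fun i => List.mem_toFinset.2 (h' i)
  rw [this, Finset.card_univ, Fintype.card_fin]

/-- `S` is a union of connected components of `Γ`. -/
def ClosedIn (Γ : NGraph n) (S : Finset (Fin n)) : Prop := ∀ e ∈ Γ, e.1.1 ∈ S ↔ e.1.2 ∈ S

theorem ClosedIn.mem_iff_of_conn {Γ : NGraph n} {S : Finset (Fin n)} (h : ClosedIn Γ S)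
    {i j : Fin n} (hij : Conn Γ i j) : i ∈ S ↔ j ∈ S := by
  induction hij with
  | rel a b hab => obtain ⟨e, he, rfl, rfl⟩ := hab; exact h e he
  | refl a => rfl
  | symm a b _ ih => exact ih.symm
  | trans a b c _ _ h1 h2 => exact h1.trans h2

open Classical in
theorem closedIn_component (Γ : NGraph n) (i : Fin n) :
    ClosedIn Γ (Finset.univ.filter fun j => Conn Γ i j) := by
  intro e he
  have hc : Conn Γ e.1.1 e.1.2 := Relation.EqvGen.rel _ _ ⟨e, he, rfl, rfl⟩
  simp only [Finset.mem_filter, Finset.mem_univ, true_and]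
  exact ⟨fun h => h.trans _ _ _ hc, fun h => h.trans _ _ _ (hc.symm _ _)⟩

/-- A graph with few different edges is not connected. -/
theorem exists_closedIn_of_card_lt {Γ : NGraph n} {s : Finset (Edge n)} (hs : ∀ e ∈ Γ, e ∈ s)
    (h : s.card + 1 < n) :
    ∃ S : Finset (Fin n), S.Nonempty ∧ S ≠ Finset.univ ∧ ClosedIn Γ S := by
  classical
  -- Orientation and multiplicity are forgotten: the simple graph has at most `s.card` edges, while
  -- a connected one needs `n - 1`.
  let G : SimpleGraph (Fin n) := SimpleGraph.fromRel fun i j => ∃ e ∈ Γ, e.1.1 = i ∧ e.1.2 = j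
  have hG : ¬ G.Connected := by
    intro hc
    have h1 := hc.card_vert_le_card_edgeSet_add_one
    have h2 : G.edgeSet ⊆ (s.image fun e => s(e.1.1, e.1.2) : Finset (Sym2 (Fin n))) := by
      intro x
      induction x with
      | _ a b =>
        intro hx
        rw [SimpleGraph.mem_edgeSet, SimpleGraph.fromRel_adj] at hx
        rcases hx.2 with ⟨e, he, rfl, rfl⟩ | ⟨e, he, rfl, rfl⟩
        · exact Finset.mem_coe.2 (Finset.mem_image.2 ⟨e, hs e he, rfl⟩)
        · exact Finset.mem_coe.2 (Finset.mem_image.2 ⟨e, hs e he, Sym2.eq_swap⟩)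
    have h3 : Nat.card G.edgeSet ≤ s.card := by
      refine (Nat.card_mono (Finset.finite_toSet _) h2).trans ?_
      rw [Nat.card_coe_set_eq, Set.ncard_coe_finset]
      exact Finset.card_image_le
    rw [Nat.card_eq_fintype_card, Fintype.card_fin] at h1
    omega
  have hpos : 0 < n := by omega
  have : Nonempty (Fin n) := ⟨⟨0, hpos⟩⟩
  have hpre : ¬ G.Preconnected := fun hp => hG ⟨hp⟩
  unfold SimpleGraph.Preconnected at hpre
  push Not at hpre
  obtain ⟨i, j, hij⟩ := hpre
  refine ⟨Finset.univ.filter fun k => G.Reachable i k, ⟨i, by simp⟩, fun hu => hij ?_, ?_⟩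
  · have := Finset.mem_univ j
    rw [← hu] at this
    simpa using this
  · intro e he
    have hadj : G.Adj e.1.1 e.1.2 := (SimpleGraph.fromRel_adj _ _ _).2 ⟨e.2, Or.inl ⟨e, he, rfl, rfl⟩⟩
    simp only [Finset.mem_filter, Finset.mem_univ, true_and]
    exact ⟨fun h => h.trans hadj.reachable, fun h => h.trans hadj.symm.reachable⟩

theorem exists_closedIn_of_card_add_one_lt {Γ : NGraph n} (h : Multiset.card Γ + 1 < n) :
    ∃ S : Finset (Fin n), S.Nonempty ∧ S ≠ Finset.univ ∧ ClosedIn Γ S := by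
  classical
  exact exists_closedIn_of_card_lt (s := Γ.toFinset) (fun e he => Multiset.mem_toFinset.2 he)
    (lt_of_le_of_lt (Nat.add_le_add_right (Multiset.toFinset_card_le Γ) 1) h)

/-- The rest of the cycle still joins the two ends of the erased edge, so erasing it does not
separate any vertices. -/
theorem IsCycle.closedIn_of_erase {Γ : NGraph n} {s : ℕ} {c : Fin (s + 1) → Edge n}
    (hc : IsCycle Γ c) [DecidableEq (Edge n)] {S : Finset (Fin n)}
    (hS : ClosedIn (Γ.erase (c 0)) S) : ClosedIn Γ S := by
  have hmem : ∀ t, t ≠ 0 → c t ∈ Γ.erase (c 0) := by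
    intro t ht
    have h1 : (Finset.univ.val.map c).erase (c 0) ≤ Γ.erase (c 0) := Multiset.erase_le_erase _ hc.2
    refine Multiset.mem_of_le h1 ?_
    have h2 : (Finset.univ : Finset (Fin (s + 1))).val = 0 ::ₘ (Finset.univ.erase 0).val := by
      rw [Finset.erase_val, Multiset.cons_erase (Finset.mem_univ_val 0)]
    rw [h2, Multiset.map_cons, Multiset.erase_cons_head]
    exact Multiset.mem_map_of_mem c (Finset.mem_erase.2 ⟨ht, Finset.mem_univ t⟩)
  -- Walking round the cycle from the head of `c 0`, every vertex passed lies on the same side of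
  -- `S`.
  have hstep : ∀ k : ℕ, ∀ hk : k ≤ s, (c 0).1.2 ∈ S ↔ (c (⟨k, by omega⟩ + 1)).1.1 ∈ S := by
    intro k
    induction k with
    | zero => intro _; rw [← hc.1]; rfl
    | succ k ih =>
      intro hk
      have e1 : (⟨k, by omega⟩ + 1 : Fin (s + 1)) = ⟨k + 1, by omega⟩ := by
        apply Fin.ext
        rw [Fin.val_add_one_of_lt (by rw [Fin.lt_def]; simp; omega)]
      rw [ih (by omega), e1, ← hc.1]
      exact hS _ (hmem _ (fun h => by simpa using congrArg Fin.val h))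
  intro e he
  by_cases hec : e = c 0
  · subst hec
    have h := hstep s le_rfl
    -- Addition is cyclic, so the walk of full length ends at the tail of `c 0`.
    have e2 : (⟨s, by omega⟩ + 1 : Fin (s + 1)) = 0 := Fin.last_add_one s
    rw [e2] at h
    exact h.symm
  · exact hS e ((Multiset.mem_erase_of_ne hec).2 he)

/-- Erasing one edge of the cycle leaves `n - 2` edges, too few for a connected graph, and does not
change the unions of components. -/
theorem IsCycle.exists_closedIn {Γ : NGraph n} {s : ℕ} {c : Fin (s + 1) → Edge n}
    (hc : IsCycle Γ c) (h : Multiset.card Γ + 1 = n) :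
    ∃ S : Finset (Fin n), S.Nonempty ∧ S ≠ Finset.univ ∧ ClosedIn Γ S := by
  classical
  have hmem : c 0 ∈ Γ := Multiset.mem_of_le hc.2 (Multiset.mem_map_of_mem c (Finset.mem_univ_val 0))
  have hcard := Multiset.card_erase_add_one hmem
  obtain ⟨S, h1, h2, h3⟩ := exists_closedIn_of_card_add_one_lt (Γ := Γ.erase (c 0)) (by omega)
  exact ⟨S, h1, h2, hc.closedIn_of_erase h3⟩

/-! ### Reduction of graphs to paths -/

/-- The number of edges at `v`. -/
def degAt (v : Fin n) (Γ : NGraph n) : ℕ := Γ.countP fun e => e.1.1 = v ∨ e.1.2 = v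

theorem degAt_add (v : Fin n) (Γ Γ' : NGraph n) : degAt v (Γ + Γ') = degAt v Γ + degAt v Γ' :=
  Multiset.countP_add _ _ _

theorem degAt_edg_left {v a : Fin n} (h : v ≠ a) : degAt v (edg v a) = 1 := by
  simp [edg_of_ne h, degAt, ← Multiset.cons_zero]

theorem degAt_edg_right {v a : Fin n} (h : a ≠ v) : degAt v (edg a v) = 1 := by
  simp [edg_of_ne h, degAt, ← Multiset.cons_zero]

theorem degAt_edg_of_ne {v a b : Fin n} (ha : a ≠ v) (hb : b ≠ v) : degAt v (edg a b) = 0 := by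
  rw [degAt, Multiset.countP_eq_zero]
  intro e he
  obtain ⟨h1, h2⟩ := mem_edg he
  rw [h1, h2]; simp [ha, hb]

theorem degAt_nsmul (v : Fin n) (k : ℕ) (Γ : NGraph n) : degAt v (k • Γ) = k * degAt v Γ :=
  Multiset.countP_nsmul _ _ _

/-- Functions on graphs that satisfy the relations of the functions `p_Γ` modulo derivatives. -/
structure TreeRelations {M : Type*} [AddCommGroup M] (y : NGraph n → M) : Prop where
  flip : ∀ (Γ : NGraph n) {i j : Fin n}, i ≠ j → y (Γ + edg i j) = - y (Γ + edg j i)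
  arnold : ∀ (Γ : NGraph n) {v a b : Fin n}, v ≠ a → v ≠ b → a ≠ b →
    y (Γ + edg v a + edg v b) = y (Γ + edg v a + edg a b) + y (Γ + edg v b + edg b a)
  disc : ∀ (Γ : NGraph n) (S : Finset (Fin n)), S.Nonempty → S ≠ Finset.univ → ClosedIn Γ S →
    y Γ = 0
  bridge : ∀ (Γ : NGraph n) (S : Finset (Fin n)) (e : Edge n), e ∈ Γ → e.1.1 ∈ S → e.1.2 ∉ S →
    (∀ e' ∈ Γ, e' ≠ e → (e'.1.1 ∈ S ↔ e'.1.2 ∈ S)) → y Γ = 0 → y (Γ + {e}) = 0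

/-- A path starting at `r` is grown vertex by vertex. The remaining edges may meet it only at its
end `v`. If several edges leave `v` to different vertices, the Arnold relation trades `v → a`, `v →
b` for one of them together with an edge between `a` and `b`, which lowers the degree at `v`.
Parallel edges at `v`, once they are the only ones left there, are removed by `bridge`. A single
remaining edge `v → a` is appended to the path. If no edge is left at `v`, the graph is a
Hamiltonian path or disconnected. -/
theorem TreeRelations.eq_zero {M : Type*} [AddCommGroup M] {y : NGraph n → M}
    (hy : TreeRelations y) (r : Fin n)
    (hchain : ∀ l, (r :: l).Nodup → (∀ i, i ∈ r :: l) → y (chainG r l) = 0) (Γ : NGraph n) :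
    y Γ = 0 := by
  classical
  suffices key : ∀ (k : ℕ) (l : List (Fin n)), (r :: l).Nodup → n - l.length = k →
      ∀ v, v = (r :: l).getLast (List.cons_ne_nil _ _) →
      ∀ Γ' : NGraph n, (∀ e ∈ Γ', ∀ w ∈ r :: l, (e.1.1 = w ∨ e.1.2 = w) → w = v) →
        y (chainG r l + Γ') = 0 by
    have := key _ [] (by simp) rfl r rfl Γ (by simp)
    simpa [chainG] using this
  intro k
  induction k using Nat.strong_induction_on with
  | _ k IH =>
  intro l hl hk v hv
  have hvmem : v ∈ r :: l := hv ▸ List.getLast_mem _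
  have hlen : l.length + 1 ≤ n := by
    have := hl.length_le_card
    simpa using this
  -- Here `N` is the degree at `v` outside the path: `k + 1` parallel edges `v → a` and `q` edges
  -- still unsorted. The outer induction is on `N`, the inner one on `q`.
  have claim : ∀ (N q k : ℕ) (a : Fin n) (Γ' : NGraph n), a ∉ r :: l →
      (∀ e ∈ Γ', ∀ w ∈ r :: l, (e.1.1 = w ∨ e.1.2 = w) → w = v) → degAt v Γ' = q →
      k + 1 + q = N → y (chainG r l + (k + 1) • edg v a + Γ') = 0 := by
    intro N
    induction N using Nat.strong_induction_on with
    | _ N ihN =>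
    intro q
    induction q with
    | zero =>
      intro k a Γ' ha hav hdeg hN
      have hva : v ≠ a := fun h => ha (h ▸ hvmem)
      have hav' : ∀ e ∈ Γ', ∀ w ∈ r :: l, ¬ (e.1.1 = w ∨ e.1.2 = w) := by
        intro e he w hw hew
        have hwv := hav e he w hw hew
        subst hwv
        rw [degAt, Multiset.countP_eq_zero] at hdeg
        exact hdeg e he hew
      rcases k with _ | k
      · rw [zero_add, one_nsmul]
        have hc : chainG r l + edg v a = chainG r (l ++ [a]) := by rw [chainG_append, ← hv]
        rw [hc]
        refine IH (n - (l ++ [a]).length) ?_ (l ++ [a]) ?_ rfl a (by simp) Γ' ?_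
        · rw [List.length_append, List.length_singleton]; omega
        · rw [← List.cons_append, List.nodup_append]
          exact ⟨hl, by simp, fun b hb c hc => by
            rw [List.mem_singleton] at hc; subst hc; exact fun h => ha (h ▸ hb)⟩
        · intro e he w hw hew
          rw [← List.cons_append, List.mem_append, List.mem_singleton] at hw
          rcases hw with hw | hw
          · exact absurd hew (hav' e he w hw)
          · exact hw
      -- The copies of `v → a` are now the only edges leaving the path, so the case with one copy
      -- fewer implies the present one through `bridge`.
      · have h0 := ihN (k + 1) (by omega) 0 k a Γ' ha hav hdeg (by omega)
        have hb := hy.bridge (chainG r l + (k + 1) • edg v a + Γ') (r :: l).toFinset ⟨(v, a), hva⟩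
          ?_ (by simpa using hvmem) (by simpa using ha) ?_ h0
        · rw [← hb, succ_nsmul _ (k + 1), edg_of_ne hva]
          congr 1; abel
        · rw [edg_of_ne hva]
          simp
        · intro e' he' hne
          rw [Multiset.mem_add, Multiset.mem_add] at he'
          rcases he' with (he' | he') | he'
          · have := mem_of_mem_chainG he'
            simp only [List.mem_toFinset, this]
          · rw [edg_of_ne hva] at he'
            exact absurd (Multiset.mem_singleton.1 (Multiset.mem_of_mem_nsmul he')) hne
          · have h1 : e'.1.1 ∉ r :: l := fun h => hav' e' he' _ h (Or.inl rfl)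
            have h2 : e'.1.2 ∉ r :: l := fun h => hav' e' he' _ h (Or.inr rfl)
            simp only [List.mem_toFinset, h1, h2]
    | succ q ihq =>
      intro k a Γ' ha hav hdeg hN
      have hva : v ≠ a := fun h => ha (h ▸ hvmem)
      have main : ∀ (b : Fin n) (Γ'' : NGraph n), b ∉ r :: l →
          (∀ e ∈ Γ'', ∀ w ∈ r :: l, (e.1.1 = w ∨ e.1.2 = w) → w = v) → degAt v Γ'' = q →
          y (chainG r l + (k + 1) • edg v a + (Γ'' + edg v b)) = 0 := by
        intro b Γ'' hb hav'' hdeg''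
        have hvb : v ≠ b := fun h => hb (h ▸ hvmem)
        by_cases hab : a = b
        · subst hab
          have := ihq (k + 1) a Γ'' ha hav'' hdeg'' (by omega)
          rw [← this, succ_nsmul _ (k + 1)]
          congr 1; abel
        -- Both terms on the right have one edge fewer at `v`. In the second the distinguished edge
        -- is the single `v → b`, and the remaining `k` copies of `v → a` join the unsorted edges.
        · have h1 := hy.arnold (chainG r l + k • edg v a + Γ'') hva hvb hab
          have h2 := ihN (N - 1) (by omega) q k a (Γ'' + edg a b) ha ?_ ?_ (by omega)
          · have h3 := ihN (N - 1) (by omega) (k + q) 0 b (k • edg v a + Γ'' + edg b a) hb ?_ ?_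
              (by omega)
            · have e1 : chainG r l + (k + 1) • edg v a + (Γ'' + edg v b) =
                  chainG r l + k • edg v a + Γ'' + edg v a + edg v b := by
                rw [succ_nsmul]; abel
              have e2 : chainG r l + (k + 1) • edg v a + (Γ'' + edg a b) =
                  chainG r l + k • edg v a + Γ'' + edg v a + edg a b := by
                rw [succ_nsmul]; abel
              have e3 : chainG r l + (0 + 1) • edg v b + (k • edg v a + Γ'' + edg b a) =
                  chainG r l + k • edg v a + Γ'' + edg v b + edg b a := by
                rw [zero_add, one_nsmul]; abel
              rw [e1, h1, ← e2, ← e3, h2, h3, add_zero]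
            · intro e he w hw hew
              rw [Multiset.mem_add, Multiset.mem_add] at he
              rcases he with (he | he) | he
              · obtain ⟨q1, q2⟩ := mem_edg (Multiset.mem_of_mem_nsmul he)
                rcases hew with h | h
                · rw [← h, q1]
                · exact absurd (h ▸ hw) (q2 ▸ ha)
              · exact hav'' e he w hw hew
              · obtain ⟨q1, q2⟩ := mem_edg he
                rcases hew with h | h
                · exact absurd (h ▸ hw) (q1 ▸ hb)
                · exact absurd (h ▸ hw) (q2 ▸ ha)
            · rw [degAt_add, degAt_add, degAt_nsmul, degAt_edg_left hva, hdeg'',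
                degAt_edg_of_ne hvb.symm hva.symm]; ring
          · intro e he w hw hew
            rw [Multiset.mem_add] at he
            rcases he with he | he
            · exact hav'' e he w hw hew
            · obtain ⟨q1, q2⟩ := mem_edg he
              rcases hew with h | h
              · exact absurd (h ▸ hw) (q1 ▸ ha)
              · exact absurd (h ▸ hw) (q2 ▸ hb)
          · rw [degAt_add, hdeg'', degAt_edg_of_ne hva.symm hvb.symm, add_zero]
      have hpos : 0 < degAt v Γ' := by omega
      rw [degAt, Multiset.countP_pos] at hpos
      obtain ⟨e, he, hev⟩ := hpos
      obtain ⟨Γ'', rfl⟩ := exists_add_edg he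
      have hav'' : ∀ e ∈ Γ'', ∀ w ∈ r :: l, (e.1.1 = w ∨ e.1.2 = w) → w = v := fun e' he' =>
        hav e' (Multiset.mem_add.2 (Or.inl he'))
      have hne := e.2
      rcases hev with hev | hev
      · rw [hev] at hne hdeg ⊢
        rw [degAt_add, degAt_edg_left hne] at hdeg
        exact main _ Γ'' (fun h => hne (hav e he _ h (Or.inr rfl)).symm) hav'' (by omega)
      · rw [hev] at hne hdeg ⊢
        rw [degAt_add, degAt_edg_right hne] at hdeg
        rw [← add_assoc, hy.flip _ hne, add_assoc,
          main _ Γ'' (fun h => hne (hav e he _ h (Or.inl rfl))) hav'' (by omega), neg_zero]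
  intro Γ' hav
  by_cases hdeg : degAt v Γ' = 0
  · have hav' : ∀ e ∈ Γ', ∀ w ∈ r :: l, ¬ (e.1.1 = w ∨ e.1.2 = w) := by
      intro e he w hw hew
      have hwv := hav e he w hw hew
      subst hwv
      rw [degAt, Multiset.countP_eq_zero] at hdeg
      exact hdeg e he hew
    by_cases hall : ∀ i, i ∈ r :: l
    · have : Γ' = 0 := Multiset.eq_zero_of_forall_notMem fun e he =>
        hav' e he _ (hall e.1.1) (Or.inl rfl)
      rw [this, add_zero]
      exact hchain l hl hall
    -- No edge leaves the path although it misses a vertex.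
    · refine hy.disc _ (r :: l).toFinset ⟨r, by simp⟩ (fun h => hall fun i => ?_) ?_
      · rw [← List.mem_toFinset, h]; exact Finset.mem_univ i
      · intro e he
        rw [Multiset.mem_add] at he
        rcases he with he | he
        · have := mem_of_mem_chainG he
          simp only [List.mem_toFinset, this]
        · have h1 : e.1.1 ∉ r :: l := fun h => hav' e he _ h (Or.inl rfl)
          have h2 : e.1.2 ∉ r :: l := fun h => hav' e he _ h (Or.inr rfl)
          simp only [List.mem_toFinset, h1, h2]
  · have hpos : 0 < degAt v Γ' := Nat.pos_of_ne_zero hdeg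
    rw [degAt, Multiset.countP_pos] at hpos
    obtain ⟨e, he, hev⟩ := hpos
    obtain ⟨Γ'', rfl⟩ := exists_add_edg he
    have hav'' : ∀ e ∈ Γ'', ∀ w ∈ r :: l, (e.1.1 = w ∨ e.1.2 = w) → w = v := fun e' he' =>
      hav e' (Multiset.mem_add.2 (Or.inl he'))
    have hne := e.2
    rcases hev with hev | hev
    · rw [hev] at hne ⊢
      have := claim _ _ 0 e.1.2 Γ'' (fun h => hne (hav e he _ h (Or.inr rfl)).symm) hav'' rfl rfl
      rw [zero_add, one_nsmul] at this
      rw [← this]; congr 1; abel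
    · rw [hev] at hne ⊢
      have := claim _ _ 0 e.1.1 Γ'' (fun h => hne (hav e he _ h (Or.inl rfl))) hav'' rfl rfl
      rw [zero_add, one_nsmul] at this
      rw [← add_assoc, hy.flip _ hne, neg_eq_zero, ← this]; congr 1; abel

end Graphs

end VertexOperad

end

noncomputable section

namespace VertexOperad

universe u

/-! ### Translation invariant functions -/

section InvFun

variable (F : Type u) [Field F] {n : ℕ} {κ : Type} (π : Fin n → κ)

instance : CommRing (invFun F π) := Subalgebra.toCommRing _

instance : Neg (invFun F π) := Ring.toNeg

instance : Sub (invFun F π) := Ring.toSub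

/-- `z_{kl}` as a translation invariant function. -/
def zInv (k l : Fin n) : invFun F π :=
  ⟨z F π k l, Algebra.subset_adjoin (Or.inl ⟨k, l, rfl⟩)⟩

/-- `z_{kl}⁻¹` for `π k ≠ π l`. -/
def poleFun (e : {e : Fin n × Fin n // π e.1 ≠ π e.2}) : invFun F π :=
  ⟨Ring.inverse (z F π e.1.1 e.1.2), Algebra.subset_adjoin (Or.inr ⟨e.1.1, e.1.2, e.2, rfl⟩)⟩

/-- The product of the functions `z_{kl}⁻¹`. -/
def polesFun (E : Multiset {e : Fin n × Fin n // π e.1 ≠ π e.2}) : invFun F π :=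
  (E.map (poleFun F π)).prod

theorem graphFun_eq_polesFun (Γ : NGraph n) : graphFun F Γ = polesFun F id Γ := rfl

theorem zOT_eq_zInv (k l : Fin n) : zOT F k l = zInv F id k l := rfl

variable {π}

theorem polesFun_add (E E' : Multiset {e : Fin n × Fin n // π e.1 ≠ π e.2}) :
    polesFun F π (E + E') = polesFun F π E * polesFun F π E' := by
  simp [polesFun]

theorem polesFun_cons (e : {e : Fin n × Fin n // π e.1 ≠ π e.2})
    (E : Multiset {e : Fin n × Fin n // π e.1 ≠ π e.2}) :
    polesFun F π (e ::ₘ E) = poleFun F π e * polesFun F π E := by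
  simp [polesFun]

@[simp] theorem polesFun_singleton (e : {e : Fin n × Fin n // π e.1 ≠ π e.2}) :
    polesFun F π {e} = poleFun F π e := by
  simp [polesFun]

@[simp] theorem polesFun_zero :
    polesFun F π (0 : Multiset {e : Fin n × Fin n // π e.1 ≠ π e.2}) = 1 := by
  simp [polesFun]

theorem zInv_mul_poleFun (e : {e : Fin n × Fin n // π e.1 ≠ π e.2}) :
    zInv F π e.1.1 e.1.2 * poleFun F π e = 1 :=
  Subtype.ext (Ring.mul_inverse_cancel _ (isUnit_z F π e.2))

theorem zInv_add (i j k : Fin n) : zInv F π i j + zInv F π j k = zInv F π i k := by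
  apply Subtype.ext
  change z F π i j + z F π j k = z F π i k
  simp only [z, map_sub]; ring

@[simp] theorem zInv_self (i : Fin n) : zInv F π i i = 0 := by
  apply Subtype.ext
  change z F π i i = 0
  simp [z]

theorem zInv_symm (i j : Fin n) : zInv F π i j = - zInv F π j i := by
  have := zInv_add F (π := π) i j i
  rw [zInv_self] at this
  exact eq_neg_of_add_eq_zero_left this

theorem poleFun_unique {e : {e : Fin n × Fin n // π e.1 ≠ π e.2}} {f : invFun F π}
    (h : zInv F π e.1.1 e.1.2 * f = 1) : f = poleFun F π e := by
  calc f = (zInv F π e.1.1 e.1.2 * poleFun F π e) * f := by rw [zInv_mul_poleFun, one_mul]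
    _ = (zInv F π e.1.1 e.1.2 * f) * poleFun F π e := by ring
    _ = poleFun F π e := by rw [h, one_mul]

/-- The algebra is spanned by monomials in its generators. Factors are stripped off one by one; the
poles met on the way are collected in `E`, and the polynomial factors are put back by `hz`. -/
theorem adjoin_le_of_mul_z {s : Set {e : Fin n × Fin n // π e.1 ≠ π e.2}}
    (T : Submodule F (Fun F π)) (hz : ∀ k l, ∀ f ∈ T, z F π k l * f ∈ T)
    (hp : ∀ E : Multiset {e : Fin n × Fin n // π e.1 ≠ π e.2}, (∀ e ∈ E, e ∈ s) →
      (polesFun F π E : Fun F π) ∈ T) :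
    Subalgebra.toSubmodule (Algebra.adjoin F ({f | ∃ k l, f = z F π k l} ∪
      {f | ∃ e ∈ s, f = (poleFun F π e : Fun F π)})) ≤ T := by
  rw [Algebra.adjoin_eq_span]
  refine Submodule.span_le.2 fun x hx => ?_
  suffices h : ∀ E : Multiset {e : Fin n × Fin n // π e.1 ≠ π e.2}, (∀ e ∈ E, e ∈ s) →
      x * (polesFun F π E : Fun F π) ∈ T by
    simpa using h 0 (by simp)
  induction hx using Submonoid.closure_induction_left with
  | one => intro E hE; rw [one_mul]; exact hp E hE
  | mul_left g hg y _ ih =>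
    intro E hE
    rcases hg with ⟨k, l, rfl⟩ | ⟨e, he, rfl⟩
    · rw [mul_assoc]; exact hz k l _ (ih E hE)
    · have := ih (e ::ₘ E) (fun e' he' => by
        rcases Multiset.mem_cons.1 he' with rfl | h
        · exact he
        · exact hE _ h)
      rw [polesFun_cons, Subalgebra.coe_mul] at this
      rw [mul_comm _ y, mul_assoc]; exact this

/-- The functions `z_{k_1 l_1} ⋯ z_{k_s l_s} ∏_{e ∈ E} z_e⁻¹` span the space of all functions. -/
theorem eq_top_of_mul_zInv (T : Submodule F (invFun F π))
    (hz : ∀ k l, ∀ f ∈ T, zInv F π k l * f ∈ T) (hp : ∀ E, polesFun F π E ∈ T) : T = ⊤ := by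
  refine eq_top_iff.2 fun f _ => ?_
  have h := adjoin_le_of_mul_z (F := F) (π := π) (s := Set.univ)
    (T.map (Subalgebra.toSubmodule (invFun F π)).subtype) ?_ ?_
  · have hf : (f : Fun F π) ∈ T.map (Subalgebra.toSubmodule (invFun F π)).subtype := by
      refine h ?_
      refine Algebra.adjoin_mono ?_ f.2
      refine Set.union_subset_union_right _ ?_
      rintro _ ⟨k, l, hkl, rfl⟩
      exact ⟨⟨(k, l), hkl⟩, trivial, rfl⟩
    obtain ⟨g, hg, hgf⟩ := hf
    rwa [← Subtype.ext hgf]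
  · rintro k l _ ⟨g, hg, rfl⟩
    exact ⟨_, hz k l g hg, rfl⟩
  · intro E _
    exact ⟨_, hp E, rfl⟩

/-- The partial derivative `∂/∂z_k` as a derivation. -/
def dzD (π : Fin n → κ) (k : Fin n) : Derivation F (invFun F π) (invFun F π) :=
  Derivation.mk' (dz F π k) (by
    intro a b
    apply Subtype.ext
    change pderivFun F π k ((a : Fun F π) * b) = _
    rw [Derivation.leibniz]; rfl)

theorem dzD_apply (k : Fin n) (f : invFun F π) : dzD F π k f = dz F π k f := rfl

theorem dzD_zInv (k a b : Fin n) : dzD F π k (zInv F π a b) =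
    (if a = k then 1 else 0) - (if b = k then 1 else 0) := by
  apply Subtype.ext
  change pderivFun F π k (z F π a b) = _
  rw [z, map_sub, map_sub, pderivFun_X, pderivFun_X]
  split_ifs <;> simp

variable {F}

theorem derivation_poleFun (D : Derivation F (invFun F π) (invFun F π))
    (e : {e : Fin n × Fin n // π e.1 ≠ π e.2}) :
    D (poleFun F π e) = -(D (zInv F π e.1.1 e.1.2)) * poleFun F π e ^ 2 := by
  have h : poleFun F π e * zInv F π e.1.1 e.1.2 = 1 := by rw [mul_comm, zInv_mul_poleFun]
  rw [Derivation.leibniz_of_mul_eq_one D h, smul_eq_mul]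
  ring

/-- Both sides are derivations along `φ`, and the Leibniz rule forces their values at the inverses
`z_kl⁻¹`. All compatibilities of derivatives with substitutions and with expansions come from this.
-/
theorem derivation_comm {B : Type*} [CommRing B] [Algebra F B]
    (φ : invFun F π →ₐ[F] B) (D : Derivation F (invFun F π) (invFun F π))
    (D' : Derivation F B B)
    (h : ∀ k l, D' (φ (zInv F π k l)) = φ (D (zInv F π k l))) (f : invFun F π) :
    D' (φ f) = φ (D f) := by
  obtain ⟨f, hf⟩ := f
  induction hf using Algebra.adjoin_induction with
  | mem x hx =>
    rcases hx with ⟨k, l, rfl⟩ | ⟨k, l, hkl, rfl⟩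
    · exact h k l
    · change D' (φ (poleFun F π ⟨(k, l), hkl⟩)) = φ (D (poleFun F π ⟨(k, l), hkl⟩))
      have h1 : φ (poleFun F π ⟨(k, l), hkl⟩) * φ (zInv F π k l) = 1 := by
        rw [← map_mul, mul_comm]
        rw [zInv_mul_poleFun F (⟨(k, l), hkl⟩ : {e : Fin n × Fin n // π e.1 ≠ π e.2}), map_one]
      rw [Derivation.leibniz_of_mul_eq_one D' h1, derivation_poleFun, h, map_mul, map_neg, map_pow,
        smul_eq_mul]
      ring
  | algebraMap r =>
    have : (⟨algebraMap F (Fun F π) r, Subalgebra.algebraMap_mem _ r⟩ : invFun F π) =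
      algebraMap F _ r := rfl
    rw [this]; simp
  | add x y hx hy h1 h2 =>
    have : (⟨x + y, add_mem hx hy⟩ : invFun F π) = ⟨x, hx⟩ + ⟨y, hy⟩ := rfl
    rw [this]; simp only [map_add, h1, h2]
  | mul x y hx hy h1 h2 =>
    have : (⟨x * y, mul_mem hx hy⟩ : invFun F π) = ⟨x, hx⟩ * ⟨y, hy⟩ := rfl
    rw [this]
    simp only [map_mul, Derivation.leibniz, smul_eq_mul, map_add, h1, h2]

theorem derivation_ext {D D' : Derivation F (invFun F π) (invFun F π)}
    (h : ∀ k l, D (zInv F π k l) = D' (zInv F π k l)) : D = D' :=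
  by
  ext1 f
  exact derivation_comm (B := invFun F π) (AlgHom.id F (invFun F π)) D' D h f

/-- The commutator is a derivation and kills every `z_ab`, whose derivatives are constants. -/
theorem dzD_comm (k l : Fin n) (f : invFun F π) :
    dzD F π k (dzD F π l f) = dzD F π l (dzD F π k f) := by
  have h : ⁅dzD F π k, dzD F π l⁆ = 0 := derivation_ext fun a b => by
    rw [Derivation.commutator_apply, dzD_zInv, dzD_zInv]
    simp only [map_sub]
    split_ifs <;> simp
  have := congrArg (fun D => D f) h
  rw [Derivation.commutator_apply] at this
  exact sub_eq_zero.1 this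

theorem derivation_sum_apply {ι : Type*} (S : Finset ι)
    (D : ι → Derivation F (invFun F π) (invFun F π)) (f : invFun F π) :
    (∑ k ∈ S, D k) f = ∑ k ∈ S, D k f := by
  classical
  induction S using Finset.induction_on with
  | empty => simp
  | insert a S ha ih => rw [Finset.sum_insert ha, Finset.sum_insert ha, Derivation.add_apply, ih]

/-- `∑_{k ∈ S} ∂/∂z_k`. -/
def dzS (F : Type u) [Field F] (π : Fin n → κ) (S : Finset (Fin n)) :
    Derivation F (invFun F π) (invFun F π) := ∑ k ∈ S, dzD F π k

theorem dzS_apply (S : Finset (Fin n)) (f : invFun F π) :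
    dzS F π S f = ∑ k ∈ S, dz F π k f := by
  rw [dzS, derivation_sum_apply]; rfl

theorem dzS_zInv (S : Finset (Fin n)) (a b : Fin n) : dzS F π S (zInv F π a b) =
    (if a ∈ S then 1 else 0) - (if b ∈ S then 1 else 0) := by
  rw [dzS, derivation_sum_apply]
  simp only [dzD_zInv, Finset.sum_sub_distrib, Finset.sum_ite_eq]

theorem dzS_univ : dzS F π Finset.univ = 0 :=
  derivation_ext fun k l => by rw [dzS_zInv]; simp

theorem derivation_polesFun_eq_zero (D : Derivation F (invFun F π) (invFun F π))
    {E : Multiset {e : Fin n × Fin n // π e.1 ≠ π e.2}}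
    (h : ∀ e ∈ E, D (zInv F π e.1.1 e.1.2) = 0) : D (polesFun F π E) = 0 := by
  induction E using Multiset.induction_on with
  | empty => simp
  | cons e E ih =>
    rw [polesFun_cons, Derivation.leibniz, derivation_poleFun, h e (Multiset.mem_cons_self e E),
      ih fun e' he' => h e' (Multiset.mem_cons_of_mem he')]
    simp

/-- Only the copies of `z_e⁻¹` are differentiated, and each gives `-z_e⁻²`. So an additional copy of
a bridge is, up to a non-zero integer, the effect of a derivative; this feeds the relation `bridge`.
-/
theorem derivation_polesFun_bridge (D : Derivation F (invFun F π) (invFun F π))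
    {E : Multiset {e : Fin n × Fin n // π e.1 ≠ π e.2}}
    {e : {e : Fin n × Fin n // π e.1 ≠ π e.2}} (he : D (zInv F π e.1.1 e.1.2) = 1)
    (h : ∀ e' ∈ E, e' ≠ e → D (zInv F π e'.1.1 e'.1.2) = 0) [DecidableEq {e : Fin n × Fin n // π e.1 ≠ π e.2}] :
    D (polesFun F π E) = -(E.count e : F) • polesFun F π (E + {e}) := by
  induction E using Multiset.induction_on with
  | empty => simp
  | cons e' E ih =>
    rw [polesFun_cons, Derivation.leibniz, derivation_poleFun,
      ih fun e'' he'' => h e'' (Multiset.mem_cons_of_mem he'')]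
    by_cases hee : e' = e
    · subst hee
      rw [he, Multiset.count_cons_self, Multiset.cons_add, polesFun_cons, polesFun_add,
        polesFun_singleton]
      simp only [smul_eq_mul, Algebra.smul_def, Nat.cast_add, Nat.cast_one, map_neg, map_add, map_one]
      ring
    · rw [h e' (Multiset.mem_cons_self _ _) hee, Multiset.count_cons_of_ne (Ne.symm hee),
        Multiset.cons_add, polesFun_cons, neg_zero, zero_mul, smul_zero, add_zero, smul_eq_mul,
        mul_smul_comm]

theorem diagonals_le_nonZeroDivisors :
    diagonals F π ≤ nonZeroDivisors (MvPolynomial (Fin n) F) := by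
  refine Submonoid.closure_le.2 ?_
  rintro _ ⟨k, l, hkl, rfl⟩
  refine mem_nonZeroDivisors_of_ne_zero (sub_ne_zero.2 fun h => hkl ?_)
  rw [MvPolynomial.X_injective h]

theorem algebraMap_Fun_injective :
    Function.Injective (algebraMap (MvPolynomial (Fin n) F) (Fun F π)) :=
  IsLocalization.injective (Fun F π) (diagonals_le_nonZeroDivisors (F := F) (π := π))

instance : Nontrivial (Fun F π) := (algebraMap_Fun_injective (F := F) (π := π)).nontrivial

variable {b : ℕ} {κ' : Type} {π' : Fin b → κ'} {θ : Fin n → Fin b}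
  (hθ : ∀ k l, π k ≠ π l → π' (θ k) ≠ π' (θ l))

theorem renameInv_zInv (k l : Fin n) :
    renameInv F π π' θ hθ (zInv F π k l) = zInv F π' (θ k) (θ l) :=
  Subtype.ext (renameFun_z F π π' θ hθ k l)

theorem renameInv_poleFun (e : {e : Fin n × Fin n // π e.1 ≠ π e.2}) :
    renameInv F π π' θ hθ (poleFun F π e) = poleFun F π' ⟨(θ e.1.1, θ e.1.2), hθ _ _ e.2⟩ := by
  apply poleFun_unique
  rw [← renameInv_zInv hθ, ← map_mul, zInv_mul_poleFun, map_one]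

theorem renameInv_polesFun (E : Multiset {e : Fin n × Fin n // π e.1 ≠ π e.2}) :
    renameInv F π π' θ hθ (polesFun F π E) =
      polesFun F π' (E.map fun e => ⟨(θ e.1.1, θ e.1.2), hθ _ _ e.2⟩) := by
  rw [polesFun, map_multiset_prod, Multiset.map_map, polesFun, Multiset.map_map]
  congr 1
  exact Multiset.map_congr rfl fun e _ => renameInv_poleFun hθ e

theorem dzD_renameInv (i : Fin b) (f : invFun F π) :
    dzD F π' i (renameInv F π π' θ hθ f) =
      renameInv F π π' θ hθ (dzS F π (Finset.univ.filter fun k => θ k = i) f) := by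
  refine derivation_comm _ _ _ (fun k l => ?_) f
  rw [renameInv_zInv, dzD_zInv, dzS_zInv]
  simp only [Finset.mem_filter, Finset.mem_univ, true_and, map_sub]
  split_ifs <;> simp

/-- After clearing denominators this is the injectivity of renaming the variables of polynomials. -/
theorem renameInv_injective (hinj : Function.Injective θ) :
    Function.Injective (renameInv F π π' θ hθ) := by
  intro f g hfg
  apply Subtype.ext
  have h1 : renameFun F π π' θ hθ f = renameFun F π π' θ hθ g := congrArg Subtype.val hfg
  have hinjF : Function.Injective (renameFun F π π' θ hθ) := by
    rw [injective_iff_map_eq_zero]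
    intro f hf
    obtain ⟨⟨p, s⟩, hps⟩ := IsLocalization.surj (diagonals F π) f
    have hal : renameFun F π π' θ hθ (algebraMap (MvPolynomial (Fin n) F) (Fun F π) p) =
        algebraMap (MvPolynomial (Fin b) F) (Fun F π') (MvPolynomial.rename θ p) :=
      IsLocalization.lift_eq _ _
    rw [← hps, map_mul, hf, zero_mul] at hal
    have hp : p = 0 := by
      have h0 := algebraMap_Fun_injective (hal.symm.trans (map_zero _).symm)
      exact MvPolynomial.rename_injective θ hinj (h0.trans (map_zero _).symm)
    have hs : IsUnit (algebraMap (MvPolynomial (Fin n) F) (Fun F π) s) :=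
      IsLocalization.map_units _ s
    simp only at hps
    rw [hp, map_zero] at hps
    exact (hs.mul_left_eq_zero).1 hps
  exact hinjF h1

end InvFun

end VertexOperad

end

noncomputable section

namespace VertexOperad

universe u v

/-! ### Chiral and classical operations with fixed arguments -/

section Graphs

variable {n : ℕ}

/-- Functions on graphs that satisfy the relations of classical operations. -/
structure TreeLike {M : Type*} [AddCommGroup M] (y : NGraph n → M) : Prop where
  flip : ∀ (Γ : NGraph n) {i j : Fin n}, i ≠ j → y (Γ + edg i j) = - y (Γ + edg j i)
  arnold : ∀ (Γ : NGraph n) {v a b : Fin n}, v ≠ a → v ≠ b → a ≠ b →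
    y (Γ + edg v a + edg v b) = y (Γ + edg v a + edg a b) + y (Γ + edg v b + edg b a)
  disc : ∀ (Γ : NGraph n) (S : Finset (Fin n)), S.Nonempty → S ≠ Finset.univ → ClosedIn Γ S →
    y Γ = 0
  double : ∀ (Γ : NGraph n) (e : Edge n), e ∈ Γ → y (Γ + {e}) = 0

variable {M : Type*} [AddCommGroup M] {y y' : NGraph n → M}

/-- Doubling any edge already gives zero, so the condition on bridges holds trivially. -/
theorem TreeLike.treeRelations (hy : TreeLike y) : TreeRelations y where
  flip := hy.flip
  arnold := hy.arnold
  disc := hy.disc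
  bridge Γ _ e he _ _ _ _ := hy.double Γ e he

theorem TreeLike.sub (hy : TreeLike y) (hy' : TreeLike y') : TreeLike (y - y') where
  flip Γ i j h := by simp only [Pi.sub_apply, hy.flip Γ h, hy'.flip Γ h]; abel
  arnold Γ v a b h1 h2 h3 := by
    simp only [Pi.sub_apply, hy.arnold Γ h1 h2 h3, hy'.arnold Γ h1 h2 h3]; abel
  disc Γ S h1 h2 h3 := by simp [hy.disc Γ S h1 h2 h3, hy'.disc Γ S h1 h2 h3]
  double Γ e he := by simp [hy.double Γ e he, hy'.double Γ e he]

theorem TreeLike.comp {N : Type*} [AddCommGroup N] (hy : TreeLike y) (f : M →+ N) :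
    TreeLike fun Γ => f (y Γ) where
  flip Γ i j h := by rw [hy.flip Γ h, map_neg]
  arnold Γ v a b h1 h2 h3 := by rw [hy.arnold Γ h1 h2 h3, map_add]
  disc Γ S h1 h2 h3 := by rw [hy.disc Γ S h1 h2 h3, map_zero]
  double Γ e he := by rw [hy.double Γ e he, map_zero]

/-- Two such functions are equal if they agree on paths. -/
theorem TreeLike.ext (hy : TreeLike y) (hy' : TreeLike y') (r : Fin n)
    (h : ∀ l, (r :: l).Nodup → (∀ i, i ∈ r :: l) → y (chainG r l) = y' (chainG r l)) : y = y' := by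
  funext Γ
  refine sub_eq_zero.1 ((hy.sub hy').treeRelations.eq_zero r (fun l h1 h2 => ?_) Γ)
  rw [Pi.sub_apply, h l h1 h2, sub_self]

/-- Graphs with fewer than `n - 1` edges are disconnected. For more edges: the relations are
homogeneous in the number of edges, so the part of `y` on graphs with more than `n - 1` edges
satisfies them too, and it vanishes on Hamiltonian paths, which have `n - 1` edges. -/
theorem TreeLike.eq_zero_of_card_ne (hy : TreeLike y) (r : Fin n) {Γ : NGraph n}
    (h : Multiset.card Γ ≠ n - 1) : y Γ = 0 := by
  have hn : 0 < n := r.pos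
  rcases lt_or_gt_of_ne h with hlt | hgt
  · obtain ⟨S, h1, h2, h3⟩ := exists_closedIn_of_card_add_one_lt (Γ := Γ) (by omega)
    exact hy.disc Γ S h1 h2 h3
  · have hz : TreeLike fun Γ : NGraph n => if n - 1 < Multiset.card Γ then y Γ else 0 :=
      { flip := fun Γ i j hij => by
          simp only [Multiset.card_add, card_edg hij, card_edg hij.symm]
          split_ifs
          · exact hy.flip Γ hij
          · simp
        arnold := fun Γ v a b h1 h2 h3 => by
          simp only [Multiset.card_add, card_edg h1, card_edg h2, card_edg h3, card_edg h3.symm]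
          split_ifs
          · exact hy.arnold Γ h1 h2 h3
          · simp
        disc := fun Γ S h1 h2 h3 => by simp [hy.disc Γ S h1 h2 h3]
        double := fun Γ e he => by simp [hy.double Γ e he] }
    have := hz.treeRelations.eq_zero r (fun l h1 h2 => ?_) Γ
    · rwa [if_pos hgt] at this
    · have h3 := length_of_nodup_of_forall_mem h1 h2
      rw [List.length_cons] at h3
      rw [if_neg]
      rw [card_chainG h1]; omega

end Graphs

section Fixed

variable {F : Type u} [Field F] {V : Type v} [AddCommGroup V] [Module F V]

variable (F V) in
/-- The linear maps `F[z_{kl}^{±1}] → V_n` satisfying the sesquilinearity conditions. -/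
def DMap (n : ℕ) : Submodule F (OT F n →ₗ[F] Vn (0 : V →ₗ[F] V) n) where
  carrier := {φ |
    (∀ (i : Fin n) (f : OT F n), φ (dz F id i f) = mulV 0 n (MvPolynomial.X i) (φ f)) ∧
    (∀ (i j : Fin n) (f : OT F n), φ (zOT F i j * f) = diffV 0 n i j (φ f))}
  add_mem' h h' := ⟨fun i f => by simp only [LinearMap.add_apply, h.1, h'.1, map_add],
    fun i j f => by simp only [LinearMap.add_apply, h.2, h'.2, map_add]⟩
  zero_mem' := by simp
  smul_mem' c φ h := ⟨fun i f => by simp only [LinearMap.smul_apply, h.1, map_smul],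
    fun i j f => by simp only [LinearMap.smul_apply, h.2, map_smul]⟩

/-- For `∂ = 0` the term in which `∂` acts on an argument vanishes by multilinearity, and the
remaining conditions no longer mix different arguments. -/
theorem mem_chiral_iff {n : ℕ}
    {X : MultilinearMap F (fun _ : Fin n => V) (OT F n →ₗ[F] Vn (0 : V →ₗ[F] V) n)} :
    X ∈ chiral (0 : V →ₗ[F] V) n ↔ ∀ x, X x ∈ DMap F V n := by
  constructor
  · intro h x
    refine ⟨fun i f => ?_, fun i j f => h.2 i j x f⟩
    rw [h.1, LinearMap.zero_apply, X.map_update_zero]; simp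
  · intro h
    refine ⟨fun i x f => ?_, fun i j x f => (h x).2 i j f⟩
    rw [(h x).1, LinearMap.zero_apply, X.map_update_zero]; simp

open Classical in
variable (F V) in
/-- The maps `G(n) → V_n` satisfying the cycle relations and the sesquilinearity conditions. -/
def CMap (n : ℕ) : Submodule F (NGraph n → Vn (0 : V →ₗ[F] V) n) where
  carrier := {y |
    (∀ (Γ : NGraph n) (s : ℕ) (c : Fin (s + 1) → Edge n), IsCycle Γ c →
      y Γ = 0 ∧ ∑ t, y (Γ.erase (c t)) = 0) ∧
    (∀ (Γ : NGraph n) (i j : Fin n), Conn Γ i j → diffV 0 n i j (y Γ) = 0) ∧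
    (∀ (Γ : NGraph n) (i : Fin n), ∑ j with Conn Γ i j, mulV 0 n (MvPolynomial.X j) (y Γ) = 0)}
  add_mem' {y y'} h h' := by
    refine ⟨fun Γ s c hc => ⟨?_, ?_⟩, fun Γ i j hij => ?_, fun Γ i => ?_⟩
    · simp [(h.1 Γ s c hc).1, (h'.1 Γ s c hc).1]
    · simp [Finset.sum_add_distrib, (h.1 Γ s c hc).2, (h'.1 Γ s c hc).2]
    · simp [h.2.1 Γ i j hij, h'.2.1 Γ i j hij]
    · simp [Finset.sum_add_distrib, h.2.2 Γ i, h'.2.2 Γ i]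
  zero_mem' := by simp
  smul_mem' r y h := by
    refine ⟨fun Γ s c hc => ⟨?_, ?_⟩, fun Γ i j hij => ?_, fun Γ i => ?_⟩
    · simp [(h.1 Γ s c hc).1]
    · simp [← Finset.smul_sum, (h.1 Γ s c hc).2]
    · simp [h.2.1 Γ i j hij]
    · simp [← Finset.smul_sum, h.2.2 Γ i]

theorem mem_classical_iff {n : ℕ}
    {Y : NGraph n → MultilinearMap F (fun _ : Fin n => V) (Vn (0 : V →ₗ[F] V) n)} :
    Y ∈ classical (0 : V →ₗ[F] V) n ↔ ∀ x, (fun Γ => Y Γ x) ∈ CMap F V n := by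
  classical
  constructor
  · intro h x
    refine ⟨fun Γ s c hc => ⟨?_, ?_⟩, fun Γ i j hij => h.2.1 Γ i j hij x, fun Γ i => ?_⟩
    · simp [(h.1 Γ s c hc).1]
    · have := congrArg (fun f => f x) (h.1 Γ s c hc).2
      simpa [sum_apply] using this
    · rw [← h.2.2 Γ i x]
      refine Finset.sum_congr rfl fun j _ => ?_
      rw [LinearMap.zero_apply, (Y Γ).map_update_zero, zero_add]
  · intro h
    refine ⟨fun Γ s c hc => ⟨?_, ?_⟩, fun Γ i j hij x => (h x).2.1 Γ i j hij, fun Γ i x => ?_⟩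
    · ext x; exact ((h x).1 Γ s c hc).1
    · ext x
      rw [sum_apply]
      exact ((h x).1 Γ s c hc).2
    · rw [← (h x).2.2 Γ i]
      refine Finset.sum_congr rfl fun j _ => ?_
      rw [LinearMap.zero_apply, (Y Γ).map_update_zero, zero_add]

/-! ### Partial fractions for the functions `p_Γ` -/

section GraphFun

variable {n : ℕ}

theorem graphFun_add (Γ Γ' : NGraph n) : graphFun F (Γ + Γ') = graphFun F Γ * graphFun F Γ' :=
  polesFun_add F (π := id) Γ Γ'

theorem zOT_mul_graphFun_edg {i j : Fin n} (h : i ≠ j) : zOT F i j * graphFun F (edg i j) = 1 := by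
  rw [edg_of_ne h, graphFun_eq_polesFun]
  rw [polesFun_singleton (F := F) (π := id)]
  exact zInv_mul_poleFun F (π := id) ⟨(i, j), h⟩

theorem zOT_add (i j k : Fin n) : zOT F i j + zOT F j k = zOT F i k := zInv_add F (π := id) i j k

theorem zOT_symm (i j : Fin n) : zOT F i j = - zOT F j i := zInv_symm F (π := id) i j

theorem graphFun_edg_symm {i j : Fin n} (h : i ≠ j) :
    graphFun F (edg i j) = - graphFun F (edg j i) := by
  have h1 := zOT_mul_graphFun_edg (F := F) h
  have h2 := zOT_mul_graphFun_edg (F := F) h.symm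
  have h3 := zOT_symm (F := F) i j
  linear_combination (-graphFun F (edg i j)) * h2 - graphFun F (edg j i) * h1 +
    graphFun F (edg i j) * graphFun F (edg j i) * h3

/-- The partial fraction identity that comes from `z_va + z_ab = z_vb`. -/
theorem graphFun_arnold {v a b : Fin n} (h1 : v ≠ a) (h2 : v ≠ b) (h3 : a ≠ b) :
    graphFun F (edg v a) * graphFun F (edg v b) =
      graphFun F (edg v a) * graphFun F (edg a b) + graphFun F (edg v b) * graphFun F (edg b a) := by
  have e1 := zOT_mul_graphFun_edg (F := F) h1
  have e2 := zOT_mul_graphFun_edg (F := F) h2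
  have e3 := zOT_mul_graphFun_edg (F := F) h3
  have e4 := graphFun_edg_symm (F := F) h3
  have e5 := zOT_add (F := F) v a b
  have e6 : graphFun F (edg b a) = - graphFun F (edg a b) := by rw [e4, neg_neg]
  rw [e6]
  set p := graphFun F (edg v a)
  set q := graphFun F (edg v b)
  set s := graphFun F (edg a b)
  linear_combination (-p * q) * e3 + p * s * e2 - q * s * e1 + p * q * s * e5

theorem zOT_mul_graphFun {Γ : NGraph n} {e : Edge n} (he : e ∈ Γ) [DecidableEq (Edge n)] :
    zOT F e.1.1 e.1.2 * graphFun F Γ = graphFun F (Γ.erase e) := by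
  conv_lhs => rw [← Multiset.cons_erase he, ← Multiset.singleton_add, graphFun_add, ← edg_edge,
    ← mul_assoc, zOT_mul_graphFun_edg e.2, one_mul]

theorem sum_zOT_cycle {s : ℕ} {c : Fin (s + 1) → Edge n} (h : ∀ t, (c t).1.2 = (c (t + 1)).1.1) :
    ∑ t, zOT F (c t).1.1 (c t).1.2 = 0 := by
  -- With all positions measured from the start of `c 0`, the sum round the cycle telescopes.
  have h1 : ∀ t, zOT F (c t).1.1 (c t).1.2 = zOT F (c t).1.1 (c 0).1.1 -
      zOT F (c (t + 1)).1.1 (c 0).1.1 := by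
    intro t
    rw [h, ← zOT_add (c t).1.1 (c (t + 1)).1.1 (c 0).1.1]; ring
  rw [Finset.sum_congr rfl fun t _ => h1 t, Finset.sum_sub_distrib, sub_eq_zero]
  exact (Equiv.sum_comp (Equiv.addRight (1 : Fin (s + 1)))
    fun t => zOT F (c t).1.1 (c 0).1.1).symm

end GraphFun

/-! ### Sesquilinear maps are determined by trees -/

section DMapLemmas

variable {n : ℕ} {φ : OT F n →ₗ[F] Vn (0 : V →ₗ[F] V) n}

theorem DMap.map_dzS (hφ : φ ∈ DMap F V n) (S : Finset (Fin n)) (f : OT F n) :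
    φ (dzS F id S f) = mulV 0 n (∑ i ∈ S, MvPolynomial.X i) (φ f) := by
  rw [dzS_apply, map_sum, map_sum, LinearMap.sum_apply]
  exact Finset.sum_congr rfl fun i _ => hφ.1 i f

theorem dzS_graphFun_of_closedIn {Γ : NGraph n} {S : Finset (Fin n)} (h : ClosedIn Γ S) :
    dzS F id S (graphFun F Γ) = 0 := by
  refine derivation_polesFun_eq_zero (π := id) (dzS F id S) fun e he => ?_
  rw [dzS_zInv]
  by_cases h1 : e.1.1 ∈ S
  · rw [if_pos h1, if_pos ((h e he).1 h1), sub_self]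
  · rw [if_neg h1, if_neg fun h2 => h1 ((h e he).2 h2), sub_self]

/-- The function `p_Γ` does not change when the variables of `S` are translated together, so `λ_S`
kills the value; and `λ_S` is not a zero divisor. -/
theorem DMap.eq_zero_of_closedIn (hφ : φ ∈ DMap F V n) {Γ : NGraph n} {S : Finset (Fin n)}
    (h1 : S.Nonempty) (h2 : S ≠ Finset.univ) (h : ClosedIn Γ S) : φ (graphFun F Γ) = 0 := by
  refine eq_zero_of_mulV_sum h1 h2 ?_
  rw [← DMap.map_dzS hφ, dzS_graphFun_of_closedIn h, map_zero]

theorem DMap.eq_zero_of_card_lt (hφ : φ ∈ DMap F V n) {Γ : NGraph n}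
    (h : Multiset.card Γ + 1 < n) : φ (graphFun F Γ) = 0 := by
  obtain ⟨S, h1, h2, h3⟩ := exists_closedIn_of_card_add_one_lt h
  exact DMap.eq_zero_of_closedIn hφ h1 h2 h3

/-- A multiple edge need not give zero, but a repeated bridge gives `λ_S` times the value without
the repetition, divided by minus a multiplicity. Hence the relations hold modulo any `W` that is
stable under multiplication by polynomials; the division needs characteristic `0`. -/
theorem DMap.treeRelations [CharZero F] (hφ : φ ∈ DMap F V n)
    (W : Submodule F (Vn (0 : V →ₗ[F] V) n)) (hW : ∀ p, ∀ w ∈ W, mulV 0 n p w ∈ W) :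
    TreeRelations fun Γ => W.mkQ (φ (graphFun F Γ)) where
  flip Γ i j hij := by
    rw [graphFun_add, graphFun_add, graphFun_edg_symm hij, mul_neg, map_neg, map_neg]
  arnold Γ v a b h1 h2 h3 := by
    simp only [graphFun_add, mul_assoc]
    rw [graphFun_arnold h1 h2 h3, mul_add, map_add, map_add]
  disc Γ S h1 h2 h3 := by rw [DMap.eq_zero_of_closedIn hφ h1 h2 h3, map_zero]
  bridge Γ S e he h1 h2 h3 h4 := by
    classical
    have hD := derivation_polesFun_bridge (π := id) (E := Γ) (e := e) (dzS F id S) ?_ ?_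
    · have hc : (Γ.count e : F) ≠ 0 := by
        rw [Nat.cast_ne_zero]
        exact (Multiset.count_pos.2 he).ne'
      have hφD := congrArg φ hD
      erw [DMap.map_dzS hφ, map_smul] at hφD
      have h5 : φ (graphFun F (Γ + {e})) = (-(Γ.count e : F))⁻¹ •
          mulV 0 n (∑ i ∈ S, MvPolynomial.X i) (φ (graphFun F Γ)) := by
        rw [eq_inv_smul_iff₀ (neg_ne_zero.2 hc)]
        exact hφD.symm
      rw [h5, map_smul, Submodule.mkQ_apply, (Submodule.Quotient.mk_eq_zero W).2, smul_zero]
      exact hW _ _ ((Submodule.Quotient.mk_eq_zero W).1 h4)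
    · rw [dzS_zInv, if_pos h1, if_neg h2, sub_zero]
    · intro e' he' hne
      rw [dzS_zInv]
      by_cases h : e'.1.1 ∈ S
      · rw [if_pos h, if_pos ((h3 e' he' hne).1 h), sub_self]
      · rw [if_neg h, if_neg fun h' => h ((h3 e' he' hne).2 h'), sub_self]

/-- The values of a sesquilinear map are controlled by those on the functions `p_Γ`. -/
theorem DMap.mem_of_forall_graphFun (hφ : φ ∈ DMap F V n)
    (W : Submodule F (Vn (0 : V →ₗ[F] V) n)) (hW : ∀ i j, ∀ w ∈ W, diffV 0 n i j w ∈ W)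
    (h : ∀ Γ, φ (graphFun F Γ) ∈ W) (f : OT F n) : φ f ∈ W := by
  have : W.comap φ = ⊤ := eq_top_of_mul_zInv F (π := id) _ (fun k l f hf => by
    change φ (zOT F k l * f) ∈ W
    rw [hφ.2]; exact hW _ _ _ hf) fun E => h E
  have hf : f ∈ W.comap φ := this ▸ Submodule.mem_top
  exact hf

/-- Two choices of `W` matter: zero, for injectivity, and the values with coefficients in a
homogeneous part of `V`, for parities. -/
theorem DMap.mem_of_forall_tree [CharZero F] (hφ : φ ∈ DMap F V n)
    (W : Submodule F (Vn (0 : V →ₗ[F] V) n)) (hW : ∀ p, ∀ w ∈ W, mulV 0 n p w ∈ W)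
    (hW' : ∀ i j, ∀ w ∈ W, diffV 0 n i j w ∈ W)
    (h : ∀ Γ, Multiset.card Γ = n - 1 → φ (graphFun F Γ) ∈ W) (f : OT F n) : φ f ∈ W := by
  refine DMap.mem_of_forall_graphFun hφ W hW' (fun Γ => ?_) f
  -- In arity `0` the only graph is the empty one, and the truncated `0 - 1 = 0` counts it as a
  -- tree.
  rcases n.eq_zero_or_pos with hn | hn
  · refine h Γ ?_
    subst hn
    rw [Multiset.eq_zero_of_forall_notMem (s := Γ) fun e => e.1.1.elim0, Multiset.card_zero]
  · rw [← Submodule.Quotient.mk_eq_zero W]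
    refine (DMap.treeRelations hφ W hW).eq_zero ⟨0, hn⟩ (fun l h1 h2 => ?_) Γ
    rw [Submodule.mkQ_apply, Submodule.Quotient.mk_eq_zero]
    refine h _ ?_
    have h3 := length_of_nodup_of_forall_mem h1 h2
    rw [List.length_cons] at h3
    rw [card_chainG h1]; omega

theorem DMap.ext [CharZero F] {ψ : OT F n →ₗ[F] Vn (0 : V →ₗ[F] V) n} (hφ : φ ∈ DMap F V n)
    (hψ : ψ ∈ DMap F V n)
    (h : ∀ Γ, Multiset.card Γ = n - 1 → φ (graphFun F Γ) = ψ (graphFun F Γ)) : φ = ψ := by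
  apply LinearMap.ext
  intro f
  have := DMap.mem_of_forall_tree (sub_mem hφ hψ) ⊥ (by simp) (by simp) (fun Γ hΓ => by
    rw [LinearMap.sub_apply, h Γ hΓ, sub_self]; exact Submodule.zero_mem _) f
  rw [Submodule.mem_bot, LinearMap.sub_apply] at this
  exact sub_eq_zero.1 this

/-- The map `Γ ↦ φ(p_Γ)` for graphs with `n - 1` edges, extended by zero. -/
def graphVal (n : ℕ) : (OT F n →ₗ[F] Vn (0 : V →ₗ[F] V) n) →ₗ[F]
    (NGraph n → Vn (0 : V →ₗ[F] V) n) where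
  toFun φ Γ := if Multiset.card Γ = n - 1 then φ (graphFun F Γ) else 0
  map_add' φ ψ := by
    funext Γ
    by_cases h : Multiset.card Γ = n - 1 <;> simp [h]
  map_smul' c φ := by
    funext Γ
    by_cases h : Multiset.card Γ = n - 1 <;> simp [h]

theorem graphVal_apply (φ : OT F n →ₗ[F] Vn (0 : V →ₗ[F] V) n) (Γ : NGraph n) :
    graphVal n φ Γ = if Multiset.card Γ = n - 1 then φ (graphFun F Γ) else 0 := rfl

/-- Multiplying `p_Γ` by `z_e` erases `e`. The cycle relation is therefore `p_Γ` times the sum of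
the `z_e` round the cycle, which is zero; and along an edge of a graph with `n - 1` edges, `∂/∂λ_j -
∂/∂λ_i` leads to a graph with `n - 2` edges, where `φ` vanishes. The last condition is that `p_Γ` is
invariant under translations of one component. -/
theorem graphVal_mem (hφ : φ ∈ DMap F V n) : graphVal n φ ∈ CMap F V n := by
  classical
  refine ⟨fun Γ s c hc => ⟨?_, ?_⟩, fun Γ i j hij => ?_, fun Γ i => ?_⟩
  · rw [graphVal_apply]
    split_ifs with h
    · have hn : 0 < n := (c 0).1.1.pos
      obtain ⟨S, h1, h2, h3⟩ := hc.exists_closedIn (by omega)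
      exact DMap.eq_zero_of_closedIn hφ h1 h2 h3
    · rfl
  · have hmem : ∀ t, c t ∈ Γ := fun t =>
      Multiset.mem_of_le hc.2 (Multiset.mem_map_of_mem c (Finset.mem_univ_val t))
    simp only [graphVal_apply, Multiset.card_erase_of_mem (hmem _)]
    split_ifs with h
    · rw [← map_sum, ← map_zero φ]
      congr 1
      rw [Finset.sum_congr rfl fun t _ => (zOT_mul_graphFun (F := F) (hmem t)).symm,
        ← Finset.sum_mul, sum_zOT_cycle hc.1, zero_mul]
    · simp
  · rw [graphVal_apply]
    split_ifs with h
    · induction hij with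
      | rel a b hab =>
        obtain ⟨e, he, rfl, rfl⟩ := hab
        rw [← hφ.2, zOT_mul_graphFun he]
        refine DMap.eq_zero_of_card_lt hφ ?_
        have := Multiset.card_erase_add_one he
        have hn : 0 < n := e.1.1.pos
        omega
      | refl a => rw [diffV_self, LinearMap.zero_apply]
      | symm a b _ ih => rw [diffV_symm, ih, neg_zero]
      | trans a b c _ _ h1 h2 => rw [← diffV_add a b c, h1, h2, add_zero]
    · rw [map_zero]
  · rw [graphVal_apply]
    split_ifs with h
    · rw [← LinearMap.sum_apply, ← map_sum, ← DMap.map_dzS hφ,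
        dzS_graphFun_of_closedIn (closedIn_component Γ i), map_zero]
    · simp

end DMapLemmas

/-! ### Classical operations are tree-like with constant values -/

section CMapLemmas

variable {n : ℕ} {y : NGraph n → Vn (0 : V →ₗ[F] V) n}

/-- This is the relation of the oriented cycle `i → j → i` of length two. -/
theorem CMap.flip (hy : y ∈ CMap F V n) (Γ : NGraph n) {i j : Fin n} (h : i ≠ j) :
    y (Γ + edg i j) = - y (Γ + edg j i) := by
  classical
  let c : Fin (1 + 1) → Edge n := ![⟨(i, j), h⟩, ⟨(j, i), h.symm⟩]
  have hc : IsCycle (Γ + edg i j + edg j i) c := by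
    refine ⟨fun t => ?_, ?_⟩
    · fin_cases t <;> rfl
    · have : (Finset.univ : Finset (Fin (1 + 1))).val.map c = edg i j + edg j i := by
        rw [edg_of_ne h, edg_of_ne h.symm]; rfl
      rw [this, add_assoc]; exact Multiset.le_add_left _ _
  have h1 := (hy.1 _ 1 c hc).2
  rw [Fin.sum_univ_two] at h1
  have e0 : (Γ + edg i j + edg j i).erase (c 0) = Γ + edg j i := by
    have : Γ + edg i j + edg j i = c 0 ::ₘ (Γ + edg j i) := by
      rw [← Multiset.singleton_add]
      change _ = ({⟨(i, j), h⟩} : NGraph n) + _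
      rw [← edg_of_ne h]; abel
    rw [this, Multiset.erase_cons_head]
  have e1 : (Γ + edg i j + edg j i).erase (c 1) = Γ + edg i j := by
    have : Γ + edg i j + edg j i = c 1 ::ₘ (Γ + edg i j) := by
      rw [← Multiset.singleton_add]
      change _ = ({⟨(j, i), h.symm⟩} : NGraph n) + _
      rw [← edg_of_ne h.symm]; abel
    rw [this, Multiset.erase_cons_head]
  rw [e0, e1] at h1
  exact eq_neg_of_add_eq_zero_right h1

/-- Reversing one of two parallel edges costs a sign and produces an oriented cycle of length two.
-/
theorem CMap.double (hy : y ∈ CMap F V n) (Γ : NGraph n) (e : Edge n) (he : e ∈ Γ) :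
    y (Γ + {e}) = 0 := by
  classical
  obtain ⟨Γ', rfl⟩ := exists_add_edg he
  rw [← edg_edge, CMap.flip hy _ e.2, neg_eq_zero]
  let c : Fin (1 + 1) → Edge n := ![e, ⟨(e.1.2, e.1.1), e.2.symm⟩]
  refine (hy.1 _ 1 c ⟨fun t => ?_, ?_⟩).1
  · fin_cases t <;> rfl
  · have : (Finset.univ : Finset (Fin (1 + 1))).val.map c = edg e.1.1 e.1.2 + edg e.1.2 e.1.1 := by
      rw [edg_of_ne e.2, edg_of_ne e.2.symm]; rfl
    rw [this, add_assoc]; exact Multiset.le_add_left _ _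

/-- This is the relation of the triangle `v → a → b → v`, with some edges reversed. -/
theorem CMap.arnold (hy : y ∈ CMap F V n) (Γ : NGraph n) {v a b : Fin n} (h1 : v ≠ a)
    (h2 : v ≠ b) (h3 : a ≠ b) :
    y (Γ + edg v a + edg v b) = y (Γ + edg v a + edg a b) + y (Γ + edg v b + edg b a) := by
  classical
  let c : Fin (2 + 1) → Edge n := ![⟨(v, a), h1⟩, ⟨(a, b), h3⟩, ⟨(b, v), h2.symm⟩]
  have hc : IsCycle (Γ + edg v a + edg a b + edg b v) c := by
    refine ⟨fun t => ?_, ?_⟩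
    · fin_cases t <;> rfl
    · have : (Finset.univ : Finset (Fin (2 + 1))).val.map c = edg v a + edg a b + edg b v := by
        rw [edg_of_ne h1, edg_of_ne h3, edg_of_ne h2.symm]; rfl
      rw [this]
      have e : Γ + edg v a + edg a b + edg b v = Γ + (edg v a + edg a b + edg b v) := by abel
      rw [e]; exact Multiset.le_add_left _ _
  have hs := (hy.1 _ 2 c hc).2
  rw [Fin.sum_univ_three] at hs
  have e0 : (Γ + edg v a + edg a b + edg b v).erase (c 0) = Γ + edg a b + edg b v := by
    have : Γ + edg v a + edg a b + edg b v = c 0 ::ₘ (Γ + edg a b + edg b v) := by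
      rw [← Multiset.singleton_add]
      change _ = ({⟨(v, a), h1⟩} : NGraph n) + _
      rw [← edg_of_ne h1]; abel
    rw [this, Multiset.erase_cons_head]
  have e1 : (Γ + edg v a + edg a b + edg b v).erase (c 1) = Γ + edg v a + edg b v := by
    have : Γ + edg v a + edg a b + edg b v = c 1 ::ₘ (Γ + edg v a + edg b v) := by
      rw [← Multiset.singleton_add]
      change _ = ({⟨(a, b), h3⟩} : NGraph n) + _
      rw [← edg_of_ne h3]; abel
    rw [this, Multiset.erase_cons_head]
  have e2 : (Γ + edg v a + edg a b + edg b v).erase (c 2) = Γ + edg v a + edg a b := by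
    have : Γ + edg v a + edg a b + edg b v = c 2 ::ₘ (Γ + edg v a + edg a b) := by
      rw [← Multiset.singleton_add]
      change _ = ({⟨(b, v), h2.symm⟩} : NGraph n) + _
      rw [← edg_of_ne h2.symm]; abel
    rw [this, Multiset.erase_cons_head]
  rw [e0, e1, e2] at hs
  have f1 : y (Γ + edg v b + edg b a) = y (Γ + edg a b + edg b v) := by
    rw [CMap.flip hy _ h3.symm, add_right_comm, CMap.flip hy _ h2, neg_neg]
  rw [CMap.flip hy _ h2, f1, neg_eq_iff_add_eq_zero, ← hs]
  abel

/-- The component of a vertex of `S` stays inside `S`, so it is proper; the sum of its `λ_j` kills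
the value and is not a zero divisor. -/
theorem CMap.disc (hy : y ∈ CMap F V n) (Γ : NGraph n) (S : Finset (Fin n)) (h1 : S.Nonempty)
    (h2 : S ≠ Finset.univ) (h3 : ClosedIn Γ S) : y Γ = 0 := by
  classical
  obtain ⟨i, hi⟩ := h1
  have h := hy.2.2 Γ i
  rw [← LinearMap.sum_apply, ← map_sum] at h
  refine eq_zero_of_mulV_sum ⟨i, ?_⟩ (fun hu => h2 ?_) h
  · simp only [Finset.mem_filter, Finset.mem_univ, true_and]
    exact Relation.EqvGen.refl i
  · refine Finset.eq_univ_of_forall fun j => ?_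
    have hj := Finset.mem_univ j
    rw [← hu, Finset.mem_filter] at hj
    exact (h3.mem_iff_of_conn hj.2).1 hi

theorem CMap.treeLike (hy : y ∈ CMap F V n) : TreeLike y where
  flip := CMap.flip hy
  arnold := CMap.arnold hy
  disc := CMap.disc hy
  double := CMap.double hy

theorem CMap.eq_zero_of_card_ne (hy : y ∈ CMap F V n) {Γ : NGraph n}
    (h : Multiset.card Γ ≠ n - 1) : y Γ = 0 := by
  rcases n.eq_zero_or_pos with hn | hn
  · subst hn
    rw [Multiset.eq_zero_of_forall_notMem (s := Γ) fun e => e.1.1.elim0] at h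
    exact absurd rfl h
  · exact (CMap.treeLike hy).eq_zero_of_card_ne ⟨0, hn⟩ h

/-- The values of classical operations are constants. -/
theorem CMap.constV_epsV [CharZero F] (hy : y ∈ CMap F V n) (Γ : NGraph n) :
    constV n (epsV n (y Γ)) = y Γ := by
  classical
  by_cases h0 : y Γ = 0
  · simp [h0]
  -- A graph with non-zero value is connected, so the condition on `λ`-derivatives applies to all
  -- pairs of vertices.
  · refine constV_epsV_of_diffV fun i j => hy.2.1 Γ i j ?_
    by_contra hij
    refine h0 (CMap.disc hy Γ (Finset.univ.filter fun j => Conn Γ i j) ⟨i, ?_⟩ (fun hu => hij ?_)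
      (closedIn_component Γ i))
    · simp only [Finset.mem_filter, Finset.mem_univ, true_and]
      exact Relation.EqvGen.refl i
    · have hj := Finset.mem_univ j
      rw [← hu, Finset.mem_filter] at hj
      exact hj.2

end CMapLemmas

end Fixed

end VertexOperad

end

noncomputable section

namespace VertexOperad

universe u

/-! ### Residues

Functions are expanded in the domain `|z_{v_1} - z_{v_0}| ≪ |z_{v_2} - z_{v_1}| ≪ ⋯`, where
`v_0, v_1, …` are the vertices in a given order. The expansions are Hahn series in
`t_j = z_{v_j} - z_{v_{j - 1}}`, with exponents in a lexicographically ordered group. -/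

section Residue

/-- The group of exponents. -/
abbrev Expo : Type := Lex (ℕ → ℤ)

/-- The exponent of `t_j`. -/
def expo (j : ℕ) : Expo := toLex (Pi.single j 1)

theorem expo_apply (j i : ℕ) : ofLex (expo j) i = if i = j then 1 else 0 := by
  simp [expo, Pi.single_apply]

/-- In the lexicographic order later variables have smaller exponents and so dominate, as required
by `|t_i| ≪ |t_j|` for `i < j`. -/
theorem expo_lt {i j : ℕ} (h : i < j) : expo j < expo i := by
  refine ⟨i, fun k hk => ?_, ?_⟩
  · change ofLex (expo j) k = ofLex (expo i) k
    rw [expo_apply, expo_apply, if_neg (by omega), if_neg (by omega)]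
  · change ofLex (expo j) i < ofLex (expo i) i
    rw [expo_apply, expo_apply, if_neg (by omega), if_pos rfl]; norm_num

variable (F : Type u) [Field F]

/-- Hahn series in the variables `t_j`. -/
abbrev HS : Type u := HahnSeries Expo F

/-- The variable `t_j`. -/
def tvar (j : ℕ) : HS F := HahnSeries.single (expo j) 1

theorem tvar_ne_zero (j : ℕ) : tvar F j ≠ 0 := by
  simp [tvar]

variable {F} in
/-- The map `t_j ∂/∂t_j`. -/
def eulerFun (j : ℕ) (x : HS F) : HS F where
  coeff γ := (ofLex γ j : F) * x.coeff γ
  isPWO_support' := x.isPWO_support.mono fun γ h h' => h (by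
    change x.coeff γ = 0 at h'
    change (ofLex γ j : F) * x.coeff γ = 0
    rw [h', mul_zero])

variable {F} in
theorem support_eulerFun (j : ℕ) (x : HS F) : (eulerFun j x).support ⊆ x.support :=
  fun γ h h' => h (by
    change x.coeff γ = 0 at h'
    change (ofLex γ j : F) * x.coeff γ = 0
    rw [h', mul_zero])

variable {F} in
/-- The derivation `t_j ∂/∂t_j`. -/
def eulerHS (j : ℕ) : Derivation F (HS F) (HS F) :=
  Derivation.mk'
    { toFun := eulerFun j
      map_add' := fun x y => by ext γ; simp [eulerFun, mul_add]
      map_smul' := fun c x => by ext γ; simp [eulerFun, mul_left_comm] }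
    (by
      intro x y
      ext γ
      change (ofLex γ j : F) * (x * y).coeff γ = (x * eulerFun j y + y * eulerFun j x).coeff γ
      -- The smaller supports are enlarged to those of `x` and `y`, so that all convolutions run
      -- over one index set; the rule then follows from the additivity of exponents.
      rw [HahnSeries.coeff_add, mul_comm y, HahnSeries.coeff_mul,
        HahnSeries.coeff_mul_left' x.isPWO_support (support_eulerFun j x),
        HahnSeries.coeff_mul_right' y.isPWO_support (support_eulerFun j y),
        ← Finset.sum_add_distrib, Finset.mul_sum]
      refine Finset.sum_congr rfl fun ij hij => ?_
      have : ij.1 + ij.2 = γ := (Finset.mem_antidiagonal.1 hij).2.2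
      rw [← this]
      have h2 : ofLex (ij.1 + ij.2) j = ofLex ij.1 j + ofLex ij.2 j := rfl
      have h3 : ∀ (z : HS F) γ, (eulerFun j z).coeff γ = (ofLex γ j : F) * z.coeff γ := fun _ _ => rfl
      rw [h2, h3, h3]; push_cast; ring)

variable {F}

theorem coeff_eulerHS (j : ℕ) (x : HS F) (γ : Expo) :
    (eulerHS j x).coeff γ = (ofLex γ j : F) * x.coeff γ := rfl

theorem eulerHS_tvar (i j : ℕ) : eulerHS j (tvar F i) = if i = j then tvar F i else 0 := by
  ext γ
  rw [coeff_eulerHS, tvar, HahnSeries.coeff_single]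
  by_cases h : γ = expo i
  · subst h
    rw [expo_apply]
    by_cases hij : i = j
    · simp [hij]
    · simp [hij, Ne.symm hij]
  · rw [if_neg h, mul_zero]
    split_ifs
    · rw [HahnSeries.coeff_single, if_neg h]
    · simp

/-- The derivation `∂/∂t_j`. -/
def dtHS (j : ℕ) : Derivation F (HS F) (HS F) := (tvar F j)⁻¹ • eulerHS j

theorem dtHS_tvar (i j : ℕ) : dtHS j (tvar F i) = if i = j then 1 else 0 := by
  rw [dtHS, Derivation.smul_apply, eulerHS_tvar, smul_eq_mul]
  split_ifs with h
  · subst h; exact inv_mul_cancel₀ (tvar_ne_zero F i)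
  · simp

/-- The residue of a derivative vanishes. -/
theorem coeff_dtHS (j : ℕ) (x : HS F) {γ : Expo} (hγ : ofLex γ j = -1) :
    (dtHS j x).coeff γ = 0 := by
  have h : tvar F j * dtHS j x = eulerHS j x := by
    rw [dtHS, Derivation.smul_apply, smul_eq_mul, mul_inv_cancel_left₀ (tvar_ne_zero F j)]
  -- After the shift by `t_j` the coefficient carries the factor `γ_j + 1`, which is zero.
  have h1 : (tvar F j * dtHS j x).coeff (γ + expo j) = (dtHS j x).coeff γ := by
    rw [tvar, HahnSeries.coeff_single_mul_add, one_mul]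
  have h2 : ofLex (γ + expo j) j = ofLex γ j + ofLex (expo j) j := rfl
  rw [← h1, h, coeff_eulerHS, h2, hγ, expo_apply]
  simp

theorem addVal_tvar (j : ℕ) : HahnSeries.addVal Expo F (tvar F j) = (expo j : WithTop Expo) := by
  rw [HahnSeries.addVal_apply, tvar, HahnSeries.orderTop_single one_ne_zero]

/-- `t_0 + ⋯ + t_a`. -/
def tsum (F : Type u) [Field F] (a : ℕ) : HS F := ∑ j ∈ Finset.range (a + 1), tvar F j

theorem tsum_succ (a : ℕ) : tsum F (a + 1) = tsum F a + tvar F (a + 1) :=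
  Finset.sum_range_succ _ _

/-- The difference is `-(t_{a+1} + ⋯ + t_b)`, and the last summand dominates. -/
theorem addVal_tsum_sub_of_lt {a b : ℕ} (h : a < b) :
    HahnSeries.addVal Expo F (tsum F a - tsum F b) = (expo b : WithTop Expo) := by
  obtain ⟨c, rfl⟩ : ∃ c, b = c + 1 := ⟨b - 1, by omega⟩
  have h1 : tsum F a - tsum F (c + 1) = -(tvar F (c + 1) +
      ∑ j ∈ Finset.Ico (a + 1) (c + 1), tvar F j) := by
    rw [tsum_succ, Finset.sum_Ico_eq_sub _ (by omega)]
    change tsum F a - (tsum F c + _) = -(_ + (tsum F c - tsum F a))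
    ring
  rw [h1, AddValuation.map_neg, AddValuation.map_add_eq_of_lt_left, addVal_tvar]
  rw [addVal_tvar]
  refine AddValuation.map_lt_sum _ (WithTop.coe_ne_top) fun j hj => ?_
  rw [addVal_tvar, WithTop.coe_lt_coe]
  exact expo_lt (Finset.mem_Ico.1 hj).2

theorem addVal_tsum_sub {a b : ℕ} (h : a ≠ b) :
    HahnSeries.addVal Expo F (tsum F a - tsum F b) = (expo (max a b) : WithTop Expo) := by
  rcases lt_or_gt_of_ne h with h | h
  · rw [addVal_tsum_sub_of_lt h, max_eq_right h.le]
  · rw [← neg_sub, AddValuation.map_neg, addVal_tsum_sub_of_lt h, max_eq_left h.le]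

theorem tsum_sub_ne_zero {a b : ℕ} (h : a ≠ b) : tsum F a - tsum F b ≠ 0 := by
  intro h0
  have := addVal_tsum_sub (F := F) h
  rw [h0, AddValuation.map_zero] at this
  exact WithTop.coe_ne_top this.symm

variable {n : ℕ}

/-- The substitution `z_v = t_0 + ⋯ + t_{pos v}`. -/
def expandFun (F : Type u) [Field F] (pos : Fin n → ℕ) (hpos : Function.Injective pos) :
    Fun F (id : Fin n → Fin n) →ₐ[F] HS F :=
  IsLocalization.liftAlgHom (M := diagonals F (id : Fin n → Fin n)) (S := Fun F (id : Fin n → Fin n))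
    (f := MvPolynomial.aeval fun v => tsum F (pos v)) (by
    intro y
    have hle : diagonals F (id : Fin n → Fin n) ≤ (IsUnit.submonoid (HS F)).comap
        (MvPolynomial.aeval fun v => tsum F (pos v)) := by
      refine (Submonoid.closure_le).2 ?_
      rintro _ ⟨k, l, hkl, rfl⟩
      have := tsum_sub_ne_zero (F := F) (fun h => hkl (hpos h) : pos k ≠ pos l)
      simpa [IsUnit.mem_submonoid_iff] using this
    exact hle y.2)

/-- The expansion of translation invariant functions. -/
def expand (F : Type u) [Field F] (pos : Fin n → ℕ) (hpos : Function.Injective pos) :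
    OT F n →ₐ[F] HS F := (expandFun F pos hpos).comp (OT F n).val

variable {pos : Fin n → ℕ} (hpos : Function.Injective pos)

theorem expand_zOT (k l : Fin n) : expand F pos hpos (zOT F k l) = tsum F (pos k) - tsum F (pos l) := by
  have h : expandFun F pos hpos (z F id k l) =
      MvPolynomial.aeval (fun v => tsum F (pos v)) (MvPolynomial.X k - MvPolynomial.X l) :=
    IsLocalization.lift_eq _ _
  refine h.trans ?_
  simp

theorem dtHS_tsum (a j : ℕ) : dtHS j (tsum F a) = if j ≤ a then 1 else 0 := by
  rw [tsum, map_sum]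
  simp only [dtHS_tvar, Finset.sum_ite_eq', Finset.mem_range, Nat.lt_succ_iff]

/-- Varying `t_j` translates together all points at positions `≥ j`. -/
theorem dtHS_expand (j : ℕ) (f : OT F n) : dtHS j (expand F pos hpos f) =
    expand F pos hpos (dzS F id (Finset.univ.filter fun v => j ≤ pos v) f) := by
  refine derivation_comm (expand F pos hpos) _ _ (fun k l => ?_) f
  rw [dzS_zInv, ← zOT_eq_zInv, expand_zOT, map_sub, dtHS_tsum, dtHS_tsum]
  simp only [Finset.mem_filter, Finset.mem_univ, true_and, map_sub]
  split_ifs <;> simp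

/-- A coefficient of the expansion, as a linear functional. -/
def expandCoeff (F : Type u) [Field F] (pos : Fin n → ℕ) (hpos : Function.Injective pos)
    (γ : Expo) : OT F n →ₗ[F] F where
  toFun f := (expand F pos hpos f).coeff γ
  map_add' f g := by simp
  map_smul' c f := by simp

/-- For `j = pos i` the derivative `∂/∂z_i` is `∂/∂t_j - ∂/∂t_{j+1}`, the second term being absent
for a point in last position; residues of derivatives vanish. -/
theorem expandCoeff_dz {γ : Expo} {i : Fin n} (hi : ofLex γ (pos i) = -1)
    (hi' : ofLex γ (pos i + 1) = -1 ∨ ∀ v, pos v ≤ pos i) (f : OT F n) :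
    expandCoeff F pos hpos γ (dz F id i f) = 0 := by
  classical
  have hS : (Finset.univ.filter fun v => pos i ≤ pos v) =
      insert i (Finset.univ.filter fun v => pos i + 1 ≤ pos v) := by
    ext v
    simp only [Finset.mem_filter, Finset.mem_univ, true_and, Finset.mem_insert]
    rw [← hpos.eq_iff]; omega
  have h1 : dz F id i f = dzS F id (Finset.univ.filter fun v => pos i ≤ pos v) f -
      dzS F id (Finset.univ.filter fun v => pos i + 1 ≤ pos v) f := by
    rw [dzS_apply, dzS_apply, hS, Finset.sum_insert (by simp)]
    ring
  rw [h1, map_sub]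
  change (expand F pos hpos _).coeff γ - (expand F pos hpos _).coeff γ = 0
  rw [← dtHS_expand, coeff_dtHS _ _ hi, zero_sub, neg_eq_zero]
  rcases hi' with h | h
  · rw [← dtHS_expand, coeff_dtHS _ _ h]
  · rw [Finset.filter_false_of_mem fun v _ => by have := h v; omega]
    simp [dzS]

/-- The exponent of the leading term of the expansion of `p_Γ` for a path `Γ`. -/
def chainExpo (pos : Fin n → ℕ) : Fin n → List (Fin n) → Expo
  | _, [] => 0
  | u, b :: l => -expo (max (pos u) (pos b)) + chainExpo pos b l

theorem expand_edg {u b : Fin n} (h : u ≠ b) : expand F pos hpos (graphFun F (edg u b)) =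
    (tsum F (pos u) - tsum F (pos b))⁻¹ := by
  refine eq_inv_of_mul_eq_one_left ?_
  rw [← expand_zOT hpos, ← map_mul, mul_comm, zOT_mul_graphFun_edg h, map_one]

theorem addVal_expand_chainG {u : Fin n} {l : List (Fin n)} (h : (u :: l).Nodup) :
    HahnSeries.addVal Expo F (expand F pos hpos (graphFun F (chainG u l))) =
      (chainExpo pos u l : WithTop Expo) := by
  induction l generalizing u with
  | nil =>
    have : graphFun F (chainG u []) = 1 := by simp [chainG, graphFun]
    rw [this, map_one, AddValuation.map_one]; rfl
  | cons b l ih =>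
    have hub : u ≠ b := fun h' => by subst h'; simp at h
    have h2 : pos u ≠ pos b := fun h' => hub (hpos h')
    rw [chainG, graphFun_add, map_mul, AddValuation.map_mul, ih (List.nodup_cons.1 h).2,
      expand_edg hpos hub, AddValuation.map_inv, addVal_tsum_sub h2]
    rfl

/-- Every edge contributes at the larger of its two positions, which exceeds `K` because the
positions are distinct and at least `K`. -/
theorem chainExpo_eq_zero {u : Fin n} {l : List (Fin n)} (h : (u :: l).Nodup)
    (hpos : Function.Injective pos) {K : ℕ}
    (hK : ∀ v ∈ u :: l, K ≤ pos v) {i : ℕ} (hi : i ≤ K) : ofLex (chainExpo pos u l) i = 0 := by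
  induction l generalizing u with
  | nil => rfl
  | cons b l ih =>
    have hub : u ≠ b := fun h' => by subst h'; simp at h
    have h2 : pos u ≠ pos b := fun h' => hub (hpos h')
    have e : ofLex (chainExpo pos u (b :: l)) i =
      -ofLex (expo (max (pos u) (pos b))) i + ofLex (chainExpo pos b l) i := rfl
    have h3 := hK u (by simp)
    have h4 := hK b (by simp)
    rw [e, expo_apply, if_neg (by omega), ih (List.nodup_cons.1 h).2
      fun v hv => hK v (List.mem_cons_of_mem _ hv)]
    rfl

/-- At the first place where `l'` departs from `l`, the vertex whose turn it was is skipped. When it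
is met later, all its neighbours have larger positions, so its own coordinate `j` of the exponent is
`0` and not `-1`. Thus the leading exponent of the path of `l'` is lexicographically larger than
that of `l`. -/
theorem chainExpo_perm {k : ℕ} {u : Fin n} {l l' : List (Fin n)} (hu : pos u = k)
    (hl : ∀ (i : ℕ) (h : i < l.length), pos l[i] = k + 1 + i) (hp : l'.Perm l)
    (hnd : (u :: l').Nodup) (hne : l' ≠ l) (hpos : Function.Injective pos) :
    ∃ j, k < j ∧ j ≤ k + l.length ∧
      (∀ i < j, ofLex (chainExpo pos u l') i = if k < i then -1 else 0) ∧
      ofLex (chainExpo pos u l') j = 0 := by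
  induction l generalizing k u l' with
  | nil => exact absurd hp.eq_nil hne
  | cons a s ih =>
    have ha : pos a = k + 1 := hl 0 (by simp)
    rcases l' with _ | ⟨b, s'⟩
    · exact absurd hp.symm.eq_nil (by simp)
    have e : ∀ i, ofLex (chainExpo pos u (b :: s')) i =
      -ofLex (expo (max (pos u) (pos b))) i + ofLex (chainExpo pos b s') i := fun i => rfl
    have hnd' := (List.nodup_cons.1 hnd).2
    by_cases hab : b = a
    · subst hab
      obtain ⟨j, h1, h2, h3, h4⟩ := ih (k := k + 1) (u := b) (l' := s') ha
        (fun i h => by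
          have := hl (i + 1) (by simpa using h)
          simp only [List.getElem_cons_succ] at this
          omega) hp.cons_inv hnd' (fun h => hne (by rw [h]))
      refine ⟨j, by omega, by simp only [List.length_cons]; omega, fun i hi => ?_, ?_⟩
      · rw [e, h3 i hi, expo_apply, ha, hu]
        split_ifs <;> omega
      · rw [e, h4, expo_apply, if_neg (by omega)]; rfl
    · have hK : ∀ v ∈ b :: s', k + 1 ≤ pos v := by
        intro v hv
        obtain ⟨i, hi, rfl⟩ := List.mem_iff_getElem.1 (hp.subset hv)
        rw [hl i hi]; omega
      have hb : pos b ≠ k + 1 := fun h => hab (hpos (h.trans ha.symm))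
      have hb' := hK b (by simp)
      refine ⟨k + 1, by omega, by simp, fun i hi => ?_, ?_⟩
      · rw [e, chainExpo_eq_zero hnd' hpos hK hi.le, expo_apply, if_neg (by omega), if_neg (by omega)]
        rfl
      · rw [e, chainExpo_eq_zero hnd' hpos hK le_rfl, expo_apply, if_neg (by omega)]
        rfl

/-- For the path in its own order each difference of consecutive points is exactly `-t_j`, so the
expansion is a monomial. -/
theorem expand_chainG_self {k : ℕ} {u : Fin n} {l : List (Fin n)} (hu : pos u = k)
    (hl : ∀ (i : ℕ) (h : i < l.length), pos l[i] = k + 1 + i) :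
    expand F pos hpos (graphFun F (chainG u l)) =
      HahnSeries.single (toLex fun i => if k < i ∧ i ≤ k + l.length then (-1 : ℤ) else 0)
        ((-1 : F) ^ l.length) := by
  induction l generalizing k u with
  | nil =>
    have : graphFun F (chainG u []) = 1 := by simp [chainG, graphFun]
    rw [this, map_one, ← HahnSeries.single_zero_one]
    congr 1
    · congr 1
      apply ofLex.injective
      funext i
      rw [ofLex_toLex, if_neg (by simp)]; rfl
    · simp
  | cons a s ih =>
    have ha : pos a = k + 1 := hl 0 (by simp)
    have hua : u ≠ a := fun h => by subst h; omega
    rw [chainG, graphFun_add, map_mul, expand_edg hpos hua, ih ha (fun i h => by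
          have := hl (i + 1) (by simpa using h)
          simp only [List.getElem_cons_succ] at this
          omega), hu, ha, tsum_succ]
    rw [inv_mul_eq_iff_eq_mul₀ (by
      have := tvar_ne_zero F (k + 1)
      simpa using this)]
    have h1 : tsum F k - (tsum F k + tvar F (k + 1)) = HahnSeries.single (expo (k + 1)) (-1) := by
      rw [sub_add_cancel_left, tvar, ← HahnSeries.single_neg]
    rw [h1, HahnSeries.single_mul_single]
    congr 1
    · congr 1
      apply ofLex.injective
      funext i
      change _ = ofLex (expo (k + 1)) i + (if _ then _ else _)
      rw [expo_apply, ofLex_toLex, List.length_cons]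
      split_ifs <;> omega
    · rw [List.length_cons]; ring

/-- Functionals that are dual to the functions of the paths starting at `r`. -/
theorem exists_residue (r : Fin n) {l : List (Fin n)} (h : (r :: l).Nodup)
    (hall : ∀ i, i ∈ r :: l) : ∃ ρ : OT F n →ₗ[F] F,
      (∀ i, i ≠ r → ∀ f, ρ (dz F id i f) = 0) ∧
      ∀ l', (r :: l').Nodup → (∀ i, i ∈ r :: l') →
        ρ (graphFun F (chainG r l')) = if l' = l then 1 else 0 := by
  classical
  let pos : Fin n → ℕ := fun v => (r :: l).idxOf v
  have hpos : Function.Injective pos := fun a b hab => (List.idxOf_inj (hall a)).1 hab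
  have hlen : ∀ v, pos v ≤ l.length := fun v => by
    have := List.idxOf_lt_length_of_mem (hall v)
    rw [List.length_cons] at this
    exact Nat.lt_succ_iff.1 this
  have hr : pos r = 0 := List.idxOf_cons_self
  have hl : ∀ (i : ℕ) (h : i < l.length), pos l[i] = 0 + 1 + i := by
    intro i hi
    have := h.idxOf_getElem (i + 1) (by simpa using hi)
    simp only [List.getElem_cons_succ] at this
    change List.idxOf _ (r :: l) = _
    rw [this]; omega
  -- The iterated residue has exponent `-1` in `t_1, …, t_{n-1}` and `0` in `t_0`, as `r` has
  -- position `0`. The shape `0 + l.length` matches `expand_chainG_self` at `k = 0`.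
  let γ : Expo := toLex fun i => if 0 < i ∧ i ≤ 0 + l.length then (-1 : ℤ) else 0
  have hγ : ∀ i, ofLex γ i = if 0 < i ∧ i ≤ 0 + l.length then (-1 : ℤ) else 0 := fun i => rfl
  -- The sign compensates the factors `-1` from the differences `-t_j`.
  refine ⟨(-1 : F) ^ l.length • expandCoeff F pos hpos γ, fun i hi f => ?_, fun l' h1 h2 => ?_⟩
  · rw [LinearMap.smul_apply, expandCoeff_dz, smul_zero]
    · rw [hγ, if_pos]
      have := hlen i
      have h0 : pos i ≠ 0 := fun h0 => hi (hpos (h0.trans hr.symm))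
      omega
    · by_cases hi' : pos i + 1 ≤ l.length
      · left; rw [hγ, if_pos]; omega
      · right; intro v; have := hlen v; omega
  · split_ifs with hll
    · subst hll
      rw [LinearMap.smul_apply]
      change _ • (expand F pos hpos _).coeff γ = 1
      rw [expand_chainG_self hpos hr hl, HahnSeries.coeff_single_same, smul_eq_mul, ← mul_pow]
      simp
    · have hp : l'.Perm l := by
        rw [List.perm_ext_iff_of_nodup (List.nodup_cons.1 h1).2 (List.nodup_cons.1 h).2]
        intro v
        by_cases hv : v = r
        · subst hv
          simp only [(List.nodup_cons.1 h1).1, (List.nodup_cons.1 h).1]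
        · have h3 := h2 v
          have h4 := hall v
          simp only [List.mem_cons, hv, false_or] at h3 h4
          simp only [h3, h4]
      obtain ⟨j, h3, h4, h5, h6⟩ := chainExpo_perm hr hl hp h1 hll hpos
      rw [LinearMap.smul_apply]
      change _ • (expand F pos hpos _).coeff γ = 0
      -- The leading exponent of any other path lies strictly above `γ`, so the coefficient at `γ`
      -- is zero.
      rw [HahnSeries.coeff_eq_zero_of_lt_orderTop, smul_zero]
      rw [← HahnSeries.addVal_apply, addVal_expand_chainG hpos h1, WithTop.coe_lt_coe]
      refine ⟨j, fun i hi => ?_, ?_⟩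
      · change ofLex γ i = ofLex (chainExpo pos r l') i
        rw [h5 i hi, hγ]
        split_ifs <;> omega
      · change ofLex γ j < ofLex (chainExpo pos r l') j
        rw [h6, hγ, if_pos ⟨h3, h4⟩]; norm_num

end Residue

end VertexOperad

end

noncomputable section

namespace VertexOperad

universe u v

/-! ### Sesquilinear maps from functionals -/

section DividedPower

variable {F : Type u} [Field F] {B : Type*} [CommRing B] [Algebra F B]

/-- `(-b)^k / k!`. -/
def dpow (F : Type u) [Field F] {B : Type*} [CommRing B] [Algebra F B] (b : B) (k : ℕ) : B :=
  ((k.factorial : F)⁻¹) • (-b) ^ k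

@[simp] theorem dpow_zero (b : B) : dpow F b 0 = 1 := by simp [dpow]

/-- The `dpow F b k` are the coefficients of `exp(-λ b)` in `λ`, on which `b` acts as `-∂/∂λ`. -/
theorem mul_dpow [CharZero F] (b : B) (k : ℕ) :
    b * dpow F b k = -((k + 1 : ℕ) : F) • dpow F b (k + 1) := by
  have h1 : ((k.factorial : F)) ≠ 0 := Nat.cast_ne_zero.2 k.factorial_ne_zero
  have h2 : ((k + 1 : ℕ) : F) ≠ 0 := Nat.cast_ne_zero.2 (Nat.succ_ne_zero k)
  rw [dpow, dpow, smul_smul, Nat.factorial_succ, Nat.cast_mul, mul_inv, neg_mul,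
    mul_inv_cancel_left₀ h2, neg_smul, mul_smul_comm, pow_succ, ← smul_neg]
  congr 1; ring

theorem derivation_dpow [CharZero F] (D : Derivation F B B) (b : B) (k : ℕ) :
    D (dpow F b (k + 1)) = -(D b) * dpow F b k := by
  have h1 : ((k.factorial : F)) ≠ 0 := Nat.cast_ne_zero.2 k.factorial_ne_zero
  have h2 : ((k + 1 : ℕ) : F) ≠ 0 := Nat.cast_ne_zero.2 (Nat.succ_ne_zero k)
  rw [dpow, dpow, Derivation.map_smul, Derivation.leibniz_pow, Nat.add_sub_cancel, map_neg, smul_eq_mul,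
    ← Nat.cast_smul_eq_nsmul F, smul_smul, Nat.factorial_succ, Nat.cast_mul, mul_inv, mul_comm _ ((k + 1 : ℕ) : F),
    mul_inv_cancel_left₀ h2, mul_smul_comm]
  congr 1; ring

end DividedPower

/-! ### The generating polynomial of a functional -/

section Functional

variable {F : Type u} [Field F] [CharZero F] {n : ℕ} (r : Fin n)

/-- `∏_k (-z_{kr})^{α_k} / α_k!`. -/
def dmon (F : Type u) [Field F] {n : ℕ} (r : Fin n) (α : Fin n →₀ ℕ) : OT F n :=
  ∏ k, dpow F (zInv F id k r) (α k)

omit [CharZero F] in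
theorem dmon_zero : dmon F r 0 = 1 := by
  simp [dmon]

omit [CharZero F] in
theorem dmon_add_single (α : Fin n →₀ ℕ) (k : Fin n) (j : ℕ) :
    dmon F r (α + Finsupp.single k j) = dpow F (zInv F id k r) (α k + j) *
      ∏ i ∈ Finset.univ.erase k, dpow F (zInv F id i r) (α i) := by
  rw [dmon, ← Finset.mul_prod_erase _ _ (Finset.mem_univ k)]
  congr 1
  · simp
  · refine Finset.prod_congr rfl fun i hi => ?_
    rw [Finsupp.add_apply, Finsupp.single_eq_of_ne (Finset.ne_of_mem_erase hi), add_zero]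

omit [CharZero F] in
theorem dmon_eq (α : Fin n →₀ ℕ) (k : Fin n) :
    dmon F r α = dpow F (zInv F id k r) (α k) *
      ∏ i ∈ Finset.univ.erase k, dpow F (zInv F id i r) (α i) := by
  have := dmon_add_single (F := F) r α k 0
  simpa using this

theorem zInv_mul_dmon (α : Fin n →₀ ℕ) (k : Fin n) :
    zInv F id k r * dmon F r α = -((α k + 1 : ℕ) : F) • dmon F r (α + Finsupp.single k 1) := by
  rw [dmon_add_single, dmon_eq r α k, ← mul_assoc, mul_dpow, smul_mul_assoc]

omit [CharZero F] in
theorem derivation_prod_eq_zero {B : Type*} [CommRing B] [Algebra F B] (D : Derivation F B B)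
    {ι : Type*} (s : Finset ι) (g : ι → B) (h : ∀ i ∈ s, D (g i) = 0) : D (∏ i ∈ s, g i) = 0 := by
  classical
  induction s using Finset.induction_on with
  | empty => simp
  | insert a s ha ih =>
    rw [Finset.prod_insert ha, Derivation.leibniz, h a (Finset.mem_insert_self a s),
      ih fun i hi => h i (Finset.mem_insert_of_mem hi)]
    simp

theorem derivation_dpow_eq_zero {B : Type*} [CommRing B] [Algebra F B] (D : Derivation F B B)
    (b : B) (h : D b = 0) (k : ℕ) : D (dpow F b k) = 0 := by
  rcases k with _ | k
  · simp
  · rw [derivation_dpow, h]; simp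

theorem dzD_zInv_dpow {i k : Fin n} (hik : k ≠ i) (hi : i ≠ r) (j : ℕ) :
    dzD F id i (dpow F (zInv F id k r) j) = 0 := by
  refine derivation_dpow_eq_zero (B := invFun F (id : Fin n → Fin n)) _ _ ?_ j
  rw [dzD_zInv, if_neg hik, if_neg hi.symm, sub_zero]

theorem dzD_dmon_add_single {i : Fin n} (hi : i ≠ r) (α : Fin n →₀ ℕ) :
    dzD F id i (dmon F r (α + Finsupp.single i 1)) = -dmon F r α := by
  have h1 := derivation_prod_eq_zero (B := invFun F (id : Fin n → Fin n)) (dzD F id i)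
    (Finset.univ.erase i) (fun k => dpow F (zInv F id k r) (α k)) fun k hk =>
      dzD_zInv_dpow r (Finset.ne_of_mem_erase hk) hi _
  have h2 := derivation_dpow (B := invFun F (id : Fin n → Fin n)) (dzD F id i) (zInv F id i r) (α i)
  rw [dzD_zInv, if_pos rfl, if_neg hi.symm, sub_zero] at h2
  rw [dmon_add_single, Derivation.leibniz, h1, h2, smul_zero, zero_add, dmon_eq r α i, smul_eq_mul]
  ring

theorem dzD_dmon_eq_zero {i : Fin n} (hi : i ≠ r) {α : Fin n →₀ ℕ} (hα : α i = 0) :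
    dzD F id i (dmon F r α) = 0 := by
  apply derivation_prod_eq_zero
  intro k _
  by_cases hk : k = i
  · subst hk; rw [hα]; simp
  · exact dzD_zInv_dpow r hk hi _

/-- The Euler derivation `∑_i z_{ir} ∂/∂z_i`. -/
def eulerD (F : Type u) [Field F] {n : ℕ} (r : Fin n) : Derivation F (OT F n) (OT F n) :=
  Derivation.mk' (∑ i, LinearMap.mulLeft F (zInv F id i r) ∘ₗ dz F id i) (by
    intro f g
    simp only [LinearMap.sum_apply, LinearMap.comp_apply, LinearMap.mulLeft_apply, smul_eq_mul,
      Finset.mul_sum, ← Finset.sum_add_distrib]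
    refine Finset.sum_congr rfl fun i _ => ?_
    rw [← dzD_apply, Derivation.leibniz, ← dzD_apply, ← dzD_apply, smul_eq_mul, smul_eq_mul]
    ring)

omit [CharZero F] in
theorem eulerD_apply (f : OT F n) : eulerD F r f = ∑ i, zInv F id i r * dzD F id i f := by
  change (∑ i, LinearMap.mulLeft F (zInv F id i r) ∘ₗ dz F id i) f = _
  rw [LinearMap.sum_apply]; rfl

omit [CharZero F] in
theorem eulerD_zInv (k l : Fin n) : eulerD F r (zInv F id k l) = zInv F id k l := by
  rw [eulerD_apply]
  simp only [dzD_zInv, mul_sub, mul_ite, mul_one, mul_zero, Finset.sum_sub_distrib, Finset.sum_ite_eq,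
    Finset.mem_univ, if_true]
  rw [← zInv_add F k r l, zInv_symm F r l]; ring

omit [CharZero F] in
theorem eulerD_polesFun (E : NGraph n) :
    eulerD F r (polesFun F id E) = -(Multiset.card E : F) • polesFun F id E := by
  induction E using Multiset.induction_on with
  | empty => simp
  | cons e E ih =>
    rw [polesFun_cons, Derivation.leibniz, derivation_poleFun, ih, eulerD_zInv, Multiset.card_cons]
    have := zInv_mul_poleFun F (π := id) e
    simp only [smul_eq_mul, Algebra.smul_def, map_neg, map_add, map_one, map_natCast, Nat.cast_add,
      Nat.cast_one]
    linear_combination (-poleFun F id e * polesFun F id E) * this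

theorem eulerD_dpow (k : Fin n) (j : ℕ) :
    eulerD F r (dpow F (zInv F id k r) j) = (j : F) • dpow F (zInv F id k r) j := by
  rcases j with _ | j
  · simp
  · rw [derivation_dpow, eulerD_zInv, neg_mul, mul_dpow, neg_smul, neg_neg]

theorem eulerD_dmon (α : Fin n →₀ ℕ) :
    eulerD F r (dmon F r α) = (α.degree : F) • dmon F r α := by
  have key : ∀ s : Finset (Fin n), eulerD F r (∏ k ∈ s, dpow F (zInv F id k r) (α k)) =
      ((∑ k ∈ s, α k : ℕ) : F) • ∏ k ∈ s, dpow F (zInv F id k r) (α k) := by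
    intro s
    induction s using Finset.induction_on with
    | empty => simp
    | insert a s ha ih =>
      rw [Finset.prod_insert ha, Derivation.leibniz, ih, eulerD_dpow, Finset.sum_insert ha]
      simp only [smul_eq_mul, Algebra.smul_def, map_add, map_natCast, Nat.cast_add]
      ring
  rw [dmon, key, Finsupp.degree_eq_sum]

variable {ρ : OT F n →ₗ[F] F} (hρ : ∀ i, i ≠ r → ∀ f, ρ (dz F id i f) = 0)

include hρ

-- Integration by parts: `ρ` kills `∂/∂z_i (z_ir f)` for each of the `n - 1` indices `i ≠ r`, and
-- the term of index `r` is absent because `z_rr = 0`.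
omit [CharZero F] in
theorem map_eulerD (f : OT F n) : ρ (eulerD F r f) = -((n - 1 : ℕ) : F) * ρ f := by
  have h1 : ∀ i, i ≠ r → ρ (zInv F id i r * dzD F id i f) = - ρ f := by
    intro i hi
    have h := hρ i hi (zInv F id i r * f)
    rw [← dzD_apply, Derivation.leibniz, dzD_zInv, if_pos rfl, if_neg hi.symm, sub_zero, map_add,
      smul_eq_mul, smul_eq_mul, mul_one] at h
    exact eq_neg_of_add_eq_zero_left h
  rw [eulerD_apply, map_sum, ← Finset.add_sum_erase _ _ (Finset.mem_univ r),
    Finset.sum_congr rfl fun i hi => h1 i (Finset.ne_of_mem_erase hi)]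
  simp

/-- On a homogeneous function the Euler derivation is multiplication by the degree, so `map_eulerD`
makes `ρ` vanish unless the degree is `-(n - 1)`. The product of `dmon F r α` with `p_E` has degree
`|α| - |E|`, which is positive as soon as `|α| > |E|`. -/
theorem exists_degree_bound (f : OT F n) : ∃ N, ∀ α : Fin n →₀ ℕ, N < α.degree →
    ρ (dmon F r α * f) = 0 := by
  let T : Submodule F (OT F n) :=
    { carrier := {f | ∃ N, ∀ α : Fin n →₀ ℕ, N < α.degree → ρ (dmon F r α * f) = 0}
      add_mem' := by
        rintro f g ⟨N, hN⟩ ⟨M, hM⟩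
        refine ⟨max N M, fun α hα => ?_⟩
        rw [mul_add, map_add, hN α (lt_of_le_of_lt (le_max_left _ _) hα),
          hM α (lt_of_le_of_lt (le_max_right _ _) hα), add_zero]
      zero_mem' := ⟨0, fun α _ => by simp⟩
      smul_mem' := by
        rintro c f ⟨N, hN⟩
        exact ⟨N, fun α hα => by rw [mul_smul_comm, map_smul, hN α hα, smul_zero]⟩ }
  have hT : T = ⊤ := by
    -- Up to a scalar, `z_kr` raises `α` by one in the index `k`, so the same bound `N` still works.
    have hz : ∀ k, ∀ f ∈ T, zInv F id k r * f ∈ T := by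
      rintro k f ⟨N, hN⟩
      refine ⟨N, fun α hα => ?_⟩
      rw [← mul_assoc, mul_comm (dmon F r α), zInv_mul_dmon, smul_mul_assoc, map_smul, hN, smul_zero]
      rw [map_add]; omega
    refine eq_top_of_mul_zInv F (π := id) T (fun k l f hf => ?_) fun E => ?_
    · rw [← zInv_add F k r l, zInv_symm F r l, add_mul, neg_mul]
      exact T.add_mem (hz k f hf) (T.neg_mem (hz l f hf))
    · refine ⟨Multiset.card E, fun α hα => ?_⟩
      have h1 : eulerD F r (dmon F r α * polesFun F id E) =
          ((α.degree : F) - (Multiset.card E : F)) • (dmon F r α * polesFun F id E) := by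
        rw [Derivation.leibniz, eulerD_dmon, eulerD_polesFun]
        simp only [smul_eq_mul, Algebra.smul_def, map_natCast, map_neg, map_sub]
        ring
      have h2 := map_eulerD r hρ (dmon F r α * polesFun F id E)
      rw [h1, map_smul, smul_eq_mul] at h2
      have h3 : ((α.degree + (n - 1) - Multiset.card E : ℕ) : F) *
          ρ (dmon F r α * polesFun F id E) = 0 := by
        rw [Nat.cast_sub (by omega), Nat.cast_add]
        linear_combination h2
      refine (mul_eq_zero.1 h3).resolve_left (Nat.cast_ne_zero.2 (by omega))
  have hf : f ∈ T := hT ▸ Submodule.mem_top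
  exact hf

theorem exists_genPoly (f : OT F n) : ∃ P : MvPolynomial (Fin n) F,
    ∀ α, P.coeff α = ρ (dmon F r α * f) := by
  classical
  obtain ⟨N, hN⟩ := exists_degree_bound r hρ f
  refine ⟨∑ α ∈ (Finsupp.finite_of_degree_le (σ := Fin n) N).toFinset,
    MvPolynomial.monomial α (ρ (dmon F r α * f)), fun β => ?_⟩
  rw [MvPolynomial.coeff_sum]
  simp only [MvPolynomial.coeff_monomial, Finset.sum_ite_eq', Set.Finite.mem_toFinset, Set.mem_ofPred_eq]
  split_ifs with h
  · rfl
  · exact (hN β (not_le.1 h)).symm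

/-- The sesquilinear map `f ↦ ρ(exp(-∑_k λ_k z_{kr}) f)` with values in polynomials. -/
def genPoly : OT F n →ₗ[F] MvPolynomial (Fin n) F where
  toFun f := (exists_genPoly r hρ f).choose
  map_add' f g := by
    ext α
    rw [MvPolynomial.coeff_add, (exists_genPoly r hρ f).choose_spec,
      (exists_genPoly r hρ g).choose_spec, (exists_genPoly r hρ (f + g)).choose_spec, mul_add, map_add]
  map_smul' c f := by
    ext α
    rw [MvPolynomial.coeff_smul, (exists_genPoly r hρ f).choose_spec,
      (exists_genPoly r hρ (c • f)).choose_spec, mul_smul_comm, map_smul, RingHom.id_apply]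

theorem coeff_genPoly (f : OT F n) (α : Fin n →₀ ℕ) :
    (genPoly r hρ f).coeff α = ρ (dmon F r α * f) := (exists_genPoly r hρ f).choose_spec α

theorem genPoly_zInv_mul (k : Fin n) (f : OT F n) :
    genPoly r hρ (zInv F id k r * f) = - MvPolynomial.pderiv k (genPoly r hρ f) := by
  ext α
  rw [MvPolynomial.coeff_neg, MvPolynomial.coeff_pderiv, coeff_genPoly, coeff_genPoly, ← mul_assoc,
    mul_comm (dmon F r α), zInv_mul_dmon, smul_mul_assoc, map_smul, smul_eq_mul]
  push_cast; ring

/-- Integration by parts moves the derivative to `dmon F r α`, where it lowers `α i` by one. The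
signs from these two steps cancel, and lowering the index is multiplication by `λ_i` on generating
polynomials. -/
theorem genPoly_dz {i : Fin n} (hi : i ≠ r) (f : OT F n) :
    genPoly r hρ (dz F id i f) = MvPolynomial.X i * genPoly r hρ f := by
  classical
  have h1 : ∀ α, ρ (dmon F r α * dz F id i f) = - ρ (dzD F id i (dmon F r α) * f) := by
    intro α
    have h := hρ i hi (dmon F r α * f)
    rw [← dzD_apply, Derivation.leibniz, map_add, smul_eq_mul, smul_eq_mul, mul_comm f] at h
    exact eq_neg_of_add_eq_zero_left h
  ext α
  rw [coeff_genPoly, h1, MvPolynomial.coeff_X_mul']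
  split_ifs with hα
  · obtain ⟨β, rfl⟩ : ∃ β, α = β + Finsupp.single i 1 :=
      ⟨α - Finsupp.single i 1, (tsub_add_cancel_of_le (Finsupp.single_le_iff.2
        (Nat.one_le_iff_ne_zero.2 (Finsupp.mem_support_iff.1 hα)))).symm⟩
    rw [dzD_dmon_add_single r hi, neg_mul, map_neg, neg_neg, add_tsub_cancel_right, coeff_genPoly]
  · rw [dzD_dmon_eq_zero r hi (Finsupp.notMem_support_iff.1 hα), zero_mul, map_zero, neg_zero]

variable {V : Type v} [AddCommGroup V] [Module F V]

/-- The sesquilinear map defined by a functional and a vector. -/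
theorem exists_DMap (x : V) : ∃ φ ∈ DMap F V n, ∀ f, epsV n (φ f) = ρ f • x := by
  refine ⟨mkV 0 n ∘ₗ (TensorProduct.mk F (MvPolynomial (Fin n) F) V).flip x ∘ₗ genPoly r hρ,
    ⟨fun i f => ?_, fun i j f => ?_⟩, fun f => ?_⟩
  · have h1 : ∀ i, i ≠ r → mkV (0 : V →ₗ[F] V) n (genPoly r hρ (dz F id i f) ⊗ₜ[F] x) =
        mulV 0 n (MvPolynomial.X i) (mkV 0 n (genPoly r hρ f ⊗ₜ[F] x)) := by
      intro i hi
      rw [mulV_mkV_tmul, genPoly_dz r hρ hi]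
    change mkV (0 : V →ₗ[F] V) n (genPoly r hρ (dz F id i f) ⊗ₜ[F] x) =
        mulV 0 n (MvPolynomial.X i) (mkV 0 n (genPoly r hρ f ⊗ₜ[F] x))
    -- For `i = r` both sides are minus the sum over the other indices: by translation invariance
    -- for `∂/∂z_r`, and by the relation of `V_n` for `λ_r`.
    by_cases hi : i = r
    · subst hi
      have e1 : dz F id i f = -∑ k ∈ Finset.univ.erase i, dz F id k f := by
        have := congrArg (fun D => D f) (dzS_univ (F := F) (π := (id : Fin n → Fin n)))
        simp only [dzS_apply] at this
        rw [← Finset.add_sum_erase _ _ (Finset.mem_univ i)] at this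
        exact eq_neg_of_add_eq_zero_left this
      have e2 := mulV_sum_X n (mkV (0 : V →ₗ[F] V) n (genPoly i hρ f ⊗ₜ[F] x))
      rw [← Finset.add_sum_erase _ _ (Finset.mem_univ i), map_add, LinearMap.add_apply] at e2
      rw [eq_neg_of_add_eq_zero_left e2, e1, map_neg, TensorProduct.neg_tmul, map_neg, map_sum,
        map_sum, LinearMap.sum_apply, TensorProduct.sum_tmul, map_sum]
      congr 1
      exact Finset.sum_congr rfl fun k hk => h1 k (Finset.ne_of_mem_erase hk)
    · exact h1 i hi
  · change mkV (0 : V →ₗ[F] V) n (genPoly r hρ (zInv F id i j * f) ⊗ₜ[F] x) =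
        diffV 0 n i j (mkV 0 n (genPoly r hρ f ⊗ₜ[F] x))
    rw [diffV_mkV_tmul, ← zInv_add F i r j, zInv_symm F r j, add_mul, neg_mul, map_add, map_neg,
      genPoly_zInv_mul, genPoly_zInv_mul]
    congr 2; ring
  · change epsV n (mkV (0 : V →ₗ[F] V) n (genPoly r hρ f ⊗ₜ[F] x)) = _
    rw [epsV_mkV]
    congr 1
    have h0 := coeff_genPoly r hρ f 0
    rw [dmon_zero, one_mul, ← MvPolynomial.constantCoeff_eq] at h0
    rw [← h0, MvPolynomial.aeval_def, ← Pi.zero_def, MvPolynomial.eval₂_zero_apply]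
    rfl

end Functional

/-! ### Every classical operation comes from a chiral one -/

section Surjective

variable {F : Type u} [Field F] [CharZero F] {V : Type v} [AddCommGroup V] [Module F V] {n : ℕ}

/-- The map is the sum, over the Hamiltonian paths from `r`, of the sesquilinear map of the dual
residue with vector the value of `y` at that path. Both sides are tree-like, so it suffices to
compare them on paths. -/
theorem exists_DMap_of_treeLike (r : Fin n) {y : NGraph n → V} (hy : TreeLike y) :
    ∃ φ ∈ DMap F V n, graphVal n φ = fun Γ => constV n (y Γ) := by
  classical
  have hfin : {l : List (Fin n) | l.length = n - 1}.Finite := List.finite_length_eq _ _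
  let L : Finset (List (Fin n)) := hfin.toFinset.filter fun l => (r :: l).Nodup ∧ ∀ i, i ∈ r :: l
  have hL : ∀ l, l ∈ L ↔ (r :: l).Nodup ∧ ∀ i, i ∈ r :: l := by
    intro l
    simp only [L, Finset.mem_filter, Set.Finite.mem_toFinset, Set.mem_ofPred_eq, and_iff_right_iff_imp]
    rintro ⟨h1, h2⟩
    have := length_of_nodup_of_forall_mem h1 h2
    rw [List.length_cons] at this
    omega
  have key : ∀ l, ∃ φ ∈ DMap F V n, l ∈ L → ∀ l' ∈ L,
      epsV n (φ (graphFun F (chainG r l'))) = if l' = l then y (chainG r l) else 0 := by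
    intro l
    by_cases hl : l ∈ L
    · obtain ⟨ρ, h1, h2⟩ := exists_residue (F := F) r ((hL l).1 hl).1 ((hL l).1 hl).2
      obtain ⟨φ, h3, h4⟩ := exists_DMap r h1 (y (chainG r l))
      refine ⟨φ, h3, fun _ l' hl' => ?_⟩
      rw [h4, h2 l' ((hL l').1 hl').1 ((hL l').1 hl').2]
      split_ifs <;> simp
    · exact ⟨0, Submodule.zero_mem _, fun h => absurd h hl⟩
  choose φ h1 h2 using key
  have hmem : ∑ l ∈ L, φ l ∈ DMap F V n := Submodule.sum_mem _ fun l _ => h1 l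
  refine ⟨∑ l ∈ L, φ l, hmem, ?_⟩
  have hC := graphVal_mem hmem
  refine TreeLike.ext (CMap.treeLike hC) (hy.comp (constV (F := F) n).toAddMonoidHom) r
    fun l h3 h4 => ?_
  have hl : l ∈ L := (hL l).2 ⟨h3, h4⟩
  rw [← CMap.constV_epsV hC]
  change constV n _ = constV n _
  congr 1
  rw [graphVal_apply, if_pos, LinearMap.sum_apply, map_sum,
    Finset.sum_congr rfl fun l' hl' => h2 l' hl' l hl, Finset.sum_ite_eq, if_pos hl]
  rw [card_chainG h3]
  have := length_of_nodup_of_forall_mem h3 h4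
  rw [List.length_cons] at this
  omega

-- Needed in arity `0`, where the sesquilinearity conditions are empty and only the value at `1`,
-- the function of the empty graph, is prescribed.
omit [CharZero F] in
theorem exists_linear_one : ∃ ψ : OT F n →ₗ[F] F, ψ 1 = 1 := by
  have h : (1 : OT F n) ≠ 0 := fun h => one_ne_zero (congrArg Subtype.val h)
  obtain ⟨ψ, hψ⟩ := Module.Projective.exists_dual_ne_zero F h
  exact ⟨(ψ 1)⁻¹ • ψ, by simp [inv_mul_cancel₀ hψ]⟩

theorem exists_DMap_eq {y : NGraph n → Vn (0 : V →ₗ[F] V) n} (hy : y ∈ CMap F V n) :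
    ∃ φ ∈ DMap F V n, graphVal n φ = y := by
  rcases n.eq_zero_or_pos with hn | hn
  · subst hn
    obtain ⟨ψ, hψ⟩ := exists_linear_one (F := F) (n := 0)
    refine ⟨ψ.smulRight (y 0), ⟨fun i => i.elim0, fun i => i.elim0⟩, ?_⟩
    funext Γ
    have hΓ : Γ = 0 := Multiset.eq_zero_of_forall_notMem fun e => e.1.1.elim0
    subst hΓ
    rw [graphVal_apply, if_pos (by simp)]
    have : graphFun F (0 : NGraph 0) = 1 := by simp [graphFun]
    rw [this, LinearMap.smulRight_apply, hψ, one_smul]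
  · obtain ⟨φ, h1, h2⟩ := exists_DMap_of_treeLike (F := F) ⟨0, hn⟩
      ((CMap.treeLike hy).comp (epsV (F := F) (V := V) n).toAddMonoidHom)
    refine ⟨φ, h1, h2.trans ?_⟩
    funext Γ
    exact CMap.constV_epsV hy Γ

/-- The cycle relations of all lengths follow from the few relations of `TreeLike` by a detour: `y`
is realised by a sesquilinear map, whose values on trees satisfy all of them. -/
theorem constV_mem_CMap (hn : 0 < n) {y : NGraph n → V} (hy : TreeLike y) :
    (fun Γ => constV (F := F) n (y Γ)) ∈ CMap F V n := by
  obtain ⟨φ, h1, h2⟩ := exists_DMap_of_treeLike (F := F) ⟨0, hn⟩ hy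
  rw [← h2]
  exact graphVal_mem h1

end Surjective

end VertexOperad

end

noncomputable section

namespace VertexOperad

universe u v

/-! ### Multilinear maps on superspaces -/

section Super

variable {F : Type u} [Field F] {V : Type v} [AddCommGroup V] [Module F V]
  {𝒱 : ZMod 2 → Submodule F V}

theorem exists_proj (h𝒱 : DirectSum.IsInternal 𝒱) : ∃ pr : ZMod 2 → V →ₗ[F] V,
    (∀ p x, pr p x ∈ 𝒱 p) ∧ (∀ p, ∀ x ∈ 𝒱 p, pr p x = x) ∧
    (∀ p q x, x ∈ 𝒱 q → p ≠ q → pr p x = 0) ∧ ∀ x, ∑ p, pr p x = x := by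
  classical
  let D := h𝒱.chooseDecomposition
  refine ⟨fun p => (𝒱 p).subtype ∘ₗ DirectSum.component F (ZMod 2) (fun p => 𝒱 p) p ∘ₗ
    (DirectSum.decomposeLinearEquiv 𝒱).toLinearMap, fun p x => Subtype.property _, fun p x hx => ?_,
    fun p q x hx hpq => ?_, fun x => ?_⟩
  · exact DirectSum.decompose_of_mem_same 𝒱 hx
  · exact DirectSum.decompose_of_mem_ne 𝒱 hx hpq.symm
  · have h := DirectSum.sum_support_decompose 𝒱 x
    refine Eq.trans (Finset.sum_subset (Finset.subset_univ _) fun p _ hp => ?_).symm h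
    change ((DirectSum.decompose 𝒱 x p : 𝒱 p) : V) = 0
    rw [DFinsupp.notMem_support_iff.1 hp]; rfl

variable {ι : Type*} [Fintype ι] {W : Type*} [AddCommGroup W] [Module F W]

/-- Multilinear maps are determined by their values at homogeneous vectors. -/
theorem multilinear_ext_homogeneous (h𝒱 : DirectSum.IsInternal 𝒱)
    {f g : MultilinearMap F (fun _ : ι => V) W}
    (h : ∀ (q : ι → ZMod 2) (x : ι → V), (∀ i, x i ∈ 𝒱 (q i)) → f x = g x) : f = g := by
  classical
  obtain ⟨pr, h1, _, _, h4⟩ := exists_proj h𝒱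
  ext x
  have hx : x = fun i => ∑ p, pr p (x i) := funext fun i => (h4 (x i)).symm
  rw [hx, MultilinearMap.map_sum, MultilinearMap.map_sum]
  exact Finset.sum_congr rfl fun q _ => h q _ fun i => h1 _ _

/-- Multilinear maps can be prescribed at homogeneous vectors. -/
theorem exists_multilinear_homogeneous (h𝒱 : DirectSum.IsInternal 𝒱)
    (M : (ι → ZMod 2) → MultilinearMap F (fun _ : ι => V) W) (D : Submodule F W)
    (hD : ∀ q x, M q x ∈ D) :
    ∃ f : MultilinearMap F (fun _ : ι => V) W, (∀ x, f x ∈ D) ∧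
      ∀ (q : ι → ZMod 2) (x : ι → V), (∀ i, x i ∈ 𝒱 (q i)) → f x = M q x := by
  classical
  obtain ⟨pr, h1, h2, h3, _⟩ := exists_proj h𝒱
  have hf : ∀ x, (∑ q, (M q).compLinearMap fun i => pr (q i)) x = ∑ q, M q fun i => pr (q i) (x i) :=
    fun x => by simp
  -- At vectors of parities `q` all summands but the one of index `q` contain a zero argument. This
  -- is how signs that depend on parities are inserted; `D` keeps track of sesquilinearity.
  refine ⟨∑ q, (M q).compLinearMap fun i => pr (q i), fun x => ?_, fun q x hx => ?_⟩
  · rw [hf]; exact Submodule.sum_mem _ fun q _ => hD q _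
  · rw [hf, Finset.sum_eq_single q]
    · congr 1; funext i; exact h2 _ _ (hx i)
    · intro q' _ hq
      obtain ⟨i, hi⟩ := Function.ne_iff.1 hq
      exact (M q').map_coord_zero i (h3 _ _ _ (hx i) hi)
    · simp

variable {n : ℕ} {m : Fin n → ℕ} {U : Fin n → Type*} [∀ i, AddCommGroup (U i)] [∀ i, Module F (U i)]

/-- The composition of multilinear maps along consecutive blocks of arguments. -/
def blockComp (f : MultilinearMap F U W) (g : ∀ i, MultilinearMap F (fun _ : Fin (m i) => V) (U i)) :
    MultilinearMap F (fun _ : Fin (∑ i, m i) => V) W :=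
  (f.compMultilinearMap g).domDomCongr finSigmaFinEquiv

/-- Replacing the arguments of a multilinear map one by one. -/
theorem multilinear_congr {ι : Type*} [Finite ι] [DecidableEq ι] {A : ι → Type*}
    [∀ i, AddCommGroup (A i)] [∀ i, Module F (A i)] (f : MultilinearMap F A W) {x y : ∀ i, A i}
    (h : ∀ i z, f (Function.update z i (x i - y i)) = 0) : f x = f y := by
  cases nonempty_fintype ι
  suffices H : ∀ s : Finset ι, f (s.piecewise x y) = f y by
    simpa using H Finset.univ
  intro s
  induction s using Finset.induction_on with
  | empty => simp
  | insert a s ha ih =>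
    have h1 := h a (s.piecewise x y)
    rw [MultilinearMap.map_update_sub] at h1
    rw [Finset.piecewise_insert, sub_eq_zero.1 h1, ← ih]
    congr 1
    rw [← Finset.piecewise_eq_of_notMem s x y ha, Function.update_eq_self]

end Super

/-! ### From chiral to classical operations -/

section Phi

variable {F : Type u} [Field F] [CharZero F] {V : Type v} [AddCommGroup V] [Module F V]

/-- Sesquilinear maps are the same as their values on the functions of trees. -/
def graphValEquiv (F : Type u) [Field F] [CharZero F] (V : Type v) [AddCommGroup V] [Module F V]
    (n : ℕ) : DMap F V n ≃ₗ[F] CMap F V n :=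
  LinearEquiv.ofBijective
    ((graphVal n ∘ₗ (DMap F V n).subtype).codRestrict (CMap F V n) fun φ => graphVal_mem φ.2) (by
    constructor
    · intro φ ψ h
      apply Subtype.ext
      refine DMap.ext φ.2 ψ.2 fun Γ hΓ => ?_
      have h1 := congrFun (congrArg Subtype.val h) Γ
      change graphVal n φ.1 Γ = graphVal n ψ.1 Γ at h1
      rwa [graphVal_apply, graphVal_apply, if_pos hΓ, if_pos hΓ] at h1
    · intro y
      obtain ⟨φ, h1, h2⟩ := exists_DMap_eq y.2
      exact ⟨⟨φ, h1⟩, Subtype.ext h2⟩)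

/-- A chiral operation with values in the space of sesquilinear maps. -/
def chiralVal {n : ℕ} (X : chiral (0 : V →ₗ[F] V) n) :
    MultilinearMap F (fun _ : Fin n => V) (DMap F V n) :=
  X.1.codRestrict (DMap F V n) (mem_chiral_iff.1 X.2)

/-- A classical operation with values in the space of functions on graphs. -/
def classicalVal {n : ℕ} (Y : classical (0 : V →ₗ[F] V) n) :
    MultilinearMap F (fun _ : Fin n => V) (CMap F V n) :=
  (MultilinearMap.pi Y.1).codRestrict (CMap F V n) fun x => mem_classical_iff.1 Y.2 x

/-- The isomorphism between the spaces of chiral and classical operations. -/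
def chiralEquiv (F : Type u) [Field F] [CharZero F] (V : Type v) [AddCommGroup V] [Module F V]
    (n : ℕ) : chiral (0 : V →ₗ[F] V) n ≃ₗ[F] classical (0 : V →ₗ[F] V) n where
  toFun X := ⟨fun Γ => (LinearMap.proj Γ ∘ₗ (CMap F V n).subtype ∘ₗ
      (graphValEquiv F V n).toLinearMap).compMultilinearMap (chiralVal X),
    mem_classical_iff.2 fun x => (graphValEquiv F V n (chiralVal X x)).2⟩
  map_add' X X' := by
    apply Subtype.ext; funext Γ; ext x
    change (graphValEquiv F V n (chiralVal X x + chiralVal X' x)).1 Γ = _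
    rw [map_add]; rfl
  map_smul' c X := by
    apply Subtype.ext; funext Γ; ext x
    change (graphValEquiv F V n (c • chiralVal X x)).1 Γ = _
    rw [map_smul]; rfl
  invFun Y := ⟨((DMap F V n).subtype ∘ₗ (graphValEquiv F V n).symm.toLinearMap).compMultilinearMap
      (classicalVal Y), mem_chiral_iff.2 fun x => ((graphValEquiv F V n).symm (classicalVal Y x)).2⟩
  left_inv X := by
    apply Subtype.ext; ext x : 1
    change ((graphValEquiv F V n).symm (graphValEquiv F V n (chiralVal X x))).1 = _
    rw [LinearEquiv.symm_apply_apply]; rfl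
  right_inv Y := by
    apply Subtype.ext; funext Γ; ext x
    change (graphValEquiv F V n ((graphValEquiv F V n).symm (classicalVal Y x))).1 Γ = _
    rw [LinearEquiv.apply_symm_apply]; rfl

theorem chiralEquiv_apply {n : ℕ} (X : chiral (0 : V →ₗ[F] V) n) (Γ : NGraph n) (x : Fin n → V) :
    (chiralEquiv F V n X).1 Γ x =
      if Multiset.card Γ = n - 1 then X.1 x (graphFun F Γ) else 0 := rfl

variable (𝒱 : ZMod 2 → Submodule F V)

/-- For the converse, the elements of `V_n` with coefficients in one parity are stable under all
`λ_i` and `∂/∂λ_j - ∂/∂λ_i`, so their parity can be tested on trees. -/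
theorem chiralEquiv_parity {n : ℕ} (p : ZMod 2) (X : chiral (0 : V →ₗ[F] V) n) :
    X ∈ chiralParity 𝒱 0 n p ↔ chiralEquiv F V n X ∈ classicalParity 𝒱 0 n p := by
  constructor
  · intro h Γ q x hx
    rw [chiralEquiv_apply]
    split_ifs
    · exact h q x _ hx
    · exact Submodule.zero_mem _
  · intro h q x f hx
    refine DMap.mem_of_forall_tree (mem_chiral_iff.1 X.2 x) _ (fun p w hw => mulV_mem_subV p hw)
      (fun i j w hw => diffV_mem_subV i j hw) (fun Γ hΓ => ?_) f
    have := h Γ q x hx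
    rwa [chiralEquiv_apply, if_pos hΓ] at this

theorem chiralEquiv_one (X : chiral (0 : V →ₗ[F] V) 1) :
    (chiralOperad 𝒱 (0 : V →ₗ[F] V)).IsOne X ↔
      (classicalOperad 𝒱 (0 : V →ₗ[F] V)).IsOne (chiralEquiv F V 1 X) := by
  change (∀ x : Fin 1 → V, X.1 x 1 = mkV 0 1 (1 ⊗ₜ[F] x 0)) ↔
    ∀ x : Fin 1 → V, (chiralEquiv F V 1 X).1 0 x = mkV 0 1 (1 ⊗ₜ[F] x 0)
  have h : graphFun F (0 : NGraph 1) = 1 := by simp [graphFun]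
  simp only [chiralEquiv_apply, Multiset.card_zero, Nat.sub_self, if_true, h]

/-! ### The unit and the actions of the symmetric groups -/

theorem isEmpty_edge_one : IsEmpty (Edge 1) := ⟨fun e => e.2 (Subsingleton.elim _ _)⟩

theorem classical_one_existsUnique :
    ∃! Y, (classicalOperad 𝒱 (0 : V →ₗ[F] V)).IsOne Y := by
  have h0 : ∀ Γ : NGraph 1, Γ = 0 := fun Γ =>
    Multiset.eq_zero_of_forall_notMem fun e _ => isEmpty_edge_one.false e
  let M : MultilinearMap F (fun _ : Fin 1 => V) (Vn (0 : V →ₗ[F] V) 1) :=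
    (constV (F := F) 1).compMultilinearMap (MultilinearMap.ofSubsingleton F V V (0 : Fin 1) LinearMap.id)
  have hM : ∀ x, M x = constV 1 (x 0) := fun x => rfl
  refine ⟨⟨fun _ => M, mem_classical_iff.2 fun x => ?_⟩, fun x => hM x, fun Y hY => ?_⟩
  · refine constV_mem_CMap (F := F) one_pos (y := fun _ => x 0) ⟨fun Γ i j h => ?_,
      fun Γ v a b h => ?_, fun Γ S h1 h2 => ?_, fun Γ e => ?_⟩
    · exact absurd (Subsingleton.elim i j) h
    · exact absurd (Subsingleton.elim v a) h
    · obtain ⟨i, hi⟩ := h1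
      exact absurd (Finset.eq_univ_of_forall fun j => Subsingleton.elim i j ▸ hi) h2
    · exact (isEmpty_edge_one.false e).elim
  · apply Subtype.ext; funext Γ; ext x
    rw [h0 Γ]; exact hY x

omit [CharZero F] in
theorem graphFun_relabel {a b : ℕ} (θ : Fin a → Fin b) (hθ : Function.Injective θ) (Γ : NGraph a) :
    graphFun F (Γ.relabel θ hθ) =
      renameInv F id id θ (fun _ _ h h' => h (hθ h')) (graphFun F Γ) :=
  (renameInv_polesFun (F := F) (π := id) (π' := id) (fun _ _ h h' => h (hθ h')) Γ).symm

theorem card_relabel {a b : ℕ} (θ : Fin a → Fin b) (hθ : Function.Injective θ) (Γ : NGraph a) :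
    Multiset.card (Γ.relabel θ hθ) = Multiset.card Γ := Multiset.card_map _ _

/-- The action of a permutation on sesquilinear maps. -/
def permMap {n : ℕ} (σ : Equiv.Perm (Fin n)) :
    (OT F n →ₗ[F] Vn (0 : V →ₗ[F] V) n) →ₗ[F] (OT F n →ₗ[F] Vn (0 : V →ₗ[F] V) n) :=
  LinearMap.lcomp F _ (renameInv F id id σ
      (fun _ _ h h' => h (σ.injective h'))).toLinearMap ∘ₗ LinearMap.compRight F (substV 0 σ)

omit [CharZero F] in
theorem permMap_apply {n : ℕ} (σ : Equiv.Perm (Fin n)) (φ : OT F n →ₗ[F] Vn (0 : V →ₗ[F] V) n)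
    (f : OT F n) : permMap σ φ f = substV 0 σ (φ (renameInv F id id σ
      (fun _ _ h h' => h (σ.injective h')) f)) := rfl

omit [CharZero F] in
theorem permMap_mem {n : ℕ} (σ : Equiv.Perm (Fin n)) {φ : OT F n →ₗ[F] Vn (0 : V →ₗ[F] V) n}
    (hφ : φ ∈ DMap F V n) : permMap σ φ ∈ DMap F V n := by
  refine ⟨fun i f => ?_, fun i j f => ?_⟩
  · rw [permMap_apply, permMap_apply]
    have h1 := dzD_renameInv (F := F) (π := id) (π' := id) (θ := σ)
      (fun _ _ h h' => h (σ.injective h')) (σ i) f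
    have h2 : (Finset.univ.filter fun k => σ k = σ i) = {i} := by
      ext k; simp
    rw [h2] at h1
    have h3 : dzS F id {i} f = dz F id i f := by rw [dzS_apply, Finset.sum_singleton]
    rw [h3, dzD_apply] at h1
    rw [← h1, hφ.1, substV_mulV, MvPolynomial.aeval_X, h2, Finset.sum_singleton]
  · rw [permMap_apply, permMap_apply, map_mul]
    have h1 := renameInv_zInv (F := F) (π := id) (π' := id) (θ := σ)
      (fun _ _ h h' => h (σ.injective h')) i j
    rw [← zOT_eq_zInv, ← zOT_eq_zInv] at h1
    rw [h1, hφ.2, diffV_substV]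

variable {𝒱} (h𝒱 : DirectSum.IsInternal 𝒱)
include h𝒱

omit [CharZero F] in
theorem chiral_act_exists {n : ℕ} (σ : Equiv.Perm (Fin n)) (X : chiral (0 : V →ₗ[F] V) n) :
    ∃ X', (chiralOperad 𝒱 (0 : V →ₗ[F] V)).IsAct σ X X' := by
  obtain ⟨f, h1, h2⟩ := exists_multilinear_homogeneous h𝒱
    (fun q => permSign q σ • (permMap σ).compMultilinearMap
      (X.1.domDomCongr σ⁻¹)) (DMap F V n) (fun q x =>
        zsmul_mem (permMap_mem σ (mem_chiral_iff.1 X.2 _)) _)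
  refine ⟨⟨f, mem_chiral_iff.2 h1⟩, fun q x g hx => ?_⟩
  change f x g = _
  rw [h2 q x hx, smul_apply, LinearMap.smul_apply]
  rfl

omit [CharZero F] in
theorem classical_ext {n : ℕ} {Y Y' : classical (0 : V →ₗ[F] V) n}
    (h : ∀ (Γ : NGraph n) (q : Fin n → ZMod 2) (x : Fin n → V), (∀ i, x i ∈ 𝒱 (q i)) →
      Y.1 Γ x = Y'.1 Γ x) : Y = Y' := by
  apply Subtype.ext; funext Γ
  exact multilinear_ext_homogeneous h𝒱 (h Γ)

theorem chiral_ext {n : ℕ} {X X' : chiral (0 : V →ₗ[F] V) n}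
    (h : ∀ (Γ : NGraph n) (q : Fin n → ZMod 2) (x : Fin n → V), (∀ i, x i ∈ 𝒱 (q i)) →
      Multiset.card Γ = n - 1 → X.1 x (graphFun F Γ) = X'.1 x (graphFun F Γ)) : X = X' := by
  apply (chiralEquiv F V n).injective
  refine classical_ext h𝒱 fun Γ q x hx => ?_
  rw [chiralEquiv_apply, chiralEquiv_apply]
  split_ifs with hΓ
  · exact h Γ q x hx hΓ
  · rfl

theorem chiral_act_unique {n : ℕ} (σ : Equiv.Perm (Fin n)) (X X' X'' : chiral (0 : V →ₗ[F] V) n)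
    (h : (chiralOperad 𝒱 (0 : V →ₗ[F] V)).IsAct σ X X')
    (h' : (chiralOperad 𝒱 (0 : V →ₗ[F] V)).IsAct σ X X'') : X' = X'' :=
  chiral_ext h𝒱 fun _ q x hx _ => (h q x _ hx).trans (h' q x _ hx).symm

/-- Only the forward direction needs a computation. For the converse, the chiral action exists, the
classical one is unique, and the comparison map is injective; compositions are treated by the same
pattern. -/
theorem chiralEquiv_act {n : ℕ} (σ : Equiv.Perm (Fin n)) (X X' : chiral (0 : V →ₗ[F] V) n) :
    (chiralOperad 𝒱 (0 : V →ₗ[F] V)).IsAct σ X X' ↔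
      (classicalOperad 𝒱 (0 : V →ₗ[F] V)).IsAct σ (chiralEquiv F V n X) (chiralEquiv F V n X') := by
  have hfwd : ∀ X' : chiral (0 : V →ₗ[F] V) n, (chiralOperad 𝒱 (0 : V →ₗ[F] V)).IsAct σ X X' →
      (classicalOperad 𝒱 (0 : V →ₗ[F] V)).IsAct σ (chiralEquiv F V n X) (chiralEquiv F V n X') := by
    intro X' h Γ q x hx
    change (chiralEquiv F V n X').1 Γ x = _ • substV 0 σ ((chiralEquiv F V n X).1 _ _)
    rw [chiralEquiv_apply, chiralEquiv_apply, card_relabel]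
    split_ifs with hΓ
    · rw [graphFun_relabel]
      exact h q x _ hx
    · simp
  refine ⟨hfwd X', fun h => ?_⟩
  obtain ⟨X'', hX''⟩ := chiral_act_exists h𝒱 σ X
  have h1 := hfwd _ hX''
  have h2 : chiralEquiv F V n X' = chiralEquiv F V n X'' :=
    classical_ext h𝒱 fun Γ q x hx => (h Γ q x hx).trans (h1 Γ q x hx).symm
  rw [(chiralEquiv F V n).injective h2]
  exact hX''

end Phi

end VertexOperad

end

noncomputable section

namespace VertexOperad

universe w' u v w

/-! ### Multilinear maps on tensor products -/

section Slots

variable {F : Type u} [Field F] {V : Type v} [AddCommGroup V] [Module F V] {n : ℕ}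
  {A : Fin n → Type w} [∀ i, AddCommGroup (A i)] [∀ i, Module F (A i)]
  {W : Type w'} [AddCommGroup W] [Module F W]

/-- Bases of the `A i` identify `A i ⊗ V` with finitely supported families in `V`, and there a
multilinear map may be prescribed component by component. -/
theorem exists_multilinear_tmul
    (B : MultilinearMap F A (MultilinearMap F (fun _ : Fin n => V) W)) :
    ∃ T : MultilinearMap F (fun i => A i ⊗[F] V) W, ∀ p v, T (fun i => p i ⊗ₜ[F] v i) = B p v := by
  classical
  let b := fun i => Module.Basis.ofVectorSpace F (A i)
  let e := fun i => (finsuppLequivDFinsupp F (ι := Module.Basis.ofVectorSpaceIndex F (A i)) (M := V)).toLinearMap ∘ₗ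
    (TensorProduct.equivFinsuppOfBasisLeft (N := V) (b i)).toLinearMap
  have he : ∀ i k v, e i (b i k ⊗ₜ[F] v) = DFinsupp.single k v := by
    intro i k v
    change finsuppLequivDFinsupp F (TensorProduct.equivFinsuppOfBasisLeft (b i) (b i k ⊗ₜ[F] v)) = _
    rw [TensorProduct.equivFinsuppOfBasisLeft_apply_tmul]
    simp
  let T := (MultilinearMap.fromDFinsuppEquiv (R := F) (N := W)
    (κ := fun i => Module.Basis.ofVectorSpaceIndex F (A i)) (M := fun _ _ => V)
    fun α => B fun i => b i (α i)).compLinearMap e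
  refine ⟨T, fun p v => ?_⟩
  have h : T.compLinearMap (fun i => (TensorProduct.mk F (A i) V).flip (v i)) =
      (LinearMap.compMultilinearMap
        { toFun := fun f : MultilinearMap F (fun _ : Fin n => V) W => f v
          map_add' := fun _ _ => rfl
          map_smul' := fun _ _ => rfl } B) := by
    refine Module.Basis.ext_multilinear b fun α => ?_
    change (MultilinearMap.fromDFinsuppEquiv (R := F) (N := W)
      (κ := fun i => Module.Basis.ofVectorSpaceIndex F (A i)) (M := fun _ _ => V)
      fun α => B fun i => b i (α i)) (fun i => e i (b i (α i) ⊗ₜ[F] v i)) = B (fun i => b i (α i)) v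
    simp only [he]
    rw [MultilinearMap.fromDFinsuppEquiv_single]
  exact DFunLike.congr_fun h p

theorem multilinear_ext_tmul {T T' : MultilinearMap F (fun i => A i ⊗[F] V) W}
    (h : ∀ (p : ∀ i, A i) (v : Fin n → V),
      T (fun i => p i ⊗ₜ[F] v i) = T' (fun i => p i ⊗ₜ[F] v i)) : T = T' :=
  Module.Basis.ext_multilinear (fun i => (Module.Basis.ofVectorSpace F (A i)).tensorProduct
    (Module.Basis.ofVectorSpace F V)) fun α => by
    simp only [Module.Basis.tensorProduct_apply']
    exact h _ _

end Slots

/-! ### The operators `p(λ - ∂_z)` -/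

section Shift

theorem prod_ofFn_pow_add_single {A : Type*} [Monoid A] {N : ℕ} (s : Fin N → A)
    (hs : ∀ i j, Commute (s i) (s j)) (α : Fin N → ℕ) (k : Fin N) :
    (List.ofFn fun j => s j ^ (α j + if j = k then 1 else 0)).prod =
      s k * (List.ofFn fun j => s j ^ α j).prod := by
  induction N with
  | zero => exact k.elim0
  | succ N ih =>
    rw [List.ofFn_succ, List.ofFn_succ, List.prod_cons, List.prod_cons]
    refine Fin.cases ?_ (fun k' => ?_) k
    · have h : ∀ i : Fin N, (i.succ = 0) = False := fun i => eq_false (Fin.succ_ne_zero i)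
      simp only [h, if_true, if_false, add_zero]
      rw [pow_succ', mul_assoc]
    · have h : (0 = k'.succ) = False := eq_false (Fin.succ_ne_zero k').symm
      have h2 := ih (fun j => s j.succ) (fun i j => hs _ _) (fun j => α j.succ) k'
      simp only [h, if_false, add_zero, Fin.succ_inj]
      rw [h2, ← mul_assoc, ← mul_assoc, ((hs 0 k'.succ).pow_left _).eq]

variable {F : Type u} [Field F] {n : ℕ} {m : Fin n → ℕ}

theorem chiralShift_tmul (k : Fin (∑ i, m i)) (p : MvPolynomial (Fin (∑ i, m i)) F)
    (h : invFun F (block m)) : chiralShift m k (p ⊗ₜ[F] h) =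
      (MvPolynomial.X k * p) ⊗ₜ[F] h - p ⊗ₜ[F] dz F (block m) k h := rfl

theorem chiralShift_commute (k l : Fin (∑ i, m i)) :
    Commute (chiralShift (F := F) m k) (chiralShift m l) := by
  refine TensorProduct.ext' fun p h => ?_
  rw [Module.End.mul_apply, Module.End.mul_apply, chiralShift_tmul, chiralShift_tmul, map_sub,
    map_sub, chiralShift_tmul, chiralShift_tmul, chiralShift_tmul, chiralShift_tmul,
    mul_left_comm, ← dzD_apply, ← dzD_apply, ← dzD_apply, dzD_comm k l]
  abel

/-- The operator `p(λ - ∂_z)`. -/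
def shiftOp (F : Type u) [Field F] {n : ℕ} (m : Fin n → ℕ) : MvPolynomial (Fin (∑ i, m i)) F →ₗ[F]
    Module.End F (MvPolynomial (Fin (∑ i, m i)) F ⊗[F] invFun F (block m)) :=
  (MvPolynomial.basisMonomials (Fin (∑ i, m i)) F).constr F fun α => chiralShiftPow m α

theorem shiftOp_monomial (α : Fin (∑ i, m i) →₀ ℕ) :
    shiftOp F m (MvPolynomial.monomial α 1) = chiralShiftPow m α := by
  have := (MvPolynomial.basisMonomials (Fin (∑ i, m i)) F).constr_basis F
    (fun α => chiralShiftPow (F := F) m α) α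
  rwa [MvPolynomial.coe_basisMonomials] at this

/-- The operators `λ_k - ∂/∂z_k` commute, so `p ↦ p(λ - ∂_z)`, which is fixed on monomials by an
ordered product, respects multiplication by variables. -/
theorem shiftOp_X_mul (k : Fin (∑ i, m i)) (p : MvPolynomial (Fin (∑ i, m i)) F) :
    shiftOp F m (MvPolynomial.X k * p) = chiralShift m k * shiftOp F m p := by
  have h : shiftOp F m ∘ₗ LinearMap.mulLeft F (MvPolynomial.X k) =
      LinearMap.mulLeft F (chiralShift m k) ∘ₗ shiftOp F m := by
    refine (MvPolynomial.basisMonomials (Fin (∑ i, m i)) F).ext fun α => ?_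
    rw [MvPolynomial.coe_basisMonomials, LinearMap.comp_apply, LinearMap.comp_apply,
      LinearMap.mulLeft_apply, LinearMap.mulLeft_apply, MvPolynomial.X,
      MvPolynomial.monomial_mul, one_mul, add_comm, shiftOp_monomial, shiftOp_monomial,
      chiralShiftPow, chiralShiftPow, ← prod_ofFn_pow_add_single _ chiralShift_commute α k]
    congr 2
    funext j
    rw [Finsupp.add_apply, Finsupp.single_apply]
    simp only [eq_comm]
  exact LinearMap.congr_fun h p

theorem shiftOp_one : shiftOp F m 1 = 1 := by
  have h := shiftOp_monomial (F := F) (m := m) 0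
  refine h.trans ?_
  simp [chiralShiftPow]

theorem shiftOp_C (a : F) : shiftOp F m (MvPolynomial.C a) = a • 1 := by
  rw [← mul_one (MvPolynomial.C a), ← MvPolynomial.smul_eq_C_mul, map_smul, shiftOp_one]

theorem commute_shiftOp
    {A : Module.End F (MvPolynomial (Fin (∑ i, m i)) F ⊗[F] invFun F (block m))}
    (hA : ∀ k, Commute A (chiralShift m k)) (p : MvPolynomial (Fin (∑ i, m i)) F) :
    Commute A (shiftOp F m p) := by
  induction p using MvPolynomial.induction_on with
  | C a => rw [shiftOp_C]; exact (Commute.one_right A).smul_right a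
  | add p q hp hq => rw [map_add]; exact hp.add_right hq
  | mul_X p k hp => rw [mul_comm, shiftOp_X_mul]; exact (hA k).mul_right hp

/-- `1 ⊗ ∂/∂z_k`. -/
def derivOp (F : Type u) [Field F] {n : ℕ} (m : Fin n → ℕ) (k : Fin (∑ i, m i)) :
    Module.End F (MvPolynomial (Fin (∑ i, m i)) F ⊗[F] invFun F (block m)) :=
  LinearMap.lTensor _ (dz F (block m) k)

/-- `1 ⊗ z_{kl}`. -/
def zOp (F : Type u) [Field F] {n : ℕ} (m : Fin n → ℕ) (k l : Fin (∑ i, m i)) :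
    Module.End F (MvPolynomial (Fin (∑ i, m i)) F ⊗[F] invFun F (block m)) :=
  LinearMap.lTensor _ (LinearMap.mulLeft F (zInv F (block m) k l))

/-- `(∂/∂λ_l - ∂/∂λ_k) ⊗ 1 + 1 ⊗ z_{kl}`. -/
def weylOp (F : Type u) [Field F] {n : ℕ} (m : Fin n → ℕ) (k l : Fin (∑ i, m i)) :
    Module.End F (MvPolynomial (Fin (∑ i, m i)) F ⊗[F] invFun F (block m)) :=
  LinearMap.rTensor _ ((MvPolynomial.pderiv l).toLinearMap - (MvPolynomial.pderiv k).toLinearMap) +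
    zOp F m k l

theorem derivOp_tmul (k : Fin (∑ i, m i)) (p : MvPolynomial (Fin (∑ i, m i)) F)
    (h : invFun F (block m)) : derivOp F m k (p ⊗ₜ[F] h) = p ⊗ₜ[F] dz F (block m) k h := rfl

theorem zOp_tmul (k l : Fin (∑ i, m i)) (p : MvPolynomial (Fin (∑ i, m i)) F)
    (h : invFun F (block m)) : zOp F m k l (p ⊗ₜ[F] h) = p ⊗ₜ[F] (zInv F (block m) k l * h) := rfl

theorem weylOp_tmul (k l : Fin (∑ i, m i)) (p : MvPolynomial (Fin (∑ i, m i)) F)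
    (h : invFun F (block m)) : weylOp F m k l (p ⊗ₜ[F] h) =
      (MvPolynomial.pderiv l p - MvPolynomial.pderiv k p) ⊗ₜ[F] h +
        p ⊗ₜ[F] (zInv F (block m) k l * h) := rfl

theorem derivOp_commute (j k : Fin (∑ i, m i)) :
    Commute (derivOp F m j) (chiralShift m k) := by
  refine TensorProduct.ext' fun p h => ?_
  rw [Module.End.mul_apply, Module.End.mul_apply, chiralShift_tmul, derivOp_tmul, map_sub,
    chiralShift_tmul, derivOp_tmul, derivOp_tmul, ← dzD_apply, ← dzD_apply, ← dzD_apply,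
    ← dzD_apply, dzD_comm j k]

theorem dz_zInv_mul (j k l : Fin (∑ i, m i)) (h : invFun F (block m)) :
    dz F (block m) j (zInv F (block m) k l * h) =
      zInv F (block m) k l * dz F (block m) j h +
        (if k = j then (1 : F) else 0) • h - (if l = j then (1 : F) else 0) • h := by
  rw [← dzD_apply, Derivation.leibniz, dzD_zInv, smul_eq_mul, smul_eq_mul, dzD_apply]
  split_ifs <;> simp [sub_eq_add_neg]

theorem pderiv_X_mul (j l : Fin (∑ i, m i)) (p : MvPolynomial (Fin (∑ i, m i)) F) :
    MvPolynomial.pderiv l (MvPolynomial.X j * p) = MvPolynomial.X j * MvPolynomial.pderiv l p +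
      (if l = j then (1 : F) else 0) • p := by
  rw [Derivation.leibniz, MvPolynomial.pderiv_X, smul_eq_mul, smul_eq_mul, Pi.single_apply]
  simp only [eq_comm]
  split_ifs <;> simp

theorem chiralShift_zOp (j k l : Fin (∑ i, m i)) :
    chiralShift m j * zOp F m k l = zOp F m k l * chiralShift m j +
      (if l = j then (1 : F) else 0) • 1 - (if k = j then (1 : F) else 0) • 1 := by
  refine TensorProduct.ext' fun p h => ?_
  rw [LinearMap.sub_apply, LinearMap.add_apply, LinearMap.smul_apply, LinearMap.smul_apply, Module.End.mul_apply, Module.End.mul_apply,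
    chiralShift_tmul, zOp_tmul, map_sub, chiralShift_tmul, zOp_tmul, zOp_tmul, dz_zInv_mul,
    TensorProduct.tmul_sub, TensorProduct.tmul_add, TensorProduct.tmul_smul, TensorProduct.tmul_smul,
    Module.End.one_apply]
  abel

/-- The commutator of the `λ`-derivatives with `λ_j` cancels that of `z_kl` with `-∂/∂z_j`. -/
theorem weylOp_commute (j k l : Fin (∑ i, m i)) :
    Commute (weylOp F m k l) (chiralShift m j) := by
  refine TensorProduct.ext' fun p h => ?_
  rw [Module.End.mul_apply, Module.End.mul_apply, chiralShift_tmul, weylOp_tmul, map_sub, map_add,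
    chiralShift_tmul, weylOp_tmul, weylOp_tmul, chiralShift_tmul, pderiv_X_mul, pderiv_X_mul,
    dz_zInv_mul]
  simp only [TensorProduct.tmul_add, TensorProduct.tmul_sub, TensorProduct.add_tmul,
    TensorProduct.sub_tmul, mul_sub, ← TensorProduct.smul_tmul', TensorProduct.tmul_smul]
  abel

/-- As in a Weyl algebra, moving `z_kl` through `p(λ - ∂_z)` differentiates `p`. -/
theorem shiftOp_zOp (k l : Fin (∑ i, m i)) (p : MvPolynomial (Fin (∑ i, m i)) F)
    (t : MvPolynomial (Fin (∑ i, m i)) F ⊗[F] invFun F (block m)) :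
    shiftOp F m p (zOp F m k l t) = zOp F m k l (shiftOp F m p t) +
      shiftOp F m (MvPolynomial.pderiv l p - MvPolynomial.pderiv k p) t := by
  induction p using MvPolynomial.induction_on with
  | C a => rw [shiftOp_C]; simp
  | add p q hp hq =>
    simp only [map_add, map_sub, LinearMap.add_apply, LinearMap.sub_apply] at hp hq ⊢
    rw [hp, hq]
    abel
  | mul_X p j hp =>
    have h := LinearMap.congr_fun (chiralShift_zOp (F := F) j k l) (shiftOp F m p t)
    rw [LinearMap.sub_apply, LinearMap.add_apply, Module.End.mul_apply, Module.End.mul_apply] at h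
    rw [mul_comm p, shiftOp_X_mul, Module.End.mul_apply, hp, map_add, h, pderiv_X_mul, pderiv_X_mul]
    simp only [map_add, map_sub, map_smul, shiftOp_X_mul, LinearMap.add_apply, LinearMap.sub_apply,
      LinearMap.smul_apply, Module.End.mul_apply, Module.End.one_apply]
    abel

end Shift

end VertexOperad

end

noncomputable section

namespace VertexOperad

universe w' u v w

/-! ### The composition of chiral operations -/

section Blocks

variable {n : ℕ} {m : Fin n → ℕ}

@[simp] theorem block_emb (i : Fin n) (k : Fin (m i)) : block m (emb m i k) = i := by
  simp [block, emb]

theorem exists_emb (k : Fin (∑ i, m i)) : ∃ i k', k = emb m i k' :=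
  ⟨(finSigmaFinEquiv.symm k).1, (finSigmaFinEquiv.symm k).2, by simp [emb]⟩

theorem filter_block (i : Fin n) :
    (Finset.univ.filter fun k => block m k = i) = Finset.univ.map ⟨emb m i, emb_injective m i⟩ := by
  ext k
  simp only [Finset.mem_filter, Finset.mem_univ, true_and, Finset.mem_map, Function.Embedding.coeFn_mk]
  constructor
  · rintro rfl
    obtain ⟨i, k', rfl⟩ := exists_emb k
    rw [block_emb]
    exact ⟨k', rfl⟩
  · rintro ⟨k', rfl⟩; exact block_emb i k'

theorem sum_block {M : Type*} [AddCommMonoid M] (i : Fin n) (f : Fin (∑ i, m i) → M) :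
    ∑ k with block m k = i, f k = ∑ k', f (emb m i k') := by
  rw [filter_block, Finset.sum_map]; rfl

variable {F : Type u} [Field F]

/-- The product of polynomials in the variables of the blocks. -/
def blockPoly (F : Type u) [Field F] {n : ℕ} (m : Fin n → ℕ) :
    MultilinearMap F (fun i => MvPolynomial (Fin (m i)) F) (MvPolynomial (Fin (∑ i, m i)) F) :=
  (MultilinearMap.mkPiAlgebra F (Fin n) (MvPolynomial (Fin (∑ i, m i)) F)).compLinearMap
    fun i => (MvPolynomial.rename (emb m i)).toLinearMap

theorem blockPoly_apply (p : ∀ i, MvPolynomial (Fin (m i)) F) :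
    blockPoly F m p = ∏ i, MvPolynomial.rename (emb m i) (p i) := rfl

theorem blockPoly_update (p : ∀ i, MvPolynomial (Fin (m i)) F) (i : Fin n)
    (q : MvPolynomial (Fin (m i)) F) : blockPoly F m (Function.update p i q) =
      MvPolynomial.rename (emb m i) q * ∏ j ∈ Finset.univ.erase i, MvPolynomial.rename (emb m j) (p j) := by
  rw [blockPoly_apply, ← Finset.mul_prod_erase _ _ (Finset.mem_univ i), Function.update_self]
  congr 1
  exact Finset.prod_congr rfl fun j hj => by
    rw [Function.update_of_ne (Finset.ne_of_mem_erase hj)]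

theorem blockPoly_eq (p : ∀ i, MvPolynomial (Fin (m i)) F) (i : Fin n) : blockPoly F m p =
      MvPolynomial.rename (emb m i) (p i) * ∏ j ∈ Finset.univ.erase i, MvPolynomial.rename (emb m j) (p j) := by
  rw [← blockPoly_update, Function.update_eq_self]

theorem blockPoly_update_mul (p : ∀ i, MvPolynomial (Fin (m i)) F) (i : Fin n)
    (q : MvPolynomial (Fin (m i)) F) : blockPoly F m (Function.update p i (q * p i)) =
      MvPolynomial.rename (emb m i) q * blockPoly F m p := by
  rw [blockPoly_update, map_mul, mul_assoc, ← blockPoly_eq]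

theorem pderiv_blockPoly (p : ∀ i, MvPolynomial (Fin (m i)) F) (i : Fin n) (k : Fin (m i)) :
    MvPolynomial.pderiv (emb m i k) (blockPoly F m p) =
      blockPoly F m (Function.update p i (MvPolynomial.pderiv k (p i))) := by
  rw [blockPoly_update, blockPoly_eq p i, Derivation.leibniz, derivation_prod_eq_zero, smul_zero,
    zero_add, MvPolynomial.pderiv_rename (emb_injective m i), smul_eq_mul, mul_comm]
  intro j hj
  refine MvPolynomial.pderiv_eq_zero_of_notMem_vars fun h => ?_
  classical
  have h1 := MvPolynomial.vars_rename _ _ h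
  rw [Finset.mem_image] at h1
  obtain ⟨l, _, hl⟩ := h1
  have h2 := congrArg (block m) hl
  rw [block_emb, block_emb] at h2
  exact Finset.ne_of_mem_erase hj h2

theorem blockPoly_monomial (α : ∀ i, Fin (m i) →₀ ℕ) :
    blockPoly F m (fun i => MvPolynomial.monomial (α i) 1) =
      MvPolynomial.monomial (Finsupp.equivFunOnFinite.symm (glue α)) 1 := by
  rw [blockPoly_apply]
  simp only [MvPolynomial.rename_monomial]
  rw [← MvPolynomial.monomial_sum_one]
  congr 2
  ext k
  obtain ⟨j, l, rfl⟩ := exists_emb k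
  rw [Finsupp.finsetSum_apply, Finset.sum_eq_single j, Finsupp.mapDomain_apply (emb_injective m j)]
  · change α j l = (fun x : Σ i, Fin (m i) => α x.1 x.2) (finSigmaFinEquiv.symm (finSigmaFinEquiv ⟨j, l⟩))
    rw [Equiv.symm_apply_apply]
  · intro i _ hi
    refine Finsupp.mapDomain_of_notMem_range _ _ fun h => hi ?_
    obtain ⟨l', hl'⟩ := h
    have := congrArg (block m) hl'
    rwa [block_emb, block_emb] at this
  · simp

end Blocks

/-! ### Evaluation on the locus where each block collapses -/

section Evaluation

variable {F : Type u} [Field F] {V : Type v} [AddCommGroup V] [Module F V] {n : ℕ} {m : Fin n → ℕ}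

theorem evalV_tmul {N : ℕ} {W : Type*} [AddCommGroup W] [Module F W]
    (S : W →ₗ[F] Vn (0 : V →ₗ[F] V) N) (p : MvPolynomial (Fin N) F) (h : W) :
    evalV 0 S (p ⊗ₜ[F] h) = mulV 0 N p (S h) := rfl

/-- `evalV` as a linear map. -/
def evalLin (F : Type u) [Field F] (V : Type v) [AddCommGroup V] [Module F V] (N : ℕ)
    (W : Type*) [AddCommGroup W] [Module F W] :
    (W →ₗ[F] Vn (0 : V →ₗ[F] V) N) →ₗ[F] (MvPolynomial (Fin N) F ⊗[F] W →ₗ[F] Vn (0 : V →ₗ[F] V) N) where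
  toFun S := evalV 0 S
  map_add' S S' := TensorProduct.ext' fun p h => by
    rw [LinearMap.add_apply, evalV_tmul, evalV_tmul, evalV_tmul, LinearMap.add_apply, map_add]
  map_smul' c S := TensorProduct.ext' fun p h => by
    rw [RingHom.id_apply, LinearMap.smul_apply, evalV_tmul, evalV_tmul, LinearMap.smul_apply, map_smul]

/-- The functional `h ↦ φ(h|)` with `λ_i` replaced by the sum over the `i`-th block. -/
def restrSub (m : Fin n → ℕ) : (OT F n →ₗ[F] Vn (0 : V →ₗ[F] V) n) →ₗ[F]
    (invFun F (block m) →ₗ[F] Vn (0 : V →ₗ[F] V) (∑ i, m i)) :=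
  LinearMap.lcomp F _ (restrFun m).toLinearMap ∘ₗ LinearMap.compRight F (substV 0 (block m))

theorem restrSub_apply (φ : OT F n →ₗ[F] Vn (0 : V →ₗ[F] V) n) (h : invFun F (block m)) :
    restrSub m φ h = substV 0 (block m) (φ (restrFun m h)) := rfl

variable {φ : OT F n →ₗ[F] Vn (0 : V →ₗ[F] V) n}

theorem restrFun_zInv (k l : Fin (∑ i, m i)) :
    restrFun (F := F) m (zInv F (block m) k l) = zOT F (block m k) (block m l) :=
  renameInv_zInv _ k l

theorem diffV_restrSub (hφ : φ ∈ DMap F V n) (k l : Fin (∑ i, m i)) (h : invFun F (block m)) :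
    diffV 0 _ k l (restrSub m φ h) = restrSub m φ (zInv F (block m) k l * h) := by
  rw [restrSub_apply, restrSub_apply, diffV_substV, map_mul, restrFun_zInv, hφ.2]

theorem mulV_restrSub (hφ : φ ∈ DMap F V n) (i : Fin n) (h : invFun F (block m)) :
    mulV 0 _ (∑ k with block m k = i, MvPolynomial.X k) (restrSub m φ h) =
      restrSub m φ (dzS F (block m) (Finset.univ.filter fun k => block m k = i) h) := by
  have h1 : dz F id i (restrFun (F := F) m h) =
      restrFun m (dzS F (block m) (Finset.univ.filter fun k => block m k = i) h) :=
    dzD_renameInv (F := F) (π := block m) (π' := id) (θ := block m) (fun _ _ h => h) i h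
  rw [restrSub_apply, restrSub_apply, ← h1, hφ.1, substV_mulV, MvPolynomial.aeval_X]

theorem diffV_evalV (hφ : φ ∈ DMap F V n) (k l : Fin (∑ i, m i))
    (t : MvPolynomial (Fin (∑ i, m i)) F ⊗[F] invFun F (block m)) :
    diffV 0 _ k l (evalV 0 (restrSub m φ) t) = evalV 0 (restrSub m φ) (weylOp F m k l t) := by
  induction t with
  | zero => simp
  | tmul p h =>
    rw [weylOp_tmul, map_add, evalV_tmul, evalV_tmul, evalV_tmul, diffV_mulV, diffV_restrSub hφ]
  | add s t hs ht => simp only [map_add, hs, ht]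

/-- For two variables of the same block, `z_kl` vanishes where the block collapses to a point. -/
theorem evalV_zOp (hφ : φ ∈ DMap F V n) {k l : Fin (∑ i, m i)} (hkl : block m k = block m l)
    (t : MvPolynomial (Fin (∑ i, m i)) F ⊗[F] invFun F (block m)) :
    evalV 0 (restrSub m φ) (zOp F m k l t) = 0 := by
  induction t with
  | zero => simp
  | tmul p h =>
    rw [zOp_tmul, evalV_tmul, ← diffV_restrSub hφ, restrSub_apply, diffV_substV, hkl, diffV_self]
    simp
  | add s t hs ht => simp only [map_add, hs, ht, add_zero]

theorem evalV_chiralShift (k : Fin (∑ i, m i))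
    (t : MvPolynomial (Fin (∑ i, m i)) F ⊗[F] invFun F (block m)) :
    evalV 0 (restrSub m φ) (chiralShift m k t) =
      mulV 0 _ (MvPolynomial.X k) (evalV 0 (restrSub m φ) t) -
        evalV 0 (restrSub m φ) (derivOp F m k t) := by
  induction t with
  | zero => simp
  | tmul p h =>
    rw [chiralShift_tmul, derivOp_tmul, map_sub, evalV_tmul, evalV_tmul, evalV_tmul, mulV_mul]
  | add s t hs ht => simp only [map_add, hs, ht]; abel

/-- The derivatives in the variables of the `i`-th block add up, after restriction, to `∂/∂z_i`, and
`φ` turns this into `Λ_i`. So `∑ (λ_k - ∂/∂z_k)` over a block acts as zero, which is why only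
classes in `V_{m_i}` matter for the composition. -/
theorem sum_evalV_chiralShift (hφ : φ ∈ DMap F V n) (i : Fin n)
    (t : MvPolynomial (Fin (∑ i, m i)) F ⊗[F] invFun F (block m)) :
    ∑ k with block m k = i, evalV 0 (restrSub m φ) (chiralShift m k t) = 0 := by
  induction t with
  | zero => simp
  | tmul p h =>
    simp only [evalV_chiralShift, Finset.sum_sub_distrib, derivOp_tmul, evalV_tmul, ← mulV_mul,
      mul_comm _ p]
    have h1 := mulV_restrSub hφ i h
    rw [dzS_apply, map_sum, map_sum, LinearMap.sum_apply] at h1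
    simp only [mulV_mul, ← map_sum]
    rw [map_sum (restrSub m φ), ← h1, map_sum, sub_self]
  | add s t hs ht => simp only [map_add, Finset.sum_add_distrib, hs, ht, add_zero]

end Evaluation

/-! ### Inserting polynomials into the arguments -/

section SlotMap

variable {F : Type u} [Field F] {V : Type v} [AddCommGroup V] [Module F V] {n : ℕ} {m : Fin n → ℕ}

/-- Applying a linear map to one of the arguments. -/
theorem update_eq_apply {ι : Type*} [DecidableEq ι] {A : ι → Type*} [∀ i, AddCommGroup (A i)]
    [∀ i, Module F (A i)] (i : ι) (D : A i →ₗ[F] A i) (P : ∀ i, A i) :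
    Function.update P i (D (P i)) =
      fun j => Function.update (fun j => (LinearMap.id : A j →ₗ[F] A j)) i D j (P j) := by
  funext j
  by_cases h : j = i
  · subst h; simp
  · simp [h]

theorem slot_ext {A : Fin n → Type w} [∀ i, AddCommGroup (A i)] [∀ i, Module F (A i)]
    {W : Type w'} [AddCommGroup W] [Module F W] {T T' : MultilinearMap F (fun i => A i ⊗[F] V) W}
    (i : Fin n) (D : A i →ₗ[F] A i)
    (h : ∀ (p : ∀ i, A i) (v : Fin n → V), T (fun j => Function.update p i (D (p i)) j ⊗ₜ[F] v j) =
      T' (fun j => p j ⊗ₜ[F] v j)) (P : ∀ i, A i ⊗[F] V) :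
    T (Function.update P i (LinearMap.rTensor V D (P i))) = T' P := by
  have key : T.compLinearMap (fun j => Function.update
      (fun j => (LinearMap.id : A j ⊗[F] V →ₗ[F] A j ⊗[F] V)) i (LinearMap.rTensor V D) j) = T' := by
    refine multilinear_ext_tmul fun p v => ?_
    rw [← h p v, MultilinearMap.compLinearMap_apply]
    congr 1
    rw [← update_eq_apply (F := F) i (LinearMap.rTensor V D) (fun j => p j ⊗ₜ[F] v j)]
    funext j
    by_cases hj : j = i
    · subst hj; simp
    · simp [hj]
  rw [← key, MultilinearMap.compLinearMap_apply, ← update_eq_apply (F := F)]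

variable (X : MultilinearMap F (fun _ : Fin n => V) (OT F n →ₗ[F] Vn (0 : V →ₗ[F] V) n))

theorem exists_slotMap (m : Fin n → ℕ) :
    ∃ T : MultilinearMap F (fun i => MvPolynomial (Fin (m i)) F ⊗[F] V)
      (invFun F (block m) →ₗ[F] Vn (0 : V →ₗ[F] V) (∑ i, m i)),
    ∀ (p : ∀ i, MvPolynomial (Fin (m i)) F) (v : Fin n → V) h, T (fun i => p i ⊗ₜ[F] v i) h =
      evalV 0 (restrSub m (X v)) (shiftOp F m (blockPoly F m p) (1 ⊗ₜ[F] h)) := by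
  let L : MvPolynomial (Fin (∑ i, m i)) F →ₗ[F] MultilinearMap F (fun _ : Fin n => V)
      (invFun F (block m) →ₗ[F] Vn (0 : V →ₗ[F] V) (∑ i, m i)) :=
    { toFun := fun p => (LinearMap.lcomp F _ (shiftOp F m p ∘ₗ
          TensorProduct.mk F (MvPolynomial (Fin (∑ i, m i)) F) (invFun F (block m)) 1) ∘ₗ
        evalLin F V _ _ ∘ₗ restrSub m).compMultilinearMap X
      map_add' := fun p q => by
        ext v h
        simp
      map_smul' := fun c p => by
        ext v h
        simp }
  obtain ⟨T, hT⟩ := exists_multilinear_tmul (L.compMultilinearMap (blockPoly F m))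
  exact ⟨T, fun p v h => by rw [hT]; rfl⟩

/-- The composition of `X` with polynomials in its arguments. -/
def slotMap (m : Fin n → ℕ) : MultilinearMap F (fun i => MvPolynomial (Fin (m i)) F ⊗[F] V)
    (invFun F (block m) →ₗ[F] Vn (0 : V →ₗ[F] V) (∑ i, m i)) := (exists_slotMap X m).choose

theorem slotMap_tmul (p : ∀ i, MvPolynomial (Fin (m i)) F) (v : Fin n → V)
    (h : invFun F (block m)) : slotMap X m (fun i => p i ⊗ₜ[F] v i) h =
      evalV 0 (restrSub m (X v)) (shiftOp F m (blockPoly F m p) (1 ⊗ₜ[F] h)) :=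
  (exists_slotMap X m).choose_spec p v h

theorem slotMap_polyV (a : ∀ i, (Fin (m i) →₀ ℕ) →₀ V) (h : invFun F (block m)) :
    slotMap X m (fun i => polyV (a i)) h = ∑ α ∈ Fintype.piFinset (fun i => (a i).support),
      evalV 0 (substV 0 (block m) ∘ₗ X (fun i => a i (α i)) ∘ₗ (restrFun m).toLinearMap)
        (chiralShiftPow m (glue α) (1 ⊗ₜ[F] h)) := by
  simp only [polyV, Finsupp.sum]
  rw [MultilinearMap.map_sum_finset, LinearMap.sum_apply]
  refine Finset.sum_congr rfl fun α _ => ?_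
  rw [slotMap_tmul, blockPoly_monomial, shiftOp_monomial]
  rfl

variable {X} (hX : ∀ v, X v ∈ DMap F V n)
include hX

/-- Differentiating the polynomial in a slot is the commutator of `p(λ - ∂_z)` with a `z_kl` inside
the block; the other term of the commutator restricts to zero. Hence `z_kl` may be moved between
`g_i` and `h`. -/
theorem slotMap_diff (i : Fin n) (k l : Fin (m i)) (P : ∀ i, MvPolynomial (Fin (m i)) F ⊗[F] V)
    (h : invFun F (block m)) :
    slotMap X m (Function.update P i (LinearMap.rTensor V ((MvPolynomial.pderiv l).toLinearMap -
      (MvPolynomial.pderiv k).toLinearMap) (P i))) h =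
    slotMap X m P (zInv F (block m) (emb m i k) (emb m i l) * h) := by
  have := slot_ext (T := slotMap X m) (T' := (LinearMap.lcomp F _ (LinearMap.mulLeft F
    (zInv F (block m) (emb m i k) (emb m i l)))).compMultilinearMap (slotMap X m)) i
      ((MvPolynomial.pderiv l).toLinearMap - (MvPolynomial.pderiv k).toLinearMap) (fun p v => ?_) P
  · rw [this]; rfl
  · ext h
    change _ = slotMap X m (fun j => p j ⊗ₜ[F] v j) (zInv F (block m) (emb m i k) (emb m i l) * h)
    rw [slotMap_tmul, slotMap_tmul, ← zOp_tmul, shiftOp_zOp, map_add, evalV_zOp (hX v) (by simp),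
      zero_add, pderiv_blockPoly, pderiv_blockPoly, ← MultilinearMap.map_update_sub]
    rfl

/-- The operator `weylOp` commutes with every `p(λ - ∂_z)`, and on `1 ⊗ h` it is just multiplication
by `z_kl`. -/
theorem diffV_slotMap (k l : Fin (∑ i, m i)) (P : ∀ i, MvPolynomial (Fin (m i)) F ⊗[F] V)
    (h : invFun F (block m)) :
    slotMap X m P (zInv F (block m) k l * h) = diffV 0 _ k l (slotMap X m P h) := by
  have : (LinearMap.lcomp F _ (LinearMap.mulLeft F (zInv F (block m) k l))).compMultilinearMap
      (slotMap X m) = (LinearMap.compRight F (diffV 0 _ k l)).compMultilinearMap (slotMap X m) := by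
    refine multilinear_ext_tmul fun p v => ?_
    ext h
    change slotMap X m _ (zInv F (block m) k l * h) = diffV 0 _ k l (slotMap X m _ h)
    rw [slotMap_tmul, slotMap_tmul, diffV_evalV (hX v), ← Module.End.mul_apply,
      (commute_shiftOp (fun j => weylOp_commute j k l) _).eq, Module.End.mul_apply, weylOp_tmul]
    simp
  exact LinearMap.congr_fun (DFunLike.congr_fun this P) h

omit hX in
theorem slotMap_mul (i : Fin n) (k : Fin (m i)) (P : ∀ i, MvPolynomial (Fin (m i)) F ⊗[F] V)
    (h : invFun F (block m)) :
    slotMap X m (Function.update P i (LinearMap.rTensor V (LinearMap.mulLeft F (MvPolynomial.X k))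
      (P i))) h = mulV 0 _ (MvPolynomial.X (emb m i k)) (slotMap X m P h) -
        slotMap X m P (dz F (block m) (emb m i k) h) := by
  have := slot_ext (T := slotMap X m) (T' := (LinearMap.compRight F
    (mulV 0 _ (MvPolynomial.X (emb m i k)))).compMultilinearMap (slotMap X m) -
      (LinearMap.lcomp F _ (dz F (block m) (emb m i k))).compMultilinearMap (slotMap X m)) i
      (LinearMap.mulLeft F (MvPolynomial.X k)) (fun p v => ?_) P
  · rw [this]; rfl
  · ext h
    change _ = mulV 0 _ (MvPolynomial.X (emb m i k)) (slotMap X m (fun j => p j ⊗ₜ[F] v j) h) -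
      slotMap X m (fun j => p j ⊗ₜ[F] v j) (dz F (block m) (emb m i k) h)
    rw [slotMap_tmul, slotMap_tmul, slotMap_tmul, LinearMap.mulLeft_apply, blockPoly_update_mul,
      MvPolynomial.rename_X, shiftOp_X_mul, Module.End.mul_apply, evalV_chiralShift,
      ← Module.End.mul_apply, (commute_shiftOp (fun j => derivOp_commute _ j) _).eq,
      Module.End.mul_apply, derivOp_tmul]

theorem slotMap_sum_X (i : Fin n) (P : ∀ i, MvPolynomial (Fin (m i)) F ⊗[F] V)
    (h : invFun F (block m)) :
    slotMap X m (Function.update P i (LinearMap.rTensor V (LinearMap.mulLeft F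
      (∑ k, MvPolynomial.X k)) (P i))) h = 0 := by
  have := slot_ext (T := slotMap X m) (T' := 0) i
      (LinearMap.mulLeft F (∑ k, MvPolynomial.X k)) (fun p v => ?_) P
  · rw [this]; rfl
  · ext h
    rw [slotMap_tmul, LinearMap.mulLeft_apply, blockPoly_update_mul, map_sum, Finset.sum_mul, map_sum,
      LinearMap.sum_apply, map_sum]
    simp only [MvPolynomial.rename_X, shiftOp_X_mul, Module.End.mul_apply]
    rw [← sum_block i fun k => evalV 0 (restrSub m (X v))
      (chiralShift m k (shiftOp F m (blockPoly F m p) (1 ⊗ₜ[F] h))), sum_evalV_chiralShift (hX v)]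
    rfl

/-- The composition of `X` with elements of the spaces `V_{m_i}`. -/
theorem exists_compMap (m : Fin n → ℕ) :
    ∃ Q : MultilinearMap F (fun i => Vn (0 : V →ₗ[F] V) (m i))
      (invFun F (block m) →ₗ[F] Vn (0 : V →ₗ[F] V) (∑ i, m i)),
    ∀ P, Q (fun i => mkV 0 (m i) (P i)) = slotMap X m P := by
  -- Any linear sections of the quotient maps will do: `slotMap` kills the multiples of `∑ λ_k` in
  -- every slot.
  have hs : ∀ i, ∃ s : Vn (0 : V →ₗ[F] V) (m i) →ₗ[F] MvPolynomial (Fin (m i)) F ⊗[F] V,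
      mkV 0 (m i) ∘ₗ s = LinearMap.id := fun i =>
    LinearMap.exists_rightInverse_of_surjective _ (LinearMap.range_eq_top.2 (mkV_surjective 0 (m i)))
  choose s hs using hs
  refine ⟨(slotMap X m).compLinearMap s, fun P => ?_⟩
  rw [MultilinearMap.compLinearMap_apply]
  refine multilinear_congr _ fun i z => ?_
  have h1 : s i (mkV 0 (m i) (P i)) - P i ∈ LinearMap.range (totalOp (0 : V →ₗ[F] V) (m i)) := by
    rw [← Submodule.Quotient.mk_eq_zero]
    change mkV 0 (m i) _ = 0
    rw [map_sub, sub_eq_zero]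
    exact LinearMap.congr_fun (hs i) _
  obtain ⟨t, ht⟩ := h1
  rw [← ht, totalOp_zero]
  ext h
  have h2 := slotMap_sum_X hX i (Function.update z i t) h
  rw [Function.update_self, Function.update_idem] at h2
  rw [h2]; rfl

end SlotMap

end VertexOperad

end

noncomputable section

namespace VertexOperad

universe u v

/-! ### Composition with elements of the quotients `V_{m_i}` -/

section CompMap

variable {F : Type u} [Field F] {V : Type v} [AddCommGroup V] [Module F V] {n : ℕ} {m : Fin n → ℕ}
  {X : MultilinearMap F (fun _ : Fin n => V) (OT F n →ₗ[F] Vn (0 : V →ₗ[F] V) n)}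
  (hX : ∀ v, X v ∈ DMap F V n)

/-- The composition of a chiral operation `X` with elements of the spaces `V_{m_i}`. -/
def compMap (m : Fin n → ℕ) : MultilinearMap F (fun i => Vn (0 : V →ₗ[F] V) (m i))
    (invFun F (block m) →ₗ[F] Vn (0 : V →ₗ[F] V) (∑ i, m i)) := (exists_compMap hX m).choose

theorem compMap_mkV (P : ∀ i, MvPolynomial (Fin (m i)) F ⊗[F] V) :
    compMap hX m (fun i => mkV 0 (m i) (P i)) = slotMap X m P := (exists_compMap hX m).choose_spec P

theorem exists_mkV_eq (y : ∀ i, Vn (0 : V →ₗ[F] V) (m i)) :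
    ∃ P : ∀ i, MvPolynomial (Fin (m i)) F ⊗[F] V, y = fun i => mkV 0 (m i) (P i) := by
  choose P hP using fun i => mkV_surjective (0 : V →ₗ[F] V) (m i) (y i)
  exact ⟨P, funext fun i => (hP i).symm⟩

theorem update_mkV (P : ∀ i, MvPolynomial (Fin (m i)) F ⊗[F] V) (i : Fin n)
    (t : MvPolynomial (Fin (m i)) F ⊗[F] V) :
    Function.update (fun i => mkV (0 : V →ₗ[F] V) (m i) (P i)) i (mkV 0 (m i) t) =
      fun j => mkV 0 (m j) (Function.update P i t j) := by
  funext j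
  by_cases h : j = i
  · subst h; simp
  · simp [h]

theorem compMap_diff (i : Fin n) (k l : Fin (m i)) (y : ∀ i, Vn (0 : V →ₗ[F] V) (m i))
    (h : invFun F (block m)) : compMap hX m (Function.update y i (diffV 0 (m i) k l (y i))) h =
      compMap hX m y (zInv F (block m) (emb m i k) (emb m i l) * h) := by
  obtain ⟨P, rfl⟩ := exists_mkV_eq y
  rw [compMap_mkV, ← slotMap_diff hX, ← compMap_mkV hX, ← update_mkV]
  rfl

theorem diffV_compMap (k l : Fin (∑ i, m i)) (y : ∀ i, Vn (0 : V →ₗ[F] V) (m i))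
    (h : invFun F (block m)) : compMap hX m y (zInv F (block m) k l * h) =
      diffV 0 _ k l (compMap hX m y h) := by
  obtain ⟨P, rfl⟩ := exists_mkV_eq y
  rw [compMap_mkV, diffV_slotMap hX]

theorem compMap_mul (i : Fin n) (k : Fin (m i)) (y : ∀ i, Vn (0 : V →ₗ[F] V) (m i))
    (h : invFun F (block m)) :
    compMap hX m (Function.update y i (mulV 0 (m i) (MvPolynomial.X k) (y i))) h =
      mulV 0 _ (MvPolynomial.X (emb m i k)) (compMap hX m y h) -
        compMap hX m y (dz F (block m) (emb m i k) h) := by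
  obtain ⟨P, rfl⟩ := exists_mkV_eq y
  rw [compMap_mkV, ← slotMap_mul, ← compMap_mkV hX, ← update_mkV]
  rfl

/-- A constant contains no `λ_k`, so no derivative acts on `h`. For trees, where all values are
constants, this is the whole composition. -/
theorem compMap_constV (x : Fin n → V) (h : invFun F (block m)) :
    compMap hX m (fun i => constV (m i) (x i)) h = substV 0 (block m) (X x (restrFun m h)) := by
  simp only [constV_apply]
  rw [compMap_mkV hX (fun i => (1 : MvPolynomial (Fin (m i)) F) ⊗ₜ[F] x i), slotMap_tmul]
  have : blockPoly F m (fun i => (1 : MvPolynomial (Fin (m i)) F)) = 1 := by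
    simp [blockPoly_apply]
  rw [this, shiftOp_one, Module.End.one_apply, evalV_tmul, mulV_one]
  rfl

/-- Sums of derivatives of the variables of whole blocks act on the values. -/
theorem mulV_compMap (I : Finset (Fin n)) (y : ∀ i, Vn (0 : V →ₗ[F] V) (m i))
    (h : invFun F (block m)) :
    mulV 0 _ (∑ k with block m k ∈ I, MvPolynomial.X k) (compMap hX m y h) =
      compMap hX m y (dzS F (block m) (Finset.univ.filter fun k => block m k ∈ I) h) := by
  have h1 : ∀ i, mulV 0 _ (∑ k with block m k = i, MvPolynomial.X k) (compMap hX m y h) =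
      compMap hX m y (dzS F (block m) (Finset.univ.filter fun k => block m k = i) h) := by
    intro i
    rw [dzS_apply, sum_block, sum_block, map_sum, map_sum, LinearMap.sum_apply, ← sub_eq_zero,
      ← Finset.sum_sub_distrib]
    simp only [← compMap_mul]
    rw [← LinearMap.sum_apply, ← MultilinearMap.map_update_sum, ← LinearMap.sum_apply, ← map_sum,
      mulV_sum_X, MultilinearMap.map_update_zero]
    rfl
  have h2 : ∀ {M : Type _} [AddCommMonoid M] (f : Fin (∑ i, m i) → M),
      ∑ k with block m k ∈ I, f k = ∑ i ∈ I, ∑ k with block m k = i, f k := by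
    intro M _ f
    rw [Finset.sum_fiberwise_eq_sum_filter]
  rw [dzS_apply, h2, h2, map_sum, map_sum, LinearMap.sum_apply]
  refine Finset.sum_congr rfl fun i _ => ?_
  rw [h1, dzS_apply]

theorem sum_filter_mem_block_ne {I : Finset (Fin n)} (hm : ∀ i, 0 < m i) (h1 : I.Nonempty)
    (h2 : I ≠ Finset.univ) : (Finset.univ.filter fun k => block m k ∈ I).Nonempty ∧
      (Finset.univ.filter fun k => block m k ∈ I) ≠ Finset.univ := by
  constructor
  · obtain ⟨i, hi⟩ := h1
    exact ⟨emb m i ⟨0, hm i⟩, by simpa using hi⟩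
  · intro h
    refine h2 (Finset.eq_univ_of_forall fun i => ?_)
    have := Finset.mem_univ (emb m i ⟨0, hm i⟩)
    rw [← h] at this
    simpa using this

/-- The argument for disconnected graphs, with a set of blocks in place of a set of vertices. Blocks
are non-empty, so the union of the blocks in `I` is again proper and non-empty. -/
theorem compMap_poles_eq_zero (hm : ∀ i, 0 < m i) {E : Multiset (InterEdge m)} {I : Finset (Fin n)}
    (h1 : I.Nonempty) (h2 : I ≠ Finset.univ) (hE : ClosedIn (collapse E) I)
    (y : ∀ i, Vn (0 : V →ₗ[F] V) (m i)) : compMap hX m y (polesFun F (block m) E) = 0 := by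
  obtain ⟨h3, h4⟩ := sum_filter_mem_block_ne hm h1 h2
  refine eq_zero_of_mulV_sum h3 h4 ?_
  rw [mulV_compMap, derivation_polesFun_eq_zero, map_zero]
  intro e he
  have h5 := hE _ (Multiset.mem_map_of_mem _ he)
  rw [dzS_zInv]
  simp only [Finset.mem_filter, Finset.mem_univ, true_and]
  by_cases h6 : block m e.1.1 ∈ I
  · rw [if_pos h6, if_pos (h5.1 h6), sub_self]
  · rw [if_neg h6, if_neg fun h => h6 (h5.2 h), sub_self]

/-- Compositions with an operation without arguments vanish. -/
theorem compMap_eq_zero_of_empty (hn : 1 < n) {i : Fin n} (hi : m i = 0)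
    (y : ∀ i, Vn (0 : V →ₗ[F] V) (m i)) : compMap hX m y = 0 := by
  have h0 : ∀ (v : Fin n → V) (h : invFun F (block m)), X v (restrFun m h) = 0 := by
    intro v h
    -- A restricted function does not involve `z_i` when the `i`-th block is empty, so `λ_i` kills
    -- the value of `X`; the set `{i}` is proper because `n > 1`.
    refine eq_zero_of_mulV_sum (S := {i}) ⟨i, by simp⟩ (fun h => ?_) ?_
    · have := congrArg Finset.card h
      rw [Finset.card_singleton, Finset.card_univ, Fintype.card_fin] at this
      omega
    · rw [Finset.sum_singleton, ← (hX v).1]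
      have h1 : dz F id i (restrFun (F := F) m h) =
          restrFun m (dzS F (block m) (Finset.univ.filter fun k => block m k = i) h) :=
        dzD_renameInv (F := F) (π := block m) (π' := id) (θ := block m) (fun _ _ h => h) i h
      have h2 : (Finset.univ.filter fun k => block m k = i) = ∅ := by
        rw [filter_block, Finset.map_eq_empty, Finset.univ_eq_empty_iff, hi]
        infer_instance
      rw [h1, h2, dzS_apply, Finset.sum_empty, map_zero, map_zero]
  have h1 : ∀ v, restrSub m (X v) = 0 := by
    intro v; ext h
    rw [restrSub_apply, h0, map_zero]; rfl
  obtain ⟨P, rfl⟩ := exists_mkV_eq y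
  rw [compMap_mkV]
  have : slotMap X m = 0 := multilinear_ext_tmul fun p v => by
    ext h
    rw [slotMap_tmul, h1]
    have := (evalLin F V (∑ i, m i) (invFun F (block m))).map_zero
    exact LinearMap.congr_fun this _
  rw [this]; rfl

end CompMap

/-! ### Functions as products of functions of the blocks and regular functions -/

section Lift

variable {F : Type u} [Field F] {n : ℕ} {m : Fin n → ℕ}

/-- The product of the functions of graphs on the blocks. -/
def blockGraphFun (F : Type u) [Field F] {n : ℕ} {m : Fin n → ℕ} (G : ∀ i, NGraph (m i)) :
    OT F (∑ i, m i) := ∏ i, blockFun m i (graphFun F (G i))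

/-- The product of the functions `z_{kl}` over the edges of graphs on the blocks. -/
def blockGraphDen (F : Type u) [Field F] {n : ℕ} {m : Fin n → ℕ} (G : ∀ i, NGraph (m i)) :
    invFun F (block m) :=
  ∏ i, ((G i).map fun e => zInv F (block m) (emb m i e.1.1) (emb m i e.1.2)).prod

theorem regFun_zInv (k l : Fin (∑ i, m i)) :
    regFun m (zInv F (block m) k l) = zOT F k l := renameInv_zInv _ k l

theorem blockFun_zOT (i : Fin n) (k l : Fin (m i)) :
    blockFun m i (zOT F k l) = zOT F (emb m i k) (emb m i l) := renameInv_zInv _ k l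

theorem blockGraphFun_mul_den (G : ∀ i, NGraph (m i)) :
    blockGraphFun F G * regFun m (blockGraphDen F G) = 1 := by
  rw [blockGraphFun, blockGraphDen, map_prod, ← Finset.prod_mul_distrib]
  refine Finset.prod_eq_one fun i _ => ?_
  rw [map_multiset_prod, Multiset.map_map, graphFun, map_multiset_prod, Multiset.map_map,
    ← Multiset.prod_map_mul]
  refine Multiset.prod_eq_one fun f hf => ?_
  obtain ⟨e, _, rfl⟩ := Multiset.mem_map.1 hf
  simp only [Function.comp_apply]
  rw [regFun_zInv, ← blockFun_zOT, ← map_mul, mul_comm]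
  have := zInv_mul_poleFun F (π := id) e
  change zOT F e.1.1 e.1.2 * edgeFun F e = 1 at this
  rw [this, map_one]

theorem blockGraphFun_add (G G' : ∀ i, NGraph (m i)) :
    blockGraphFun F (G + G') = blockGraphFun F G * blockGraphFun F G' := by
  simp only [blockGraphFun, Pi.add_apply, graphFun_add, map_mul, Finset.prod_mul_distrib]

theorem regFun_injective : Function.Injective (regFun (F := F) m) :=
  renameInv_injective _ Function.injective_id

/-- Every function is a product of a function `p_G` for graphs on the blocks and a function without
poles inside the blocks. -/
theorem exists_eq_blockGraphFun_mul (f : OT F (∑ i, m i)) :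
    ∃ (G : ∀ i, NGraph (m i)) (h : invFun F (block m)), f = blockGraphFun F G * regFun m h := by
  classical
  let T : Submodule F (OT F (∑ i, m i)) :=
    { carrier := {f | ∃ (G : ∀ i, NGraph (m i)) (h : invFun F (block m)),
        f = blockGraphFun F G * regFun m h}
      add_mem' := by
        rintro _ _ ⟨G, h, rfl⟩ ⟨G', h', rfl⟩
        -- Addition of fractions with a common denominator.
        refine ⟨G + G', blockGraphDen F G' * h + blockGraphDen F G * h', ?_⟩
        have h1 := blockGraphFun_mul_den (F := F) G
        have h2 := blockGraphFun_mul_den (F := F) G'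
        rw [blockGraphFun_add, map_add, map_mul, map_mul]
        linear_combination (-blockGraphFun F G * regFun m h) * h2 -
          (blockGraphFun F G' * regFun m h') * h1
      zero_mem' := ⟨0, 0, by simp⟩
      smul_mem' := by
        rintro c _ ⟨G, h, rfl⟩
        exact ⟨G, c • h, by rw [map_smul, mul_smul_comm]⟩ }
  have hT : T = ⊤ := by
    refine eq_top_of_mul_zInv F (π := id) T ?_ fun E => ?_
    · rintro k l _ ⟨G, h, rfl⟩
      refine ⟨G, zInv F (block m) k l * h, ?_⟩
      rw [map_mul, regFun_zInv, ← zOT_eq_zInv]; ring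
    · induction E using Multiset.induction_on with
      | empty => exact ⟨0, 1, by simp [blockGraphFun, graphFun]⟩
      | cons e E ih =>
        obtain ⟨G, h, hf⟩ := ih
        rw [polesFun_cons, hf]
        by_cases hb : block m e.1.1 = block m e.1.2
        · obtain ⟨⟨k, l⟩, hkl⟩ := e
          obtain ⟨i, k, rfl⟩ := exists_emb k
          obtain ⟨j, l, rfl⟩ := exists_emb l
          simp only [block_emb] at hb
          subst hb
          have hkl' : k ≠ l := fun h => hkl (by simp [h])
          refine ⟨Function.update G i (G i + edg k l), h, ?_⟩
          have h1 : blockGraphFun F (Function.update G i (G i + edg k l)) =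
              blockFun m i (graphFun F (edg k l)) * blockGraphFun F G := by
            rw [blockGraphFun, blockGraphFun, ← Finset.mul_prod_erase _ _ (Finset.mem_univ i),
              ← Finset.mul_prod_erase (a := i) _ _ (Finset.mem_univ i), Function.update_self,
              graphFun_add, map_mul, ← mul_assoc, mul_comm (blockFun m i (graphFun F (G i)))]
            congr 1
            exact Finset.prod_congr rfl fun j hj => by
              rw [Function.update_of_ne (Finset.ne_of_mem_erase hj)]
          have h2 : poleFun F id ⟨(emb m i k, emb m i l), hkl⟩ = blockFun m i (graphFun F (edg k l)) := by
            refine (poleFun_unique F (π := id) ?_).symm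
            change zOT F (emb m i k) (emb m i l) * _ = 1
            rw [← blockFun_zOT, ← map_mul, zOT_mul_graphFun_edg hkl', map_one]
          rw [h1, h2]; ring
        · refine ⟨G, poleFun F (block m) ⟨e.1, hb⟩ * h, ?_⟩
          have h1 : regFun m (poleFun F (block m) ⟨e.1, hb⟩) = poleFun F id e :=
            renameInv_poleFun _ _
          rw [map_mul, h1]; ring
  have hf : f ∈ T := hT ▸ Submodule.mem_top
  exact hf

variable {W : Type*} [AddCommGroup W] [Module F W]

/-- Linear maps can be defined by their values on the products of functions of graphs on the blocks
and of functions without poles inside the blocks. -/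
theorem exists_lift_blockGraphFun (U : (∀ i, NGraph (m i)) → invFun F (block m) →ₗ[F] W)
    (hU : ∀ (G : ∀ i, NGraph (m i)) (i : Fin n) (e : Edge (m i)) (h : invFun F (block m)),
      U (Function.update G i (e ::ₘ G i)) (zInv F (block m) (emb m i e.1.1) (emb m i e.1.2) * h) =
        U G h) :
    ∃ T : OT F (∑ i, m i) →ₗ[F] W, ∀ G h, T (blockGraphFun F G * regFun m h) = U G h := by
  classical
  -- Expanding the fraction by `G'` does not change the value: the hypothesis is applied edge by
  -- edge within a block, and then block by block.
  have hU' : ∀ (G' G : ∀ i, NGraph (m i)) h, U (G + G') (blockGraphDen F G' * h) = U G h := by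
    intro G'
    have key : ∀ (s : Finset (Fin n)) (G : ∀ i, NGraph (m i)) h,
        U (G + fun i => if i ∈ s then G' i else 0) ((∏ i ∈ s,
          ((G' i).map fun e => zInv F (block m) (emb m i e.1.1) (emb m i e.1.2)).prod) * h) =
          U G h := by
      intro s
      induction s using Finset.induction_on with
      | empty =>
        intro G h
        have : (G + fun i => if i ∈ (∅ : Finset (Fin n)) then G' i else 0) = G := by
          funext i; simp
        rw [this]; simp
      | insert a s ha ih =>
        intro G h
        have one : ∀ (Γ : NGraph (m a)) (G : ∀ i, NGraph (m i)) h,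
            U (Function.update G a (Γ + G a)) ((Γ.map fun e => zInv F (block m) (emb m a e.1.1)
              (emb m a e.1.2)).prod * h) = U G h := by
          intro Γ
          induction Γ using Multiset.induction_on with
          | empty => intro G h; simp
          | cons e Γ ihΓ =>
            intro G h
            have h1 := hU (Function.update G a (Γ + G a)) a e ((Γ.map fun e =>
              zInv F (block m) (emb m a e.1.1) (emb m a e.1.2)).prod * h)
            rw [Function.update_self, Function.update_idem, ihΓ, ← Multiset.cons_add] at h1
            rw [Multiset.map_cons, Multiset.prod_cons, mul_assoc, h1]
        have h2 := one (G' a) (G + fun i => if i ∈ s then G' i else 0) ((∏ i ∈ s,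
          ((G' i).map fun e => zInv F (block m) (emb m i e.1.1) (emb m i e.1.2)).prod) * h)
        rw [Finset.prod_insert ha, mul_assoc, ← ih G h, ← h2]
        congr 2
        funext i
        by_cases hi : i = a
        · subst hi; simp [ha, add_comm]
        · simp [hi]
    intro G h
    have := key Finset.univ G h
    simpa [blockGraphDen] using this
  -- Cross-multiplication, valid because regular functions embed into all functions, reduces two
  -- representations to one.
  have hwd : ∀ G h G' h', blockGraphFun F G * regFun m h = blockGraphFun F G' * regFun m h' →
      U G h = U G' h' := by
    intro G h G' h' he
    have h1 := blockGraphFun_mul_den (F := F) G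
    have h2 := blockGraphFun_mul_den (F := F) G'
    have h3 : blockGraphDen F G' * h = blockGraphDen F G * h' := by
      apply regFun_injective
      rw [map_mul, map_mul]
      linear_combination (-regFun m (blockGraphDen F G') * regFun m h) * h1 +
        (regFun m (blockGraphDen F G) * regFun m (blockGraphDen F G')) * he +
        (regFun m (blockGraphDen F G) * regFun m h') * h2
    rw [← hU' G' G h, ← hU' G G' h', h3, add_comm]
  choose G h hf using exists_eq_blockGraphFun_mul (F := F) (m := m)
  refine ⟨{ toFun := fun f => U (G f) (h f), map_add' := fun f g => ?_, map_smul' := fun c f => ?_ },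
    fun G' h' => hwd _ _ _ _ (hf _).symm⟩
  · rw [← hU' (G g) (G f), ← hU' (G f) (G g), add_comm (G g), ← map_add]
    apply hwd
    rw [← hf, map_add, map_mul, map_mul, blockGraphFun_add]
    have h1 := blockGraphFun_mul_den (F := F) (G f)
    have h2 := blockGraphFun_mul_den (F := F) (G g)
    linear_combination hf f + hf g - (blockGraphFun F (G f) * regFun m (h f)) * h2 -
      (blockGraphFun F (G g) * regFun m (h g)) * h1
  · rw [RingHom.id_apply, ← map_smul]
    apply hwd
    rw [← hf, map_smul, mul_smul_comm, ← hf]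

end Lift

end VertexOperad

end

noncomputable section

namespace VertexOperad

universe u v

/-! ### Existence of the compositions of chiral operations -/

section ChiralComp

variable {F : Type u} [Field F] {V : Type v} [AddCommGroup V] [Module F V] {n : ℕ} {m : Fin n → ℕ}

theorem dzD_blockFun_self (a : Fin n) (k : Fin (m a)) (f : OT F (m a)) :
    dzD F id (emb m a k) (blockFun m a f) = blockFun m a (dz F id k f) := by
  refine (dzD_renameInv (F := F) (π := id) (π' := id) (θ := emb m a)
    (fun _ _ h h' => h (emb_injective m a h')) _ f).trans ?_
  have : (Finset.univ.filter fun l => emb m a l = emb m a k) = {k} := by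
    ext l; simp [(emb_injective m a).eq_iff]
  rw [this, dzS_apply, Finset.sum_singleton]
  rfl

theorem dzD_blockFun_of_ne {a j : Fin n} (h : j ≠ a) (k : Fin (m a)) (f : OT F (m j)) :
    dzD F id (emb m a k) (blockFun m j f) = 0 := by
  refine (dzD_renameInv (F := F) (π := id) (π' := id) (θ := emb m j)
    (fun _ _ h h' => h (emb_injective m j h')) _ f).trans ?_
  have : (Finset.univ.filter fun l => emb m j l = emb m a k) = ∅ := by
    ext l
    simp only [Finset.mem_filter, Finset.mem_univ, true_and, Finset.notMem_empty, iff_false]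
    intro h'
    have := congrArg (block m) h'
    rw [block_emb, block_emb] at this
    exact h this
  rw [this, dzS_apply, Finset.sum_empty, map_zero]

theorem dzD_regFun (k : Fin (∑ i, m i)) (h : invFun F (block m)) :
    dzD F id k (regFun m h) = regFun m (dz F (block m) k h) := by
  refine (dzD_renameInv (F := F) (π := block m) (π' := id) (θ := id)
    (fun _ _ h h' => h (congrArg (block m) h')) _ h).trans ?_
  have : (Finset.univ.filter fun l : Fin (∑ i, m i) => id l = k) = {k} := by
    ext l; simp
  rw [this, dzS_apply, Finset.sum_singleton]
  rfl

theorem prod_blockFun_update (g : ∀ i, OT F (m i)) (a : Fin n) (u : OT F (m a)) :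
    ∏ i, blockFun m i (Function.update g a u i) =
      blockFun m a u * ∏ i ∈ Finset.univ.erase a, blockFun m i (g i) := by
  rw [← Finset.mul_prod_erase _ _ (Finset.mem_univ a), Function.update_self]
  congr 1
  exact Finset.prod_congr rfl fun i hi => by
    rw [Function.update_of_ne (Finset.ne_of_mem_erase hi)]

theorem dzD_prod_blockFun (g : ∀ i, OT F (m i)) (a : Fin n) (k : Fin (m a)) :
    dzD F id (emb m a k) (∏ i, blockFun m i (g i)) =
      ∏ i, blockFun m i (Function.update g a (dz F id k (g a)) i) := by
  rw [prod_blockFun_update, ← Finset.mul_prod_erase _ _ (Finset.mem_univ a),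
    Derivation.leibniz (A := OT F (∑ i, m i)), dzD_blockFun_self]
  have : dzD F id (emb m a k) (∏ i ∈ Finset.univ.erase a, blockFun m i (g i)) = 0 := by
    refine Finset.prod_induction _ (fun f => dzD F id (emb m a k) f = 0) ?_ ?_ ?_
    · intro x y hx hy
      rw [Derivation.leibniz (A := OT F (∑ i, m i)), hx, hy, smul_zero, smul_zero, add_zero]
    · exact Derivation.map_one_eq_zero _
    · intro i hi
      exact dzD_blockFun_of_ne (Finset.ne_of_mem_erase hi) k (g i)
  rw [this, smul_zero, zero_add, smul_eq_mul, mul_comm]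

theorem exists_polyV_eq {N : ℕ} (y : Vn (0 : V →ₗ[F] V) N) :
    ∃ a : (Fin N →₀ ℕ) →₀ V, mkV 0 N (polyV a) = y := by
  have hadd : ∀ y y' : Vn (0 : V →ₗ[F] V) N, (∃ a : (Fin N →₀ ℕ) →₀ V, mkV 0 N (polyV a) = y) →
      (∃ a : (Fin N →₀ ℕ) →₀ V, mkV 0 N (polyV a) = y') →
      ∃ a : (Fin N →₀ ℕ) →₀ V, mkV 0 N (polyV a) = y + y' := by
    rintro _ _ ⟨a, rfl⟩ ⟨b, rfl⟩
    refine ⟨a + b, ?_⟩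
    rw [← map_add, polyV, Finsupp.sum_add_index' (by simp) (by simp [TensorProduct.tmul_add])]
    rfl
  refine Vn_induction ⟨0, by simp [polyV]⟩ (fun p x => ?_) hadd y
  induction p using MvPolynomial.induction_on' with
  | monomial α c =>
    refine ⟨Finsupp.single α (c • x), ?_⟩
    rw [polyV, Finsupp.sum_single_index (by simp), TensorProduct.tmul_smul,
      TensorProduct.smul_tmul', MvPolynomial.smul_monomial, smul_eq_mul, mul_one]
  | add p q hp hq => rw [TensorProduct.add_tmul, map_add]; exact hadd _ _ hp hq

variable {X : MultilinearMap F (fun _ : Fin n => V) (OT F n →ₗ[F] Vn (0 : V →ₗ[F] V) n)}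
  (hX : ∀ v, X v ∈ DMap F V n)

theorem update_apply_eq {A B : Fin n → Type*} (T : ∀ i, A i → B i) (g : ∀ i, A i) (a : Fin n)
    (u : A a) : (fun i => T i (Function.update g a u i)) =
      Function.update (fun i => T i (g i)) a (T a u) := by
  funext i
  by_cases h : i = a
  · subst h; simp
  · simp [h]

/-- The value is prescribed for `g i = p_{G i}`. This is consistent because cancelling a pole of
`p_{G i}` against a factor `z_kl` of `h` does not change it, by `compMap_diff` and the
sesquilinearity of `T i`. -/
theorem exists_comp_DMap {T : ∀ i, OT F (m i) →ₗ[F] Vn (0 : V →ₗ[F] V) (m i)}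
    (hT : ∀ i, T i ∈ DMap F V (m i)) :
    ∃ Z ∈ DMap F V (∑ i, m i), ∀ (g : ∀ i, OT F (m i)) (h : invFun F (block m)),
      Z ((∏ i, blockFun m i (g i)) * regFun m h) = compMap hX m (fun i => T i (g i)) h := by
  classical
  obtain ⟨Z, hZ⟩ := exists_lift_blockGraphFun (F := F) (m := m)
    (fun G => compMap hX m (fun i => T i (graphFun F (G i)))) (by
      intro G i e h
      rw [← compMap_diff, update_apply_eq (fun i Γ => T i (graphFun F Γ)) G i (e ::ₘ G i),
        Function.update_self, Function.update_idem, ← (hT i).2]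
      have h1 : zOT F e.1.1 e.1.2 * graphFun F (e ::ₘ G i) = graphFun F (G i) := by
        rw [zOT_mul_graphFun (Multiset.mem_cons_self e _), Multiset.erase_cons_head]
      rw [h1, Function.update_eq_self])
  -- The formula passes from graph functions to arbitrary `g i` one block at a time; `s` is the set
  -- of blocks already freed.
  have key : ∀ (s : Finset (Fin n)) (g : ∀ i, OT F (m i)) (h : invFun F (block m)),
      (∀ i, i ∉ s → ∃ Γ, g i = graphFun F Γ) →
      Z ((∏ i, blockFun m i (g i)) * regFun m h) = compMap hX m (fun i => T i (g i)) h := by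
    intro s
    induction s using Finset.induction_on with
    | empty =>
      intro g h hg
      choose G hG using fun i => hg i (Finset.notMem_empty i)
      obtain rfl : g = fun i => graphFun F (G i) := funext hG
      exact hZ G h
    | insert a s ha ih =>
      intro g h hg
      let K : Submodule F (OT F (m a)) :=
        { carrier := {u | ∀ h, Z ((∏ i, blockFun m i (Function.update g a u i)) * regFun m h) =
            compMap hX m (fun i => T i (Function.update g a u i)) h}
          add_mem' := by
            intro u v hu hv h
            have hu := hu h
            have hv := hv h
            rw [update_apply_eq (fun i => T i), prod_blockFun_update] at hu hv ⊢
            rw [map_add, map_add, add_mul, add_mul, map_add, MultilinearMap.map_update_add, hu, hv]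
            rfl
          zero_mem' := by
            intro h
            rw [update_apply_eq (fun i => T i), prod_blockFun_update, map_zero, map_zero, zero_mul,
              zero_mul, map_zero, MultilinearMap.map_update_zero]
            rfl
          smul_mem' := by
            intro c u hu h
            have hu := hu h
            rw [update_apply_eq (fun i => T i), prod_blockFun_update] at hu ⊢
            rw [map_smul, map_smul, smul_mul_assoc, smul_mul_assoc, map_smul,
              MultilinearMap.map_update_smul, hu]
            rfl }
      have hK : K = ⊤ := by
        -- A factor `z_kl` of `u` can be moved into `h`, so `K` is stable under these factors; on
        -- graph functions the induction hypothesis applies.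
        refine eq_top_of_mul_zInv F (π := id) K ?_ fun E => ?_
        · intro k l u hu h
          have hu := hu (zInv F (block m) (emb m a k) (emb m a l) * h)
          rw [update_apply_eq (fun i => T i), prod_blockFun_update] at hu ⊢
          rw [← compMap_diff, Function.update_self, Function.update_idem, ← (hT a).2,
            map_mul (regFun m), regFun_zInv, ← blockFun_zOT] at hu
          rw [← zOT_eq_zInv, ← hu, map_mul (blockFun m a)]
          congr 1
          ring
        · intro h
          refine ih _ _ fun i hi => ?_
          by_cases hia : i = a
          · subst hia
            exact ⟨E, by rw [Function.update_self, graphFun_eq_polesFun]⟩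
          · rw [Function.update_of_ne hia]
            exact hg i (by simp [hia, hi])
      have hm : g a ∈ K := hK ▸ Submodule.mem_top
      have := hm h
      rwa [Function.update_eq_self] at this
  have key' := fun g h => key Finset.univ g h (fun i hi => absurd (Finset.mem_univ i) hi)
  refine ⟨Z, ⟨fun k f => ?_, fun k l f => ?_⟩, key'⟩
  · obtain ⟨G, h, rfl⟩ := exists_eq_blockGraphFun_mul f
    obtain ⟨a, k, rfl⟩ := exists_emb k
    rw [← dzD_apply, Derivation.leibniz (A := OT F (∑ i, m i)), dzD_regFun, blockGraphFun,
      dzD_prod_blockFun, smul_eq_mul, smul_eq_mul, map_add, key', mul_comm (regFun m h), key', key',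
      update_apply_eq (fun i => T i), (hT a).1]
    -- The Leibniz term with the derivative on `h` is exactly what `λ_k - ∂/∂z_k` subtracts in the
    -- slot.
    have := compMap_mul hX a k (fun i => T i (graphFun F (G i))) h
    rw [this, add_sub_cancel]
  · obtain ⟨G, h, rfl⟩ := exists_eq_blockGraphFun_mul f
    have h1 : zOT F k l * (blockGraphFun F G * regFun m h) =
        blockGraphFun F G * regFun m (zInv F (block m) k l * h) := by
      rw [map_mul, regFun_zInv]; ring
    rw [h1, hZ, hZ, diffV_compMap]

/-- The maps `Z x` are chosen for each `x` separately. Since every function is a product `p_G h`,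
multilinearity in `x` can be read off from the formula for the values on these products. -/
theorem exists_comp_multilinear
    {Y : ∀ i, MultilinearMap F (fun _ : Fin (m i) => V) (OT F (m i) →ₗ[F] Vn (0 : V →ₗ[F] V) (m i))}
    (hY : ∀ i x, Y i x ∈ DMap F V (m i)) :
    ∃ Z : MultilinearMap F (fun _ : Fin (∑ i, m i) => V)
        (OT F (∑ i, m i) →ₗ[F] Vn (0 : V →ₗ[F] V) (∑ i, m i)),
      (∀ x, Z x ∈ DMap F V (∑ i, m i)) ∧
      ∀ x (g : ∀ i, OT F (m i)) (h : invFun F (block m)),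
        Z x ((∏ i, blockFun m i (g i)) * regFun m h) =
          compMap hX m (fun i => Y i (fun k => x (emb m i k)) (g i)) h := by
  choose Z hZ hZ' using fun x : Fin (∑ i, m i) → V =>
    exists_comp_DMap hX (fun i => hY i (fun k => x (emb m i k)))
  have hb : ∀ x G h, Z x (blockGraphFun F G * regFun m h) = blockComp (compMap hX m)
      (fun i => (LinearMap.applyₗ (graphFun F (G i))).compMultilinearMap (Y i)) x h :=
    fun x G h => hZ' x _ h
  refine ⟨{ toFun := Z, map_update_add' := ?_, map_update_smul' := ?_ }, hZ, hZ'⟩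
  · intro _ x i a b
    refine LinearMap.ext fun f => ?_
    obtain ⟨G, h, rfl⟩ := exists_eq_blockGraphFun_mul f
    rw [LinearMap.add_apply, hb, hb, hb, MultilinearMap.map_update_add, LinearMap.add_apply]
  · intro _ x i c a
    refine LinearMap.ext fun f => ?_
    obtain ⟨G, h, rfl⟩ := exists_eq_blockGraphFun_mul f
    rw [LinearMap.smul_apply, hb, hb, MultilinearMap.map_update_smul, LinearMap.smul_apply]

/-- The defining property of the compositions of chiral operations, in terms of `compMap`. -/
theorem isChiralComp_iff (𝒱 : ZMod 2 → Submodule F V) {p : Fin n → ZMod 2}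
    (X : chiral (0 : V →ₗ[F] V) n) (Y : ∀ i, chiral (0 : V →ₗ[F] V) (m i))
    (Z : chiral (0 : V →ₗ[F] V) (∑ i, m i)) :
    IsChiralComp 𝒱 0 p X Y Z ↔ (∀ i, Y i ∈ chiralParity 𝒱 0 (m i) (p i)) ∧
      ∀ (q : Fin (∑ i, m i) → ZMod 2) (x : Fin (∑ i, m i) → V), (∀ k, x k ∈ 𝒱 (q k)) →
      ∀ (g : ∀ i, OT F (m i)) (h : invFun F (block m)),
        Z.1 x ((∏ i, blockFun m i (g i)) * regFun m h) = compSign p q •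
          compMap (mem_chiral_iff.1 X.2) m (fun i => (Y i).1 (fun k => x (emb m i k)) (g i)) h := by
  refine and_congr_right fun _ => forall_congr' fun q => forall_congr' fun x => forall_congr' fun hx =>
    forall_congr' fun g => forall_congr' fun h => ⟨fun H => ?_, fun H a ha => ?_⟩
  · choose a ha using fun i => exists_polyV_eq ((Y i).1 (fun k => x (emb m i k)) (g i))
    rw [H a fun i => (ha i).symm, ← slotMap_polyV, ← compMap_mkV (mem_chiral_iff.1 X.2)]
    simp only [ha]
  · rw [H, ← slotMap_polyV, ← compMap_mkV (mem_chiral_iff.1 X.2)]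
    simp only [ha]

theorem chiral_comp_exists {𝒱 : ZMod 2 → Submodule F V} (h𝒱 : DirectSum.IsInternal 𝒱)
    (p : Fin n → ZMod 2) (X : chiral (0 : V →ₗ[F] V) n) (Y : ∀ i, chiral (0 : V →ₗ[F] V) (m i))
    (hY : ∀ i, Y i ∈ chiralParity 𝒱 0 (m i) (p i)) : ∃ Z, IsChiralComp 𝒱 0 p X Y Z := by
  obtain ⟨Z, hZ, hZ'⟩ := exists_comp_multilinear (mem_chiral_iff.1 X.2) (m := m)
    (Y := fun i => (Y i).1) (fun i => mem_chiral_iff.1 (Y i).2)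
  obtain ⟨Z', h1, h2⟩ := exists_multilinear_homogeneous h𝒱
    (fun q : Fin (∑ i, m i) → ZMod 2 => compSign p q • Z) (DMap F V (∑ i, m i))
    (fun q x => zsmul_mem (hZ x) _)
  refine ⟨⟨Z', mem_chiral_iff.2 h1⟩, (isChiralComp_iff 𝒱 X Y _).2 ⟨hY, fun q x hx g h => ?_⟩⟩
  change Z' x _ = _
  rw [h2 q x hx, ← hZ']
  rfl

end ChiralComp

end VertexOperad

end

noncomputable section

namespace VertexOperad

universe u v

/-! ### External connectedness in trees -/

section ExtConn

variable {n : ℕ} {m : Fin n → ℕ} {E : Multiset (InterEdge m)}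

theorem ExtConn.ne {k : Fin (∑ i, m i)} {j : Fin n} (h : ExtConn E k j) : j ≠ block m k := by
  obtain ⟨e, _, l, hl, hp⟩ := h
  rcases Relation.ReflTransGen.cases_tail hp with h | ⟨b, _, h, _⟩
  · subst h
    rcases hl with hl | hl
    · have := e.2; rw [hl] at this; exact this.symm
    · have := e.2; rw [hl] at this; exact this
  · exact h

/-- The block `i` together with the blocks reached from it without returning is closed under
adjacency, so by connectedness it is everything. -/
theorem exists_extConn (hE : ∀ S : Finset (Fin n), S.Nonempty → ClosedIn (collapse E) S →
      S = Finset.univ) {i j : Fin n} (hij : j ≠ i) : ∃ k, block m k = i ∧ ExtConn E k j := by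
  classical
  let S : Finset (Fin n) := Finset.univ.filter fun j => j = i ∨ ∃ k, block m k = i ∧ ExtConn E k j
  have hS : S = Finset.univ := by
    refine hE S ⟨i, by simp [S]⟩ ?_
    have key : ∀ a b, a ≠ b → (∃ e ∈ E, (block m e.1.1 = a ∧ block m e.1.2 = b) ∨
        (block m e.1.1 = b ∧ block m e.1.2 = a)) → a ∈ S → b ∈ S := by
      rintro a b hab ⟨e, he, hab'⟩ ha
      simp only [S, Finset.mem_filter, Finset.mem_univ, true_and] at ha ⊢
      by_cases hb : b = i
      · exact Or.inl hb
      right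
      rcases ha with rfl | ⟨k, hk, e', he', l, hl, hp⟩
      · rcases hab' with ⟨h1, h2⟩ | ⟨h1, h2⟩
        · exact ⟨e.1.1, h1, e, he, e.1.2, Or.inl rfl, h2 ▸ Relation.ReflTransGen.refl⟩
        · exact ⟨e.1.2, h2, e, he, e.1.1, Or.inr rfl, h1 ▸ Relation.ReflTransGen.refl⟩
      · refine ⟨k, hk, e', he', l, hl, hp.tail ⟨hk ▸ hb, _, Multiset.mem_map_of_mem _ he, ?_⟩⟩
        rcases hab' with ⟨rfl, rfl⟩ | ⟨rfl, rfl⟩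
        · exact Or.inl rfl
        · exact Or.inr rfl
    intro e he
    obtain ⟨e, he', rfl⟩ := Multiset.mem_map.1 he
    exact ⟨key _ _ e.2 ⟨e, he', Or.inl ⟨rfl, rfl⟩⟩, key _ _ e.2.symm ⟨e, he', Or.inr ⟨rfl, rfl⟩⟩⟩
  have hj : j ∈ S := hS ▸ Finset.mem_univ j
  simpa [S, hij] using hj

/-- Two different starting vertices in one block would close up to a cycle in a tree. Concretely,
erasing the first edge `e` disconnects the collapsed graph, yet the detour through `e'` still joins
the ends of `e`. -/
theorem extConn_unique (hE : ∀ S : Finset (Fin n), S.Nonempty → ClosedIn (collapse E) S →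
      S = Finset.univ) (hc : Multiset.card E + 1 = n) {k k' : Fin (∑ i, m i)} {j : Fin n}
    (hk : block m k = block m k') (h : ExtConn E k j) (h' : ExtConn E k' j) : k = k' := by
  classical
  by_contra hne
  obtain ⟨e, he, l, hl, hp⟩ := h
  obtain ⟨e', he', l', hl', hp'⟩ := h'
  have hle : block m l ≠ block m k := by
    rcases hl with hl | hl
    · have := e.2; rw [hl] at this; exact this.symm
    · have := e.2; rw [hl] at this; exact this
  have hle' : block m l' ≠ block m k' := by
    rcases hl' with hl | hl
    · have := e'.2; rw [hl] at this; exact this.symm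
    · have := e'.2; rw [hl] at this; exact this
  have hee : e' ≠ e := by
    rintro rfl
    rcases hl with hl | hl <;> rcases hl' with hl' | hl' <;> rw [hl, Prod.mk.injEq] at hl'
    · exact hne hl'.1
    · exact hle' (by rw [← hl'.1, hk])
    · exact hle' (by rw [← hl'.2, hk])
    · exact hne hl'.2
  have hcard : Multiset.card (collapse (E.erase e)) + 1 < n := by
    have := Multiset.card_erase_of_mem he
    have h1 : 0 < Multiset.card E := Multiset.card_pos_iff_exists_mem.2 ⟨e, he⟩
    rw [collapse, Multiset.card_map, this, Nat.pred_eq_sub_one]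
    omega
  obtain ⟨S, hS1, hS2, hS3⟩ := exists_closedIn_of_card_add_one_lt hcard
  -- Paths that avoid the block of `k` cannot use `e`, which has an end there; so they survive the
  -- erasure and stay on one side of `S`.
  have path : ∀ {a b : Fin n}, a ≠ block m k → Relation.ReflTransGen (fun a b => b ≠ block m k ∧
      ∃ e ∈ collapse E, e.1 = (a, b) ∨ e.1 = (b, a)) a b → b ≠ block m k ∧ (a ∈ S ↔ b ∈ S) := by
    intro a b ha hab
    induction hab with
    | refl => exact ⟨ha, Iff.rfl⟩
    | tail _ hbc ih =>
      obtain ⟨hc, c, hcE, hc'⟩ := hbc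
      obtain ⟨f, hf, rfl⟩ := Multiset.mem_map.1 hcE
      have hfe : f ≠ e := by
        rintro rfl
        rcases hl with hl | hl <;> rcases hc' with hc' | hc' <;>
          simp only [hl, Prod.mk.injEq] at hc'
        · exact ih.1 hc'.1.symm
        · exact hc hc'.1.symm
        · exact hc hc'.2.symm
        · exact ih.1 hc'.2.symm
      have h3 := hS3 _ (Multiset.mem_map_of_mem _ ((Multiset.mem_erase_of_ne hfe).2 hf))
      refine ⟨hc, ih.2.trans ?_⟩
      rcases hc' with hc' | hc' <;> simp only [Prod.mk.injEq] at hc' h3 <;>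
        rw [hc'.1, hc'.2] at h3
      · exact h3
      · exact h3.symm
  rw [← hk] at hp' hle'
  have h1 := (path hle hp).2
  have h2 := (path hle' hp').2
  have h3 : block m l' ∈ S ↔ block m k ∈ S := by
    have h3 := hS3 _ (Multiset.mem_map_of_mem _ ((Multiset.mem_erase_of_ne hee).2 he'))
    rw [hk]
    rcases hl' with hl' | hl' <;> simp only [hl'] at h3
    · exact h3.symm
    · exact h3
  refine hS2 (hE S hS1 fun c hcE => ?_)
  obtain ⟨f, hf, rfl⟩ := Multiset.mem_map.1 hcE
  by_cases hfe : f = e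
  · subst hfe
    rcases hl with hl | hl <;> simp only [hl]
    · rw [← h3, h2, ← h1]
    · rw [← h3, h2, ← h1]
  · exact hS3 _ (Multiset.mem_map_of_mem _ ((Multiset.mem_erase_of_ne hfe).2 hf))

end ExtConn

/-! ### Compositions of classical operations -/

section ClassicalComp

variable {F : Type u} [Field F] {V : Type v} [AddCommGroup V] [Module F V] {n : ℕ} {m : Fin n → ℕ}

open Classical in
/-- The linear form `λ_k + ∑_j Λ_j`, the sum being over the blocks externally connected to `k`. -/
def shiftVar (F : Type u) [Field F] (E : Multiset (InterEdge m)) (k : Fin (∑ i, m i)) :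
    MvPolynomial (Fin (∑ i, m i)) F :=
  MvPolynomial.X k + ∑ j with ExtConn E k j, ∑ l with block m l = j, MvPolynomial.X l

/-- In a tree every other block is externally connected to exactly one vertex of the block `i`, so
each `Λ_j` is collected once. -/
theorem sum_shiftVar {E : Multiset (InterEdge m)}
    (hE : ∀ S : Finset (Fin n), S.Nonempty → ClosedIn (collapse E) S → S = Finset.univ)
    (hc : Multiset.card E + 1 = n) (i : Fin n) :
    ∑ k : Fin (m i), shiftVar F E (emb m i k) = ∑ k, MvPolynomial.X k := by
  classical
  rw [← sum_block]
  simp only [shiftVar, Finset.sum_add_distrib]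
  generalize hL : (fun j => ∑ l with block m l = j,
    (MvPolynomial.X l : MvPolynomial (Fin (∑ i, m i)) F)) = L
  have hL' : ∀ j, ∑ l with block m l = j, (MvPolynomial.X l : MvPolynomial (Fin (∑ i, m i)) F) =
    L j := fun j => congrFun hL j
  have h0 : ∑ k, (MvPolynomial.X k : MvPolynomial (Fin (∑ i, m i)) F) = ∑ j, L j := by
    rw [← hL, Finset.sum_fiberwise]
  rw [h0, ← Finset.add_sum_erase Finset.univ L (Finset.mem_univ i)]
  simp only [hL']
  congr 1
  rw [Finset.sum_comm' (t' := Finset.univ.erase i)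
    (s' := fun j => Finset.univ.filter fun k => block m k = i ∧ ExtConn E k j)]
  · refine Finset.sum_congr rfl fun j hj => ?_
    obtain ⟨k, hk, hkj⟩ := exists_extConn hE (Finset.ne_of_mem_erase hj)
    have : (Finset.univ.filter fun k => block m k = i ∧ ExtConn E k j) = {k} := by
      ext k'
      simp only [Finset.mem_filter, Finset.mem_univ, true_and, Finset.mem_singleton]
      refine ⟨fun h => extConn_unique hE hc (h.1.trans hk.symm) h.2 hkj, ?_⟩
      rintro rfl
      exact ⟨hk, hkj⟩
    rw [this, Finset.sum_singleton]
  · intro k j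
    simp only [Finset.mem_filter, Finset.mem_univ, true_and, Finset.mem_erase, and_true]
    refine ⟨fun h => ⟨h, ?_⟩, fun h => h.1⟩
    rw [← h.1]
    exact h.2.ne

/-- The algebra of polynomials acts on tensor products. -/
def polyOp (F : Type u) [Field F] (N : ℕ) (W : Type*) [AddCommGroup W] [Module F W] :
    MvPolynomial (Fin N) F →* Module.End F (MvPolynomial (Fin N) F ⊗[F] W) where
  toFun p := LinearMap.rTensor W (LinearMap.mulLeft F p)
  map_one' := by apply TensorProduct.ext'; intro q x; simp
  map_mul' p q := by apply TensorProduct.ext'; intro r x; simp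

theorem polyOp_tmul {N : ℕ} {W : Type*} [AddCommGroup W] [Module F W] (p q : MvPolynomial (Fin N) F)
    (x : W) : polyOp F N W p (q ⊗ₜ[F] x) = (p * q) ⊗ₜ[F] x := rfl

theorem classicalShift_zero (E : Multiset (InterEdge m)) (k : Fin (∑ i, m i)) :
    classicalShift (0 : V →ₗ[F] V) E k = polyOp F _ _ (shiftVar F E k) := by
  classical
  have h : ∀ j : Fin n, PiTensorProduct.map (R := F) (s := fun _ : Fin n => V) (t := fun _ => V)
      (Function.update (fun _ => LinearMap.id) j (0 : V →ₗ[F] V)) = 0 := fun j =>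
    (PiTensorProduct.mapMultilinear F (fun _ : Fin n => V) (fun _ => V)).map_update_zero _ j
  apply TensorProduct.ext'
  intro q x
  rw [polyOp_tmul, classicalShift]
  simp only [h, LinearMap.lTensor_zero, add_zero, shiftVar, LinearMap.add_apply, LinearMap.sum_apply,
    LinearMap.rTensor_tmul, LinearMap.mulLeft_apply, add_mul, TensorProduct.add_tmul,
    Finset.sum_mul, TensorProduct.sum_tmul]

theorem classicalShiftPow_zero (E : Multiset (InterEdge m)) (α : Fin (∑ i, m i) → ℕ) :
    classicalShiftPow (0 : V →ₗ[F] V) E α = polyOp F _ _ (MvPolynomial.aeval (shiftVar F E)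
      (MvPolynomial.monomial (Finsupp.equivFunOnFinite.symm α) (1 : F))) := by
  simp only [classicalShiftPow, classicalShift_zero, ← map_pow]
  rw [MvPolynomial.aeval_monomial, map_one, one_mul, Finsupp.prod_fintype _ _ (by simp),
    ← List.prod_ofFn, map_list_prod, List.map_ofFn]
  rfl

/-- The composition of a multilinear map `f` with polynomials in its arguments, with the
substitution `λ_k ↦ c_k`. -/
theorem exists_substMap (c : Fin (∑ i, m i) → MvPolynomial (Fin (∑ i, m i)) F)
    (f : MultilinearMap F (fun _ : Fin n => V) (Vn (0 : V →ₗ[F] V) (∑ i, m i))) :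
    ∃ T : MultilinearMap F (fun i => MvPolynomial (Fin (m i)) F ⊗[F] V)
      (Vn (0 : V →ₗ[F] V) (∑ i, m i)),
    ∀ (p : ∀ i, MvPolynomial (Fin (m i)) F) (v : Fin n → V), T (fun i => p i ⊗ₜ[F] v i) =
      mulV 0 _ (MvPolynomial.aeval c (blockPoly F m p)) (f v) := by
  let L : MvPolynomial (Fin (∑ i, m i)) F →ₗ[F] MultilinearMap F (fun _ : Fin n => V)
      (Vn (0 : V →ₗ[F] V) (∑ i, m i)) :=
    { toFun := fun p => (mulV 0 _ (MvPolynomial.aeval c p)).compMultilinearMap f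
      map_add' := fun p q => by ext v; simp
      map_smul' := fun a p => by ext v; simp }
  obtain ⟨T, hT⟩ := exists_multilinear_tmul (L.compMultilinearMap (blockPoly F m))
  exact ⟨T, fun p v => by rw [hT]; rfl⟩

/-- Passing to the constant representative changes a slot by a multiple of `∑ λ_k`. By
`sum_shiftVar` the substitution turns this into the sum of all variables, which is zero in the
target. -/
theorem sum_classicalShiftPow {E : Multiset (InterEdge m)}
    (hE : ∀ S : Finset (Fin n), S.Nonempty → ClosedIn (collapse E) S → S = Finset.univ)
    (hc : Multiset.card E + 1 = n) (f : MultilinearMap F (fun _ : Fin n => V) (Vn (0 : V →ₗ[F] V) n))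
    (a : ∀ i, (Fin (m i) →₀ ℕ) →₀ V) (y : Fin n → V)
    (ha : ∀ i, mkV (F := F) 0 (m i) (polyV (a i)) = constV (m i) (y i)) :
    ∑ α ∈ Fintype.piFinset (fun i => (a i).support),
        evalV 0 (substV 0 (block m) ∘ₗ PiTensorProduct.lift f)
          (classicalShiftPow 0 E (glue α) (1 ⊗ₜ[F] PiTensorProduct.tprod F fun i => a i (α i))) =
      substV 0 (block m) (f y) := by
  classical
  obtain ⟨T, hT⟩ := exists_substMap (shiftVar F E) ((substV 0 (block m)).compMultilinearMap f)
  have h1 : T (fun i => polyV (a i)) = ∑ α ∈ Fintype.piFinset (fun i => (a i).support),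
        evalV 0 (substV 0 (block m) ∘ₗ PiTensorProduct.lift f)
          (classicalShiftPow 0 E (glue α)
            (1 ⊗ₜ[F] PiTensorProduct.tprod F fun i => a i (α i))) := by
    simp only [polyV, Finsupp.sum]
    rw [MultilinearMap.map_sum_finset]
    refine Finset.sum_congr rfl fun α _ => ?_
    rw [hT, blockPoly_monomial, classicalShiftPow_zero, polyOp_tmul, evalV_tmul, mul_one]
    simp
  have h2 : T (fun i => (1 : MvPolynomial (Fin (m i)) F) ⊗ₜ[F] y i) = substV 0 (block m) (f y) := by
    have : blockPoly F m (fun i => (1 : MvPolynomial (Fin (m i)) F)) = 1 := by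
      simp [blockPoly_apply]
    rw [hT, this, map_one, mulV_one]
    rfl
  rw [← h1, ← h2]
  refine multilinear_congr _ fun i z => ?_
  have h3 : polyV (a i) - (1 : MvPolynomial (Fin (m i)) F) ⊗ₜ[F] y i ∈
      LinearMap.range (totalOp (0 : V →ₗ[F] V) (m i)) := by
    rw [← Submodule.Quotient.mk_eq_zero]
    change mkV 0 (m i) _ = 0
    rw [map_sub, sub_eq_zero, ha, constV_apply]
  obtain ⟨t, ht⟩ := h3
  rw [← ht, totalOp_zero]
  have h4 := slot_ext (T := T) (T' := 0) i (LinearMap.mulLeft F (∑ k, MvPolynomial.X k))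
    (fun p v => ?_) (Function.update z i t)
  · rw [Function.update_self, Function.update_idem] at h4
    rw [h4]; rfl
  · rw [hT, LinearMap.mulLeft_apply, blockPoly_update_mul, map_mul, map_sum, map_sum]
    simp only [MvPolynomial.rename_X, MvPolynomial.aeval_X]
    rw [sum_shiftVar hE hc, mulV_mul, mulV_sum_X]
    rfl

theorem classical_eq_zero {Y : classical (0 : V →ₗ[F] V) n} {Γ : NGraph n}
    (h : ¬ ((∀ S : Finset (Fin n), S.Nonempty → ClosedIn Γ S → S = Finset.univ) ∧
      Multiset.card Γ = n - 1)) : Y.1 Γ = 0 := by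
  ext x
  have hx := mem_classical_iff.1 Y.2 x
  by_cases hc : Multiset.card Γ = n - 1
  · have : ∃ S : Finset (Fin n), S.Nonempty ∧ ClosedIn Γ S ∧ S ≠ Finset.univ := by
      by_contra! h'
      exact h ⟨h', hc⟩
    obtain ⟨S, h1, h2, h3⟩ := this
    exact CMap.disc hx Γ S h1 h3 h2
  · exact CMap.eq_zero_of_card_ne hx hc

variable [CharZero F]

/-- For the trivial action of `∂` the values of classical operations are constant, and the
composition is given by the constants. -/
theorem isClassicalComp_iff (𝒱 : ZMod 2 → Submodule F V) {p : Fin n → ZMod 2}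
    (X : classical (0 : V →ₗ[F] V) n) (Y : ∀ i, classical (0 : V →ₗ[F] V) (m i))
    (Z : classical (0 : V →ₗ[F] V) (∑ i, m i)) :
    IsClassicalComp 𝒱 0 p X Y Z ↔ (∀ i, Y i ∈ classicalParity 𝒱 0 (m i) (p i)) ∧
      ∀ (q : Fin (∑ i, m i) → ZMod 2) (x : Fin (∑ i, m i) → V), (∀ k, x k ∈ 𝒱 (q k)) →
      ∀ (E : Multiset (InterEdge m)) (G : ∀ i, NGraph (m i)),
        Z.1 (assemble E G) x = compSign p q • substV 0 (block m)
          (X.1 (collapse E) fun i => epsV (m i) ((Y i).1 (G i) (fun k => x (emb m i k)))) := by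
  have hY : ∀ i Γ x, constV (m i) (epsV (m i) ((Y i).1 Γ x)) = (Y i).1 Γ x := fun i Γ x =>
    CMap.constV_epsV (mem_classical_iff.1 (Y i).2 x) Γ
  have key : ∀ (x : Fin (∑ i, m i) → V) (E : Multiset (InterEdge m)) (G : ∀ i, NGraph (m i))
      (a : ∀ i, (Fin (m i) →₀ ℕ) →₀ V),
      (∀ i, (Y i).1 (G i) (fun k => x (emb m i k)) = mkV 0 (m i) (polyV (a i))) →
      ∑ α ∈ Fintype.piFinset (fun i => (a i).support),
        evalV 0 (substV 0 (block m) ∘ₗ PiTensorProduct.lift (X.1 (collapse E)))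
          (classicalShiftPow 0 E (glue α) (1 ⊗ₜ[F] PiTensorProduct.tprod F fun i => a i (α i))) =
      substV 0 (block m)
          (X.1 (collapse E) fun i => epsV (m i) ((Y i).1 (G i) (fun k => x (emb m i k)))) := by
    intro x E G a ha
    by_cases hE : (∀ S : Finset (Fin n), S.Nonempty → ClosedIn (collapse E) S → S = Finset.univ) ∧
      Multiset.card (collapse E) = n - 1
    · rcases Nat.eq_zero_or_pos n with hn | hn
      · subst hn
        have hP : Fintype.piFinset (fun i : Fin 0 => (a i).support) = {fun i => i.elim0} := by
          ext α; simp [funext_iff]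
        rw [hP, Finset.sum_singleton, classicalShiftPow_zero, polyOp_tmul, evalV_tmul]
        have : IsEmpty (Fin (∑ i : Fin 0, m i)) := by
          simp only [Finset.univ_eq_empty, Finset.sum_empty]; infer_instance
        have h1 : (Finsupp.equivFunOnFinite.symm
          (glue (m := m) fun i : Fin 0 => (i.elim0 : Fin (m i) →₀ ℕ))) = 0 := Subsingleton.elim _ _
        rw [h1, mul_one, MvPolynomial.monomial_zero', map_one, map_one, mulV_one,
          LinearMap.comp_apply, PiTensorProduct.lift.tprod]
        congr 2
        exact Subsingleton.elim _ _
      · refine sum_classicalShiftPow hE.1 ?_ _ _ _ fun i => by rw [hY, ha]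
        have := hE.2
        rw [collapse, Multiset.card_map] at this
        omega
    -- If the collapsed graph is not a tree, `X` vanishes on it and both sides are zero.
    · rw [classical_eq_zero hE]
      refine (Finset.sum_eq_zero fun α _ => ?_).trans (by simp)
      rw [map_zero, LinearMap.comp_zero]
      exact LinearMap.congr_fun (evalLin F V _ _).map_zero _
  refine and_congr_right fun _ => forall_congr' fun q => forall_congr' fun x => forall_congr' fun hx =>
    forall_congr' fun E => forall_congr' fun G => ⟨fun H => ?_, fun H a ha => ?_⟩
  · choose a ha using fun i => exists_polyV_eq ((Y i).1 (G i) (fun k => x (emb m i k)))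
    rw [H a fun i => (ha i).symm, key x E G a fun i => (ha i).symm]
  · rw [H, key x E G a ha]

end ClassicalComp

end VertexOperad

end

noncomputable section

namespace VertexOperad

universe w' u v w

/-! ### Cutting graphs and their functions along blocks -/

section Assemble

variable {n : ℕ} {m : Fin n → ℕ}

theorem card_assemble (E : Multiset (InterEdge m)) (G : ∀ i, NGraph (m i)) :
    Multiset.card (assemble E G) = Multiset.card E + ∑ i, Multiset.card (G i) := by
  rw [assemble, Multiset.card_add, Multiset.card_map, Multiset.card_sum]
  simp only [card_relabel]

theorem card_collapse (E : Multiset (InterEdge m)) :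
    Multiset.card (collapse E) = Multiset.card E := Multiset.card_map _ _

theorem exists_assemble_eq (Γ : NGraph (∑ i, m i)) :
    ∃ (E : Multiset (InterEdge m)) (G : ∀ i, NGraph (m i)), Γ = assemble E G := by
  classical
  induction Γ using Multiset.induction_on with
  | empty => exact ⟨0, 0, by simp [assemble, NGraph.relabel]⟩
  | cons e Γ ih =>
    obtain ⟨E, G, rfl⟩ := ih
    by_cases hb : block m e.1.1 = block m e.1.2
    · obtain ⟨⟨k, l⟩, hkl⟩ := e
      obtain ⟨i, k, rfl⟩ := exists_emb k
      obtain ⟨j, l, rfl⟩ := exists_emb l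
      simp only [block_emb] at hb
      subst hb
      have hkl' : k ≠ l := fun h => hkl (by simp [h])
      refine ⟨E, Function.update G i (⟨(k, l), hkl'⟩ ::ₘ G i), ?_⟩
      rw [assemble, assemble, ← Finset.add_sum_erase Finset.univ (fun j => (G j).relabel
        (emb m j) (emb_injective m j)) (Finset.mem_univ i),
        ← Finset.add_sum_erase Finset.univ (fun j => (Function.update G i (⟨(k, l), hkl'⟩ ::ₘ G i)
          j).relabel (emb m j) (emb_injective m j)) (Finset.mem_univ i), Function.update_self]
      have h1 : ∀ j ∈ Finset.univ.erase i, (Function.update G i (⟨(k, l), hkl'⟩ ::ₘ G i) j).relabel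
          (emb m j) (emb_injective m j) = (G j).relabel (emb m j) (emb_injective m j) := by
        intro j hj
        rw [Function.update_of_ne (Finset.ne_of_mem_erase hj)]
      rw [Finset.sum_congr rfl h1]
      rw [NGraph.relabel, NGraph.relabel, Multiset.map_cons, Multiset.cons_add, Multiset.add_cons]
    · refine ⟨⟨e.1, hb⟩ ::ₘ E, G, ?_⟩
      rw [assemble, assemble, Multiset.map_cons, Multiset.cons_add]

variable {F : Type u} [Field F]

theorem graphFun_assemble (E : Multiset (InterEdge m)) (G : ∀ i, NGraph (m i)) :
    graphFun F (assemble E G) =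
      (∏ i, blockFun m i (graphFun F (G i))) * regFun m (polesFun F (block m) E) := by
  have h1 : regFun m (polesFun F (block m) E) = graphFun F (E.map (fun e =>
      (⟨e.1, fun h => e.2 (congrArg (block m) h)⟩ : Edge (∑ i, m i)))) :=
    renameInv_polesFun _ E
  have h2 : ∀ s : Finset (Fin n), graphFun F (∑ i ∈ s, (G i).relabel (emb m i) (emb_injective m i)) =
      ∏ i ∈ s, blockFun m i (graphFun F (G i)) := by
    intro s
    induction s using Finset.cons_induction with
    | empty => simp [graphFun]
    | cons a s ha ih =>
      rw [Finset.sum_cons, Finset.prod_cons, graphFun_add, ih, graphFun_relabel]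
      rfl
  rw [assemble, graphFun_add, h1, h2, mul_comm]

theorem restrFun_polesFun (E : Multiset (InterEdge m)) :
    restrFun m (polesFun F (block m) E) = graphFun F (collapse E) := renameInv_polesFun _ E

end Assemble

/-! ### Comparison of chiral and classical compositions -/

section Iso

theorem OperadIso.wellDefined {F : Type u} [Field F] {A : OperadData.{u, w} F} {B : OperadData.{u, w'} F}
    (Φ : OperadIso 0 A B) (hA : A.WellDefined) : B.WellDefined where
  one := by
    obtain ⟨X, hX, hu⟩ := hA.one
    refine ⟨Φ.equiv 1 (Nat.zero_le _) X, (Φ.one_iff _ X).1 hX, fun Y hY => ?_⟩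
    obtain ⟨Y, rfl⟩ := (Φ.equiv 1 (Nat.zero_le _)).surjective Y
    rw [hu Y ((Φ.one_iff _ Y).2 hY)]
  act σ X := by
    obtain ⟨X, rfl⟩ := (Φ.equiv _ (Nat.zero_le _)).surjective X
    obtain ⟨X', hX, hu⟩ := hA.act σ X
    refine ⟨Φ.equiv _ (Nat.zero_le _) X', (Φ.act_iff _ _ σ X X').1 hX, fun Y hY => ?_⟩
    obtain ⟨Y, rfl⟩ := (Φ.equiv _ (Nat.zero_le _)).surjective Y
    rw [hu Y ((Φ.act_iff _ _ σ X Y).2 hY)]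
  comp {n m} p X Y hY := by
    obtain ⟨X, rfl⟩ := (Φ.equiv _ (Nat.zero_le _)).surjective X
    choose Y' hY' using fun i => (Φ.equiv (m i) (Nat.zero_le _)).surjective (Y i)
    obtain rfl : (fun i => Φ.equiv (m i) (Nat.zero_le _) (Y' i)) = Y := funext hY'
    obtain ⟨Z, hZ, hu⟩ := hA.comp p X Y' fun i => (Φ.parity_iff _ _ _ _).2 (hY i)
    refine ⟨Φ.equiv _ (Nat.zero_le _) Z, (Φ.comp_iff _ _ _ (fun _ => Nat.zero_le _)
      (Nat.zero_le _) p X Y' Z).1 hZ, fun Z' hZ' => ?_⟩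
    obtain ⟨Z', rfl⟩ := (Φ.equiv _ (Nat.zero_le _)).surjective Z'
    rw [hu Z' ((Φ.comp_iff _ _ _ (fun _ => Nat.zero_le _) (Nat.zero_le _) p X Y' Z').2 hZ')]

variable {F : Type u} [Field F] [CharZero F] {V : Type v} [AddCommGroup V] [Module F V]
  {n : ℕ} {m : Fin n → ℕ}

-- For non-empty blocks a tree has `∑ m_i - 1 = (n - 1) + ∑ (m_i - 1)` edges. If they are
-- distributed in this way, all inserted values are constants and the two sides agree. Otherwise
-- either there are too few edges between the blocks and the collapsed graph is disconnected, or
-- some block has too few edges and its `Y i` vanishes.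
set_option maxHeartbeats 1000000 in
theorem compMap_graphFun (X : chiral (0 : V →ₗ[F] V) n) (Y : ∀ i, chiral (0 : V →ₗ[F] V) (m i))
    (x : Fin (∑ i, m i) → V) (E : Multiset (InterEdge m)) (G : ∀ i, NGraph (m i)) :
    (if Multiset.card (assemble E G) = ∑ i, m i - 1 then compMap (mem_chiral_iff.1 X.2) m
      (fun i => (Y i).1 (fun k => x (emb m i k)) (graphFun F (G i))) (polesFun F (block m) E)
      else 0) =
    substV 0 (block m) ((chiralEquiv F V n X).1 (collapse E) fun i =>
      epsV (m i) ((chiralEquiv F V (m i) (Y i)).1 (G i) (fun k => x (emb m i k)))) := by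
  have hX := mem_chiral_iff.1 X.2
  have hpos : (Multiset.card E = n - 1 ∧ ∀ i, Multiset.card (G i) = m i - 1) →
      compMap hX m (fun i => (Y i).1 (fun k => x (emb m i k)) (graphFun F (G i)))
        (polesFun F (block m) E) = substV 0 (block m) ((chiralEquiv F V n X).1 (collapse E) fun i =>
      epsV (m i) ((chiralEquiv F V (m i) (Y i)).1 (G i) (fun k => x (emb m i k)))) := by
    rintro ⟨h1, h2⟩
    have h3 : ∀ i, (Y i).1 (fun k => x (emb m i k)) (graphFun F (G i)) = constV (m i) (epsV (m i)
        ((chiralEquiv F V (m i) (Y i)).1 (G i) (fun k => x (emb m i k)))) := by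
      intro i
      rw [CMap.constV_epsV (mem_classical_iff.1 (chiralEquiv F V (m i) (Y i)).2 _), chiralEquiv_apply,
        if_pos (h2 i)]
    simp only [h3]
    rw [compMap_constV, restrFun_polesFun, chiralEquiv_apply X, if_pos (by rw [card_collapse, h1])]
  have hneg : ¬ (Multiset.card E = n - 1 ∧ ∀ i, Multiset.card (G i) = m i - 1) →
      (chiralEquiv F V n X).1 (collapse E) (fun i =>
      epsV (m i) ((chiralEquiv F V (m i) (Y i)).1 (G i) (fun k => x (emb m i k)))) = 0 := by
    intro h
    by_cases h1 : Multiset.card E = n - 1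
    · have : ∃ i, Multiset.card (G i) ≠ m i - 1 := by
        by_contra! h'
        exact h ⟨h1, h'⟩
      obtain ⟨i, hi⟩ := this
      refine MultilinearMap.map_coord_zero _ i ?_
      rw [chiralEquiv_apply, if_neg hi, map_zero]
    · rw [chiralEquiv_apply X, if_neg (by rwa [card_collapse])]
  -- Here all graphs are empty, and the truncated differences `n - 1`, `m i - 1` and `∑ m_i - 1` are
  -- all `0`, so this still counts as the case of trees.
  by_cases hA : ∑ i, m i = 0 ∧ n ≤ 1
  · have hm : ∀ i, m i = 0 := fun i => by
      have := (Finset.sum_eq_zero_iff.1 hA.1) i (Finset.mem_univ i)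
      exact this
    have hE : Multiset.card E = 0 := by
      rw [Multiset.card_eq_zero, Multiset.eq_zero_iff_forall_notMem]
      intro e
      exact absurd e.1.1.2 (by omega)
    have hG : ∀ i, Multiset.card (G i) = 0 := by
      intro i
      rw [Multiset.card_eq_zero, Multiset.eq_zero_iff_forall_notMem]
      intro e
      exact absurd e.1.1.2 (by have := hm i; omega)
    rw [if_pos, hpos]
    · refine ⟨by omega, fun i => ?_⟩
      rw [hG, hm]
    · rw [card_assemble, hE, hA.1]
      simp [hG]
  -- With several blocks and an empty one among them the chiral composition is zero, whatever the
  -- edge count.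
  by_cases hB : 1 < n ∧ ∃ i, m i = 0
  · obtain ⟨hn, i, hi⟩ := hB
    have h0 := compMap_eq_zero_of_empty hX hn hi
      (fun i => (Y i).1 (fun k => x (emb m i k)) (graphFun F (G i)))
    rw [h0] at hpos ⊢
    rw [LinearMap.zero_apply, ite_self]
    by_cases hc : Multiset.card E = n - 1 ∧ ∀ i, Multiset.card (G i) = m i - 1
    · rw [← hpos hc]; rfl
    · rw [hneg hc, map_zero]
  have hn : 0 < n := by
    rcases Nat.eq_zero_or_pos n with h | h
    · subst h; exact absurd ⟨by simp, by omega⟩ hA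
    · exact h
  have hm : ∀ i, 0 < m i := by
    intro i
    rcases Nat.eq_zero_or_pos (m i) with h | h
    · exfalso
      have h1 : n = 1 := by
        by_contra h1
        exact hB ⟨by omega, i, h⟩
      subst h1
      refine hA ⟨?_, le_rfl⟩
      rw [Fin.sum_univ_one, ← Subsingleton.elim i 0, h]
    · exact h
  have hsum : ∑ i, m i = ∑ i, (m i - 1) + n := by
    have : ∀ i, m i = m i - 1 + 1 := fun i => by have := hm i; omega
    calc ∑ i, m i = ∑ i, (m i - 1 + 1) := Finset.sum_congr rfl fun i _ => this i
      _ = _ := by rw [Finset.sum_add_distrib]; simp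
  by_cases hc : Multiset.card E = n - 1 ∧ ∀ i, Multiset.card (G i) = m i - 1
  · rw [if_pos, hpos hc]
    have h1 := card_assemble E G
    have h2 : ∑ i, Multiset.card (G i) = ∑ i, (m i - 1) := Finset.sum_congr rfl fun i _ => hc.2 i
    omega
  · rw [hneg hc, map_zero]
    by_cases hcard : Multiset.card (assemble E G) = ∑ i, m i - 1
    · rw [if_pos hcard]
      have hcard' := card_assemble E G
      by_cases h1 : Multiset.card E + 1 < n
      · obtain ⟨S, hS1, hS2, hS3⟩ := exists_closedIn_of_card_add_one_lt (Γ := collapse E)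
          (by rwa [card_collapse])
        exact compMap_poles_eq_zero hX hm hS1 hS2 hS3 _
      -- If no block were short of edges, the total count would force equality everywhere.
      · have : ∃ i, Multiset.card (G i) < m i - 1 := by
          by_contra! h2
          have h3 : ∑ i, (m i - 1) = ∑ i, Multiset.card (G i) := by
            have := Finset.sum_le_sum fun i (_ : i ∈ Finset.univ) => h2 i
            omega
          have h4 := (Finset.sum_eq_sum_iff_of_le fun i _ => h2 i).1 h3
          exact hc ⟨by omega, fun i => (h4 i (Finset.mem_univ i)).symm⟩
        obtain ⟨i, hi⟩ := this
        have h5 : (Y i).1 (fun k => x (emb m i k)) (graphFun F (G i)) = 0 :=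
          DMap.eq_zero_of_card_lt (mem_chiral_iff.1 (Y i).2 _) (by omega)
        rw [MultilinearMap.map_coord_zero _ i h5]
        rfl
    · rw [if_neg hcard]

theorem isClassicalComp_of_isChiralComp {𝒱 : ZMod 2 → Submodule F V} {p : Fin n → ZMod 2}
    {X : chiral (0 : V →ₗ[F] V) n} {Y : ∀ i, chiral (0 : V →ₗ[F] V) (m i)}
    {Z : chiral (0 : V →ₗ[F] V) (∑ i, m i)} (h : IsChiralComp 𝒱 0 p X Y Z) :
    IsClassicalComp 𝒱 0 p (chiralEquiv F V n X) (fun i => chiralEquiv F V (m i) (Y i))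
      (chiralEquiv F V _ Z) := by
  rw [isChiralComp_iff] at h
  rw [isClassicalComp_iff]
  refine ⟨fun i => (chiralEquiv_parity 𝒱 _ _).1 (h.1 i), fun q x hx E G => ?_⟩
  rw [← compMap_graphFun, chiralEquiv_apply, graphFun_assemble, h.2 q x hx]
  split_ifs <;> simp

variable {𝒱 : ZMod 2 → Submodule F V} (h𝒱 : DirectSum.IsInternal 𝒱)
include h𝒱

theorem classical_comp_unique {p : Fin n → ZMod 2} {X : classical (0 : V →ₗ[F] V) n}
    {Y : ∀ i, classical (0 : V →ₗ[F] V) (m i)} {Z Z' : classical (0 : V →ₗ[F] V) (∑ i, m i)}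
    (h : IsClassicalComp 𝒱 0 p X Y Z) (h' : IsClassicalComp 𝒱 0 p X Y Z') : Z = Z' := by
  rw [isClassicalComp_iff] at h h'
  refine classical_ext h𝒱 fun Γ q x hx => ?_
  obtain ⟨E, G, rfl⟩ := exists_assemble_eq Γ
  rw [h.2 q x hx, h'.2 q x hx]

/-- The converse combines existence of chiral compositions with uniqueness of classical ones. -/
theorem isChiralComp_iff_isClassicalComp {p : Fin n → ZMod 2}
    {X : chiral (0 : V →ₗ[F] V) n} {Y : ∀ i, chiral (0 : V →ₗ[F] V) (m i)}
    {Z : chiral (0 : V →ₗ[F] V) (∑ i, m i)} : IsChiralComp 𝒱 0 p X Y Z ↔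
    IsClassicalComp 𝒱 0 p (chiralEquiv F V n X) (fun i => chiralEquiv F V (m i) (Y i))
      (chiralEquiv F V _ Z) := by
  refine ⟨isClassicalComp_of_isChiralComp, fun h => ?_⟩
  obtain ⟨Z', hZ'⟩ := chiral_comp_exists h𝒱 p X Y fun i => (chiralEquiv_parity 𝒱 _ _).2 (h.1 i)
  have := classical_comp_unique h𝒱 h (isClassicalComp_of_isChiralComp hZ')
  rwa [(chiralEquiv F V _).injective this]

theorem chiralOperad_wellDefined : (chiralOperad 𝒱 (0 : V →ₗ[F] V)).WellDefined where
  one := by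
    obtain ⟨Y, hY, hu⟩ := classical_one_existsUnique (F := F) 𝒱
    refine ⟨(chiralEquiv F V 1).symm Y, ?_, fun X hX => ?_⟩
    · have h : chiralEquiv F V 1 ((chiralEquiv F V 1).symm Y) = Y := LinearEquiv.apply_symm_apply _ _
      exact (chiralEquiv_one 𝒱 _).2 (h.symm ▸ hY)
    · exact (LinearEquiv.eq_symm_apply _).2 (hu _ ((chiralEquiv_one 𝒱 X).1 hX))
  act σ X := by
    obtain ⟨X', hX'⟩ := chiral_act_exists h𝒱 σ X
    exact ⟨X', hX', fun X'' h => chiral_act_unique h𝒱 σ X _ _ h hX'⟩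
  comp p X Y hY := by
    obtain ⟨Z, hZ⟩ := chiral_comp_exists h𝒱 p X Y hY
    exact ⟨Z, hZ, fun Z' hZ' => (chiralEquiv F V _).injective (classical_comp_unique h𝒱
      (isClassicalComp_of_isChiralComp hZ') (isClassicalComp_of_isChiralComp hZ))⟩

/-- The isomorphism between the chiral and the classical operad. -/
def chiralIso : OperadIso 0 (chiralOperad 𝒱 (0 : V →ₗ[F] V)) (classicalOperad 𝒱 (0 : V →ₗ[F] V)) where
  equiv n _ := chiralEquiv F V n
  parity_iff _ _ p X := chiralEquiv_parity 𝒱 p X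
  one_iff _ X := chiralEquiv_one 𝒱 X
  act_iff _ _ σ X X' := chiralEquiv_act h𝒱 σ X X'
  comp_iff _ _ _ _ _ _ _ _ _ := isChiralComp_iff_isClassicalComp h𝒱

end Iso

end VertexOperad

end

noncomputable section

namespace VertexOperad

universe u v

/-! ### The filtration and the grading -/

section Filtration

variable {F : Type u} [Field F] {V : Type v} [AddCommGroup V] [Module F V] {n : ℕ}

/-- The filtration counts divisors and not pole orders: the graphs involved may have many edges, but
at most `p` different ones, which is too few to connect `n` vertices. -/
theorem DMap.eq_zero_of_mem_filOT {φ : OT F n →ₗ[F] Vn (0 : V →ₗ[F] V) n} (hφ : φ ∈ DMap F V n)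
    {p : ℤ} (hp : p + 1 < n) {f : OT F n} (hf : (f : Fun F (id : Fin n → Fin n)) ∈ filOT F n p) :
    φ f = 0 := by
  classical
  let K : Submodule F (Fun F (id : Fin n → Fin n)) :=
    (LinearMap.ker φ).map (OT F n).val.toLinearMap
  have hK : filOT F n p ≤ K := by
    refine Submodule.span_le.2 ?_
    rintro g ⟨S, hS, hg⟩
    have hset : {f | ∃ e ∈ S, e.1 ≠ e.2 ∧ f = Ring.inverse (z F (id : Fin n → Fin n) e.1 e.2)} =
        {f | ∃ e ∈ {e : Edge n | e.1 ∈ S},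
          f = (poleFun F (id : Fin n → Fin n) e : Fun F (id : Fin n → Fin n))} := by
      ext f
      constructor
      · rintro ⟨e, he, hne, rfl⟩
        exact ⟨⟨e, hne⟩, he, rfl⟩
      · rintro ⟨e, he, rfl⟩
        exact ⟨e.1, he, e.2, rfl⟩
    rw [hset] at hg
    refine adjoin_le_of_mul_z F (π := id) K ?_ ?_ hg
    · rintro k l _ ⟨h, hh, rfl⟩
      refine ⟨zOT F k l * h, ?_, rfl⟩
      change φ _ = 0
      rw [hφ.2, LinearMap.mem_ker.1 hh, map_zero]
    · intro E hE
      refine ⟨polesFun F id E, ?_, rfl⟩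
      obtain ⟨T, h1, h2, h3⟩ := exists_closedIn_of_card_lt (Γ := E)
        (s := Finset.univ.filter fun e : Edge n => e.1 ∈ S) (fun e he => by simpa using hE e he) (by
          have : (Finset.univ.filter fun e : Edge n => e.1 ∈ S).card ≤ S.card :=
            Finset.card_le_card_of_injOn (fun e => e.1) (fun e he => by simpa using he)
              fun _ _ _ _ h => Subtype.ext h
          omega)
      exact DMap.eq_zero_of_closedIn hφ h1 h2 h3
  obtain ⟨g, hg, hgf⟩ := hK hf
  rwa [← Subtype.ext hgf]

theorem graphFun_mem_filOT (Γ : NGraph n) :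
    (graphFun F Γ : Fun F (id : Fin n → Fin n)) ∈ filOT F n (Multiset.card Γ) := by
  classical
  refine Submodule.subset_span ⟨(Γ.map fun e => e.1).toFinset, ?_, ?_⟩
  · have := Multiset.toFinset_card_le (Γ.map fun e => e.1)
    rw [Multiset.card_map] at this
    exact_mod_cast this
  · rw [graphFun, ← Subalgebra.coe_val, map_multiset_prod, Multiset.map_map]
    refine multiset_prod_mem _ fun f hf => ?_
    obtain ⟨e, he, rfl⟩ := Multiset.mem_map.1 hf
    refine Algebra.subset_adjoin (Or.inr ⟨e.1, ?_, e.2, rfl⟩)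
    rw [Multiset.mem_toFinset]
    exact Multiset.mem_map_of_mem _ he

theorem trivialFil_of_neg {s : ℤ} (h : s < 0) : trivialFil F V s = ⊥ := if_pos h

theorem trivialFil_of_nonneg {s : ℤ} (h : 0 ≤ s) : trivialFil F V s = ⊤ := if_neg (not_lt.2 h)

theorem chiralFil_eq_top {r : ℤ} (hr : r ≤ n - 1) :
    chiralFil (0 : V →ₗ[F] V) (trivialFil F V) n r = ⊤ := by
  refine eq_top_iff.2 fun X _ s t p hs x f hx hf => ?_
  by_cases ht : ∃ i, t i < 0
  · obtain ⟨i, hi⟩ := ht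
    have h0 : x i = 0 := by
      have := hx i
      rwa [trivialFil_of_neg hi, Submodule.mem_bot] at this
    rw [MultilinearMap.map_coord_zero _ i h0]
    exact Submodule.zero_mem _
  · push Not at ht
    by_cases hsr : s - r < 0
    · have := Finset.sum_nonneg fun i (_ : i ∈ Finset.univ) => ht i
      rw [DMap.eq_zero_of_mem_filOT (mem_chiral_iff.1 X.2 x) (p := p) (by omega) hf]
      exact Submodule.zero_mem _
    · rw [trivialFil_of_nonneg (not_lt.1 hsr), subV_top]
      trivial

theorem chiralFil_eq_bot [CharZero F] (hn : 1 ≤ n) {r : ℤ} (hr : n ≤ r) :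
    chiralFil (0 : V →ₗ[F] V) (trivialFil F V) n r = ⊥ := by
  refine eq_bot_iff.2 fun X hX => (Submodule.mem_bot F).2 (Subtype.ext (MultilinearMap.ext fun x => ?_))
  refine DMap.ext (mem_chiral_iff.1 X.2 x) (Submodule.zero_mem _) fun Γ hΓ => ?_
  -- Tested with `s = p = n - 1` and `t = 0`: then `s - r < 0`, so the values on trees vanish.
  have h := hX (n - 1) 0 (n - 1) (by simp) x (graphFun F Γ)
    (fun i => by rw [Pi.zero_apply, trivialFil_of_nonneg le_rfl]; trivial)
    (by
      have := graphFun_mem_filOT (F := F) Γ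
      rw [hΓ] at this
      rwa [Nat.cast_sub hn, Nat.cast_one] at this)
  rw [trivialFil_of_neg (by omega), subV_bot, Submodule.mem_bot] at h
  rw [h]; rfl

theorem classicalGr_eq_top (hn : 1 ≤ n) {r : ℤ} (hr : r = n - 1) :
    classicalGr (0 : V →ₗ[F] V) (trivialGr F V) n r = ⊤ := by
  refine eq_top_iff.2 fun Y _ Γ t x hx => ?_
  by_cases ht : ∃ i, t i ≠ 0
  · obtain ⟨i, hi⟩ := ht
    have h0 : x i = 0 := by
      have := hx i
      rwa [trivialGr, if_neg hi, Submodule.mem_bot] at this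
    rw [MultilinearMap.map_coord_zero _ i h0]
    exact Submodule.zero_mem _
  · push Not at ht
    by_cases hc : Multiset.card Γ = n - 1
    · rw [trivialGr, if_pos (by simp only [ht, Finset.sum_const_zero]; omega), subV_top]
      trivial
    · have : Y.1 Γ x = 0 := CMap.eq_zero_of_card_ne (mem_classical_iff.1 Y.2 x) hc
      rw [this]
      exact Submodule.zero_mem _

theorem classicalGr_eq_bot (hn : 1 ≤ n) {r : ℤ} (hr : r ≠ n - 1) :
    classicalGr (0 : V →ₗ[F] V) (trivialGr F V) n r = ⊥ := by
  refine eq_bot_iff.2 fun Y hY => (Submodule.mem_bot F).2 (Subtype.ext (funext fun Γ =>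
    MultilinearMap.ext fun x => ?_))
  by_cases hc : Multiset.card Γ = n - 1
  · have h := hY Γ 0 x fun i => by rw [Pi.zero_apply, trivialGr, if_pos rfl]; trivial
    simp only [Pi.zero_apply, Finset.sum_const_zero, add_zero] at h
    rw [trivialGr, if_neg (by omega), subV_bot, Submodule.mem_bot] at h
    rw [h]; rfl
  · exact CMap.eq_zero_of_card_ne (mem_classical_iff.1 Y.2 x) hc

end Filtration

end VertexOperad

end

noncomputable section

namespace VertexOperad

/-! ### The Lie algebra of a torus -/

section Torus

variable {G : Type*} [AddCommMonoid G] {R : Type*} [CommRing R] (ω : G →+ G →+ R)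

/-- The bilinear map `(e_S f, e_T g) ↦ ω(S, T) e_{S + T} f g`. -/
def torusBracket : (G →₀ R) →ₗ[R] (G →₀ R) →ₗ[R] (G →₀ R) :=
  Finsupp.lsum R fun S => LinearMap.toSpanSingleton R _
    (Finsupp.lsum R fun T => ω S T • Finsupp.lsingle (S + T))

theorem torusBracket_single (S T : G) (f g : R) :
    torusBracket ω (Finsupp.single S f) (Finsupp.single T g) =
      Finsupp.single (S + T) (ω S T * f * g) := by
  simp only [torusBracket, Finsupp.lsum_single, LinearMap.toSpanSingleton_apply,
    LinearMap.smul_apply, Finsupp.lsingle_apply, Finsupp.smul_single, smul_eq_mul]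
  congr 1; ring

/-- The Lie algebra with basis `e_S` over `R` and the bracket `[e_S, e_T] = ω(S, T) e_{S + T}`, for an
alternating biadditive map `ω`. -/
def TorusLie (_ : ∀ S, ω S S = 0) : Type _ := G →₀ R

variable {ω} (hω : ∀ S, ω S S = 0)

instance : AddCommGroup (TorusLie ω hω) := inferInstanceAs (AddCommGroup (G →₀ R))

instance : Module R (TorusLie ω hω) := inferInstanceAs (Module R (G →₀ R))

instance : Bracket (TorusLie ω hω) (TorusLie ω hω) := ⟨fun a b => torusBracket ω a b⟩

/-- The element `e_S f`. -/
def torusSingle (S : G) : R →ₗ[R] TorusLie ω hω := Finsupp.lsingle S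

/-- The coefficient of `e_S`. -/
def torusCoeff (S : G) : TorusLie ω hω →ₗ[R] R := Finsupp.lapply S

theorem torusCoeff_single (S : G) (f : R) : torusCoeff hω S (torusSingle hω S f) = f :=
  Finsupp.single_eq_same

theorem torus_lie_single (S T : G) (f g : R) :
    ⁅torusSingle hω S f, torusSingle hω T g⁆ = torusSingle hω (S + T) (ω S T * f * g) :=
  torusBracket_single ω S T f g

theorem torus_induction {P : TorusLie ω hω → Prop} (h0 : P 0)
    (hadd : ∀ a b, P a → P b → P (a + b)) (h1 : ∀ S f, P (torusSingle hω S f)) (a) : P a :=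
  Finsupp.induction_linear (motive := P) a h0 hadd h1

include hω in
theorem torus_skew (S T : G) : ω S T = - ω T S := by
  have h := hω (S + T)
  simp only [map_add, AddMonoidHom.add_apply, hω, zero_add, add_zero] at h
  exact eq_neg_of_add_eq_zero_right h

theorem torus_add_lie (a b c : TorusLie ω hω) : ⁅a + b, c⁆ = ⁅a, c⁆ + ⁅b, c⁆ :=
   LinearMap.map_add₂ (torusBracket ω) (a : G →₀ R) b c

theorem torus_lie_add (a b c : TorusLie ω hω) : ⁅a, b + c⁆ = ⁅a, b⁆ + ⁅a, c⁆ :=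
  map_add (torusBracket ω a) (b : G →₀ R) c

theorem torus_zero_lie (a : TorusLie ω hω) : ⁅(0 : TorusLie ω hω), a⁆ = 0 :=
  LinearMap.map_zero₂ (torusBracket ω) (a : G →₀ R)

theorem torus_lie_zero (a : TorusLie ω hω) : ⁅a, (0 : TorusLie ω hω)⁆ = 0 :=
  map_zero (torusBracket ω a)

theorem torus_lie_skew (a b : TorusLie ω hω) : ⁅a, b⁆ = - ⁅b, a⁆ := by
  induction a using torus_induction with
  | h0 => rw [torus_zero_lie, torus_lie_zero, neg_zero]
  | hadd a a' ha ha' => rw [torus_add_lie, torus_lie_add, ha, ha', neg_add]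
  | h1 S f =>
    induction b using torus_induction with
    | h0 => rw [torus_zero_lie, torus_lie_zero, neg_zero]
    | hadd a a' ha ha' => rw [torus_add_lie, torus_lie_add, ha, ha', neg_add]
    | h1 T g =>
      rw [torus_lie_single, torus_lie_single, ← map_neg, add_comm, torus_skew hω S T]
      congr 1; ring

instance : LieRing (TorusLie ω hω) where
  add_lie := torus_add_lie hω
  lie_add := torus_lie_add hω
  lie_self a := by
    induction a using torus_induction with
    | h0 => exact torus_zero_lie hω _
    | hadd a a' ha ha' =>
      rw [torus_add_lie, torus_lie_add, torus_lie_add, ha, ha', torus_lie_skew hω a a']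
      simp
    | h1 S f => rw [torus_lie_single, hω, zero_mul, zero_mul, map_zero]
  leibniz_lie a b c := by
    induction a using torus_induction with
    | h0 => simp only [torus_zero_lie, torus_lie_zero, add_zero]
    | hadd a a' ha ha' =>
      simp only [torus_add_lie, torus_lie_add, ha, ha']; abel
    | h1 S f =>
      induction b using torus_induction with
      | h0 => simp only [torus_zero_lie, torus_lie_zero, add_zero]
      | hadd a a' ha ha' =>
        simp only [torus_add_lie, torus_lie_add, ha, ha']; abel
      | h1 T g =>
        induction c using torus_induction with
        | h0 => simp only [torus_lie_zero, add_zero]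
        | hadd a a' ha ha' =>
          simp only [torus_lie_add, ha, ha']; abel
        | h1 U h =>
          simp only [torus_lie_single]
          -- All three terms are multiples of `e_{S+T+U}`; the coefficients match because `ω` is
          -- biadditive and skew.
          rw [← add_assoc, add_left_comm T S U, ← add_assoc S T U, ← map_add]
          congr 1
          simp only [map_add, AddMonoidHom.add_apply]
          rw [torus_skew hω T S]
          ring

variable (F : Type*) [Field F] [Algebra F R]

instance : Module F (TorusLie ω hω) := inferInstanceAs (Module F (G →₀ R))

instance : IsScalarTower F R (TorusLie ω hω) := inferInstanceAs (IsScalarTower F R (G →₀ R))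

instance : LieAlgebra F (TorusLie ω hω) where
  lie_smul c a b := LinearMap.map_smul_of_tower (M := G →₀ R) (torusBracket ω a) c b

end Torus

end VertexOperad

end

noncomputable section

namespace VertexOperad

universe u

/-! ### Polynomials of Lie monomials -/

section EdgePoly

variable (F : Type u) [Field F] {n : ℕ}

/-- The variable `w_{ij} = X_{ij} - X_{ji}`. -/
def edgeVar (i j : Fin n) : MvPolynomial (Edge n) F :=
  if h : i ≠ j then MvPolynomial.X ⟨(i, j), h⟩ - MvPolynomial.X ⟨(j, i), h.symm⟩ else 0

theorem edgeVar_symm (i j : Fin n) : edgeVar F i j = - edgeVar F j i := by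
  by_cases h : i = j
  · simp [edgeVar, h]
  · rw [edgeVar, edgeVar, dif_pos h, dif_pos (Ne.symm h), neg_sub]

/-- The alternating form `∑_{i, j} S_i T_j w_{ij}`. -/
def edgeForm (n : ℕ) : (Fin n → ℕ) →+ (Fin n → ℕ) →+ MvPolynomial (Edge n) F where
  toFun S :=
    { toFun := fun T => ∑ i, ∑ j, (S i * T j) • edgeVar F i j
      map_zero' := by simp
      map_add' := fun T T' => by simp only [Pi.add_apply, mul_add, add_smul, Finset.sum_add_distrib] }
  map_zero' := by ext; simp
  map_add' S S' := by
    refine AddMonoidHom.ext fun T => ?_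
    simp [add_mul, add_smul, Finset.sum_add_distrib]

theorem edgeForm_apply (S T : Fin n → ℕ) :
    edgeForm F n S T = ∑ i, ∑ j, (S i * T j) • edgeVar F i j := rfl

theorem edgeForm_single (i j : Fin n) :
    edgeForm F n (Pi.single i 1) (Pi.single j 1) = edgeVar F i j := by
  classical
  rw [edgeForm_apply, Finset.sum_eq_single i, Finset.sum_eq_single j]
  · simp
  · intro k _ hk; simp [hk]
  · simp
  · intro k _ hk; simp [hk]
  · simp

/-- The indicator function of a set. -/
def ind (s : Finset (Fin n)) : Fin n → ℕ := ∑ i ∈ s, Pi.single i 1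

theorem edgeForm_ind (s t : Finset (Fin n)) :
    edgeForm F n (ind s) (ind t) = ∑ i ∈ s, ∑ j ∈ t, edgeVar F i j := by
  simp only [ind, map_sum, AddMonoidHom.finsetSum_apply, edgeForm_single]
  exact Finset.sum_comm

/-- The polynomials of Lie monomials. -/
inductive IsEdgeMonomial : Finset (Fin n) → MvPolynomial (Edge n) F → Prop
  | of (i : Fin n) : IsEdgeMonomial {i} 1
  | lie (s t : Finset (Fin n)) (p q : MvPolynomial (Edge n) F) (hst : Disjoint s t)
      (hp : IsEdgeMonomial s p) (hq : IsEdgeMonomial t q) :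
      IsEdgeMonomial (s ∪ t) ((∑ i ∈ s, ∑ j ∈ t, edgeVar F i j) * p * q)

variable [CharZero F]

theorem edgeForm_self (S : Fin n → ℕ) : edgeForm F n S S = 0 := by
  have h : edgeForm F n S S = - edgeForm F n S S := by
    rw [edgeForm_apply, ← Finset.sum_neg_distrib]
    conv_lhs => rw [Finset.sum_comm]
    refine Finset.sum_congr rfl fun i _ => ?_
    rw [← Finset.sum_neg_distrib]
    refine Finset.sum_congr rfl fun j _ => ?_
    rw [edgeVar_symm, smul_neg, mul_comm]
  exact self_eq_neg.1 h

variable (n) in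
/-- The homomorphism from the free Lie algebra to the Lie algebra of a torus. -/
def lieEval : FreeLieAlgebra F (Fin n) →ₗ⁅F⁆ TorusLie (edgeForm F n) (edgeForm_self F) :=
  FreeLieAlgebra.lift F fun i => torusSingle (edgeForm_self F) (Pi.single i 1) 1

theorem lieEval_of (i : Fin n) :
    lieEval F n (FreeLieAlgebra.of F i) = torusSingle (edgeForm_self F) (Pi.single i 1) 1 :=
  FreeLieAlgebra.lift_of_apply _ i

variable (n) in
/-- The coefficient at `e_{(1, …, 1)}`. -/
def lieCoeff : FreeLieAlgebra F (Fin n) →ₗ[F] MvPolynomial (Edge n) F :=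
  (torusCoeff (edgeForm_self F) (ind Finset.univ)).restrictScalars F ∘ₗ
    (lieEval F n : FreeLieAlgebra F (Fin n) →ₗ[F] _)

variable {F}

/-- A bracket of monomials in disjoint sets `s` and `t` multiplies their polynomials by `ω(1_s,
1_t)`, the sum of the `w_ij` with `i ∈ s` and `j ∈ t`. -/
theorem exists_isEdgeMonomial {s : Finset (Fin n)} {a : FreeLieAlgebra F (Fin n)}
    (h : IsLieMonomial F s a) : ∃ p, IsEdgeMonomial F s p ∧
      lieEval F n a = torusSingle (edgeForm_self F) (ind s) p := by
  induction h with
  | of i => exact ⟨1, .of i, by rw [lieEval_of, ind, Finset.sum_singleton]⟩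
  | lie s t a b hst _ _ ha hb =>
    obtain ⟨p, hp, hp'⟩ := ha
    obtain ⟨q, hq, hq'⟩ := hb
    refine ⟨_, .lie s t p q hst hp hq, ?_⟩
    rw [LieHom.map_lie, hp', hq', torus_lie_single, edgeForm_ind, ind, ind, ind,
      Finset.sum_union hst]

theorem lieCoeff_eq {a : FreeLieAlgebra F (Fin n)} {p : MvPolynomial (Edge n) F}
    (h : lieEval F n a = torusSingle (edgeForm_self F) (ind Finset.univ) p) : lieCoeff F n a = p := by
  change torusCoeff (edgeForm_self F) (ind Finset.univ) (lieEval F n a) = p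
  rw [h, torusCoeff_single]

variable {N : ℕ} {f : Fin n → FreeLieAlgebra F (Fin N)} {S : Fin n → Fin N → ℕ}
  {c : Fin n → MvPolynomial (Edge N) F} {θ : MvPolynomial (Edge n) F →ₐ[F] MvPolynomial (Edge N) F}
  (hf : ∀ i, lieEval F N (f i) = torusSingle (edgeForm_self F) (S i) (c i))
  (hθ : ∀ i j, i ≠ j → θ (edgeVar F i j) = edgeForm F N (S i) (S j))
include hf hθ

/-- Replacing `x_i` by an element `c_i e_{S_i}` turns `w_ij` into `ω(S_i, S_j)` in every bracket
factor; by multilinearity each `c_i` enters exactly once and only pairs `i ≠ j` occur. -/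
theorem lieEval_lift_monomial {s : Finset (Fin n)} {a : FreeLieAlgebra F (Fin n)}
    (h : IsLieMonomial F s a) :
    ∃ p, lieEval F n a = torusSingle (edgeForm_self F) (ind s) p ∧
      lieEval F N (FreeLieAlgebra.lift F f a) =
        torusSingle (edgeForm_self F) (∑ i ∈ s, S i) (θ p * ∏ i ∈ s, c i) := by
  induction h with
  | of i =>
    refine ⟨1, by rw [lieEval_of, ind, Finset.sum_singleton], ?_⟩
    rw [FreeLieAlgebra.lift_of_apply, hf, Finset.sum_singleton, Finset.prod_singleton, map_one, one_mul]
  | lie s t a b hst _ _ ha hb =>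
    obtain ⟨p, hp, hp'⟩ := ha
    obtain ⟨q, hq, hq'⟩ := hb
    refine ⟨(∑ i ∈ s, ∑ j ∈ t, edgeVar F i j) * p * q, ?_, ?_⟩
    · rw [LieHom.map_lie, hp, hq, torus_lie_single, edgeForm_ind, ind, ind, ind,
        Finset.sum_union hst]
    · have h1 : θ (∑ i ∈ s, ∑ j ∈ t, edgeVar F i j) =
          edgeForm F N (∑ i ∈ s, S i) (∑ j ∈ t, S j) := by
        simp only [map_sum, AddMonoidHom.finsetSum_apply]
        rw [Finset.sum_comm]
        refine Finset.sum_congr rfl fun j hj => Finset.sum_congr rfl fun i hi => hθ i j ?_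
        rintro rfl
        exact (Finset.disjoint_left.1 hst hi) hj
      rw [LieHom.map_lie, LieHom.map_lie, hp', hq', torus_lie_single, Finset.sum_union hst,
        Finset.prod_union hst, map_mul θ, map_mul θ, h1]
      refine congrArg (torusSingle _ _) ?_
      generalize edgeForm F N (∑ i ∈ s, S i) (∑ j ∈ t, S j) = A
      ring

/-- The polynomials of substitutions. -/
theorem lieEval_lift {a : FreeLieAlgebra F (Fin n)} (ha : a ∈ lieMultilinear F n) :
    lieEval F N (FreeLieAlgebra.lift F f a) =
      torusSingle (edgeForm_self F) (∑ i, S i) (θ (lieCoeff F n a) * ∏ i, c i) := by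
  induction ha using Submodule.span_induction with
  | mem a ha =>
    obtain ⟨p, hp, hp'⟩ := lieEval_lift_monomial hf hθ ha
    rw [lieCoeff_eq hp, hp']
  | zero => simp
  | add a b _ _ ha hb => rw [map_add, map_add, map_add, map_add, ha, hb, add_mul, map_add]
  | smul r a _ ha =>
    rw [map_smul, map_smul, map_smul, map_smul, ha, smul_mul_assoc]
    exact (LinearMap.map_smul_of_tower (torusSingle (edgeForm_self F) _) r _).symm

end EdgePoly

end VertexOperad

end

noncomputable section

namespace VertexOperad

universe u

/-! ### The pairing of graphs and Lie elements -/

section GraphDeriv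

variable (F : Type u) [Field F] {n : ℕ}

theorem pderiv_comm {σ : Type*} (i j : σ) (p : MvPolynomial σ F) :
    MvPolynomial.pderiv i (MvPolynomial.pderiv j p) =
      MvPolynomial.pderiv j (MvPolynomial.pderiv i p) := by
  classical
  have : ⁅(MvPolynomial.pderiv i : Derivation F (MvPolynomial σ F) (MvPolynomial σ F)),
      (MvPolynomial.pderiv j : Derivation F (MvPolynomial σ F) (MvPolynomial σ F))⁆ = 0 := by
    refine MvPolynomial.derivation_ext fun k => ?_
    rw [Derivation.commutator_apply, MvPolynomial.pderiv_X, MvPolynomial.pderiv_X, Pi.single_apply,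
      Pi.single_apply]
    split_ifs <;> simp
  have h := DFunLike.congr_fun this p
  rw [Derivation.commutator_apply] at h
  exact sub_eq_zero.1 h

instance : LeftCommutative fun (e : Edge n)
    (A : MvPolynomial (Edge n) F →ₗ[F] MvPolynomial (Edge n) F) =>
    (MvPolynomial.pderiv e).toLinearMap ∘ₗ A :=
  ⟨fun e e' A => LinearMap.ext fun p => pderiv_comm F e e' (A p)⟩

/-- The differential operator `∏_e ∂/∂X_e`, the product being over the edges of a graph. -/
def graphDeriv (Γ : NGraph n) : MvPolynomial (Edge n) F →ₗ[F] MvPolynomial (Edge n) F :=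
  Γ.foldr (fun e A => (MvPolynomial.pderiv e).toLinearMap ∘ₗ A) LinearMap.id

theorem graphDeriv_zero (p : MvPolynomial (Edge n) F) : graphDeriv F 0 p = p := rfl

theorem graphDeriv_cons (e : Edge n) (Γ : NGraph n) (p : MvPolynomial (Edge n) F) :
    graphDeriv F (e ::ₘ Γ) p = MvPolynomial.pderiv e (graphDeriv F Γ p) := by
  rw [graphDeriv, Multiset.foldr_cons]; rfl

theorem graphDeriv_add (Γ Γ' : NGraph n) (p : MvPolynomial (Edge n) F) :
    graphDeriv F (Γ + Γ') p = graphDeriv F Γ (graphDeriv F Γ' p) := by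
  induction Γ using Multiset.induction_on with
  | empty => rw [zero_add, graphDeriv_zero]
  | cons e Γ ih => rw [Multiset.cons_add, graphDeriv_cons, graphDeriv_cons, ih]

theorem graphDeriv_edg {i j : Fin n} (h : i ≠ j) (p : MvPolynomial (Edge n) F) :
    graphDeriv F (edg i j) p = MvPolynomial.pderiv ⟨(i, j), h⟩ p := by
  rw [edg_of_ne h, ← Multiset.cons_zero, graphDeriv_cons, graphDeriv_zero]

/-- The coefficient of a polynomial at a graph. -/
def graphCoeff (Γ : NGraph n) : MvPolynomial (Edge n) F →ₗ[F] F :=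
  (MvPolynomial.aeval fun _ => (0 : F)).toLinearMap ∘ₗ graphDeriv F Γ

theorem graphCoeff_apply (Γ : NGraph n) (p : MvPolynomial (Edge n) F) :
    graphCoeff F Γ p = MvPolynomial.aeval (fun _ => (0 : F)) (graphDeriv F Γ p) := rfl

theorem graphCoeff_add (Γ Γ' : NGraph n) (p : MvPolynomial (Edge n) F) :
    graphCoeff F (Γ + Γ') p = graphCoeff F Γ (graphDeriv F Γ' p) := by
  rw [graphCoeff_apply, graphDeriv_add, graphCoeff_apply]

/-! ### Derivatives of the polynomials of Lie monomials -/

/-- The subalgebra generated by the `w_{ij}` with `i, j ∈ s`. -/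
def edgeAlg (s : Finset (Fin n)) : Subalgebra F (MvPolynomial (Edge n) F) :=
  Algebra.adjoin F {p | ∃ i ∈ s, ∃ j ∈ s, p = edgeVar F i j}

variable {F}

theorem edgeAlg_mono {s t : Finset (Fin n)} (h : s ⊆ t) : edgeAlg F s ≤ edgeAlg F t :=
  Algebra.adjoin_mono fun _ ⟨i, hi, j, hj, hp⟩ => ⟨i, h hi, j, h hj, hp⟩

theorem edgeVar_mem {s : Finset (Fin n)} {i j : Fin n} (hi : i ∈ s) (hj : j ∈ s) :
    edgeVar F i j ∈ edgeAlg F s := Algebra.subset_adjoin ⟨i, hi, j, hj, rfl⟩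

theorem IsEdgeMonomial.mem {s : Finset (Fin n)} {p : MvPolynomial (Edge n) F}
    (h : IsEdgeMonomial F s p) : p ∈ edgeAlg F s := by
  induction h with
  | of i => exact Subalgebra.one_mem _
  | lie s t p q _ _ _ hp hq =>
    refine Subalgebra.mul_mem _ (Subalgebra.mul_mem _ ?_ (edgeAlg_mono Finset.subset_union_left hp))
      (edgeAlg_mono Finset.subset_union_right hq)
    exact Subalgebra.sum_mem _ fun i hi => Subalgebra.sum_mem _ fun j hj =>
      edgeVar_mem (Finset.mem_union_left _ hi) (Finset.mem_union_right _ hj)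

theorem pderiv_edgeVar {a b : Fin n} (hab : a ≠ b) (i j : Fin n) :
    MvPolynomial.pderiv ⟨(a, b), hab⟩ (edgeVar F i j) =
      (if i = a ∧ j = b then 1 else 0) - (if i = b ∧ j = a then 1 else 0) := by
  classical
  by_cases h : i = j
  · subst h
    rw [edgeVar, dif_neg (by simp), map_zero, if_neg fun h => hab (h.1.symm.trans h.2),
      if_neg fun h => hab (h.2.symm.trans h.1), sub_zero]
  · rw [edgeVar, dif_pos h, map_sub, MvPolynomial.pderiv_X, MvPolynomial.pderiv_X, Pi.single_apply,
      Pi.single_apply]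
    simp only [Subtype.mk.injEq, Prod.mk.injEq]
    congr 1
    simp only [and_comm]

theorem derivation_edgeAlg {s : Finset (Fin n)}
    (D : Derivation F (MvPolynomial (Edge n) F) (MvPolynomial (Edge n) F))
    (hD : ∀ i ∈ s, ∀ j ∈ s, D (edgeVar F i j) = 0) {p : MvPolynomial (Edge n) F}
    (hp : p ∈ edgeAlg F s) : D p = 0 := by
  induction hp using Algebra.adjoin_induction with
  | mem x hx =>
    obtain ⟨i, hi, j, hj, rfl⟩ := hx
    exact hD i hi j hj
  | algebraMap r => exact D.map_algebraMap r
  | add x y _ _ hx hy => rw [map_add, hx, hy, add_zero]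
  | mul x y _ _ hx hy => rw [D.leibniz, hx, hy, smul_zero, smul_zero, add_zero]

theorem pderiv_edgeAlg_of_notMem {s : Finset (Fin n)} {a b : Fin n} (hab : a ≠ b)
    (h : ¬ (a ∈ s ∧ b ∈ s)) {p : MvPolynomial (Edge n) F} (hp : p ∈ edgeAlg F s) :
    MvPolynomial.pderiv ⟨(a, b), hab⟩ p = 0 := by
  refine derivation_edgeAlg _ (fun i hi j hj => ?_) hp
  rw [pderiv_edgeVar, if_neg, if_neg, sub_zero]
  · rintro ⟨rfl, rfl⟩; exact h ⟨hj, hi⟩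
  · rintro ⟨rfl, rfl⟩; exact h ⟨hi, hj⟩

theorem pderiv_flip {s : Finset (Fin n)} {a b : Fin n} (hab : a ≠ b) {p : MvPolynomial (Edge n) F}
    (hp : p ∈ edgeAlg F s) : MvPolynomial.pderiv ⟨(a, b), hab⟩ p =
      - MvPolynomial.pderiv ⟨(b, a), hab.symm⟩ p := by
  have := derivation_edgeAlg (MvPolynomial.pderiv (R := F) (⟨(a, b), hab⟩ : Edge n) +
    MvPolynomial.pderiv (⟨(b, a), hab.symm⟩ : Edge n)) (fun i _ j _ => ?_) hp
  · exact eq_neg_of_add_eq_zero_left this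
  · rw [Derivation.add_apply, pderiv_edgeVar, pderiv_edgeVar]; ring

/-- The derivative of `∑_{i ∈ s, j ∈ t} w_{ij}` with respect to `w_{ab}`. -/
def crossSign (F : Type u) [Field F] (s t : Finset (Fin n)) (a b : Fin n) :
    MvPolynomial (Edge n) F :=
  (if a ∈ s ∧ b ∈ t then 1 else 0) - (if b ∈ s ∧ a ∈ t then 1 else 0)

theorem crossSign_symm (s t : Finset (Fin n)) (a b : Fin n) :
    crossSign F s t a b = - crossSign F s t b a := by
  rw [crossSign, crossSign, neg_sub]

theorem pderiv_crossSign (e : Edge n) (s t : Finset (Fin n)) (a b : Fin n) :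
    MvPolynomial.pderiv e (crossSign F s t a b) = 0 := by
  rw [crossSign, map_sub]
  split_ifs <;> simp

theorem pderiv_sum_edgeVar {s t : Finset (Fin n)} {a b : Fin n} (hab : a ≠ b) :
    MvPolynomial.pderiv ⟨(a, b), hab⟩ (∑ i ∈ s, ∑ j ∈ t, edgeVar F i j) = crossSign F s t a b := by
  simp only [map_sum, pderiv_edgeVar, Finset.sum_sub_distrib, crossSign]
  simp only [ite_and, Finset.sum_ite_eq', Finset.sum_ite_irrel, Finset.sum_const_zero]

theorem pderiv_pderiv_lie {s t : Finset (Fin n)} (p q : MvPolynomial (Edge n) F) {a b c d : Fin n}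
    (hab : a ≠ b) (hcd : c ≠ d) :
    MvPolynomial.pderiv ⟨(a, b), hab⟩ (MvPolynomial.pderiv ⟨(c, d), hcd⟩
      ((∑ i ∈ s, ∑ j ∈ t, edgeVar F i j) * p * q)) =
    crossSign F s t c d * (MvPolynomial.pderiv ⟨(a, b), hab⟩ p * q +
        p * MvPolynomial.pderiv ⟨(a, b), hab⟩ q) +
      crossSign F s t a b * (MvPolynomial.pderiv ⟨(c, d), hcd⟩ p * q +
        p * MvPolynomial.pderiv ⟨(c, d), hcd⟩ q) +
      (∑ i ∈ s, ∑ j ∈ t, edgeVar F i j) *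
        (MvPolynomial.pderiv ⟨(a, b), hab⟩ (MvPolynomial.pderiv ⟨(c, d), hcd⟩ p) * q +
          MvPolynomial.pderiv ⟨(c, d), hcd⟩ p * MvPolynomial.pderiv ⟨(a, b), hab⟩ q +
          MvPolynomial.pderiv ⟨(a, b), hab⟩ p * MvPolynomial.pderiv ⟨(c, d), hcd⟩ q +
          p * MvPolynomial.pderiv ⟨(a, b), hab⟩ (MvPolynomial.pderiv ⟨(c, d), hcd⟩ q)) := by
  simp only [Derivation.leibniz, map_add, pderiv_sum_edgeVar, pderiv_crossSign, smul_eq_mul]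
  ring

/-- Where the derivative of `p` along `a → b` is non-zero, `a` and `b` lie both in `s` or both in
`t`, and then their signs relative to `c` agree. -/
theorem crossSign_mul_pderiv {s t : Finset (Fin n)} (hst : Disjoint s t) {p : MvPolynomial (Edge n) F}
    (hp : p ∈ edgeAlg F s ∨ p ∈ edgeAlg F t) {a b : Fin n} (hab : a ≠ b) (c : Fin n) :
    (crossSign F s t a c - crossSign F s t b c) * MvPolynomial.pderiv ⟨(a, b), hab⟩ p = 0 := by
  have hd : ∀ i, i ∈ s → i ∉ t := fun i hi => Finset.disjoint_left.1 hst hi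
  rcases hp with hp | hp
  · by_cases h : a ∈ s ∧ b ∈ s
    · simp [crossSign, h.1, h.2, hd a h.1, hd b h.2]
    · rw [pderiv_edgeAlg_of_notMem hab h hp, mul_zero]
  · by_cases h : a ∈ t ∧ b ∈ t
    · have ha : a ∉ s := fun h' => hd a h' h.1
      have hb : b ∉ s := fun h' => hd b h' h.2
      simp [crossSign, h.1, h.2, ha, hb]
    · rw [pderiv_edgeAlg_of_notMem hab h hp, mul_zero]

theorem crossSign_mul_pderiv_self {s t : Finset (Fin n)} (hst : Disjoint s t)
    {p : MvPolynomial (Edge n) F} (hp : p ∈ edgeAlg F s ∨ p ∈ edgeAlg F t) {a b : Fin n}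
    (hab : a ≠ b) : crossSign F s t a b * MvPolynomial.pderiv ⟨(a, b), hab⟩ p = 0 := by
  have := crossSign_mul_pderiv hst hp hab b
  have h : crossSign F s t b b = 0 := sub_self _
  rwa [h, sub_zero] at this

/-- The common vertex `v` of the two edges cannot lie both in `s` and in `t`. -/
theorem pderiv_mul_pderiv {s t : Finset (Fin n)} (hst : Disjoint s t) {p q : MvPolynomial (Edge n) F}
    (hp : p ∈ edgeAlg F s) (hq : q ∈ edgeAlg F t) {e e' : Edge n} (v : Fin n)
    (h : v = e.1.1 ∨ v = e.1.2) (h' : v = e'.1.1 ∨ v = e'.1.2) :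
    MvPolynomial.pderiv e p * MvPolynomial.pderiv e' q = 0 := by
  by_cases hv : v ∈ s
  · have hv' : v ∉ t := Finset.disjoint_left.1 hst hv
    have : MvPolynomial.pderiv e' q = 0 := pderiv_edgeAlg_of_notMem e'.2
      (by rintro ⟨h1, h2⟩; rcases h' with rfl | rfl <;> contradiction) hq
    rw [this, mul_zero]
  · have : MvPolynomial.pderiv e p = 0 := pderiv_edgeAlg_of_notMem e.2
      (by rintro ⟨h1, h2⟩; rcases h with rfl | rfl <;> contradiction) hp
    rw [this, zero_mul]

/-- The variable `w_ab` enters only through the one bracket that joins `a` and `b`, and there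
linearly. -/
theorem IsEdgeMonomial.double {s : Finset (Fin n)} {p : MvPolynomial (Edge n) F}
    (h : IsEdgeMonomial F s p) (e : Edge n) :
    MvPolynomial.pderiv e (MvPolynomial.pderiv e p) = 0 := by
  obtain ⟨⟨a, b⟩, hab⟩ := e
  induction h with
  | of i => simp
  | lie s t p q hst hp hq ihp ihq =>
    have h1 := crossSign_mul_pderiv_self hst (Or.inl hp.mem) hab
    have h2 := crossSign_mul_pderiv_self hst (Or.inr hq.mem) hab
    have h3 := pderiv_mul_pderiv hst hp.mem hq.mem (e := ⟨(a, b), hab⟩) (e' := ⟨(a, b), hab⟩) a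
      (Or.inl rfl) (Or.inl rfl)
    rw [pderiv_pderiv_lie, ihp, ihq]
    linear_combination 2 * q * h1 + 2 * p * h2 + 2 * (∑ i ∈ s, ∑ j ∈ t, edgeVar F i j) * h3

/-- Under the Leibniz rule, terms with both derivatives on one factor are handled by induction, and
products of derivatives of `p` and of `q` vanish since the two edges share a vertex. When one
derivative hits the bracket factor, the three relations combine into differences of signs covered by
`crossSign_mul_pderiv`. -/
theorem IsEdgeMonomial.arnold {s : Finset (Fin n)} {p : MvPolynomial (Edge n) F}
    (h : IsEdgeMonomial F s p) {v a b : Fin n} (hva : v ≠ a) (hvb : v ≠ b) (hab : a ≠ b) :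
    MvPolynomial.pderiv ⟨(v, a), hva⟩ (MvPolynomial.pderiv ⟨(v, b), hvb⟩ p) =
      MvPolynomial.pderiv ⟨(v, a), hva⟩ (MvPolynomial.pderiv ⟨(a, b), hab⟩ p) +
        MvPolynomial.pderiv ⟨(v, b), hvb⟩ (MvPolynomial.pderiv ⟨(b, a), hab.symm⟩ p) := by
  induction h with
  | of i => simp
  | lie s t p q hst hp hq ihp ihq =>
    have hx : ∀ (e e' : Edge n) (v : Fin n), (v = e.1.1 ∨ v = e.1.2) → (v = e'.1.1 ∨ v = e'.1.2) →
        MvPolynomial.pderiv e p * MvPolynomial.pderiv e' q = 0 := fun e e' v h h' =>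
      pderiv_mul_pderiv hst hp.mem hq.mem v h h'
    have hc : ∀ (x y : Fin n) (hxy : x ≠ y) (c : Fin n),
        (crossSign F s t x c - crossSign F s t y c) * (MvPolynomial.pderiv ⟨(x, y), hxy⟩ p * q +
          p * MvPolynomial.pderiv ⟨(x, y), hxy⟩ q) = 0 := by
      intro x y hxy c
      linear_combination q * crossSign_mul_pderiv hst (Or.inl hp.mem) hxy c +
        p * crossSign_mul_pderiv hst (Or.inr hq.mem) hxy c
    have c1 := hc v a hva b
    have c2 := hc v b hvb a
    have c3 := hc a b hab v
    rw [crossSign_symm s t a v, crossSign_symm s t b v] at c3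
    rw [pderiv_pderiv_lie, pderiv_pderiv_lie, pderiv_pderiv_lie]
    have fp := pderiv_flip hab.symm hp.mem
    have fq := pderiv_flip hab.symm hq.mem
    have x1 := hx ⟨(v, a), hva⟩ ⟨(v, b), hvb⟩ v (Or.inl rfl) (Or.inl rfl)
    have x2 := hx ⟨(v, b), hvb⟩ ⟨(v, a), hva⟩ v (Or.inl rfl) (Or.inl rfl)
    have x3 := hx ⟨(v, a), hva⟩ ⟨(a, b), hab⟩ a (Or.inr rfl) (Or.inl rfl)
    have x4 := hx ⟨(a, b), hab⟩ ⟨(v, a), hva⟩ a (Or.inl rfl) (Or.inr rfl)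
    have x5 := hx ⟨(v, b), hvb⟩ ⟨(b, a), hab.symm⟩ b (Or.inr rfl) (Or.inl rfl)
    have x6 := hx ⟨(b, a), hab.symm⟩ ⟨(v, b), hvb⟩ b (Or.inl rfl) (Or.inr rfl)
    rw [fp] at x6
    rw [fq] at x5
    rw [ihp, ihq, fp, fq]
    set Ω : MvPolynomial (Edge n) F := ∑ i ∈ s, ∑ j ∈ t, edgeVar F i j
    linear_combination c1 + c2 + c3 + Ω * (x1 + x2 - x3 - x4 - x5 - x6)

/-- The substitution `w_{ij} ↦ 0` for `i ∈ S`, `j ∉ S`. -/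
def cutHom (F : Type u) [Field F] (S : Finset (Fin n)) :
    MvPolynomial (Edge n) F →ₐ[F] MvPolynomial (Edge n) F :=
  MvPolynomial.aeval fun e => if e.1.1 ∈ S ↔ e.1.2 ∈ S then MvPolynomial.X e else 0

theorem cutHom_edgeVar {S : Finset (Fin n)} {i j : Fin n} (h : ¬ (i ∈ S ↔ j ∈ S)) :
    cutHom F S (edgeVar F i j) = 0 := by
  have hij : i ≠ j := by rintro rfl; exact h Iff.rfl
  rw [edgeVar, dif_pos hij, map_sub, cutHom, MvPolynomial.aeval_X, MvPolynomial.aeval_X, if_neg h,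
    if_neg fun h' => h h'.symm, sub_zero]

/-- Some bracket is the first to mix `S` with its complement: one of its sides lies in `S` and the
other outside, so all the variables in its factor are set to zero. -/
theorem IsEdgeMonomial.cutHom_eq_zero {s : Finset (Fin n)} {p : MvPolynomial (Edge n) F}
    (h : IsEdgeMonomial F s p) {S : Finset (Fin n)} (h1 : ∃ i ∈ s, i ∈ S) (h2 : ∃ i ∈ s, i ∉ S) :
    cutHom F S p = 0 := by
  induction h with
  | of i => simp only [Finset.mem_singleton, exists_eq_left] at h1 h2; exact absurd h1 h2
  | lie s t p q hst hp hq ihp ihq =>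
    rw [map_mul, map_mul]
    by_cases hs : (∃ i ∈ s, i ∈ S) ∧ ∃ i ∈ s, i ∉ S
    · rw [ihp hs.1 hs.2, mul_zero, zero_mul]
    by_cases ht : (∃ i ∈ t, i ∈ S) ∧ ∃ i ∈ t, i ∉ S
    · rw [ihq ht.1 ht.2, mul_zero]
    have : cutHom F S (∑ i ∈ s, ∑ j ∈ t, edgeVar F i j) = 0 := by
      simp only [map_sum]
      refine Finset.sum_eq_zero fun i hi => Finset.sum_eq_zero fun j hj => cutHom_edgeVar ?_
      intro hij
      obtain ⟨a, ha, ha'⟩ := h1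
      obtain ⟨b, hb, hb'⟩ := h2
      rw [Finset.mem_union] at ha hb
      by_cases hiS : i ∈ S
      · have hjS := hij.1 hiS
        rcases hb with hb | hb
        · exact hs ⟨⟨i, hi, hiS⟩, b, hb, hb'⟩
        · exact ht ⟨⟨j, hj, hjS⟩, b, hb, hb'⟩
      · have hjS : j ∉ S := fun h => hiS (hij.2 h)
        rcases ha with ha | ha
        · exact hs ⟨⟨a, ha, ha'⟩, i, hi, hiS⟩
        · exact ht ⟨⟨a, ha, ha'⟩, j, hj, hjS⟩
    rw [this, zero_mul, zero_mul]

theorem pderiv_algHom {σ τ : Type*} (φ : MvPolynomial σ F →ₐ[F] MvPolynomial τ F) (e : τ)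
    (D : Derivation F (MvPolynomial σ F) (MvPolynomial σ F))
    (h : ∀ k, MvPolynomial.pderiv e (φ (MvPolynomial.X k)) = φ (D (MvPolynomial.X k)))
    (p : MvPolynomial σ F) : MvPolynomial.pderiv e (φ p) = φ (D p) := by
  induction p using MvPolynomial.induction_on with
  | C a =>
    rw [← MvPolynomial.algebraMap_eq, AlgHom.commutes, Derivation.map_algebraMap,
      Derivation.map_algebraMap, map_zero]
  | add p q hp hq => rw [map_add, map_add, hp, hq, map_add, map_add]
  | mul_X p k hp =>
    rw [map_mul, Derivation.leibniz, Derivation.leibniz, hp, h, map_add]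
    simp only [smul_eq_mul, map_mul]

theorem graphDeriv_cutHom {S : Finset (Fin n)} {Γ : NGraph n} (hΓ : ClosedIn Γ S)
    (p : MvPolynomial (Edge n) F) :
    graphDeriv F Γ (cutHom F S p) = cutHom F S (graphDeriv F Γ p) := by
  classical
  induction Γ using Multiset.induction_on with
  | empty => rfl
  | cons e Γ ih =>
    rw [graphDeriv_cons, graphDeriv_cons, ih fun e' he' => hΓ e' (Multiset.mem_cons_of_mem he')]
    refine pderiv_algHom _ _ _ (fun k => ?_) _
    have he := hΓ e (Multiset.mem_cons_self e Γ)
    rw [cutHom, MvPolynomial.aeval_X, MvPolynomial.pderiv_X, Pi.single_apply]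
    by_cases hk : k = e
    · subst hk; rw [if_pos he, if_pos rfl, MvPolynomial.pderiv_X_self, map_one]
    · rw [if_neg hk, map_zero]
      split_ifs
      · rw [MvPolynomial.pderiv_X_of_ne hk]
      · rw [map_zero]

theorem aeval_zero_algHom {σ τ : Type*} (φ : MvPolynomial σ F →ₐ[F] MvPolynomial τ F)
    (h : ∀ k, MvPolynomial.aeval (fun _ => (0 : F)) (φ (MvPolynomial.X k)) = 0)
    (p : MvPolynomial σ F) : MvPolynomial.aeval (fun _ => (0 : F)) (φ p) =
      MvPolynomial.aeval (fun _ => (0 : F)) p := by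
  have : (MvPolynomial.aeval fun _ => (0 : F)).comp φ = MvPolynomial.aeval fun _ => (0 : F) := by
    refine MvPolynomial.algHom_ext fun k => ?_
    rw [AlgHom.comp_apply, h, MvPolynomial.aeval_X]
  exact DFunLike.congr_fun this p

theorem IsEdgeMonomial.treeLike {p : MvPolynomial (Edge n) F}
    (h : IsEdgeMonomial F Finset.univ p) : TreeLike fun Γ => graphCoeff F Γ p where
  flip Γ i j hij := by
    rw [graphCoeff_add, graphCoeff_add, graphDeriv_edg F hij, graphDeriv_edg F hij.symm,
      pderiv_flip hij h.mem, map_neg]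
  arnold Γ v a b h1 h2 h3 := by
    rw [add_assoc, add_assoc, add_assoc, graphCoeff_add, graphCoeff_add, graphCoeff_add,
      graphDeriv_add, graphDeriv_add, graphDeriv_add]
    simp only [graphDeriv_edg F h1, graphDeriv_edg F h2, graphDeriv_edg F h3,
      graphDeriv_edg F h3.symm]
    rw [h.arnold h1 h2 h3, map_add]
  disc Γ S h1 h2 h3 := by
    have h4 : cutHom F S p = 0 := by
      refine h.cutHom_eq_zero ?_ ?_
      · obtain ⟨i, hi⟩ := h1
        exact ⟨i, Finset.mem_univ i, hi⟩
      · by_contra! h'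
        exact h2 (Finset.eq_univ_of_forall fun i => h' i (Finset.mem_univ i))
    -- No edge of `Γ` crosses `S`, so the crossing variables may be set to zero before
    -- differentiating.
    rw [graphCoeff_apply, ← aeval_zero_algHom (cutHom F S), ← graphDeriv_cutHom h3, h4, map_zero,
      map_zero]
    intro k
    rw [cutHom, MvPolynomial.aeval_X]
    split_ifs <;> simp
  double Γ e he := by
    obtain ⟨Γ', rfl⟩ := Multiset.exists_cons_of_mem he
    rw [graphCoeff_apply, Multiset.cons_add, ← Multiset.add_cons, graphDeriv_add,
      ← Multiset.cons_zero, graphDeriv_cons, graphDeriv_cons, graphDeriv_zero, h.double, map_zero,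
      map_zero]

end GraphDeriv

end VertexOperad

end

noncomputable section

namespace VertexOperad

universe u

/-! ### Duality of paths and left-normed brackets -/

section Pairing

variable {F : Type u} [Field F] {n : ℕ}

theorem TreeLike.zero {M : Type*} [AddCommGroup M] : TreeLike fun _ : NGraph n => (0 : M) :=
  ⟨by simp, by simp, by simp, by simp⟩

theorem TreeLike.add {M : Type*} [AddCommGroup M] {y y' : NGraph n → M} (hy : TreeLike y)
    (hy' : TreeLike y') : TreeLike fun Γ => y Γ + y' Γ := by
  have := hy.sub (hy'.comp (-AddMonoidHom.id M))
  convert this using 1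
  funext Γ
  simp

variable [CharZero F]

/-- The pairing of graphs and elements of the free Lie algebra. -/
def liePairing (F : Type u) [Field F] [CharZero F] {n : ℕ} (Γ : NGraph n) :
    FreeLieAlgebra F (Fin n) →ₗ[F] F := graphCoeff F Γ ∘ₗ lieCoeff F n

theorem liePairing_apply (Γ : NGraph n) (a : FreeLieAlgebra F (Fin n)) :
    liePairing F Γ a = graphCoeff F Γ (lieCoeff F n a) := rfl

theorem treeLike_liePairing {a : FreeLieAlgebra F (Fin n)} (ha : a ∈ lieMultilinear F n) :
    TreeLike fun Γ => liePairing F Γ a := by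
  induction ha using Submodule.span_induction with
  | mem a ha =>
    obtain ⟨p, hp, hp'⟩ := exists_isEdgeMonomial ha
    simp only [liePairing_apply, lieCoeff_eq hp']
    exact hp.treeLike
  | zero => simp only [map_zero]; exact TreeLike.zero
  | add a b _ _ ha hb => simp only [map_add]; exact ha.add hb
  | smul c a _ ha => simp only [map_smul]; exact ha.comp (AddMonoidHom.mulLeft c)

/-! ### Left-normed brackets -/

/-- The bracket `[…[[x_r, x_{l_1}], x_{l_2}], …, x_{l_k}]`. -/
def leftNormed (F : Type u) [Field F] {n : ℕ} (r : Fin n) (l : List (Fin n)) :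
    FreeLieAlgebra F (Fin n) :=
  l.foldl (fun a i => ⁅a, FreeLieAlgebra.of F i⁆) (FreeLieAlgebra.of F r)

omit [CharZero F] in
theorem leftNormed_append (r : Fin n) (l : List (Fin n)) (a : Fin n) :
    leftNormed F r (l ++ [a]) = ⁅leftNormed F r l, FreeLieAlgebra.of F a⁆ := by
  rw [leftNormed, List.foldl_append]; rfl

theorem toFinset_append (r : Fin n) (l : List (Fin n)) (a : Fin n) :
    (r :: (l ++ [a])).toFinset = (r :: l).toFinset ∪ {a} := by
  ext i; simp

theorem nodup_append_iff {r : Fin n} {l : List (Fin n)} {a : Fin n} :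
    (r :: (l ++ [a])).Nodup ↔ (r :: l).Nodup ∧ a ∉ r :: l := by
  rw [← List.cons_append, List.nodup_append]
  simp only [List.nodup_singleton, List.mem_singleton, true_and, and_congr_right_iff]
  intro _
  exact ⟨fun h h' => h a h' a rfl rfl, fun h b hb c hc hbc => h (hc ▸ hbc ▸ hb)⟩

omit [CharZero F] in
theorem isLieMonomial_leftNormed (r : Fin n) (l : List (Fin n)) (h : (r :: l).Nodup) :
    IsLieMonomial F (r :: l).toFinset (leftNormed F r l) := by
  induction l using List.reverseRecOn with
  | nil => exact .of r
  | append_singleton l a ih =>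
    rw [nodup_append_iff] at h
    rw [toFinset_append, leftNormed_append]
    refine .lie _ _ _ _ ?_ (ih h.1) (.of a)
    rw [Finset.disjoint_singleton_right, List.mem_toFinset]
    exact h.2

theorem toFinset_eq_univ {l : List (Fin n)} (h : ∀ i, i ∈ l) : l.toFinset = Finset.univ :=
  Finset.eq_univ_of_forall fun i => List.mem_toFinset.2 (h i)

omit [CharZero F] in
theorem leftNormed_mem {r : Fin n} {l : List (Fin n)} (h : (r :: l).Nodup)
    (hall : ∀ i, i ∈ r :: l) : leftNormed F r l ∈ lieMultilinear F n :=
  Submodule.subset_span (by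
    have := isLieMonomial_leftNormed (F := F) r l h
    rwa [toFinset_eq_univ hall] at this)

/-- The span of the left-normed brackets that start with `x_r` in the variables `x_i`, `i ∈ s`. -/
def leftSpan (F : Type u) [Field F] {n : ℕ} (r : Fin n) (s : Finset (Fin n)) :
    Submodule F (FreeLieAlgebra F (Fin n)) :=
  Submodule.span F {b | ∃ l : List (Fin n), (r :: l).Nodup ∧ (r :: l).toFinset = s ∧
    b = leftNormed F r l}

-- The Jacobi identity `[u, [a, b]] = [[u, a], b] - [[u, b], a]` unfolds nested brackets on the
-- right until only generators are bracketed on.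
omit [CharZero F] in
theorem lie_mem_leftSpan (r : Fin n) {t : Finset (Fin n)} {b : FreeLieAlgebra F (Fin n)}
    (hb : IsLieMonomial F t b) : ∀ (s : Finset (Fin n)), Disjoint s t → ∀ u ∈ leftSpan F r s,
      ⁅u, b⁆ ∈ leftSpan F r (s ∪ t) := by
  induction hb with
  | of i =>
    intro s hs u hu
    induction hu using Submodule.span_induction with
    | mem u hu =>
      obtain ⟨l, hl, rfl, rfl⟩ := hu
      rw [Finset.disjoint_singleton_right, List.mem_toFinset] at hs
      exact Submodule.subset_span ⟨l ++ [i], nodup_append_iff.2 ⟨hl, hs⟩, toFinset_append r l i,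
        (leftNormed_append r l i).symm⟩
    | zero => rw [zero_lie]; exact Submodule.zero_mem _
    | add a b _ _ ha hb => rw [add_lie]; exact Submodule.add_mem _ ha hb
    | smul c a _ ha => rw [smul_lie]; exact Submodule.smul_mem _ c ha
  | lie s' t' a b hst _ _ ha hb =>
    intro s hs u hu
    rw [Finset.disjoint_union_right] at hs
    rw [leibniz_lie, ← lie_skew a, ← sub_eq_add_neg]
    refine Submodule.sub_mem _ ?_ ?_
    · rw [← Finset.union_assoc]
      exact hb _ (Finset.disjoint_union_left.2 ⟨hs.2, hst⟩) _ (ha s hs.1 u hu)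
    · rw [Finset.union_comm s' t', ← Finset.union_assoc]
      exact ha _ (Finset.disjoint_union_left.2 ⟨hs.1, hst.symm⟩) _ (hb s hs.2 u hu)

-- By skew-symmetry the factor that contains `x_r` can be put on the left, and it is a combination
-- of left-normed brackets by induction.
omit [CharZero F] in
theorem mem_leftSpan {r : Fin n} {s : Finset (Fin n)} {a : FreeLieAlgebra F (Fin n)}
    (ha : IsLieMonomial F s a) (hr : r ∈ s) : a ∈ leftSpan F r s := by
  induction ha with
  | of i =>
    rw [Finset.mem_singleton] at hr
    subst hr
    exact Submodule.subset_span ⟨[], by simp, by simp, rfl⟩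
  | lie s t a b hst ha' hb' ha hb =>
    rcases Finset.mem_union.1 hr with hr | hr
    · exact lie_mem_leftSpan r hb' s hst a (ha hr)
    · rw [← lie_skew, Finset.union_comm]
      exact Submodule.neg_mem _ (lie_mem_leftSpan r ha' t hst.symm b (hb hr))

omit [CharZero F] in
theorem lieMultilinear_le (r : Fin n) : lieMultilinear F n ≤ leftSpan F r Finset.univ :=
  Submodule.span_le.2 fun _ ha => mem_leftSpan ha (Finset.mem_univ r)

theorem chainG_append_cons (r : Fin n) (l : List (Fin n)) (a : Fin n) (l' : List (Fin n)) :
    ∃ x ∈ r :: l, chainG r (l ++ a :: l') = chainG r l + edg x a + chainG a l' := by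
  induction l generalizing r with
  | nil => exact ⟨r, by simp, by simp [chainG]⟩
  | cons b l ih =>
    obtain ⟨x, hx, h⟩ := ih b
    refine ⟨x, List.mem_cons_of_mem r hx, ?_⟩
    rw [List.cons_append, chainG, h, chainG]
    simp only [add_assoc]

/-- Paths starting at `r` and left-normed brackets starting with `x_r` are dual to each other. -/
theorem exists_leftNormed_poly (r : Fin n) (l : List (Fin n)) (h : (r :: l).Nodup) :
    ∃ p, IsEdgeMonomial F (r :: l).toFinset p ∧
      lieEval F n (leftNormed F r l) = torusSingle (edgeForm_self F) (ind (r :: l).toFinset) p ∧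
      ∀ l' : List (Fin n), (r :: l').Nodup → (∀ i, i ∈ l' ↔ i ∈ l) →
        graphCoeff F (chainG r l') p = if l' = l then 1 else 0 := by
  classical
  induction l using List.reverseRecOn with
  | nil =>
    refine ⟨1, .of r, ?_, fun l' _ hl' => ?_⟩
    · exact (lieEval_of F r).trans (by simp [ind])
    · have : l' = [] := List.eq_nil_iff_forall_not_mem.2 fun i hi => by simpa using (hl' i).1 hi
      subst this
      rw [if_pos rfl, chainG, graphCoeff_apply, graphDeriv_zero, map_one]
  | append_singleton l a ih =>
    rw [nodup_append_iff] at h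
    obtain ⟨p, hp, hp', hc⟩ := ih h.1
    have ha : a ∉ (r :: l).toFinset := fun h' => h.2 (List.mem_toFinset.1 h')
    have hd : Disjoint (r :: l).toFinset {a} := Finset.disjoint_singleton_right.2 ha
    have hp0 : ∀ (x y : Fin n) (hxy : x ≠ y), x = a ∨ y = a →
        MvPolynomial.pderiv (⟨(x, y), hxy⟩ : Edge n) p = 0 := fun x y hxy hh =>
      pderiv_edgeAlg_of_notMem hxy (by rintro ⟨h1, h2⟩; rcases hh with rfl | rfl <;> contradiction)
        hp.mem
    refine ⟨(∑ i ∈ (r :: l).toFinset, ∑ j ∈ {a}, edgeVar F i j) * p * 1, ?_, ?_,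
      fun l' hn hl' => ?_⟩
    · rw [toFinset_append]
      exact .lie _ _ _ _ hd hp (.of a)
    · rw [leftNormed_append, LieHom.map_lie, hp', lieEval_of, torus_lie_single, toFinset_append]
      have h1 : (Pi.single a 1 : Fin n → ℕ) = ind {a} := by simp [ind]
      rw [h1, edgeForm_ind, ind, ind, ind, Finset.sum_union hd]
    · have hal : a ∈ l' := (hl' a).2 (by simp)
      obtain ⟨l₁, l₂, rfl⟩ := List.append_of_mem hal
      -- If `a` comes last in `l'`, differentiating along the last edge removes the factor of the
      -- last bracket and leaves `p`. Otherwise the path has two edges at `a`, while the polynomial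
      -- is linear in the variables at `a`.
      cases l₂ with
      | nil =>
        rw [nodup_append_iff] at hn
        obtain ⟨x, hx, hch⟩ := chainG_append_cons r l₁ a []
        have hxa : x ≠ a := by rintro rfl; exact hn.2 hx
        have hmem : ∀ i, i ∈ l₁ ↔ i ∈ l := by
          intro i
          have := hl' i
          simp only [List.mem_append, List.mem_singleton] at this
          by_cases hia : i = a
          · subst hia
            exact ⟨fun h' => absurd (List.mem_cons_of_mem r h') hn.2,
              fun h' => absurd (List.mem_cons_of_mem r h') h.2⟩
          · simpa [hia] using this
        have hxs : x ∈ (r :: l).toFinset := by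
          rw [List.mem_toFinset]
          rcases List.mem_cons.1 hx with rfl | hx
          · exact List.mem_cons_self
          · exact List.mem_cons_of_mem _ ((hmem x).1 hx)
        rw [hch, chainG, add_zero, graphCoeff_add, graphDeriv_edg F hxa]
        have hder : MvPolynomial.pderiv (⟨(x, a), hxa⟩ : Edge n)
            ((∑ i ∈ (r :: l).toFinset, ∑ j ∈ {a}, edgeVar F i j) * p * 1) = p := by
          rw [mul_one, Derivation.leibniz, hp0 x a hxa (Or.inr rfl), pderiv_sum_edgeVar, crossSign,
            if_pos ⟨hxs, Finset.mem_singleton_self a⟩, if_neg fun h' => ha h'.1]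
          simp
        rw [hder, hc l₁ hn.1 hmem]
        simp
      | cons u l₂ =>
        have hne : l₁ ++ a :: u :: l₂ ≠ l ++ [a] := by
          intro h'
          have hu : a ∈ u :: l₂ := by
            have h1 := congrArg List.getLast? h'
            simp only [List.getLast?_append, List.getLast?_cons_cons, List.getLast?_singleton] at h1
            have h2 : (u :: l₂).getLast? = some a := by
              cases h3 : (u :: l₂).getLast? with
              | none => simp at h3
              | some b => rw [h3] at h1; simpa using h1
            exact List.mem_of_getLast? h2
          rw [← List.cons_append, List.nodup_append] at hn
          exact (List.nodup_cons.1 hn.2.1).1 hu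
        rw [if_neg hne]
        obtain ⟨x, hx, hch⟩ := chainG_append_cons r l₁ a (u :: l₂)
        rw [← List.cons_append, List.nodup_append] at hn
        have hxa : x ≠ a := hn.2.2 x hx a List.mem_cons_self
        have hau : a ≠ u := by
          rintro rfl
          exact (List.nodup_cons.1 hn.2.1).1 List.mem_cons_self
        have h0 : graphDeriv F (edg x a + edg a u)
            ((∑ i ∈ (r :: l).toFinset, ∑ j ∈ {a}, edgeVar F i j) * p * 1) = 0 := by
          rw [graphDeriv_add, graphDeriv_edg F hxa, graphDeriv_edg F hau, pderiv_pderiv_lie,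
            hp0 x a hxa (Or.inr rfl), hp0 a u hau (Or.inl rfl)]
          simp
        have h1 : chainG r (l₁ ++ a :: u :: l₂) =
            (chainG r l₁ + chainG u l₂) + (edg x a + edg a u) := by
          rw [hch, chainG]
          abel
        rw [h1, graphCoeff_add, h0, map_zero]

theorem liePairing_chainG_leftNormed {r : Fin n} {l l' : List (Fin n)} (h : (r :: l).Nodup)
    (hall : ∀ i, i ∈ r :: l) (h' : (r :: l').Nodup) (hall' : ∀ i, i ∈ r :: l') :
    liePairing F (chainG r l') (leftNormed F r l) = if l' = l then 1 else 0 := by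
  obtain ⟨p, _, hp, hc⟩ := exists_leftNormed_poly (F := F) r l h
  rw [toFinset_eq_univ hall] at hp
  rw [liePairing_apply, lieCoeff_eq hp]
  refine hc l' h' fun i => ?_
  by_cases hir : i = r
  · subst hir
    exact iff_of_false (List.nodup_cons.1 h').1 (List.nodup_cons.1 h).1
  · have h1 := hall i
    have h2 := hall' i
    simp only [List.mem_cons, hir, false_or] at h1 h2
    exact iff_of_true h2 h1

end Pairing

end VertexOperad

end

noncomputable section

namespace VertexOperad

universe u

/-! ### Relabellings and substitutions -/

section Relabel

variable {F : Type u} [Field F] {a b : ℕ} {θ : Fin a → Fin b} (hθ : Function.Injective θ)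

/-- The image of an edge. -/
def mapEdge (hθ : Function.Injective θ) (e : Edge a) : Edge b :=
  ⟨(θ e.1.1, θ e.1.2), fun h => e.2 (hθ h)⟩

theorem mapEdge_injective : Function.Injective (mapEdge hθ) := by
  rintro ⟨⟨i, j⟩, h⟩ ⟨⟨k, l⟩, h'⟩ he
  simp only [mapEdge, Subtype.mk.injEq, Prod.mk.injEq] at he ⊢
  exact ⟨hθ he.1, hθ he.2⟩

/-- The substitution `X_{ij} ↦ X_{θ(i) θ(j)}`. -/
def renameEdge (F : Type u) [Field F] (hθ : Function.Injective θ) :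
    MvPolynomial (Edge a) F →ₐ[F] MvPolynomial (Edge b) F := MvPolynomial.rename (mapEdge hθ)

theorem renameEdge_edgeVar (i j : Fin a) :
    renameEdge F hθ (edgeVar F i j) = edgeVar F (θ i) (θ j) := by
  by_cases h : i = j
  · subst h; simp [edgeVar]
  · rw [edgeVar, edgeVar, dif_pos h, dif_pos fun h' => h (hθ h'), map_sub, renameEdge,
      MvPolynomial.rename_X, MvPolynomial.rename_X]
    rfl

theorem pderiv_renameEdge (e : Edge a) (p : MvPolynomial (Edge a) F) :
    MvPolynomial.pderiv (mapEdge hθ e) (renameEdge F hθ p) =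
      renameEdge F hθ (MvPolynomial.pderiv e p) :=
  MvPolynomial.pderiv_rename (mapEdge_injective hθ) e p

theorem pderiv_renameEdge_of_ne {e : Edge b} (h : ∀ e', mapEdge hθ e' ≠ e)
    (p : MvPolynomial (Edge a) F) : MvPolynomial.pderiv e (renameEdge F hθ p) = 0 := by
  have := pderiv_algHom (renameEdge F hθ) e 0 (fun k => ?_) p
  · rw [this, Derivation.zero_apply, map_zero]
  · rw [renameEdge, MvPolynomial.rename_X, MvPolynomial.pderiv_X_of_ne (h k), Derivation.zero_apply,
      map_zero]

theorem relabel_cons (e : Edge a) (Γ : NGraph a) :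
    NGraph.relabel θ hθ (e ::ₘ Γ) = mapEdge hθ e ::ₘ Γ.relabel θ hθ := Multiset.map_cons _ _ _

theorem graphDeriv_renameEdge (Γ : NGraph a) (p : MvPolynomial (Edge a) F) :
    graphDeriv F (Γ.relabel θ hθ) (renameEdge F hθ p) = renameEdge F hθ (graphDeriv F Γ p) := by
  induction Γ using Multiset.induction_on with
  | empty => rfl
  | cons e Γ ih => rw [relabel_cons, graphDeriv_cons, graphDeriv_cons, ih, pderiv_renameEdge]

theorem aeval_renameEdge (p : MvPolynomial (Edge a) F) :
    MvPolynomial.aeval (fun _ => (0 : F)) (renameEdge F hθ p) =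
      MvPolynomial.aeval (fun _ => (0 : F)) p :=
  aeval_zero_algHom _ (fun k => by rw [renameEdge, MvPolynomial.rename_X, MvPolynomial.aeval_X]) p

variable [CharZero F]

theorem lieEval_relabel {x : FreeLieAlgebra F (Fin a)} (hx : x ∈ lieMultilinear F a) :
    lieEval F b (FreeLieAlgebra.lift F (fun k => FreeLieAlgebra.of F (θ k)) x) =
      torusSingle (edgeForm_self F) (∑ k, Pi.single (θ k) 1) (renameEdge F hθ (lieCoeff F a x)) := by
  have := lieEval_lift (F := F) (f := fun k => FreeLieAlgebra.of F (θ k))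
    (S := fun k => Pi.single (θ k) 1) (c := fun _ => 1) (θ := renameEdge F hθ)
    (fun i => lieEval_of F _) (fun i j _ => by rw [renameEdge_edgeVar, edgeForm_single]) hx
  rw [this, Finset.prod_const_one, mul_one]

theorem liePairing_perm {n : ℕ} (σ : Equiv.Perm (Fin n)) {x : FreeLieAlgebra F (Fin n)}
    (hx : x ∈ lieMultilinear F n) (Γ : NGraph n) :
    liePairing F Γ (FreeLieAlgebra.lift F (fun k => FreeLieAlgebra.of F (σ⁻¹ k)) x) =
      liePairing F (Γ.relabel σ σ.injective) x := by
  have h1 := lieEval_relabel (σ⁻¹ : Equiv.Perm (Fin n)).injective hx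
  have h2 : ∑ k, (Pi.single (σ⁻¹ k) 1 : Fin n → ℕ) = ind Finset.univ :=
    Equiv.sum_comp (σ⁻¹ : Equiv.Perm (Fin n)) fun k => (Pi.single k 1 : Fin n → ℕ)
  have h3 : Γ = (Γ.relabel σ σ.injective).relabel (⇑σ⁻¹) (σ⁻¹ : Equiv.Perm (Fin n)).injective := by
    rw [NGraph.relabel, NGraph.relabel, Multiset.map_map]
    simp
  rw [h2] at h1
  rw [liePairing_apply, lieCoeff_eq h1, liePairing_apply, graphCoeff_apply, graphCoeff_apply]
  conv_lhs => rw [h3]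
  rw [graphDeriv_renameEdge, aeval_renameEdge]

end Relabel

/-! ### The pairing of substitutions -/

section Join

variable {F : Type u} [Field F] {n : ℕ} {m : Fin n → ℕ}

theorem emb_ne_emb {i j : Fin n} (h : i ≠ j) (k : Fin (m i)) (l : Fin (m j)) :
    emb m i k ≠ emb m j l := fun e => h (by simpa using congrArg (block m) e)

/-- The substitution `X_{ij} ↦ ∑ X_{kl}`, the sum being over the `k` in the `i`-th and the `l` in the
`j`-th block. -/
def joinHom (F : Type u) [Field F] (m : Fin n → ℕ) :
    MvPolynomial (Edge n) F →ₐ[F] MvPolynomial (Edge (∑ i, m i)) F :=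
  MvPolynomial.aeval fun e => ∑ k : Fin (m e.1.1), ∑ l : Fin (m e.1.2),
    MvPolynomial.X ⟨(emb m e.1.1 k, emb m e.1.2 l), emb_ne_emb e.2 k l⟩

theorem joinHom_edgeVar {i j : Fin n} (h : i ≠ j) :
    joinHom F m (edgeVar F i j) = ∑ k, ∑ l, edgeVar F (emb m i k) (emb m j l) := by
  have h1 : ∀ k l, edgeVar F (emb m i k) (emb m j l) =
      MvPolynomial.X ⟨(emb m i k, emb m j l), emb_ne_emb h k l⟩ -
        MvPolynomial.X ⟨(emb m j l, emb m i k), emb_ne_emb h.symm l k⟩ := fun k l =>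
    dif_pos (emb_ne_emb h k l)
  simp only [h1, Finset.sum_sub_distrib]
  rw [edgeVar, dif_pos h, map_sub, joinHom, MvPolynomial.aeval_X, MvPolynomial.aeval_X]
  congr 1
  exact Finset.sum_comm

/-- The variable of an edge between two blocks occurs in the image of exactly one variable, that of
the collapsed edge, with coefficient `1`. -/
theorem pderiv_joinHom (e : InterEdge m) (p : MvPolynomial (Edge n) F) :
    MvPolynomial.pderiv (⟨e.1, fun h => e.2 (congrArg (block m) h)⟩ : Edge (∑ i, m i))
      (joinHom F m p) =
    joinHom F m (MvPolynomial.pderiv ⟨(block m e.1.1, block m e.1.2), e.2⟩ p) := by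
  classical
  refine pderiv_algHom _ _ _ (fun c => ?_) p
  obtain ⟨⟨x, y⟩, hxy⟩ := e
  obtain ⟨i, k, rfl⟩ := exists_emb x
  obtain ⟨j, l, rfl⟩ := exists_emb y
  obtain ⟨⟨i', j'⟩, hij⟩ := c
  rw [joinHom, MvPolynomial.aeval_X, MvPolynomial.pderiv_X, Pi.single_apply]
  simp only [map_sum, MvPolynomial.pderiv_X, Pi.single_apply, Subtype.mk.injEq, Prod.mk.injEq,
    block_emb]
  by_cases hh : i' = i ∧ j' = j
  · obtain ⟨rfl, rfl⟩ := hh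
    simp only [(emb_injective m _).eq_iff, and_self, if_true, map_one]
    simp [ite_and]
  · rw [if_neg hh, map_zero]
    refine Finset.sum_eq_zero fun k' _ => Finset.sum_eq_zero fun l' _ => if_neg ?_
    rintro ⟨h1, h2⟩
    have h1 := congrArg (block m) h1
    have h2 := congrArg (block m) h2
    rw [block_emb, block_emb] at h1 h2
    exact hh ⟨h1, h2⟩

theorem pderiv_joinHom_of_eq (a : Fin n) (e : Edge (m a)) (p : MvPolynomial (Edge n) F) :
    MvPolynomial.pderiv (mapEdge (emb_injective m a) e) (joinHom F m p) = 0 := by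
  have := pderiv_algHom (joinHom F m) (mapEdge (emb_injective m a) e) 0 (fun c => ?_) p
  · rw [this, Derivation.zero_apply, map_zero]
  · rw [Derivation.zero_apply, map_zero, joinHom, MvPolynomial.aeval_X, map_sum]
    refine Finset.sum_eq_zero fun k _ => ?_
    rw [map_sum]
    refine Finset.sum_eq_zero fun l _ => MvPolynomial.pderiv_X_of_ne fun h => c.2 ?_
    simp only [mapEdge, Subtype.mk.injEq, Prod.mk.injEq] at h
    have h1 := congrArg (block m) h.1
    have h2 := congrArg (block m) h.2
    rw [block_emb, block_emb] at h1 h2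
    rw [h1, h2]

theorem aeval_joinHom (p : MvPolynomial (Edge n) F) :
    MvPolynomial.aeval (fun _ => (0 : F)) (joinHom F m p) =
      MvPolynomial.aeval (fun _ => (0 : F)) p :=
  aeval_zero_algHom _ (fun k => by rw [joinHom, MvPolynomial.aeval_X]; simp) p

theorem pderiv_prod_eq_zero {σ ι : Type*} (e : σ) (s : Finset ι) (f : ι → MvPolynomial σ F)
    (h : ∀ i ∈ s, MvPolynomial.pderiv e (f i) = 0) : MvPolynomial.pderiv e (∏ i ∈ s, f i) = 0 := by
  refine Finset.prod_induction _ (fun f => MvPolynomial.pderiv e f = 0) ?_ ?_ h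
  · intro x y hx hy
    rw [Derivation.leibniz, hx, hy, smul_zero, smul_zero, add_zero]
  · exact Derivation.map_one_eq_zero _

/-- The product of a polynomial of the collapsed graph and of polynomials of the blocks. -/
def joinPoly (p : MvPolynomial (Edge n) F) (q : ∀ i, MvPolynomial (Edge (m i)) F) :
    MvPolynomial (Edge (∑ i, m i)) F :=
  joinHom F m p * ∏ i, renameEdge F (emb_injective m i) (q i)

theorem pderiv_joinPoly_inter (e : InterEdge m) (p : MvPolynomial (Edge n) F)
    (q : ∀ i, MvPolynomial (Edge (m i)) F) :
    MvPolynomial.pderiv (⟨e.1, fun h => e.2 (congrArg (block m) h)⟩ : Edge (∑ i, m i))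
      (joinPoly p q) =
    joinPoly (MvPolynomial.pderiv ⟨(block m e.1.1, block m e.1.2), e.2⟩ p) q := by
  rw [joinPoly, Derivation.leibniz, pderiv_joinHom, pderiv_prod_eq_zero, smul_zero, zero_add,
    smul_eq_mul, mul_comm]
  · rfl
  · intro i _
    refine pderiv_renameEdge_of_ne _ (fun e' h => e.2 ?_) _
    have h' := congrArg (fun e => e.1) h
    have h1 := congrArg (fun e => block m e.1) h'
    have h2 := congrArg (fun e => block m e.2) h'
    simp only [mapEdge, block_emb] at h1 h2
    rw [← h1, ← h2]

theorem pderiv_joinPoly_intra (a : Fin n) (e : Edge (m a)) (p : MvPolynomial (Edge n) F)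
    (q : ∀ i, MvPolynomial (Edge (m i)) F) :
    MvPolynomial.pderiv (mapEdge (emb_injective m a) e) (joinPoly p q) =
      joinPoly p (Function.update q a (MvPolynomial.pderiv e (q a))) := by
  rw [joinPoly, joinPoly, Derivation.leibniz, pderiv_joinHom_of_eq, smul_zero, add_zero, smul_eq_mul]
  congr 1
  rw [← Finset.mul_prod_erase Finset.univ (fun i => renameEdge F (emb_injective m i) (q i))
      (Finset.mem_univ a), ← Finset.mul_prod_erase Finset.univ (fun i => renameEdge F
      (emb_injective m i) (Function.update q a (MvPolynomial.pderiv e (q a)) i)) (Finset.mem_univ a),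
    Derivation.leibniz, pderiv_renameEdge, pderiv_prod_eq_zero, smul_zero, zero_add, smul_eq_mul,
    mul_comm, Function.update_self]
  · congr 1
    exact Finset.prod_congr rfl fun i hi => by
      rw [Function.update_of_ne (Finset.ne_of_mem_erase hi)]
  · intro i hi
    refine pderiv_renameEdge_of_ne _ (fun e' h => ?_) _
    have h1 := congrArg (fun e => block m e.1.1) h
    simp only [mapEdge, block_emb] at h1
    exact Finset.ne_of_mem_erase hi h1

theorem graphDeriv_joinPoly_intra (a : Fin n) (Γ : NGraph (m a)) (p : MvPolynomial (Edge n) F)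
    (q : ∀ i, MvPolynomial (Edge (m i)) F) :
    graphDeriv F (Γ.relabel (emb m a) (emb_injective m a)) (joinPoly p q) =
      joinPoly p (Function.update q a (graphDeriv F Γ (q a))) := by
  induction Γ using Multiset.induction_on with
  | empty => rw [graphDeriv_zero, Function.update_eq_self]; rfl
  | cons e Γ ih =>
    rw [relabel_cons, graphDeriv_cons, graphDeriv_cons, ih, pderiv_joinPoly_intra,
      Function.update_self, Function.update_idem]

/-- The factors involve disjoint sets of variables: edges between blocks act only on `p`, and edges
inside the `i`-th block only on `q i`. -/
theorem graphDeriv_joinPoly (E : Multiset (InterEdge m)) (G : ∀ i, NGraph (m i))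
    (p : MvPolynomial (Edge n) F) (q : ∀ i, MvPolynomial (Edge (m i)) F) :
    graphDeriv F (assemble E G) (joinPoly p q) =
      joinPoly (graphDeriv F (collapse E) p) (fun i => graphDeriv F (G i) (q i)) := by
  classical
  induction E using Multiset.induction_on with
  | empty =>
    have key : ∀ s : Finset (Fin n), graphDeriv F
        (∑ i ∈ s, (G i).relabel (emb m i) (emb_injective m i)) (joinPoly p q) =
        joinPoly p (fun i => if i ∈ s then graphDeriv F (G i) (q i) else q i) := by
      intro s
      induction s using Finset.induction_on with
      | empty => rw [Finset.sum_empty, graphDeriv_zero]; simp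
      | insert a s ha ih =>
        rw [Finset.sum_insert ha, graphDeriv_add, ih, graphDeriv_joinPoly_intra]
        congr 1
        funext i
        by_cases hi : i = a
        · subst hi; simp [ha]
        · simp [hi]
    rw [assemble, Multiset.map_zero, zero_add, key]
    simp [collapse, graphDeriv_zero]
  | cons e E ih =>
    have h1 : assemble (e ::ₘ E) G =
        ⟨e.1, fun h => e.2 (congrArg (block m) h)⟩ ::ₘ assemble E G := by
      rw [assemble, assemble, Multiset.map_cons, Multiset.cons_add]
    have h2 : collapse (e ::ₘ E) = ⟨(block m e.1.1, block m e.1.2), e.2⟩ ::ₘ collapse E :=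
      Multiset.map_cons _ _ _
    rw [h1, h2, graphDeriv_cons, graphDeriv_cons, ih, pderiv_joinPoly_inter]

theorem graphCoeff_joinPoly (E : Multiset (InterEdge m)) (G : ∀ i, NGraph (m i))
    (p : MvPolynomial (Edge n) F) (q : ∀ i, MvPolynomial (Edge (m i)) F) :
    graphCoeff F (assemble E G) (joinPoly p q) =
      graphCoeff F (collapse E) p * ∏ i, graphCoeff F (G i) (q i) := by
  rw [graphCoeff_apply, graphDeriv_joinPoly, joinPoly, map_mul, map_prod, aeval_joinHom]
  simp only [aeval_renameEdge, graphCoeff_apply]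

variable [CharZero F]

/-- By `lieEval_lift` the polynomial of the substituted element is the `joinPoly` of those of `P`
and the `Q i`, because `ω` of two blocks is the sum of the `w_kl` between them. -/
theorem liePairing_comp {P : FreeLieAlgebra F (Fin n)} (hP : P ∈ lieMultilinear F n)
    {Q : ∀ i, FreeLieAlgebra F (Fin (m i))} (hQ : ∀ i, Q i ∈ lieMultilinear F (m i))
    (E : Multiset (InterEdge m)) (G : ∀ i, NGraph (m i)) :
    liePairing F (assemble E G) (FreeLieAlgebra.lift F
      (fun i => FreeLieAlgebra.lift F (fun k => FreeLieAlgebra.of F (emb m i k)) (Q i)) P) =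
      liePairing F (collapse E) P * ∏ i, liePairing F (G i) (Q i) := by
  have h1 := lieEval_lift (F := F) (θ := joinHom F m)
    (fun i => lieEval_relabel (emb_injective m i) (hQ i)) (fun i j hij => by
      rw [joinHom_edgeVar hij]
      simp only [map_sum, AddMonoidHom.finsetSum_apply, edgeForm_single]
      exact Finset.sum_comm) hP
  have h2 : ∑ i, ∑ k, (Pi.single (emb m i k) 1 : Fin (∑ i, m i) → ℕ) = ind Finset.univ := by
    simp only [← sum_block _ fun k => (Pi.single k 1 : Fin (∑ i, m i) → ℕ)]
    rw [Finset.sum_fiberwise]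
    rfl
  rw [h2] at h1
  rw [liePairing_apply, lieCoeff_eq h1]
  exact graphCoeff_joinPoly E G _ _

end Join

end VertexOperad

end

noncomputable section

namespace VertexOperad

universe u v

/-! ### Substitutions of multilinear Lie elements -/

section LieSpan

variable {F : Type u} [Field F] {n N : ℕ}

/-- The span of the Lie monomials in the variables `x_i`, `i ∈ s`. -/
def lieSpan (F : Type u) [Field F] {n : ℕ} (s : Finset (Fin n)) :
    Submodule F (FreeLieAlgebra F (Fin n)) := Submodule.span F {a | IsLieMonomial F s a}

theorem lie_mem_lieSpan {s t : Finset (Fin n)} (h : Disjoint s t) {a b : FreeLieAlgebra F (Fin n)}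
    (ha : a ∈ lieSpan F s) (hb : b ∈ lieSpan F t) : ⁅a, b⁆ ∈ lieSpan F (s ∪ t) := by
  induction ha using Submodule.span_induction with
  | mem a ha =>
    induction hb using Submodule.span_induction with
    | mem b hb => exact Submodule.subset_span (.lie s t a b h ha hb)
    | zero => rw [lie_zero]; exact Submodule.zero_mem _
    | add x y _ _ hx hy => rw [lie_add]; exact Submodule.add_mem _ hx hy
    | smul c x _ hx => rw [lie_smul]; exact Submodule.smul_mem _ c hx
  | zero => rw [zero_lie]; exact Submodule.zero_mem _
  | add x y _ _ hx hy => rw [add_lie]; exact Submodule.add_mem _ hx hy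
  | smul c x _ hx => rw [smul_lie]; exact Submodule.smul_mem _ c hx

theorem lift_mem_lieSpan {f : Fin n → FreeLieAlgebra F (Fin N)} {T : Fin n → Finset (Fin N)}
    (hf : ∀ i, f i ∈ lieSpan F (T i)) (hT : ∀ i j, i ≠ j → Disjoint (T i) (T j))
    {s : Finset (Fin n)} {a : FreeLieAlgebra F (Fin n)} (ha : IsLieMonomial F s a) :
    FreeLieAlgebra.lift F f a ∈ lieSpan F (s.biUnion T) := by
  induction ha with
  | of i => rw [FreeLieAlgebra.lift_of_apply, Finset.singleton_biUnion]; exact hf i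
  | lie s t a b hst _ _ ha hb =>
    rw [LieHom.map_lie, Finset.union_biUnion]
    refine lie_mem_lieSpan ?_ ha hb
    rw [Finset.disjoint_biUnion_left]
    intro i hi
    rw [Finset.disjoint_biUnion_right]
    intro j hj
    refine hT i j ?_
    rintro rfl
    exact Finset.disjoint_left.1 hst hi hj

theorem lift_mem_lieSpan_of_mem {f : Fin n → FreeLieAlgebra F (Fin N)} {T : Fin n → Finset (Fin N)}
    (hf : ∀ i, f i ∈ lieSpan F (T i)) (hT : ∀ i j, i ≠ j → Disjoint (T i) (T j))
    {a : FreeLieAlgebra F (Fin n)} (ha : a ∈ lieMultilinear F n) :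
    FreeLieAlgebra.lift F f a ∈ lieSpan F (Finset.univ.biUnion T) := by
  induction ha using Submodule.span_induction with
  | mem a ha => exact lift_mem_lieSpan hf hT ha
  | zero => rw [map_zero]; exact Submodule.zero_mem _
  | add x y _ _ hx hy => rw [map_add]; exact Submodule.add_mem _ hx hy
  | smul c x _ hx => rw [map_smul]; exact Submodule.smul_mem _ c hx

theorem lift_of_mem_lieSpan {θ : Fin n → Fin N} (hθ : Function.Injective θ)
    {a : FreeLieAlgebra F (Fin n)} (ha : a ∈ lieMultilinear F n) :
    FreeLieAlgebra.lift F (fun k => FreeLieAlgebra.of F (θ k)) a ∈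
      lieSpan F (Finset.univ.image θ) := by
  have := lift_mem_lieSpan_of_mem (f := fun k => FreeLieAlgebra.of F (θ k)) (T := fun k => {θ k})
    (fun i => Submodule.subset_span (.of (θ i)))
    (fun i j hij => by simpa using hθ.ne hij) ha
  rwa [Finset.biUnion_singleton] at this

theorem lift_perm_mem (σ : Equiv.Perm (Fin n)) {a : FreeLieAlgebra F (Fin n)}
    (ha : a ∈ lieMultilinear F n) :
    FreeLieAlgebra.lift F (fun k => FreeLieAlgebra.of F (σ⁻¹ k)) a ∈ lieMultilinear F n := by
  have := lift_of_mem_lieSpan (σ⁻¹ : Equiv.Perm (Fin n)).injective ha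
  rwa [Finset.image_univ_of_surjective (σ⁻¹ : Equiv.Perm (Fin n)).surjective] at this

theorem lift_comp_mem {m : Fin n → ℕ} {P : FreeLieAlgebra F (Fin n)} (hP : P ∈ lieMultilinear F n)
    {Q : ∀ i, FreeLieAlgebra F (Fin (m i))} (hQ : ∀ i, Q i ∈ lieMultilinear F (m i)) :
    FreeLieAlgebra.lift F (fun i => FreeLieAlgebra.lift F
      (fun k => FreeLieAlgebra.of F (emb m i k)) (Q i)) P ∈ lieMultilinear F (∑ i, m i) := by
  classical
  have h := lift_mem_lieSpan_of_mem (fun i => lift_of_mem_lieSpan (emb_injective m i) (hQ i)) ?_ hP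
  · have h1 : (Finset.univ.biUnion fun i => Finset.univ.image (emb m i)) = Finset.univ := by
      refine Finset.eq_univ_of_forall fun k => ?_
      obtain ⟨i, k, rfl⟩ := exists_emb k
      simp only [Finset.mem_biUnion, Finset.mem_image, Finset.mem_univ, true_and]
      exact ⟨i, k, rfl⟩
    rwa [h1] at h
  · intro i j hij
    rw [Finset.disjoint_left]
    intro k hk hk'
    obtain ⟨a, _, rfl⟩ := Finset.mem_image.1 hk
    obtain ⟨b, _, hb⟩ := Finset.mem_image.1 hk'
    exact emb_ne_emb hij a b hb.symm

end LieSpan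

/-! ### The isomorphism of `Hom ⊗ Lie` with the classical operad -/

section Tensor

variable {F : Type u} [Field F] [CharZero F] {V : Type v} [AddCommGroup V] [Module F V] {n : ℕ}

theorem smul_constV_mem (hn : 1 ≤ n) (φ : MultilinearMap F (fun _ : Fin n => V) V)
    (a : lieMultilinear F n) :
    (fun Γ => liePairing F Γ (a : FreeLieAlgebra F (Fin n)) •
      (constV (F := F) n).compMultilinearMap φ) ∈ classical (0 : V →ₗ[F] V) n := by
  refine mem_classical_iff.2 fun x => ?_
  have h := (treeLike_liePairing a.2).comp (LinearMap.toSpanSingleton F V (φ x)).toAddMonoidHom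
  have h' := constV_mem_CMap (F := F) hn h
  convert h' using 1
  funext Γ
  exact (map_smul (constV (F := F) n) (liePairing F Γ a) (φ x)).symm

/-- The map `φ ⊗ P ↦ (Γ ↦ ⟨Γ, P⟩ φ)`. -/
def tensorMap (hn : 1 ≤ n) : MultilinearMap F (fun _ : Fin n => V) V ⊗[F] lieMultilinear F n →ₗ[F]
    classical (0 : V →ₗ[F] V) n :=
  TensorProduct.lift (LinearMap.mk₂ F (fun φ a => ⟨_, smul_constV_mem hn φ a⟩)
    (fun φ φ' a => Subtype.ext (funext fun Γ => MultilinearMap.ext fun x => by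
      simp [smul_add]))
    (fun c φ a => Subtype.ext (funext fun Γ => MultilinearMap.ext fun x => by
      change liePairing F Γ (a : FreeLieAlgebra F (Fin n)) • constV (F := F) n (c • φ x) =
        c • liePairing F Γ (a : FreeLieAlgebra F (Fin n)) • constV (F := F) n (φ x)
      rw [map_smul, smul_comm]))
    (fun φ a a' => Subtype.ext (funext fun Γ => MultilinearMap.ext fun x => by
      simp [add_smul]))
    (fun c φ a => Subtype.ext (funext fun Γ => MultilinearMap.ext fun x => by
      simp [mul_smul])))

theorem tensorMap_tmul (hn : 1 ≤ n) (φ : MultilinearMap F (fun _ : Fin n => V) V)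
    (a : lieMultilinear F n) (Γ : NGraph n) (x : Fin n → V) :
    (tensorMap hn (φ ⊗ₜ[F] a)).1 Γ x = liePairing F Γ (a : FreeLieAlgebra F (Fin n)) •
      constV n (φ x) := rfl

/-- The lists `l` such that `r :: l` is an enumeration of the vertices. -/
abbrev Enumeration (r : Fin n) : Type := {l : List (Fin n) // (r :: l).Nodup ∧ ∀ i, i ∈ r :: l}

instance (r : Fin n) : Finite (Enumeration r) :=
  Finite.of_injective (fun l : Enumeration r => (⟨r :: l.1, l.2.1⟩ : {l : List (Fin n) // l.Nodup}))
    fun _ _ h => Subtype.ext (List.cons_injective (congrArg Subtype.val h))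

instance (r : Fin n) : Fintype (Enumeration r) := Fintype.ofFinite _

/-- The left-normed bracket of an enumeration. -/
def enumBracket (F : Type u) [Field F] {n : ℕ} {r : Fin n} (l : Enumeration r) :
    lieMultilinear F n := ⟨leftNormed F r l.1, leftNormed_mem l.2.1 l.2.2⟩

/-- The map `Y ↦ ∑_l Y^{Γ_l} ⊗ P_l`, where `Γ_l` is the path and `P_l` the left-normed bracket of an
enumeration `l` of the vertices. -/
def tensorInv (hn : 1 ≤ n) : classical (0 : V →ₗ[F] V) n →ₗ[F]
    MultilinearMap F (fun _ : Fin n => V) V ⊗[F] lieMultilinear F n where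
  toFun Y := ∑ l : Enumeration (⟨0, hn⟩ : Fin n),
    (epsV n).compMultilinearMap (Y.1 (chainG ⟨0, hn⟩ l.1)) ⊗ₜ[F] enumBracket F l
  map_add' Y Y' := by
    rw [← Finset.sum_add_distrib]
    refine Finset.sum_congr rfl fun l _ => ?_
    rw [← TensorProduct.add_tmul]
    congr 1
    ext x
    simp
  map_smul' c Y := by
    rw [RingHom.id_apply, Finset.smul_sum]
    refine Finset.sum_congr rfl fun l _ => ?_
    rw [TensorProduct.smul_tmul']
    congr 1
    ext x
    simp

omit [CharZero F] in
theorem tensorInv_apply (hn : 1 ≤ n) (Y : classical (0 : V →ₗ[F] V) n) :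
    tensorInv hn Y = ∑ l : Enumeration (⟨0, hn⟩ : Fin n),
      (epsV n).compMultilinearMap (Y.1 (chainG ⟨0, hn⟩ l.1)) ⊗ₜ[F] enumBracket F l := rfl

theorem liePairing_enumBracket {r : Fin n} (l l' : Enumeration r) :
    liePairing F (chainG r l'.1) (enumBracket F l : FreeLieAlgebra F (Fin n)) =
      if l' = l then 1 else 0 := by
  rw [enumBracket, liePairing_chainG_leftNormed l.2.1 l.2.2 l'.2.1 l'.2.2]
  simp only [Subtype.ext_iff]

/-- Both sides are tree-like, so paths suffice; there duality leaves one summand, and values of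
classical operations are constants. -/
theorem tensorMap_tensorInv (hn : 1 ≤ n) (Y : classical (0 : V →ₗ[F] V) n) :
    tensorMap hn (tensorInv hn Y) = Y := by
  classical
  refine Subtype.ext (funext fun Γ => MultilinearMap.ext fun x => ?_)
  have h1 := CMap.treeLike (mem_classical_iff.1 (tensorMap hn (tensorInv hn Y)).2 x)
  have h2 := CMap.treeLike (mem_classical_iff.1 Y.2 x)
  refine congrFun (h1.ext h2 ⟨0, hn⟩ fun l hl hl' => ?_) Γ
  rw [tensorInv_apply, map_sum]
  have h3 : ∀ (s : Finset (Enumeration (⟨0, hn⟩ : Fin n))) (f : Enumeration (⟨0, hn⟩ : Fin n) →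
      classical (0 : V →ₗ[F] V) n) Γ, (∑ i ∈ s, f i).1 Γ x = ∑ i ∈ s, (f i).1 Γ x := by
    intro s f Γ
    rw [AddSubmonoidClass.coe_finsetSum, Finset.sum_apply, sum_apply]
  rw [h3, Finset.sum_eq_single ⟨l, hl, hl'⟩]
  · rw [tensorMap_tmul, liePairing_enumBracket (⟨l, hl, hl'⟩ : Enumeration (⟨0, hn⟩ : Fin n))
      ⟨l, hl, hl'⟩, if_pos rfl, one_smul]
    exact CMap.constV_epsV (mem_classical_iff.1 Y.2 x) _
  · intro l' _ hne
    rw [tensorMap_tmul, liePairing_enumBracket l' ⟨l, hl, hl'⟩, if_neg hne.symm, zero_smul]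
  · intro h; exact absurd (Finset.mem_univ _) h

theorem epsV_comp_tensorMap (hn : 1 ≤ n) (φ : MultilinearMap F (fun _ : Fin n => V) V)
    (a : lieMultilinear F n) (Γ : NGraph n) :
    (epsV (F := F) n).compMultilinearMap ((tensorMap hn (φ ⊗ₜ[F] a)).1 Γ) =
      liePairing F Γ (a : FreeLieAlgebra F (Fin n)) • φ := by
  ext x
  rw [LinearMap.compMultilinearMap_apply, tensorMap_tmul, map_smul, epsV_constV]
  rfl

theorem tensorInv_tensorMap_enumBracket (hn : 1 ≤ n)
    (φ : MultilinearMap F (fun _ : Fin n => V) V) (l : Enumeration (⟨0, hn⟩ : Fin n)) :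
    tensorInv hn (tensorMap hn (φ ⊗ₜ[F] enumBracket F l)) = φ ⊗ₜ[F] enumBracket F l := by
  classical
  rw [tensorInv_apply, Finset.sum_eq_single l]
  · rw [epsV_comp_tensorMap, liePairing_enumBracket, if_pos rfl, one_smul]
  · intro l' _ hne
    rw [epsV_comp_tensorMap, liePairing_enumBracket, if_neg hne, zero_smul,
      TensorProduct.zero_tmul]
  · intro h; exact absurd (Finset.mem_univ _) h

omit [CharZero F] in
theorem span_enumBracket (hn : 1 ≤ n) (a : lieMultilinear F n) :
    a ∈ Submodule.span F (Set.range (enumBracket F (r := (⟨0, hn⟩ : Fin n)))) := by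
  have key : lieMultilinear F n ≤ (Submodule.span F
      (Set.range (enumBracket F (r := (⟨0, hn⟩ : Fin n))))).map (lieMultilinear F n).subtype := by
    refine (lieMultilinear_le (⟨0, hn⟩ : Fin n)).trans (Submodule.span_le.2 ?_)
    rintro b ⟨l, hl, hl', rfl⟩
    have hall : ∀ i, i ∈ (⟨0, hn⟩ : Fin n) :: l := fun i => by
      rw [← List.mem_toFinset, hl']; exact Finset.mem_univ i
    exact ⟨enumBracket F ⟨l, hl, hall⟩, Submodule.subset_span ⟨_, rfl⟩, rfl⟩
  obtain ⟨b, hb, h⟩ := key a.2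
  rwa [← Subtype.ext h]

/-- Left-normed brackets span `Lie(n)`, which reduces the claim to the dual families of paths and
brackets. -/
theorem tensorInv_tensorMap (hn : 1 ≤ n)
    (t : MultilinearMap F (fun _ : Fin n => V) V ⊗[F] lieMultilinear F n) :
    tensorInv hn (tensorMap hn t) = t := by
  induction t with
  | zero => rw [map_zero, map_zero]
  | add s t hs ht => rw [map_add, map_add, hs, ht]
  | tmul φ a =>
    induction span_enumBracket hn a using Submodule.span_induction with
    | mem b hb => obtain ⟨l, rfl⟩ := hb; exact tensorInv_tensorMap_enumBracket hn φ l
    | zero => rw [TensorProduct.tmul_zero, map_zero, map_zero]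
    | add b c _ _ hb hc => rw [TensorProduct.tmul_add, map_add, map_add, hb, hc]
    | smul r b _ hb => rw [TensorProduct.tmul_smul, map_smul, map_smul, hb]

/-- The isomorphism between `Hom(V)(n) ⊗ Lie(n)` and the space of classical operations. -/
def tensorEquiv (hn : 1 ≤ n) : classical (0 : V →ₗ[F] V) n ≃ₗ[F]
    MultilinearMap F (fun _ : Fin n => V) V ⊗[F] lieMultilinear F n :=
  LinearEquiv.ofLinearMap (tensorInv hn) (tensorMap hn) (LinearMap.ext (tensorInv_tensorMap hn))
    (LinearMap.ext (tensorMap_tensorInv hn))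

end Tensor

end VertexOperad

end

noncomputable section

namespace VertexOperad

universe u v

/-! ### The action and the compositions of `Hom ⊗ Lie` -/

section HomLie

variable {F : Type u} [Field F] {V : Type v} [AddCommGroup V] [Module F V]
  (𝒱 : ZMod 2 → Submodule F V) {n : ℕ} {m : Fin n → ℕ}

/-- The action of permutations on `Hom(V)(n) ⊗ Lie(n)`. -/
def HomLieAct (σ : Equiv.Perm (Fin n))
    (s t : MultilinearMap F (fun _ : Fin n => V) V ⊗[F] lieMultilinear F n) : Prop :=
  TensorAct (homOperad 𝒱) (lieOperad F) σ s t

/-- The compositions of `Hom(V) ⊗ Lie`. -/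
def HomLieComp (p : Fin n → ZMod 2)
    (s : MultilinearMap F (fun _ : Fin n => V) V ⊗[F] lieMultilinear F n)
    (y : ∀ i, MultilinearMap F (fun _ : Fin (m i) => V) V ⊗[F] lieMultilinear F (m i))
    (z : MultilinearMap F (fun _ : Fin (∑ i, m i) => V) V ⊗[F] lieMultilinear F (∑ i, m i)) :
    Prop :=
  TensorComp (homOperad 𝒱) (lieOperad F) p s y z

variable {𝒱} {σ : Equiv.Perm (Fin n)} {p : Fin n → ZMod 2}

theorem HomLieAct.pure {φ φ' : MultilinearMap F (fun _ : Fin n => V) V} {a a' : lieMultilinear F n}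
    (h : (homOperad 𝒱).IsAct σ φ φ') (h' : (lieOperad F).IsAct σ a a') :
    HomLieAct 𝒱 σ (φ ⊗ₜ[F] a) (φ' ⊗ₜ[F] a') := TensorAct.pure _ _ _ _ h h'

theorem HomLieAct.add {s t s₁ t₁ : MultilinearMap F (fun _ : Fin n => V) V ⊗[F] lieMultilinear F n}
    (hs : HomLieAct 𝒱 σ s s₁) (ht : HomLieAct 𝒱 σ t t₁) :
    HomLieAct 𝒱 σ (s + t) (s₁ + t₁) := TensorAct.add _ _ _ _ hs ht

theorem HomLieAct.induct
    {C : (s t : MultilinearMap F (fun _ : Fin n => V) V ⊗[F] lieMultilinear F n) → Prop}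
    (hpure : ∀ (φ φ' : MultilinearMap F (fun _ : Fin n => V) V) (a a' : lieMultilinear F n),
      (homOperad 𝒱).IsAct σ φ φ' → (lieOperad F).IsAct σ a a' → C (φ ⊗ₜ[F] a) (φ' ⊗ₜ[F] a'))
    (hadd : ∀ s t s₁ t₁, C s s₁ → C t t₁ → C (s + t) (s₁ + t₁))
    {s t : MultilinearMap F (fun _ : Fin n => V) V ⊗[F] lieMultilinear F n}
    (h : HomLieAct 𝒱 σ s t) : C s t :=
  TensorAct.rec (motive := fun s t _ => C s t) (fun φ φ' a a' h h' => hpure φ φ' a a' h h')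
    (fun s t s₁ t₁ _ _ hs ht => hadd s t s₁ t₁ hs ht) h

theorem HomLieComp.pure {φ : MultilinearMap F (fun _ : Fin n => V) V}
    {ψ : ∀ i, MultilinearMap F (fun _ : Fin (m i) => V) V}
    {χ : MultilinearMap F (fun _ : Fin (∑ i, m i) => V) V}
    {P : lieMultilinear F n} {Q : ∀ i, lieMultilinear F (m i)} {R : lieMultilinear F (∑ i, m i)}
    (h : (homOperad 𝒱).IsComp p φ ψ χ) (h' : (lieOperad F).IsComp (fun _ => 0) P Q R) :
    HomLieComp 𝒱 p (φ ⊗ₜ[F] P) (fun i => ψ i ⊗ₜ[F] Q i) (χ ⊗ₜ[F] R) :=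
  TensorComp.pure _ _ _ _ _ _ h h'

theorem HomLieComp.add_left
    {s t : MultilinearMap F (fun _ : Fin n => V) V ⊗[F] lieMultilinear F n}
    {y : ∀ i, MultilinearMap F (fun _ : Fin (m i) => V) V ⊗[F] lieMultilinear F (m i)}
    {s₁ t₁ : MultilinearMap F (fun _ : Fin (∑ i, m i) => V) V ⊗[F] lieMultilinear F (∑ i, m i)}
    (hs : HomLieComp 𝒱 p s y s₁) (ht : HomLieComp 𝒱 p t y t₁) :
    HomLieComp 𝒱 p (s + t) y (s₁ + t₁) := TensorComp.add_left _ _ _ _ _ hs ht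

theorem HomLieComp.add_right
    {s : MultilinearMap F (fun _ : Fin n => V) V ⊗[F] lieMultilinear F n}
    {y : ∀ i, MultilinearMap F (fun _ : Fin (m i) => V) V ⊗[F] lieMultilinear F (m i)} {i : Fin n}
    {a b : MultilinearMap F (fun _ : Fin (m i) => V) V ⊗[F] lieMultilinear F (m i)}
    {s₁ t₁ : MultilinearMap F (fun _ : Fin (∑ i, m i) => V) V ⊗[F] lieMultilinear F (∑ i, m i)}
    (hs : HomLieComp 𝒱 p s (Function.update y i a) s₁)
    (ht : HomLieComp 𝒱 p s (Function.update y i b) t₁) :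
    HomLieComp 𝒱 p s (Function.update y i (a + b)) (s₁ + t₁) :=
  TensorComp.add_right _ _ _ _ _ _ _ hs ht

theorem HomLieComp.induct
    {C : (s : MultilinearMap F (fun _ : Fin n => V) V ⊗[F] lieMultilinear F n) →
      (y : ∀ i, MultilinearMap F (fun _ : Fin (m i) => V) V ⊗[F] lieMultilinear F (m i)) →
      (z : MultilinearMap F (fun _ : Fin (∑ i, m i) => V) V ⊗[F] lieMultilinear F (∑ i, m i)) →
      Prop}
    (hpure : ∀ (φ : MultilinearMap F (fun _ : Fin n => V) V)
      (ψ : ∀ i, MultilinearMap F (fun _ : Fin (m i) => V) V)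
      (χ : MultilinearMap F (fun _ : Fin (∑ i, m i) => V) V) (P : lieMultilinear F n)
      (Q : ∀ i, lieMultilinear F (m i)) (R : lieMultilinear F (∑ i, m i)),
      (homOperad 𝒱).IsComp p φ ψ χ → (lieOperad F).IsComp (fun _ => 0) P Q R →
      C (φ ⊗ₜ[F] P) (fun i => ψ i ⊗ₜ[F] Q i) (χ ⊗ₜ[F] R))
    (hadd_left : ∀ s t y s₁ t₁, C s y s₁ → C t y t₁ → C (s + t) y (s₁ + t₁))
    (hadd_right : ∀ s y i a b s₁ t₁, C s (Function.update y i a) s₁ →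
      C s (Function.update y i b) t₁ → C s (Function.update y i (a + b)) (s₁ + t₁))
    {s : MultilinearMap F (fun _ : Fin n => V) V ⊗[F] lieMultilinear F n}
    {y : ∀ i, MultilinearMap F (fun _ : Fin (m i) => V) V ⊗[F] lieMultilinear F (m i)}
    {z : MultilinearMap F (fun _ : Fin (∑ i, m i) => V) V ⊗[F] lieMultilinear F (∑ i, m i)}
    (h : HomLieComp 𝒱 p s y z) : C s y z :=
  TensorComp.rec (motive := fun s y z _ => C s y z)
    (fun φ ψ χ P Q R h h' => hpure φ ψ χ P Q R h h')
    (fun s t y s₁ t₁ _ _ hs ht => hadd_left s t y s₁ t₁ hs ht)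
    (fun s y i a b s₁ t₁ _ _ hs ht => hadd_right s y i a b s₁ t₁ hs ht) h

end HomLie

/-! ### Compatibility with the structure of an operad -/

section TensorCompat

variable {F : Type u} [Field F] [CharZero F] {V : Type v} [AddCommGroup V] [Module F V]
  {𝒱 : ZMod 2 → Submodule F V} {n : ℕ} {m : Fin n → ℕ}

theorem tensorMap_tmul_mem_parity (hn : 1 ≤ n) {p : ZMod 2}
    {φ : MultilinearMap F (fun _ : Fin n => V) V} (hφ : φ ∈ homParity 𝒱 n p)
    (a : lieMultilinear F n) : tensorMap hn (φ ⊗ₜ[F] a) ∈ classicalParity 𝒱 0 n p :=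
  fun _ q x hx => Submodule.smul_mem _ _ (constV_mem_subV (hφ q x hx))

theorem mem_classicalParity_iff_tensorInv (hn : 1 ≤ n) (p : ZMod 2)
    (Y : classical (0 : V →ₗ[F] V) n) :
    Y ∈ classicalParity 𝒱 0 n p ↔ tensorInv hn Y ∈
      LinearMap.range (LinearMap.rTensor (lieMultilinear F n) (homParity 𝒱 n p).subtype) := by
  constructor
  · intro h
    rw [tensorInv_apply]
    refine Submodule.sum_mem _ fun l _ => ?_
    have h' : (epsV (F := F) n).compMultilinearMap (Y.1 (chainG ⟨0, hn⟩ l.1)) ∈ homParity 𝒱 n p :=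
      fun q x hx => epsV_mem_of_mem_subV (h _ q x hx)
    exact ⟨⟨_, h'⟩ ⊗ₜ[F] enumBracket F l, rfl⟩
  · rintro ⟨u, hu⟩
    rw [← tensorMap_tensorInv hn Y, ← hu]
    clear hu
    induction u with
    | zero => rw [map_zero, map_zero]; exact Submodule.zero_mem _
    | add s t hs ht => rw [map_add, map_add]; exact Submodule.add_mem _ hs ht
    | tmul φ a => exact tensorMap_tmul_mem_parity hn φ.2 a

omit [CharZero F] in
theorem of_zero_mem : FreeLieAlgebra.of F (0 : Fin 1) ∈ lieMultilinear F 1 :=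
  Submodule.subset_span (IsLieMonomial.of (F := F) (0 : Fin 1))

theorem liePairing_zero_of : liePairing F (0 : NGraph 1) (FreeLieAlgebra.of F 0) = 1 := by
  have h : lieCoeff F 1 (FreeLieAlgebra.of F 0) = 1 :=
    lieCoeff_eq (by rw [lieEval_of, ind, Finset.univ_unique, Finset.sum_singleton]; rfl)
  rw [liePairing_apply, h, graphCoeff_apply, graphDeriv_zero, map_one]

theorem tensorMap_isOne {φ : MultilinearMap F (fun _ : Fin 1 => V) V}
    {a : lieMultilinear F 1} (h : (homOperad 𝒱).IsOne φ) (h' : (lieOperad F).IsOne a) :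
    (classicalOperad 𝒱 (0 : V →ₗ[F] V)).IsOne (tensorMap le_rfl (φ ⊗ₜ[F] a)) := by
  intro x
  have h₁ : (a : FreeLieAlgebra F (Fin 1)) = FreeLieAlgebra.of F 0 := h'
  rw [tensorMap_tmul, h₁, liePairing_zero_of, one_smul, h x]
  rfl

theorem tensorInv_isOne_iff (X : classical (0 : V →ₗ[F] V) 1) :
    (classicalOperad 𝒱 (0 : V →ₗ[F] V)).IsOne X ↔
      ((homOperad 𝒱).tensorEven (lieOperad F)).IsOne (tensorInv le_rfl X) := by
  constructor
  · intro h
    have h₁ : (homOperad 𝒱).IsOne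
      (MultilinearMap.ofSubsingleton F V V (0 : Fin 1) LinearMap.id) := fun _ => rfl
    have h₂ : (lieOperad F).IsOne (⟨_, of_zero_mem⟩ : lieMultilinear F 1) := rfl
    refine ⟨_, _, h₁, h₂, ?_⟩
    rw [(classical_one_existsUnique 𝒱).unique h (tensorMap_isOne h₁ h₂)]
    exact tensorInv_tensorMap le_rfl _
  · rintro ⟨φ, a, h₁, h₂, h⟩
    rw [← tensorMap_tensorInv le_rfl X]
    exact h ▸ tensorMap_isOne h₁ h₂

theorem tensorMap_tmul_isAct (hn : 1 ≤ n) {σ : Equiv.Perm (Fin n)}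
    {φ φ' : MultilinearMap F (fun _ : Fin n => V) V} {a a' : lieMultilinear F n}
    (h : (homOperad 𝒱).IsAct σ φ φ') (h' : (lieOperad F).IsAct σ a a') :
    (classicalOperad 𝒱 (0 : V →ₗ[F] V)).IsAct σ (tensorMap hn (φ ⊗ₜ[F] a))
      (tensorMap hn (φ' ⊗ₜ[F] a')) := by
  intro Γ q x hx
  have h₁ : (a' : FreeLieAlgebra F (Fin n)) =
    FreeLieAlgebra.lift F (fun s => FreeLieAlgebra.of F (σ⁻¹ s)) (a : FreeLieAlgebra F _) := h'
  rw [tensorMap_tmul, tensorMap_tmul, h₁, liePairing_perm σ a.2, h q x hx, map_zsmul, map_smul,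
    substV_constV, smul_comm]

theorem HomLieAct.isAct (hn : 1 ≤ n) {σ : Equiv.Perm (Fin n)}
    {s t : MultilinearMap F (fun _ : Fin n => V) V ⊗[F] lieMultilinear F n}
    (h : HomLieAct 𝒱 σ s t) :
    (classicalOperad 𝒱 (0 : V →ₗ[F] V)).IsAct σ (tensorMap hn s) (tensorMap hn t) := by
  refine HomLieAct.induct (C := fun s t => (classicalOperad 𝒱 (0 : V →ₗ[F] V)).IsAct σ
    (tensorMap hn s) (tensorMap hn t)) ?_ ?_ h
  · intro φ φ' a a' h h'
    exact tensorMap_tmul_isAct hn h h'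
  · intro s t s₁ t₁ hs ht Γ q x hx
    have e : ∀ s t : MultilinearMap F (fun _ : Fin n => V) V ⊗[F] lieMultilinear F n, ∀ Γ x,
        (tensorMap hn (s + t)).1 Γ x = (tensorMap hn s).1 Γ x + (tensorMap hn t).1 Γ x :=
      fun s t Γ x => by rw [map_add]; rfl
    refine (e s₁ t₁ Γ x).trans ?_
    refine (congrArg₂ (· + ·) (hs Γ q x hx) (ht Γ q x hx)).trans ?_
    refine Eq.trans ?_ (congrArg (fun w => permSign q σ • substV 0 σ w) (e s t _ _).symm)
    rw [map_add, smul_add]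

omit [CharZero F] in
theorem exists_tensorAct (h𝒱 : DirectSum.IsInternal 𝒱) (σ : Equiv.Perm (Fin n))
    (s : MultilinearMap F (fun _ : Fin n => V) V ⊗[F] lieMultilinear F n) :
    ∃ t, HomLieAct 𝒱 σ s t := by
  have key : ∀ (φ : MultilinearMap F (fun _ : Fin n => V) V) (a : lieMultilinear F n),
      ∃ t, HomLieAct 𝒱 σ (φ ⊗ₜ[F] a) t := by
    intro φ a
    obtain ⟨φ', _, h⟩ := exists_multilinear_homogeneous h𝒱
      (fun q => permSign q σ • φ.domDomCongr σ⁻¹) ⊤ fun _ _ => trivial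
    exact ⟨_, HomLieAct.pure (φ' := φ') (a' := ⟨_, lift_perm_mem σ a.2⟩)
      (fun q x hx => h q x hx) rfl⟩
  induction s with
  | zero =>
    -- The relation has no clause for zero, which is treated as the pure tensor `0 ⊗ 0`.
    obtain ⟨t, ht⟩ := key 0 0
    rw [TensorProduct.zero_tmul] at ht
    exact ⟨t, ht⟩
  | tmul φ a => exact key φ a
  | add s t hs ht =>
    obtain ⟨s₁, hs⟩ := hs
    obtain ⟨t₁, ht⟩ := ht
    exact ⟨_, hs.add ht⟩

omit [CharZero F] in
theorem classical_act_unique (h𝒱 : DirectSum.IsInternal 𝒱) {σ : Equiv.Perm (Fin n)}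
    {X Y Y' : classical (0 : V →ₗ[F] V) n} (h : (classicalOperad 𝒱 (0 : V →ₗ[F] V)).IsAct σ X Y)
    (h' : (classicalOperad 𝒱 (0 : V →ₗ[F] V)).IsAct σ X Y') : Y = Y' :=
  classical_ext h𝒱 fun Γ q x hx => (h Γ q x hx).trans (h' Γ q x hx).symm

/-- Existence for the generated relation on tensors, together with uniqueness on the classical side,
turns the implication `HomLieAct.isAct` into an equivalence; the converse direction never inspects
how the relation was generated. -/
theorem tensorInv_isAct_iff (h𝒱 : DirectSum.IsInternal 𝒱) (hn : 1 ≤ n) (σ : Equiv.Perm (Fin n))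
    (X X' : classical (0 : V →ₗ[F] V) n) :
    (classicalOperad 𝒱 (0 : V →ₗ[F] V)).IsAct σ X X' ↔
      HomLieAct 𝒱 σ (tensorInv hn X) (tensorInv hn X') := by
  constructor
  · intro h
    obtain ⟨t, ht⟩ := exists_tensorAct h𝒱 σ (tensorInv hn X)
    have h' := HomLieAct.isAct hn ht
    rw [tensorMap_tensorInv] at h'
    rw [classical_act_unique h𝒱 h h', tensorInv_tensorMap]
    exact ht
  · intro h
    have h' := HomLieAct.isAct hn h
    rwa [tensorMap_tensorInv, tensorMap_tensorInv] at h'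

theorem tensorMap_tmul_isComp (hn : 1 ≤ n) (hm : ∀ i, 1 ≤ m i) (hM : 1 ≤ ∑ i, m i)
    {p : Fin n → ZMod 2} {φ : MultilinearMap F (fun _ : Fin n => V) V}
    {ψ : ∀ i, MultilinearMap F (fun _ : Fin (m i) => V) V}
    {χ : MultilinearMap F (fun _ : Fin (∑ i, m i) => V) V}
    {P : lieMultilinear F n} {Q : ∀ i, lieMultilinear F (m i)} {R : lieMultilinear F (∑ i, m i)}
    (h : (homOperad 𝒱).IsComp p φ ψ χ) (h' : (lieOperad F).IsComp (fun _ => 0) P Q R) :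
    IsClassicalComp 𝒱 0 p (tensorMap hn (φ ⊗ₜ[F] P)) (fun i => tensorMap (hm i) (ψ i ⊗ₜ[F] Q i))
      (tensorMap hM (χ ⊗ₜ[F] R)) := by
  refine (isClassicalComp_iff 𝒱 _ _ _).2
    ⟨fun i => tensorMap_tmul_mem_parity (hm i) (h.1 i) (Q i), fun q x hx E G => ?_⟩
  have h₁ : (R : FreeLieAlgebra F (Fin (∑ i, m i))) = FreeLieAlgebra.lift F
      (fun i => FreeLieAlgebra.lift F (fun k => FreeLieAlgebra.of F (emb m i k))
        (Q i : FreeLieAlgebra F _)) (P : FreeLieAlgebra F (Fin n)) := h'.2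
  have h₂ : (fun i => epsV (m i) ((tensorMap (hm i) (ψ i ⊗ₜ[F] Q i)).1 (G i)
      fun k => x (emb m i k))) = fun i => liePairing F (G i) (Q i : FreeLieAlgebra F (Fin (m i))) •
        ψ i fun k => x (emb m i k) := by
    funext i
    rw [tensorMap_tmul, map_smul, epsV_constV]
  rw [h₂, tensorMap_tmul, tensorMap_tmul, h₁, liePairing_comp P.2 (fun i => (Q i).2), h.2 q x hx,
    MultilinearMap.map_smul_univ, map_zsmul, map_smul, map_smul, map_smul, substV_constV, smul_smul,
    smul_comm]

theorem IsClassicalComp.add_left {p : Fin n → ZMod 2} {X X' : classical (0 : V →ₗ[F] V) n}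
    {Y : ∀ i, classical (0 : V →ₗ[F] V) (m i)} {Z Z' : classical (0 : V →ₗ[F] V) (∑ i, m i)}
    (h : IsClassicalComp 𝒱 0 p X Y Z) (h' : IsClassicalComp 𝒱 0 p X' Y Z') :
    IsClassicalComp 𝒱 0 p (X + X') Y (Z + Z') := by
  rw [isClassicalComp_iff] at h h' ⊢
  refine ⟨h.1, fun q x hx E G => ?_⟩
  refine (congrArg₂ (· + ·) (h.2 q x hx E G) (h'.2 q x hx E G)).trans ?_
  rw [← smul_add, ← map_add]
  rfl

theorem IsClassicalComp.add_right {p : Fin n → ZMod 2} {X : classical (0 : V →ₗ[F] V) n}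
    {Y : ∀ i, classical (0 : V →ₗ[F] V) (m i)} {i : Fin n} {A B : classical (0 : V →ₗ[F] V) (m i)}
    {Z Z' : classical (0 : V →ₗ[F] V) (∑ i, m i)}
    (h : IsClassicalComp 𝒱 0 p X (Function.update Y i A) Z)
    (h' : IsClassicalComp 𝒱 0 p X (Function.update Y i B) Z') :
    IsClassicalComp 𝒱 0 p X (Function.update Y i (A + B)) (Z + Z') := by
  rw [isClassicalComp_iff] at h h' ⊢
  refine ⟨fun j => ?_, fun q x hx E G => ?_⟩
  · by_cases hj : j = i
    · subst hj
      have h₁ := h.1 j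
      have h₂ := h'.1 j
      rw [Function.update_self] at h₁ h₂ ⊢
      exact Submodule.add_mem _ h₁ h₂
    · have h₁ := h.1 j
      rw [Function.update_of_ne hj] at h₁ ⊢
      exact h₁
  · have e : ∀ A, (fun j => epsV (F := F) (m j) ((Function.update Y i A j).1 (G j)
        fun k => x (emb m j k))) = Function.update (fun j => epsV (F := F) (m j) ((Y j).1 (G j)
          fun k => x (emb m j k))) i (epsV (F := F) (m i) (A.1 (G i) fun k => x (emb m i k))) :=
      fun A => update_apply_eq (fun j (W : classical (0 : V →ₗ[F] V) (m j)) =>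
        epsV (F := F) (m j) (W.1 (G j) fun k => x (emb m j k))) Y i A
    refine (congrArg₂ (· + ·) (h.2 q x hx E G) (h'.2 q x hx E G)).trans ?_
    rw [e, e, e, ← smul_add, ← map_add, ← MultilinearMap.map_update_add, ← map_add]
    rfl

theorem HomLieComp.isComp (hn : 1 ≤ n) (hm : ∀ i, 1 ≤ m i) (hM : 1 ≤ ∑ i, m i)
    {p : Fin n → ZMod 2} {s : MultilinearMap F (fun _ : Fin n => V) V ⊗[F] lieMultilinear F n}
    {y : ∀ i, MultilinearMap F (fun _ : Fin (m i) => V) V ⊗[F] lieMultilinear F (m i)}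
    {z : MultilinearMap F (fun _ : Fin (∑ i, m i) => V) V ⊗[F] lieMultilinear F (∑ i, m i)}
    (h : HomLieComp 𝒱 p s y z) :
    IsClassicalComp 𝒱 0 p (tensorMap hn s) (fun i => tensorMap (hm i) (y i)) (tensorMap hM z) := by
  refine HomLieComp.induct (C := fun s y z => IsClassicalComp 𝒱 0 p (tensorMap hn s)
    (fun i => tensorMap (hm i) (y i)) (tensorMap hM z)) ?_ ?_ ?_ h
  · intro φ ψ χ P Q R h h'
    exact tensorMap_tmul_isComp hn hm hM h h'
  · intro s t y s₁ t₁ hs ht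
    have := hs.add_left ht
    rw [← map_add, ← map_add] at this
    exact this
  · intro s y i a b s₁ t₁ hs ht
    have e : ∀ c, (fun j => tensorMap (hm j) (Function.update y i c j)) =
        Function.update (fun j => tensorMap (hm j) (y j)) i (tensorMap (hm i) c) :=
      fun c => update_apply_eq (fun j c => tensorMap (hm j) c) y i c
    rw [e] at hs ht
    have := hs.add_right ht
    rw [← map_add, ← map_add, ← e] at this
    exact this

omit [CharZero F] in
theorem exists_tensorComp_tmul (h𝒱 : DirectSum.IsInternal 𝒱) {p : Fin n → ZMod 2}
    (φ : MultilinearMap F (fun _ : Fin n => V) V)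
    {ψ : ∀ i, MultilinearMap F (fun _ : Fin (m i) => V) V} (hψ : ∀ i, ψ i ∈ homParity 𝒱 (m i) (p i))
    (P : lieMultilinear F n) (Q : ∀ i, lieMultilinear F (m i)) :
    ∃ z, HomLieComp 𝒱 p (φ ⊗ₜ[F] P) (fun i => ψ i ⊗ₜ[F] Q i) z := by
  obtain ⟨χ, _, h⟩ := exists_multilinear_homogeneous h𝒱
    (fun q => compSign p q • blockComp φ ψ) ⊤ fun _ _ => trivial
  have h₁ : (homOperad 𝒱).IsComp p φ ψ χ := ⟨hψ, fun q x hx => h q x hx⟩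
  have h₂ : (lieOperad F).IsComp (fun _ => 0) P Q
      (⟨_, lift_comp_mem P.2 fun i => (Q i).2⟩ : lieMultilinear F (∑ i, m i)) :=
    ⟨fun i => by rw [if_pos rfl]; trivial, rfl⟩
  exact ⟨_, HomLieComp.pure h₁ h₂⟩

omit [CharZero F] in
theorem exists_tensorComp_pure (h𝒱 : DirectSum.IsInternal 𝒱) {p : Fin n → ZMod 2}
    (s : MultilinearMap F (fun _ : Fin n => V) V ⊗[F] lieMultilinear F n)
    {ψ : ∀ i, MultilinearMap F (fun _ : Fin (m i) => V) V} (hψ : ∀ i, ψ i ∈ homParity 𝒱 (m i) (p i))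
    (Q : ∀ i, lieMultilinear F (m i)) :
    ∃ z, HomLieComp 𝒱 p s (fun i => ψ i ⊗ₜ[F] Q i) z := by
  induction s with
  | zero =>
    obtain ⟨t, ht⟩ := exists_tensorComp_tmul h𝒱 0 hψ 0 Q
    rw [TensorProduct.zero_tmul] at ht
    exact ⟨t, ht⟩
  | tmul φ P => exact exists_tensorComp_tmul h𝒱 φ hψ P Q
  | add s t hs ht =>
    obtain ⟨s₁, hs⟩ := hs
    obtain ⟨t₁, ht⟩ := ht
    exact ⟨_, hs.add_left ht⟩

-- Each argument is a sum of pure tensors with first factor of the prescribed parity. The arguments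
-- are split into pure tensors one place at a time; `T` is the set of places still to be split.
omit [CharZero F] in
theorem exists_tensorComp (h𝒱 : DirectSum.IsInternal 𝒱) {p : Fin n → ZMod 2}
    (s : MultilinearMap F (fun _ : Fin n => V) V ⊗[F] lieMultilinear F n)
    (y : ∀ i, MultilinearMap F (fun _ : Fin (m i) => V) V ⊗[F] lieMultilinear F (m i))
    (hy : ∀ i, y i ∈ LinearMap.range
      (LinearMap.rTensor (lieMultilinear F (m i)) (homParity 𝒱 (m i) (p i)).subtype)) :
    ∃ z, HomLieComp 𝒱 p s y z := by
  suffices H : ∀ (T : Finset (Fin n))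
      (y : ∀ i, MultilinearMap F (fun _ : Fin (m i) => V) V ⊗[F] lieMultilinear F (m i)),
      (∀ i, y i ∈ LinearMap.range
        (LinearMap.rTensor (lieMultilinear F (m i)) (homParity 𝒱 (m i) (p i)).subtype)) →
      (∀ i ∉ T, ∃ ψ ∈ homParity 𝒱 (m i) (p i), ∃ Q : lieMultilinear F (m i), y i = ψ ⊗ₜ[F] Q) →
      ∃ z, HomLieComp 𝒱 p s y z from
    H Finset.univ y hy fun i hi => absurd (Finset.mem_univ i) hi
  intro T
  induction T using Finset.induction_on with
  | empty =>
    intro y _ h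
    choose ψ hψ Q hQ using fun i => h i (Finset.notMem_empty i)
    rw [funext hQ]
    exact exists_tensorComp_pure h𝒱 s hψ Q
  | insert a T _ ih =>
    intro y hy h
    have key : ∀ (ψ : homParity 𝒱 (m a) (p a)) (Q : lieMultilinear F (m a)),
        ∃ z, HomLieComp 𝒱 p s
          (Function.update y a (ψ.1 ⊗ₜ[F] Q)) z := by
      intro ψ Q
      refine ih _ (fun i => ?_) fun i hi => ?_
      · by_cases hia : i = a
        · subst hia
          rw [Function.update_self]
          exact ⟨ψ ⊗ₜ[F] Q, rfl⟩
        · rw [Function.update_of_ne hia]; exact hy i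
      · by_cases hia : i = a
        · subst hia
          rw [Function.update_self]
          exact ⟨ψ.1, ψ.2, Q, rfl⟩
        · rw [Function.update_of_ne hia]
          exact h i (by simp [hia, hi])
    have H : ∀ u : homParity 𝒱 (m a) (p a) ⊗[F] lieMultilinear F (m a),
        ∃ z, HomLieComp 𝒱 p s (Function.update y a
          (LinearMap.rTensor (lieMultilinear F (m a)) (homParity 𝒱 (m a) (p a)).subtype u)) z := by
      intro u
      induction u with
      | zero =>
        rw [map_zero, ← TensorProduct.zero_tmul _ (0 : lieMultilinear F (m a))]
        exact key 0 0
      | tmul ψ Q => exact key ψ Q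
      | add u w hu hw =>
        obtain ⟨s₁, hu⟩ := hu
        obtain ⟨t₁, hw⟩ := hw
        rw [map_add]
        exact ⟨_, hu.add_right hw⟩
    obtain ⟨u, hu⟩ := hy a
    have := H u
    rwa [hu, Function.update_eq_self] at this

/-- As for the actions: a composition on the tensor side exists and maps to the classical one, which
is unique. -/
theorem tensorInv_isComp_iff (h𝒱 : DirectSum.IsInternal 𝒱) (hn : 1 ≤ n) (hm : ∀ i, 1 ≤ m i)
    (hM : 1 ≤ ∑ i, m i) (p : Fin n → ZMod 2) (X : classical (0 : V →ₗ[F] V) n)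
    (Y : ∀ i, classical (0 : V →ₗ[F] V) (m i)) (Z : classical (0 : V →ₗ[F] V) (∑ i, m i)) :
    IsClassicalComp 𝒱 0 p X Y Z ↔ HomLieComp 𝒱 p (tensorInv hn X)
      (fun i => tensorInv (hm i) (Y i)) (tensorInv hM Z) := by
  have hY : (fun i => tensorMap (hm i) (tensorInv (hm i) (Y i))) = Y :=
    funext fun i => tensorMap_tensorInv (hm i) (Y i)
  constructor
  · intro h
    obtain ⟨z, hz⟩ := exists_tensorComp h𝒱 (tensorInv hn X) (fun i => tensorInv (hm i) (Y i))
      fun i => (mem_classicalParity_iff_tensorInv (hm i) (p i) (Y i)).1 (h.1 i)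
    have h' := HomLieComp.isComp hn hm hM hz
    rw [tensorMap_tensorInv, hY] at h'
    rw [classical_comp_unique h𝒱 h h', tensorInv_tensorMap]
    exact hz
  · intro h
    have hc := HomLieComp.isComp hn hm hM h
    rwa [tensorMap_tensorInv, tensorMap_tensorInv, hY] at hc

/-- The isomorphism of the classical operad with `Hom(V) ⊗ Lie` in positive arities. -/
def tensorIso (h𝒱 : DirectSum.IsInternal 𝒱) : OperadIso 1 (classicalOperad 𝒱 (0 : V →ₗ[F] V))
    ((homOperad 𝒱).tensorEven (lieOperad F)) where
  equiv _ hn := tensorEquiv hn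
  parity_iff _ hn p X := mem_classicalParity_iff_tensorInv hn p X
  one_iff _ X := tensorInv_isOne_iff X
  act_iff _ hn σ X X' := tensorInv_isAct_iff h𝒱 hn σ X X'
  comp_iff _ hn _ hm hM p X Y Z := tensorInv_isComp_iff h𝒱 hn hm hM p X Y Z

end TensorCompat

end VertexOperad

end

open VertexOperad in
theorem theorem3p6 {F : Type*} [Field F] [CharZero F] {V : Type*} [AddCommGroup V] [Module F V]
    (𝒱 : ZMod 2 → Submodule F V) (h𝒱 : DirectSum.IsInternal 𝒱) :
    (chiralOperad 𝒱 (0 : V →ₗ[F] V)).WellDefined ∧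
    (classicalOperad 𝒱 (0 : V →ₗ[F] V)).WellDefined ∧
    (∃ Φ : OperadIso 0 (chiralOperad 𝒱 (0 : V →ₗ[F] V)) (classicalOperad 𝒱 (0 : V →ₗ[F] V)),
      ∀ (n : ℕ) (X : chiral (0 : V →ₗ[F] V) n) (Γ : NGraph n) (x : Fin n → V),
        Multiset.card Γ + 1 = n →
        (Φ.equiv n n.zero_le X : classical (0 : V →ₗ[F] V) n).1 Γ x = X.1 x (graphFun F Γ)) ∧
    Nonempty (OperadIso 1 (classicalOperad 𝒱 (0 : V →ₗ[F] V))
      ((homOperad 𝒱).tensorEven (lieOperad F))) ∧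
    (∀ n : ℕ, 1 ≤ n → ∀ r : ℤ,
      (r ≤ n - 1 → chiralFil (0 : V →ₗ[F] V) (trivialFil F V) n r = ⊤) ∧
      (n ≤ r → chiralFil (0 : V →ₗ[F] V) (trivialFil F V) n r = ⊥) ∧
      (r = n - 1 → classicalGr (0 : V →ₗ[F] V) (trivialGr F V) n r = ⊤) ∧
      (r ≠ n - 1 → classicalGr (0 : V →ₗ[F] V) (trivialGr F V) n r = ⊥)) := by
  refine ⟨chiralOperad_wellDefined h𝒱, (chiralIso h𝒱).wellDefined (chiralOperad_wellDefined h𝒱),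
    ⟨chiralIso h𝒱, fun n X Γ x h => ?_⟩, ⟨tensorIso h𝒱⟩, fun n hn r =>
      ⟨chiralFil_eq_top, chiralFil_eq_bot hn, classicalGr_eq_top hn, classicalGr_eq_bot hn⟩⟩
  change (chiralEquiv F V n X).1 Γ x = _
  rw [chiralEquiv_apply, if_pos (by omega)]
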